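/- Let $H$ be a complex Hilbert space, let $\mathcal B(H)$ be the algebra of bounded operators on $H$, and write $E_A$ for the spectral measure of a bounded self-adjoint operator $A$ on $H$. Let $\mathbf S_p$ be the Schatten–von Neumann class ($\sum_n s_n(T)^p<\infty$). The Besov class $B^1_{\infty,1}(\mathbb R^2)$ is the set of functions $$f(x)=c+\sum_{n\ge1}\alpha_n\sigma_n^{-1}\bigl(g_n(\sigma_nx)-g_n(0)\bigr),\qquad c\in\mathbb C,\ \ \sum_n|\alpha_n|<\infty,\ \ \sigma_n>0,$$ where the $g_n$ are continuous functions on $\mathbb R^2$ with $|g_n|\le1$ whose Fourier transforms $\mathcal F g_n$ (with $(\mathcal F\varphi)(t)=\int\varphi(x)e^{-i(x,t)}dx$) are supported in the closed unit ball. Put $$(\mathfrak D^{[1]}f)(x_1,x_2,y)=\frac{f(x_1,y)-f(x_2,y)}{x_1-x_2},\qquad(\mathfrak D^{[2]}f)(x,y_1,y_2)=\frac{f(x,y_1)-f(x,y_2)}{y_1-y_2},$$ understood as $\partial f/\partial x$ for $x_1=x_2$ and as $\partial f/\partial y$ for $y_1=y_2$. *Functions of a pair.* For bounded self-adjoint $A,B$,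 $f(A,B)=\iint f(x,y)\,dE_A(x)\,dE_B(y)$ is the Birman–Solomyak double operator integral: on the Hilbert–Schmidt class, $\iint\Phi\,dE_1\,T\,dE_2=\bigl(\int\Phi\,d\mathcal E\bigr)T$, where $\mathcal E(\Lambda\times\Delta)T=E_1(\Lambda)TE_2(\Delta)$; $f$ must be such that $Q\mapsto\iint f(x,y)\,dE_B(y)\,Q\,dE_A(x)$ maps $\mathbf S_1$ into $\mathbf S_1$, and $f(A,B)$ is the operator with $\operatorname{trace}(f(A,B)Q)=\operatorname{trace}\bigl(\iint f(x,y)\,dE_B(y)\,Q\,dE_A(x)\bigr)$ for all $Q\in\mathbf S_1$. *Triple operator integrals.* Let $\mathcal B$ be the space of matrices of bounded operators on $\ell^2$, and let $\sum_{j,k\ge0}=\lim_{M,N\to\infty}\sum_{j\le N}\sum_{k\le M}$. (a) $\Psi$ belongs to the Haagerup tensor product of $L^\infty(E_1),L^\infty(E_2),L^\infty(E_3)$ if $\Psi=\sum_{j,k}\alpha_j(x_1)\beta_{jk}(x_2)\gamma_k(x_3)$ almost everywhere with $\{\alpha_j\}\in L^\infty_{E_1}(\ell^2)$, $\{\beta_{jk}\}\in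 L^\infty_{E_2}(\mathcal B)$, $\{\gamma_k\}\in L^\infty_{E_3}(\ell^2)$. Then, for $T,R\in\mathcal B(H)$, $$\iiint\Psi\,dE_1\,T\,dE_2\,R\,dE_3=\sum_{j,k}\Bigl(\int\alpha_j\,dE_1\Bigr)T\Bigl(\int\beta_{jk}\,dE_2\Bigr)R\Bigl(\int\gamma_k\,dE_3\Bigr)$$ in the weak operator topology, for every such representation. (b) $\Psi$ belongs to the Haagerup-like tensor product of the first kind if $\Psi=\sum_{j,k}\alpha_j(x_1)\beta_k(x_2)\gamma_{jk}(x_3)$ with $\{\alpha_j\}\in L^\infty_{E_1}(\ell^2)$, $\{\beta_k\}\in L^\infty_{E_2}(\ell^2)$, $\{\gamma_{jk}\}\in L^\infty_{E_3}(\mathcal B)$. For such $\Psi$, $T\in\mathbf S_p$ and $R\in\mathcal B(H)$, the integral $W=\iiint\Psi\,dE_1\,T\,dE_2\,R\,dE_3$ is the operator $W\in\mathbf S_p$ with $$\operatorname{trace}(WQ)=\operatorname{trace}\Bigl(\Bigl(\iiint\Psi(x_1,x_2,x_3)\,dE_2(x_2)\,R\,dE_3(x_3)\,Q\,dE_1(x_1)\Bigr)T\Bigr)$$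 for all $Q\in\mathbf S_{p'}$, $1/p+1/p'=1$ (all compact $Q$ if $p=1$). (c) $\Psi$ belongs to the Haagerup-like tensor product of the second kind if $\Psi=\sum_{j,k}\alpha_{jk}(x_1)\beta_j(x_2)\gamma_k(x_3)$ with $\{\alpha_{jk}\}\in L^\infty_{E_1}(\mathcal B)$, $\{\beta_j\}\in L^\infty_{E_2}(\ell^2)$, $\{\gamma_k\}\in L^\infty_{E_3}(\ell^2)$. For such $\Psi$, $T\in\mathcal B(H)$ and $R\in\mathbf S_p$, the integral $W=\iiint\Psi\,dE_1\,T\,dE_2\,R\,dE_3$ is the operator $W\in\mathbf S_p$ with $$\operatorname{trace}(WQ)=\operatorname{trace}\Bigl(\Bigl(\iiint\Psi(x_1,x_2,x_3)\,dE_3(x_3)\,Q\,dE_1(x_1)\,T\,dE_2(x_2)\Bigr)R\Bigr)$$ for all $Q\in\mathbf S_{p'}$ (all compact $Q$ if $p=1$). **Theorem.** Let $f\in B^1_{\infty,1}(\mathbb R^2)$ and $1\le p\le2$. Let $A_1,B_1,A_2,B_2$ be bounded self-adjoint operators on $H$ with $A_2-A_1\in\mathbf S_p$ and $B_2-B_1\in\mathbf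 S_p$. Then $f(A_1,B_1)$ and $f(A_2,B_2)$ are well defined; $\mathfrak D^{[1]}f$ belongs to the Haagerup-like tensor product of the first kind of $L^\infty(E_{A_1}),L^\infty(E_{A_2}),L^\infty(E_{B_1})$; $\mathfrak D^{[2]}f$ belongs to the Haagerup-like tensor product of the second kind of $L^\infty(E_{A_2}),L^\infty(E_{B_1}),L^\infty(E_{B_2})$; the two triple operator integrals below, taken in the sense of (b) and (c) respectively, are well defined; and $$\begin{aligned}f(A_1,B_1)-f(A_2,B_2)&=\iiint\frac{f(x_1,y)-f(x_2,y)}{x_1-x_2}\,dE_{A_1}(x_1)(A_1-A_2)\,dE_{A_2}(x_2)\,dE_{B_1}(y)\\&\quad+\iiint\frac{f(x,y_1)-f(x,y_2)}{y_1-y_2}\,dE_{A_2}(x)\,dE_{B_1}(y_1)(B_1-B_2)\,dE_{B_2}(y_2).\end{aligned}$$ -/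

import Mathlib

open MeasureTheory Filter Topology
open scoped InnerProductSpace

namespace OpInt

/-- A spectral measure on a measurable space `X`: a countably additive (in the strong operator
topology) set function on the measurable sets of `X` whose values are orthogonal projections on the
Hilbert space `H` and whose value on `X` is the identity. The values on non-measurable sets are
irrelevant. -/
structure SpectralMeasure (X : Type*) [MeasurableSpace X] (H : Type*)
    [NormedAddCommGroup H] [InnerProductSpace ℂ H] [CompleteSpace H] where
  proj : Set X → (H →L[ℂ] H)
  isStarProjection : ∀ s, MeasurableSet s → IsStarProjection (proj s)
  proj_univ : proj Set.univ = 1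
  hasSum_proj : ∀ s : ℕ → Set X, (∀ n, MeasurableSet (s n)) →
    Pairwise (Function.onFun Disjoint s) →
    ∀ x : H, HasSum (fun n => proj (s n) x) (proj (⋃ n, s n) x)

section Construction

variable {H : Type*} [NormedAddCommGroup H] [InnerProductSpace ℂ H] [CompleteSpace H]

theorem exists_scalar_measure (A : H →L[ℂ] H) (hA : IsSelfAdjoint A) (x : H) :
    ∃ μ : Measure (spectrum ℝ A), IsFiniteMeasure μ ∧
      ∀ f : C(spectrum ℝ A, ℝ), ∫ t, f t ∂μ = (⟪x, cfcHom hA f x⟫_ℂ).re := by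
  have : CompactSpace (spectrum ℝ A) :=
    isCompact_iff_compactSpace.mp (ContinuousFunctionalCalculus.isCompact_spectrum A)
  let Λ : CompactlySupportedContinuousMap (spectrum ℝ A) ℝ →ₚ[ℝ] ℝ :=
   { toFun g := (⟪x, cfcHom hA (g : C(spectrum ℝ A, ℝ)) x⟫_ℂ).re
     map_add' g g' := by
       have : ((g + g' : CompactlySupportedContinuousMap (spectrum ℝ A) ℝ) :
         C(spectrum ℝ A, ℝ)) = (g : C(spectrum ℝ A, ℝ)) + g' := rfl
       rw [this, map_add]
       simp
     map_smul' c g := by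
       have : ((c • g : CompactlySupportedContinuousMap (spectrum ℝ A) ℝ) :
         C(spectrum ℝ A, ℝ)) = c • (g : C(spectrum ℝ A, ℝ)) := rfl
       rw [this, map_smul]
       simp [inner_smul_right_eq_smul]
     monotone' g g' h := by
       have h1 : (g : C(spectrum ℝ A, ℝ)) ≤ g' := h
       have h2 := cfcHom_mono hA h1
       rw [← sub_nonneg, ContinuousLinearMap.nonneg_iff_isPositive] at h2
       have h3 := h2.re_inner_nonneg_right x
       simp only [sub_apply, inner_sub_right, map_sub, RCLike.re_to_complex,
         sub_nonneg] at h3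
       exact h3 }
  refine ⟨RealRMK.rieszMeasure Λ, inferInstance, fun f => ?_⟩
  exact RealRMK.integral_rieszMeasure Λ ⟨f, HasCompactSupport.of_compactSpace _⟩

theorem norm_sq_cfcHom (A : H →L[ℂ] H) (hA : IsSelfAdjoint A) (x : H)
    (f : C(spectrum ℝ A, ℝ)) :
    ‖cfcHom hA f x‖ ^ 2 = (⟪x, cfcHom hA (f * f) x⟫_ℂ).re := by
  have h1 : star (cfcHom hA f) = cfcHom hA f := by
    rw [← map_star]; congr 1
  rw [map_mul, mul_apply_eq_comp]
  have h2 : ⟪x, cfcHom hA f (cfcHom hA f x)⟫_ℂ = ⟪cfcHom hA f x, cfcHom hA f x⟫_ℂ := by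
    rw [← ContinuousLinearMap.adjoint_inner_left, ← ContinuousLinearMap.star_eq_adjoint, h1]
  rw [h2, inner_self_eq_norm_sq_to_K]
  norm_cast

theorem exists_continuous_approx {K : Set ℝ} [CompactSpace K] (μ : Measure K) [IsFiniteMeasure μ]
    {s : Set K} (hs : MeasurableSet s) {ε : ℝ} (hε : 0 < ε) :
    ∃ f : C(K, ℝ), ∫ t, (f t - s.indicator 1 t) ^ 2 ∂μ ≤ ε := by
  have hm : MemLp (s.indicator (1 : K → ℝ)) (ENNReal.ofReal 2) μ :=
    (memLp_const (1 : ℝ)).indicator hs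
  obtain ⟨g, -, hg, hgc, -⟩ := hm.exists_hasCompactSupport_integral_rpow_sub_le two_pos hε
  refine ⟨⟨g, hgc⟩, le_trans (le_of_eq ?_) hg⟩
  congr 1; ext t
  simp only [ContinuousMap.coe_mk, Real.norm_eq_abs]
  rw [Real.rpow_two, sq_abs, ← neg_sub, neg_sq]

theorem integrable_sq_sub {K : Set ℝ} [CompactSpace K] (μ : Measure K) [IsFiniteMeasure μ]
    {s : Set K} (hs : MeasurableSet s) (f : C(K, ℝ)) :
    Integrable (fun t => (f t - s.indicator (1 : K → ℝ) t) ^ 2) μ := by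
  refine Integrable.of_bound (C := (‖f‖ + 1) ^ 2) ?_ (Eventually.of_forall fun t => ?_)
  · exact (((f.continuous.measurable).sub (measurable_one.indicator hs)).pow_const 2).aestronglyMeasurable
  · rw [norm_pow]
    gcongr
    refine (norm_sub_le _ _).trans (add_le_add (f.norm_coe_le_norm t) ?_)
    by_cases h : t ∈ s <;> simp [h]

theorem exists_proj_vector (A : H →L[ℂ] H) (hA : IsSelfAdjoint A) (x : H)
    (μ : Measure (spectrum ℝ A)) [IsFiniteMeasure μ]
    (hμ : ∀ f : C(spectrum ℝ A, ℝ), ∫ t, f t ∂μ = (⟪x, cfcHom hA f x⟫_ℂ).re)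
    {s : Set (spectrum ℝ A)} (hs : MeasurableSet s) :
    ∃ z : H, ∀ f : C(spectrum ℝ A, ℝ), ‖cfcHom hA f x - z‖ ^ 2 ≤
      4 * ∫ t, (f t - s.indicator 1 t) ^ 2 ∂μ := by
  have : CompactSpace (spectrum ℝ A) :=
    isCompact_iff_compactSpace.mp (ContinuousFunctionalCalculus.isCompact_spectrum A)
  have key : ∀ f g : C(spectrum ℝ A, ℝ), ‖cfcHom hA f x - cfcHom hA g x‖ ^ 2 ≤
      2 * ∫ t, (f t - s.indicator 1 t) ^ 2 ∂μ + 2 * ∫ t, (g t - s.indicator 1 t) ^ 2 ∂μ := by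
    intro f g
    have : cfcHom hA f x - cfcHom hA g x = cfcHom hA (f - g) x := by
      rw [map_sub, sub_apply]
    rw [this, norm_sq_cfcHom, ← hμ, ← integral_const_mul, ← integral_const_mul,
      ← integral_add ((integrable_sq_sub μ hs f).const_mul 2)
        ((integrable_sq_sub μ hs g).const_mul 2)]
    refine integral_mono_of_nonneg (Eventually.of_forall fun t => mul_self_nonneg _)
      (((integrable_sq_sub μ hs f).const_mul 2).add
        ((integrable_sq_sub μ hs g).const_mul 2)) (Eventually.of_forall fun t => ?_)
    simp only [ContinuousMap.mul_apply, ContinuousMap.sub_apply]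
    nlinarith [sq_nonneg ((f t - s.indicator (1 : spectrum ℝ A → ℝ) t) +
      (g t - s.indicator (1 : spectrum ℝ A → ℝ) t))]
  choose F hF using fun n : ℕ => exists_continuous_approx μ hs
    (show (0 : ℝ) < (1 / 2) ^ n by positivity)
  have h0 : Tendsto (fun n : ℕ => (1 / 2 : ℝ) ^ n) atTop (𝓝 0) :=
    tendsto_pow_atTop_nhds_zero_of_lt_one (by norm_num) (by norm_num)
  have hc : CauchySeq fun n => cfcHom hA (F n) x := by
    refine cauchySeq_of_le_tendsto_0 (fun n : ℕ => Real.sqrt (4 * (1 / 2 : ℝ) ^ n))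
      (fun n m N hn hm => ?_) ?_
    · rw [dist_eq_norm]
      refine Real.le_sqrt_of_sq_le ((key _ _).trans ?_)
      have h1 := (hF n).trans (pow_le_pow_of_le_one (by norm_num) (by norm_num) hn)
      have h2 := (hF m).trans (pow_le_pow_of_le_one (by norm_num) (by norm_num) hm)
      linarith
    · have := (h0.const_mul 4).sqrt
      simpa using this
  obtain ⟨z, hz⟩ := cauchySeq_tendsto_of_complete hc
  refine ⟨z, fun f => ?_⟩
  have h1 : Tendsto (fun n => ‖cfcHom hA f x - cfcHom hA (F n) x‖ ^ 2) atTop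
      (𝓝 (‖cfcHom hA f x - z‖ ^ 2)) := ((hz.const_sub _).norm).pow 2
  have h2 : Tendsto (fun n : ℕ => 2 * ∫ t, (f t - s.indicator 1 t) ^ 2 ∂μ + 2 * (1 / 2 : ℝ) ^ n)
      atTop (𝓝 (2 * ∫ t, (f t - s.indicator 1 t) ^ 2 ∂μ + 2 * 0)) :=
    (h0.const_mul 2).const_add _
  have h3 := le_of_tendsto_of_tendsto' h1 h2 fun n =>
    (key f (F n)).trans (by linarith [hF n])
  have h4 : 0 ≤ ∫ t, (f t - s.indicator 1 t) ^ 2 ∂μ :=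
    integral_nonneg fun t => sq_nonneg _
  linarith

theorem exists_seq_approx {K : Set ℝ} [CompactSpace K] (ν : Measure K) [IsFiniteMeasure ν]
    {s : Set K} (hs : MeasurableSet s) :
    ∃ F : ℕ → C(K, ℝ), ∀ μ : Measure K, μ ≤ ν →
      Tendsto (fun n => ∫ t, (F n t - s.indicator 1 t) ^ 2 ∂μ) atTop (𝓝 0) ∧
      Tendsto (fun n => ∫ t, |F n t - s.indicator 1 t| ∂μ) atTop (𝓝 0) := by
  choose F hF using fun n : ℕ => exists_continuous_approx ν hs
    (show (0 : ℝ) < ((1 / 2) ^ n) ^ 2 by positivity)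
  have h0 : Tendsto (fun n : ℕ => (1 / 2 : ℝ) ^ n) atTop (𝓝 0) :=
    tendsto_pow_atTop_nhds_zero_of_lt_one (by norm_num) (by norm_num)
  refine ⟨F, fun μ hμ => ?_⟩
  have : IsFiniteMeasure μ := isFiniteMeasure_of_le ν hμ
  have hsq : ∀ n, ∫ t, (F n t - s.indicator 1 t) ^ 2 ∂μ ≤ ((1 / 2 : ℝ) ^ n) ^ 2 := fun n =>
    (integral_mono_measure hμ (Eventually.of_forall fun t => sq_nonneg _)
      (integrable_sq_sub ν hs (F n))).trans (hF n)
  constructor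
  · refine squeeze_zero (fun n => integral_nonneg fun t => sq_nonneg _) hsq ?_
    simpa using h0.pow 2
  · refine squeeze_zero (g := fun n => (1 / 2 : ℝ) ^ n * (1 + μ.real Set.univ))
      (fun n => integral_nonneg fun t => abs_nonneg _) (fun n => ?_) ?_
    · have hδ : (0 : ℝ) < (1 / 2) ^ n := by positivity
      have hi : Integrable (fun t => ((1 / 2 : ℝ) ^ n)⁻¹ * (F n t - s.indicator 1 t) ^ 2
          + (1 / 2 : ℝ) ^ n) μ :=
        ((integrable_sq_sub μ hs (F n)).const_mul _).add (integrable_const _)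
      have h1 : ∫ t, |F n t - s.indicator 1 t| ∂μ ≤ ∫ t, (((1 / 2 : ℝ) ^ n)⁻¹ *
          (F n t - s.indicator 1 t) ^ 2 + (1 / 2 : ℝ) ^ n) ∂μ := by
        refine integral_mono_of_nonneg (Eventually.of_forall fun t => abs_nonneg _) hi
          (Eventually.of_forall fun t => ?_)
        simp only
        set a := F n t - s.indicator (1 : K → ℝ) t
        set δ := (1 / 2 : ℝ) ^ n
        rw [← sq_abs a]
        have h3 : δ⁻¹ * |a| ^ 2 + δ - |a| = δ⁻¹ * ((|a| - δ / 2) ^ 2 + 3 / 4 * δ ^ 2) := by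
          field_simp; ring
        have h4 : 0 ≤ δ⁻¹ * ((|a| - δ / 2) ^ 2 + 3 / 4 * δ ^ 2) := by positivity
        linarith
      refine h1.trans ?_
      rw [integral_add ((integrable_sq_sub μ hs (F n)).const_mul _) (integrable_const _),
        integral_const_mul, integral_const, smul_eq_mul]
      have h5 := mul_le_mul_of_nonneg_left (hsq n) (inv_nonneg.2 hδ.le)
      have h6 : ((1 / 2 : ℝ) ^ n)⁻¹ * ((1 / 2 : ℝ) ^ n) ^ 2 = (1 / 2 : ℝ) ^ n := by
        field_simp
      rw [h6] at h5
      linarith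
    · simpa using h0.mul_const (1 + μ.real Set.univ)

theorem exists_proj (A : H →L[ℂ] H) (hA : IsSelfAdjoint A)
    (μ : H → Measure (spectrum ℝ A)) (hfin : ∀ x, IsFiniteMeasure (μ x))
    (hμ : ∀ x, ∀ f : C(spectrum ℝ A, ℝ), ∫ t, f t ∂(μ x) = (⟪x, cfcHom hA f x⟫_ℂ).re)
    {s : Set (spectrum ℝ A)} (hs : MeasurableSet s) :
    ∃ P : H →L[ℂ] H, IsStarProjection P ∧ ∀ x, ⟪x, P x⟫_ℂ = ((μ x).real s : ℂ) := by
  have : CompactSpace (spectrum ℝ A) :=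
    isCompact_iff_compactSpace.mp (ContinuousFunctionalCalculus.isCompact_spectrum A)
  choose z hz using fun x => exists_proj_vector A hA x (μ x) (hμ x) hs
  have lim : ∀ x (F : ℕ → C(spectrum ℝ A, ℝ)),
      Tendsto (fun n => ∫ t, (F n t - s.indicator 1 t) ^ 2 ∂(μ x)) atTop (𝓝 0) →
      Tendsto (fun n => cfcHom hA (F n) x) atTop (𝓝 (z x)) := by
    intro x F h
    rw [tendsto_iff_norm_sub_tendsto_zero]
    have h1 : Tendsto (fun n => ‖cfcHom hA (F n) x - z x‖ ^ 2) atTop (𝓝 0) :=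
      squeeze_zero (fun n => sq_nonneg _) (fun n => hz x (F n)) (by simpa using h.const_mul 4)
    have := h1.sqrt
    simpa [Real.sqrt_sq] using this
  have hre : ∀ (f : C(spectrum ℝ A, ℝ)) x, ⟪x, cfcHom hA f x⟫_ℂ = ((∫ t, f t ∂(μ x) : ℝ) : ℂ) := by
    intro f x
    rw [hμ]
    have h1 : IsSelfAdjoint (cfcHom hA f) := cfcHom_predicate hA f
    have h2 := (ContinuousLinearMap.isSelfAdjoint_iff_isSymmetric.1 h1).coe_re_inner_self_apply x
    simp only [ContinuousLinearMap.coe_coe] at h2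
    exact h2.symm
  have hint : ∀ (f : C(spectrum ℝ A, ℝ)) x, Integrable (fun t => f t) (μ x) := fun f x =>
    Integrable.of_bound f.continuous.aestronglyMeasurable ‖f‖
      (Eventually.of_forall fun t => f.norm_coe_le_norm t)
  have hind : ∀ x, Integrable (s.indicator (1 : spectrum ℝ A → ℝ)) (μ x) := fun x =>
    (integrable_const (1 : ℝ)).indicator hs
  -- the quadratic form and the norm of the limit vectors
  have hquad : ∀ x, ⟪x, z x⟫_ℂ = ((μ x).real s : ℂ) ∧ ‖z x‖ ^ 2 = (μ x).real s := by
    intro x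
    obtain ⟨F, hF⟩ := exists_seq_approx (μ x) hs
    obtain ⟨hF2, hF1⟩ := hF (μ x) le_rfl
    have hl := lim x F hF2
    have hI : Tendsto (fun n => ∫ t, F n t ∂(μ x)) atTop (𝓝 ((μ x).real s)) := by
      rw [tendsto_iff_norm_sub_tendsto_zero]
      refine squeeze_zero (fun n => norm_nonneg _) (fun n => ?_) hF1
      rw [← integral_indicator_one hs, ← integral_sub (hint _ x) (hind x)]
      exact norm_integral_le_integral_norm _
    have hsq : Tendsto (fun n => ∫ t, (F n * F n) t ∂(μ x)) atTop (𝓝 ((μ x).real s)) := by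
      have hd : Tendsto (fun n => ∫ t, ((F n * F n) t - F n t) ∂(μ x)) atTop (𝓝 0) := by
        refine squeeze_zero_norm (a := fun n => ∫ t, ((F n t - s.indicator 1 t) ^ 2
          + |F n t - s.indicator 1 t|) ∂(μ x)) (fun n => ?_) ?_
        · refine (norm_integral_le_integral_norm _).trans ?_
          refine integral_mono_of_nonneg (Eventually.of_forall fun t => norm_nonneg _)
            ((integrable_sq_sub _ hs (F n)).add (((hint _ x).sub (hind x)).abs))
            (Eventually.of_forall fun t => ?_)
          simp only [ContinuousMap.mul_apply, Real.norm_eq_abs]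
          by_cases h : t ∈ s
          · simp only [h, Set.indicator_of_mem, Pi.one_apply]
            have : F n t * F n t - F n t = (F n t - 1) ^ 2 + (F n t - 1) := by ring
            rw [this]
            exact (abs_add_le _ _).trans (by rw [abs_of_nonneg (sq_nonneg (F n t - 1))])
          · simp only [h, not_false_eq_true, Set.indicator_of_notMem, sub_zero]
            exact (abs_sub _ _).trans (by rw [abs_mul_self, sq])
        · have h7 : ∀ n, ∫ t, ((F n t - s.indicator 1 t) ^ 2 + |F n t - s.indicator 1 t|) ∂(μ x)
              = ∫ t, (F n t - s.indicator 1 t) ^ 2 ∂(μ x)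
                + ∫ t, |F n t - s.indicator 1 t| ∂(μ x) := fun n =>
            integral_add (integrable_sq_sub _ hs (F n)) (((hint _ x).sub (hind x)).abs)
          simp only [h7]
          simpa using hF2.add hF1
      have := hd.add hI
      rw [zero_add] at this
      refine this.congr fun n => ?_
      rw [integral_sub (hint _ x) (hint _ x)]; ring
    constructor
    · have h1 : Tendsto (fun n => ⟪x, cfcHom hA (F n) x⟫_ℂ) atTop (𝓝 ⟪x, z x⟫_ℂ) :=
        tendsto_const_nhds.inner hl
      simp only [hre] at h1
      exact tendsto_nhds_unique h1 ((Complex.continuous_ofReal.tendsto _).comp hI)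
    · have h1 := (hl.norm).pow 2
      simp only [norm_sq_cfcHom, ← hμ] at h1
      exact tendsto_nhds_unique h1 hsq
  have hadd : ∀ x y, z (x + y) = z x + z y := by
    intro x y
    have := hfin x
    have := hfin y
    have := hfin (x + y)
    obtain ⟨F, hF⟩ := exists_seq_approx (μ x + μ y + μ (x + y)) hs
    have h1 := lim x F (hF _ (Measure.le_add_right (Measure.le_add_right le_rfl))).1
    have h2 := lim y F (hF _ (Measure.le_add_right (Measure.le_add_left le_rfl))).1
    have h3 := lim (x + y) F (hF _ (Measure.le_add_left le_rfl)).1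
    simp only [map_add] at h3
    exact tendsto_nhds_unique h3 (h1.add h2)
  have hsmul : ∀ (c : ℂ) x, z (c • x) = c • z x := by
    intro c x
    have := hfin x
    have := hfin (c • x)
    obtain ⟨F, hF⟩ := exists_seq_approx (μ x + μ (c • x)) hs
    have h1 := lim x F (hF _ (Measure.le_add_right le_rfl)).1
    have h3 := lim (c • x) F (hF _ (Measure.le_add_left le_rfl)).1
    simp only [map_smul] at h3
    exact tendsto_nhds_unique h3 (h1.const_smul c)
  have hself : ∀ x, ⟪x, z x⟫_ℂ = ⟪z x, z x⟫_ℂ := by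
    intro x
    rw [inner_self_eq_norm_sq_to_K, (hquad x).1, ← (hquad x).2]
    norm_cast
  have hbd : ∀ x, ‖z x‖ ≤ 1 * ‖x‖ := by
    intro x
    have h1 : ‖z x‖ ^ 2 ≤ ‖x‖ * ‖z x‖ := by
      have := norm_inner_le_norm (𝕜 := ℂ) x (z x)
      rw [hself, inner_self_eq_norm_sq_to_K] at this
      simpa using this
    rcases (norm_nonneg (z x)).eq_or_lt with h | h
    · rw [← h]; positivity
    · rw [one_mul]; nlinarith
  let P : H →L[ℂ] H :=
    LinearMap.mkContinuous { toFun := z, map_add' := hadd, map_smul' := hsmul } 1 hbd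
  have hP : ∀ x, P x = z x := fun x => rfl
  refine ⟨P, ?_, fun x => (hquad x).1⟩
  have hsa : IsSelfAdjoint P := by
    rw [ContinuousLinearMap.isSelfAdjoint_iff_isSymmetric, LinearMap.isSymmetric_iff_inner_map_self_real]
    intro v
    simp only [ContinuousLinearMap.coe_coe, hP]
    rw [inner_conj_symm, hself, inner_self_eq_norm_sq_to_K, ← inner_conj_symm, hself,
      inner_self_eq_norm_sq_to_K]
    norm_cast
    simp
  refine ⟨?_, hsa⟩
  have : (P * P : H →L[ℂ] H).toLinearMap = P.toLinearMap := by
    rw [← ext_inner_map]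
    intro x
    have h1 : ⟪P (P x), x⟫_ℂ = ⟪P x, P x⟫_ℂ := by
      have := ContinuousLinearMap.adjoint_inner_left P x (P x)
      rw [hsa.adjoint_eq] at this
      exact this
    have h2 : ⟪P x, x⟫_ℂ = ⟪P x, P x⟫_ℂ := by
      rw [← inner_conj_symm, hP, hself, inner_conj_symm]
    exact h1.trans h2.symm
  ext x
  exact LinearMap.congr_fun this x

end Construction

namespace SpectralMeasure

variable {X : Type*} [MeasurableSpace X] {H : Type*}
  [NormedAddCommGroup H] [InnerProductSpace ℂ H] [CompleteSpace H]

theorem re_inner_proj_nonneg (E : SpectralMeasure X H) (x : H) (s : Set X)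
    (hs : MeasurableSet s) : 0 ≤ (⟪x, E.proj s x⟫_ℂ).re :=
  ((ContinuousLinearMap.nonneg_iff_isPositive _).1
    (E.isStarProjection s hs).nonneg).re_inner_nonneg_right x

theorem hasSum_re_inner (E : SpectralMeasure X H) (x : H) (s : ℕ → Set X)
    (hs : ∀ n, MeasurableSet (s n)) (hd : Pairwise (Function.onFun Disjoint s)) :
    HasSum (fun n => (⟪x, E.proj (s n) x⟫_ℂ).re) (⟪x, E.proj (⋃ n, s n) x⟫_ℂ).re :=
  Complex.hasSum_re ((innerSL ℂ x).hasSum (E.hasSum_proj s hs hd x))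

/-- The scalar measure `s ↦ (E(s) x, x)`. -/
noncomputable def measure (E : SpectralMeasure X H) (x : H) : Measure X :=
  Measure.ofMeasurable (fun s _ => ENNReal.ofReal (⟪x, E.proj s x⟫_ℂ).re)
    (by
      have h := E.hasSum_re_inner x (fun _ => ∅) (fun _ => MeasurableSet.empty)
        (fun _ _ _ => disjoint_bot_left)
      have h0 := tendsto_nhds_unique tendsto_const_nhds h.summable.tendsto_atTop_zero
      simp [h0])
    (by
      intro s hs hd
      have h := E.hasSum_re_inner x s hs hd
      rw [← h.tsum_eq, ENNReal.ofReal_tsum_of_nonneg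
        (fun n => E.re_inner_proj_nonneg x _ (hs n)) h.summable])

theorem measure_apply (E : SpectralMeasure X H) (x : H) {s : Set X} (hs : MeasurableSet s) :
    E.measure x s = ENNReal.ofReal (⟪x, E.proj s x⟫_ℂ).re :=
  Measure.ofMeasurable_apply s hs

/-- `T = ∫ φ dE`, i.e. `(T x, x) = ∫ φ d(E(·) x, x)` for every `x`. Since the Hilbert space is
complex, there is at most one such bounded operator `T`; if `φ` is measurable and `E`-essentially
bounded, there is one. -/
def HasIntegral (E : SpectralMeasure X H) (φ : X → ℂ) (T : H →L[ℂ] H) : Prop :=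
  ∀ x : H, Integrable φ (E.measure x) ∧ ⟪x, T x⟫_ℂ = ∫ t, φ t ∂(E.measure x)

/-- The bounded operator `∫ φ dE`. -/
noncomputable def integral (E : SpectralMeasure X H) (φ : X → ℂ) : H →L[ℂ] H :=
  Classical.epsilon (E.HasIntegral φ)

/-- `P` holds `E`-almost everywhere. -/
def AE (E : SpectralMeasure X H) (P : X → Prop) : Prop :=
  ∀ x : H, ∀ᵐ t ∂(E.measure x), P t

end SpectralMeasure

section SpectralTheorem

variable {H : Type*} [NormedAddCommGroup H] [InnerProductSpace ℂ H] [CompleteSpace H]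

/-- `E` is the spectral measure of the bounded self-adjoint operator `A`: it is concentrated on the
spectrum of `A`, and `A = ∫ t dE(t)`. -/
def IsSpectralMeasureOf (E : SpectralMeasure ℝ H) (A : H →L[ℂ] H) : Prop :=
  E.proj (spectrum ℝ A) = 1 ∧ E.HasIntegral (fun t => (t : ℂ)) A

theorem eq_of_inner (S T : H →L[ℂ] H) (h : ∀ x, ⟪x, S x⟫_ℂ = ⟪x, T x⟫_ℂ) : S = T := by
  have : S.toLinearMap = T.toLinearMap := by
    rw [← ext_inner_map]
    intro x
    have := congrArg (starRingEnd ℂ) (h x)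
    rwa [inner_conj_symm, inner_conj_symm] at this
  ext x
  exact LinearMap.congr_fun this x

theorem norm_sq_starProjection {P : H →L[ℂ] H} (hP : IsStarProjection P) (x : H) :
    ‖P x‖ ^ 2 = (⟪x, P x⟫_ℂ).re := by
  have h1 : ⟪x, P (P x)⟫_ℂ = ⟪P x, P x⟫_ℂ := by
    rw [← ContinuousLinearMap.adjoint_inner_left, hP.isSelfAdjoint.adjoint_eq]
  have h2 : P (P x) = P x := DFunLike.congr_fun hP.isIdempotentElem x
  rw [h2] at h1
  rw [h1, inner_self_eq_norm_sq_to_K]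
  norm_cast

/-- The spectral theorem for a bounded self-adjoint operator. -/
theorem exists_isSpectralMeasureOf (A : H →L[ℂ] H) (hA : IsSelfAdjoint A) :
    ∃ E : SpectralMeasure ℝ H, IsSpectralMeasureOf E A := by
  classical
  have hK : IsCompact (spectrum ℝ A) := ContinuousFunctionalCalculus.isCompact_spectrum A
  have : CompactSpace (spectrum ℝ A) := isCompact_iff_compactSpace.mp hK
  choose μ hfin hμ using exists_scalar_measure A hA
  choose P hP hPμ using fun (s : Set ℝ) (hs : MeasurableSet s) =>
    exists_proj A hA μ hfin hμ (hs.preimage measurable_subtype_coe)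
  let ν : H → Measure ℝ := fun x => (μ x).map Subtype.val
  have hν : ∀ x, IsFiniteMeasure (ν x) := fun x => by
    have := hfin x
    exact inferInstanceAs (IsFiniteMeasure ((μ x).map Subtype.val))
  have hPν : ∀ s (hs : MeasurableSet s) x, ⟪x, P s hs x⟫_ℂ = ((ν x).real s : ℂ) := by
    intro s hs x
    rw [hPμ, map_measureReal_apply measurable_subtype_coe hs]
  have hone : ∀ x, (ν x).real Set.univ = ‖x‖ ^ 2 := by
    intro x
    have h1 := hμ x 1
    simp only [map_one, ContinuousMap.one_apply, integral_const, smul_eq_mul, mul_one,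
      one_apply_eq_self] at h1
    rw [map_measureReal_apply measurable_subtype_coe MeasurableSet.univ, Set.preimage_univ, h1,
      inner_self_eq_norm_sq_to_K]
    norm_cast
  have hsup : ∀ x, ∀ᵐ t ∂(ν x), t ∈ spectrum ℝ A := fun x => by
    exact (ae_map_iff (p := fun t => t ∈ spectrum ℝ A) measurable_subtype_coe.aemeasurable
      hK.measurableSet).2 (Eventually.of_forall fun t => t.2)
  let E : SpectralMeasure ℝ H :=
    { proj := fun s => if h : MeasurableSet s then P s h else 0
      isStarProjection := fun s hs => by simp only [hs, dif_pos]; exact hP s hs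
      proj_univ := by
        simp only [MeasurableSet.univ, dif_pos]
        refine eq_of_inner _ _ fun x => ?_
        rw [hPν, hone, one_apply_eq_self, inner_self_eq_norm_sq_to_K]
        norm_cast
      hasSum_proj := fun s hs hd x => by
        have hU := MeasurableSet.iUnion hs
        simp only [hs, hU, dif_pos]
        have hF : ∀ F : Finset ℕ, MeasurableSet ((⋃ n, s n) \ ⋃ n ∈ F, s n) := fun F =>
          hU.diff (F.measurableSet_biUnion fun n _ => hs n)
        have hdiff : ∀ F : Finset ℕ, (ν x).real ((⋃ n, s n) \ ⋃ n ∈ F, s n)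
            = (ν x).real (⋃ n, s n) - ∑ n ∈ F, (ν x).real (s n) := fun F => by
          rw [measureReal_sdiff (Set.iUnion₂_subset fun n _ => Set.subset_iUnion s n)
            (F.measurableSet_biUnion fun n _ => hs n),
            measureReal_biUnion_finset (fun i _ j _ hij => hd hij) (fun n _ => hs n)]
        have hop : ∀ F : Finset ℕ, P _ hU - ∑ n ∈ F, P (s n) (hs n) = P _ (hF F) := fun F => by
          refine eq_of_inner _ _ fun y => ?_
          rw [hPν, sub_apply, inner_sub_right, hPν, sum_apply, inner_sum]
          simp only [hPν]
          rw [measureReal_sdiff (Set.iUnion₂_subset fun n _ => Set.subset_iUnion s n)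
            (F.measurableSet_biUnion fun n _ => hs n),
            measureReal_biUnion_finset (fun i _ j _ hij => hd hij) (fun n _ => hs n)]
          push_cast
          rfl
        have hs1 : HasSum (fun n => (ν x).real (s n)) ((ν x).real (⋃ n, s n)) := by
          rw [measureReal_def, measure_iUnion hd hs,
            ENNReal.tsum_toReal_eq fun n => measure_ne_top _ _]
          refine (ENNReal.summable_toReal ?_).hasSum
          rw [← measure_iUnion hd hs]
          exact measure_ne_top _ _
        rw [HasSum, tendsto_iff_norm_sub_tendsto_zero]
        have h1 : Tendsto (fun F : Finset ℕ =>
            Real.sqrt ((ν x).real (⋃ n, s n) - ∑ n ∈ F, (ν x).real (s n))) atTop (𝓝 0) := by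
          have := (Tendsto.const_sub ((ν x).real (⋃ n, s n)) hs1).sqrt
          simpa using this
        refine h1.congr fun F => ?_
        rw [← hdiff, norm_sub_rev]
        have h2 : P _ hU x - ∑ n ∈ F, P (s n) (hs n) x = P _ (hF F) x := by
          rw [← hop F, sub_apply, sum_apply]
        rw [h2]
        have h3 := norm_sq_starProjection (hP _ (hF F)) x
        rw [hPν, Complex.ofReal_re] at h3
        rw [← h3, Real.sqrt_sq (norm_nonneg _)] }
  have hEP : ∀ s (hs : MeasurableSet s), E.proj s = P s hs := fun s hs => by
    simp only [E, hs, dif_pos]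
  have hEν : ∀ x, E.measure x = ν x := fun x => by
    ext s hs
    rw [E.measure_apply x hs, hEP s hs, hPν, Complex.ofReal_re, ofReal_measureReal]
  refine ⟨E, ?_, fun x => ?_⟩
  · rw [hEP _ hK.measurableSet]
    refine eq_of_inner _ _ fun x => ?_
    rw [hPν, one_apply_eq_self, inner_self_eq_norm_sq_to_K]
    have h1 : ν x (spectrum ℝ A) = ν x Set.univ := measure_congr (eventuallyEq_univ.2 (hsup x))
    rw [measureReal_def, h1, ← measureReal_def, hone]
    norm_cast
  · rw [hEν]
    obtain ⟨C, hC⟩ := hK.isBounded.exists_norm_le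
    constructor
    · refine Integrable.of_bound (C := C) Complex.continuous_ofReal.aestronglyMeasurable ?_
      filter_upwards [hsup x] with t ht
      simpa using hC t ht
    · have h1 := hμ x ((ContinuousMap.id ℝ).restrict (spectrum ℝ A))
      rw [cfcHom_id] at h1
      have h2 : ∫ t, (t : ℂ) ∂(ν x) = ((∫ t, ((ContinuousMap.id ℝ).restrict (spectrum ℝ A)) t
          ∂(μ x) : ℝ) : ℂ) := by
        rw [integral_map measurable_subtype_coe.aemeasurable
          Complex.continuous_ofReal.aestronglyMeasurable]
        exact integral_ofReal
      rw [h2, h1]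
      exact ((ContinuousLinearMap.isSelfAdjoint_iff_isSymmetric.1 hA).coe_re_inner_self_apply x).symm

/-- The spectral measure `E_A` of a bounded self-adjoint operator `A`. -/
noncomputable def spectralMeasure (A : H →L[ℂ] H) (hA : IsSelfAdjoint A) : SpectralMeasure ℝ H :=
  (exists_isSpectralMeasureOf A hA).choose

end SpectralTheorem

section Schatten

variable {H : Type*} [NormedAddCommGroup H] [InnerProductSpace ℂ H] [CompleteSpace H]

/-- The singular number `s_n(T)`, `n ≥ 0`: the distance in the operator norm from `T` to the set of
operators of rank at most `n`. -/
noncomputable def singularNumber (T : H →L[ℂ] H) (n : ℕ) : ℝ :=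
  sInf {r : ℝ | ∃ F : H →L[ℂ] H, LinearMap.rank (F : H →ₗ[ℂ] H) ≤ (n : Cardinal) ∧ r = ‖T - F‖}

/-- The Schatten--von Neumann class `S_p`, `0 < p < ∞`. -/
def MemSchatten (p : ℝ) (T : H →L[ℂ] H) : Prop :=
  Summable fun n : ℕ => singularNumber T n ^ p

/-- The class `S_{p'}` with `1/p + 1/p' = 1` if `p > 1`, and the class of compact operators if
`p = 1`. -/
def MemPredual (p : ℝ) (Q : H →L[ℂ] H) : Prop :=
  (p = 1 → IsCompactOperator Q) ∧ (p ≠ 1 → MemSchatten (p / (p - 1)) Q)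

/-- The trace `∑ (T e_i, e_i)` of a trace class operator, computed in a fixed orthonormal basis
(it does not depend on the basis if `T` is of trace class). -/
noncomputable def trace (T : H →L[ℂ] H) : ℂ :=
  ∑' i, ⟪(exists_hilbertBasis ℂ H).choose_spec.choose i,
    T ((exists_hilbertBasis ℂ H).choose_spec.choose i)⟫_ℂ

end Schatten

section DoubleOperatorIntegrals

variable {X Y : Type*} [MeasurableSpace X] [MeasurableSpace Y]
  {H : Type*} [NormedAddCommGroup H] [InnerProductSpace ℂ H] [CompleteSpace H]

/-- `Φ` is measurable and essentially bounded with respect to `E₁` and `E₂`. -/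
def IsEssBounded (E₁ : SpectralMeasure X H) (E₂ : SpectralMeasure Y H) (Φ : X → Y → ℂ) : Prop :=
  Measurable (fun q : X × Y => Φ q.1 q.2) ∧
    ∃ C : ℝ, ∀ u v : H, ∀ᵐ q ∂((E₁.measure u).prod (E₂.measure v)), ‖Φ q.1 q.2‖ ≤ C

/-- `X₀ = ∬ Φ(x, y) dE₁(x) T dE₂(y)` for `T` in the Hilbert--Schmidt class and bounded measurable
`Φ`. The double operator integral is `(∫ Φ d𝓔) T`, where `𝓔` is the spectral measure on the Hilbert
space `S_2` with `𝓔(Λ × Δ) T = E₁(Λ) T E₂(Δ)`. This equality in `S_2` is tested against the rank one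
operators `(·, a) b`: the complex measure `(𝓔(·) T, (·, a) b)` takes the value
`(E₁(Λ) T E₂(Δ) a, b)` on `Λ × Δ`, and is written as `h ν` with a finite measure `ν` and
`h ∈ L¹(ν)`. -/
def IsHilbertSchmidtDOI (E₁ : SpectralMeasure X H) (E₂ : SpectralMeasure Y H) (Φ : X → Y → ℂ)
    (T X₀ : H →L[ℂ] H) : Prop :=
  IsEssBounded E₁ E₂ Φ ∧ MemSchatten 2 T ∧ MemSchatten 2 X₀ ∧
    ∀ a b : H, ∃ (ν : Measure (X × Y)) (h : X × Y → ℂ), IsFiniteMeasure ν ∧ Integrable h ν ∧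
      (∀ (Λ : Set X) (Δ : Set Y), MeasurableSet Λ → MeasurableSet Δ →
        ∫ q in Λ ×ˢ Δ, h q ∂ν = ⟪b, E₁.proj Λ (T (E₂.proj Δ a))⟫_ℂ) ∧
      ⟪b, X₀ a⟫_ℂ = ∫ q, Φ q.1 q.2 * h q ∂ν

/-- `Φ` is a Schur multiplier of `S_1` associated with `E₁` and `E₂`. -/
def IsSchurMultiplierTraceClass (E₁ : SpectralMeasure X H) (E₂ : SpectralMeasure Y H)
    (Φ : X → Y → ℂ) : Prop :=
  IsEssBounded E₁ E₂ Φ ∧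
    ∀ T : H →L[ℂ] H, MemSchatten 1 T →
      ∃ X₀ : H →L[ℂ] H, IsHilbertSchmidtDOI E₁ E₂ Φ T X₀ ∧ MemSchatten 1 X₀

/-- `Φ` is a Schur multiplier (with respect to `E₁` and `E₂`) of the space of bounded operators. -/
def IsSchurMultiplier (E₁ : SpectralMeasure X H) (E₂ : SpectralMeasure Y H)
    (Φ : X → Y → ℂ) : Prop :=
  IsSchurMultiplierTraceClass E₂ E₁ fun y x => Φ x y

/-- `W = ∬ Φ(x, y) dE₁(x) T dE₂(y)` for a bounded operator `T` and a Schur multiplier `Φ`: the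
transformer is the dual, with respect to the trace pairing, of the transformer
`Q ↦ ∬ Φ(x, y) dE₂(y) Q dE₁(x)` on `S_1`. -/
def IsDOI (E₁ : SpectralMeasure X H) (E₂ : SpectralMeasure Y H) (Φ : X → Y → ℂ)
    (T W : H →L[ℂ] H) : Prop :=
  IsSchurMultiplier E₁ E₂ Φ ∧
    ∀ Q : H →L[ℂ] H, MemSchatten 1 Q → ∀ X₀ : H →L[ℂ] H,
      IsHilbertSchmidtDOI E₂ E₁ (fun y x => Φ x y) Q X₀ → trace (W * Q) = trace (T * X₀)

/-- The double operator integral `∬ Φ(x, y) dE₁(x) T dE₂(y)`. -/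
noncomputable def doubleOpIntegral (E₁ : SpectralMeasure X H) (E₂ : SpectralMeasure Y H)
    (Φ : X → Y → ℂ) (T : H →L[ℂ] H) : H →L[ℂ] H :=
  Classical.epsilon (IsDOI E₁ E₂ Φ T)

end DoubleOperatorIntegrals

section TripleOperatorIntegrals

variable {X₁ X₂ X₃ : Type*} [MeasurableSpace X₁] [MeasurableSpace X₂] [MeasurableSpace X₃]
  {H : Type*} [NormedAddCommGroup H] [InnerProductSpace ℂ H] [CompleteSpace H]

/-- `{α_j} ∈ L^∞_E(ℓ²)`. -/
def MemLinftyL2 {X : Type*} [MeasurableSpace X] (E : SpectralMeasure X H) (α : ℕ → X → ℂ) : Prop :=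
  (∀ j, Measurable (α j)) ∧
    ∃ C : ℝ, E.AE fun x => (Summable fun j => ‖α j x‖ ^ 2) ∧ ∑' j, ‖α j x‖ ^ 2 ≤ C

/-- The matrix `{b_{jk}}` induces an operator on `ℓ²` of norm at most `C`. -/
def MatrixNormLE (C : ℝ) (b : ℕ → ℕ → ℂ) : Prop :=
  ∃ L : lp (fun _ : ℕ => ℂ) 2 →L[ℂ] lp (fun _ : ℕ => ℂ) 2,
    ‖L‖ ≤ C ∧ ∀ j k, L (lp.single 2 k (1 : ℂ)) j = b j k

/-- `{β_{jk}} ∈ L^∞_E(𝓑)`, where `𝓑` is the space of matrices of bounded operators on `ℓ²`. -/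
def MemLinftyMatrix {X : Type*} [MeasurableSpace X] (E : SpectralMeasure X H)
    (β : ℕ → ℕ → X → ℂ) : Prop :=
  (∀ j k, Measurable (β j k)) ∧ ∃ C : ℝ, E.AE fun x => MatrixNormLE C fun j k => β j k x

/-- Equality of `Ψ` with `∑_{j,k} F j k := lim_{M,N → ∞} ∑_{j < N} ∑_{k < M} F j k` almost everywhere
with respect to `E₁`, `E₂` and `E₃`. -/
def AESum (E₁ : SpectralMeasure X₁ H) (E₂ : SpectralMeasure X₂ H) (E₃ : SpectralMeasure X₃ H)
    (F : ℕ → ℕ → X₁ → X₂ → X₃ → ℂ) (Ψ : X₁ → X₂ → X₃ → ℂ) : Prop :=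
  ∀ u v w : H, ∀ᵐ q ∂((E₁.measure u).prod ((E₂.measure v).prod (E₃.measure w))),
    Tendsto (fun N : ℕ × ℕ => ∑ j ∈ Finset.range N.1, ∑ k ∈ Finset.range N.2,
      F j k q.1 q.2.1 q.2.2) atTop (𝓝 (Ψ q.1 q.2.1 q.2.2))

/-- The representation `Ψ(x₁, x₂, x₃) = ∑_{j,k} α_j(x₁) β_{jk}(x₂) γ_k(x₃)` of an element of the
Haagerup tensor product `L^∞(E₁) ⊗_h L^∞(E₂) ⊗_h L^∞(E₃)`. -/
def IsHaagerupRep (E₁ : SpectralMeasure X₁ H) (E₂ : SpectralMeasure X₂ H)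
    (E₃ : SpectralMeasure X₃ H) (Ψ : X₁ → X₂ → X₃ → ℂ)
    (α : ℕ → X₁ → ℂ) (β : ℕ → ℕ → X₂ → ℂ) (γ : ℕ → X₃ → ℂ) : Prop :=
  MemLinftyL2 E₁ α ∧ MemLinftyMatrix E₂ β ∧ MemLinftyL2 E₃ γ ∧
    AESum E₁ E₂ E₃ (fun j k x₁ x₂ x₃ => α j x₁ * β j k x₂ * γ k x₃) Ψ

/-- `W = ∭ Ψ(x₁, x₂, x₃) dE₁(x₁) T dE₂(x₂) R dE₃(x₃)` for `Ψ` in the Haagerup tensor product: `Ψ`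
has a representation as above, and for each such representation `W` is the sum, in the weak operator
topology, of the series `∑_{j,k} (∫ α_j dE₁) T (∫ β_{jk} dE₂) R (∫ γ_k dE₃)`. -/
def IsHaagerupTOI (E₁ : SpectralMeasure X₁ H) (E₂ : SpectralMeasure X₂ H)
    (E₃ : SpectralMeasure X₃ H) (Ψ : X₁ → X₂ → X₃ → ℂ) (T R W : H →L[ℂ] H) : Prop :=
  (∃ α β γ, IsHaagerupRep E₁ E₂ E₃ Ψ α β γ) ∧
    ∀ α β γ, IsHaagerupRep E₁ E₂ E₃ Ψ α β γ → ∀ x y : H,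
      Tendsto (fun N : ℕ × ℕ => ⟪y, (∑ j ∈ Finset.range N.1, ∑ k ∈ Finset.range N.2,
        E₁.integral (α j) * T * E₂.integral (β j k) * R * E₃.integral (γ k)) x⟫_ℂ)
        atTop (𝓝 ⟪y, W x⟫_ℂ)

/-- `Ψ` belongs to the Haagerup-like tensor product of the first kind:
`Ψ(x₁, x₂, x₃) = ∑_{j,k} α_j(x₁) β_k(x₂) γ_{jk}(x₃)`. -/
def MemHaagerupFirst (E₁ : SpectralMeasure X₁ H) (E₂ : SpectralMeasure X₂ H)
    (E₃ : SpectralMeasure X₃ H) (Ψ : X₁ → X₂ → X₃ → ℂ) : Prop :=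
  ∃ (α : ℕ → X₁ → ℂ) (β : ℕ → X₂ → ℂ) (γ : ℕ → ℕ → X₃ → ℂ),
    MemLinftyL2 E₁ α ∧ MemLinftyL2 E₂ β ∧ MemLinftyMatrix E₃ γ ∧
      AESum E₁ E₂ E₃ (fun j k x₁ x₂ x₃ => α j x₁ * β k x₂ * γ j k x₃) Ψ

/-- `Ψ` belongs to the Haagerup-like tensor product of the second kind:
`Ψ(x₁, x₂, x₃) = ∑_{j,k} α_{jk}(x₁) β_j(x₂) γ_k(x₃)`. -/
def MemHaagerupSecond (E₁ : SpectralMeasure X₁ H) (E₂ : SpectralMeasure X₂ H)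
    (E₃ : SpectralMeasure X₃ H) (Ψ : X₁ → X₂ → X₃ → ℂ) : Prop :=
  ∃ (α : ℕ → ℕ → X₁ → ℂ) (β : ℕ → X₂ → ℂ) (γ : ℕ → X₃ → ℂ),
    MemLinftyMatrix E₁ α ∧ MemLinftyL2 E₂ β ∧ MemLinftyL2 E₃ γ ∧
      AESum E₁ E₂ E₃ (fun j k x₁ x₂ x₃ => α j k x₁ * β j x₂ * γ k x₃) Ψ

/-- `W = ∭ Ψ(x₁, x₂, x₃) dE₁(x₁) T dE₂(x₂) R dE₃(x₃)` for `Ψ` in the Haagerup-like tensor product of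
the first kind, `T ∈ S_p` and bounded `R`: the operator `W ∈ S_p` represents the functional
`Q ↦ trace ((∭ Ψ(x₁, x₂, x₃) dE₂(x₂) R dE₃(x₃) Q dE₁(x₁)) T)` on `S_{p'}` (on the compact operators
if `p = 1`). -/
def IsTOIFirst (p : ℝ) (E₁ : SpectralMeasure X₁ H) (E₂ : SpectralMeasure X₂ H)
    (E₃ : SpectralMeasure X₃ H) (Ψ : X₁ → X₂ → X₃ → ℂ) (T R W : H →L[ℂ] H) : Prop :=
  MemHaagerupFirst E₁ E₂ E₃ Ψ ∧ MemSchatten p T ∧ MemSchatten p W ∧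
    ∀ Q : H →L[ℂ] H, MemPredual p Q → ∃ X₀ : H →L[ℂ] H,
      IsHaagerupTOI E₂ E₃ E₁ (fun x₂ x₃ x₁ => Ψ x₁ x₂ x₃) R Q X₀ ∧
        MemSchatten 1 (X₀ * T) ∧ trace (W * Q) = trace (X₀ * T)

/-- `W = ∭ Ψ(x₁, x₂, x₃) dE₁(x₁) T dE₂(x₂) R dE₃(x₃)` for `Ψ` in the Haagerup-like tensor product of
the second kind, bounded `T` and `R ∈ S_p`: the operator `W ∈ S_p` represents the functional
`Q ↦ trace ((∭ Ψ(x₁, x₂, x₃) dE₃(x₃) Q dE₁(x₁) T dE₂(x₂)) R)` on `S_{p'}` (on the compact operators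
if `p = 1`). -/
def IsTOISecond (p : ℝ) (E₁ : SpectralMeasure X₁ H) (E₂ : SpectralMeasure X₂ H)
    (E₃ : SpectralMeasure X₃ H) (Ψ : X₁ → X₂ → X₃ → ℂ) (T R W : H →L[ℂ] H) : Prop :=
  MemHaagerupSecond E₁ E₂ E₃ Ψ ∧ MemSchatten p R ∧ MemSchatten p W ∧
    ∀ Q : H →L[ℂ] H, MemPredual p Q → ∃ X₀ : H →L[ℂ] H,
      IsHaagerupTOI E₃ E₁ E₂ (fun x₃ x₁ x₂ => Ψ x₁ x₂ x₃) Q T X₀ ∧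
        MemSchatten 1 (X₀ * R) ∧ trace (W * Q) = trace (X₀ * R)

/-- The triple operator integral `∭ Ψ dE₁ T dE₂ R dE₃` for `Ψ` in the Haagerup-like tensor product of
the first kind and `T ∈ S_p`. -/
noncomputable def tripleOpIntegralFirst (p : ℝ) (E₁ : SpectralMeasure X₁ H)
    (E₂ : SpectralMeasure X₂ H) (E₃ : SpectralMeasure X₃ H) (Ψ : X₁ → X₂ → X₃ → ℂ)
    (T R : H →L[ℂ] H) : H →L[ℂ] H :=
  Classical.epsilon (IsTOIFirst p E₁ E₂ E₃ Ψ T R)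

/-- The triple operator integral `∭ Ψ dE₁ T dE₂ R dE₃` for `Ψ` in the Haagerup-like tensor product of
the second kind and `R ∈ S_p`. -/
noncomputable def tripleOpIntegralSecond (p : ℝ) (E₁ : SpectralMeasure X₁ H)
    (E₂ : SpectralMeasure X₂ H) (E₃ : SpectralMeasure X₃ H) (Ψ : X₁ → X₂ → X₃ → ℂ)
    (T R : H →L[ℂ] H) : H →L[ℂ] H :=
  Classical.epsilon (IsTOISecond p E₁ E₂ E₃ Ψ T R)

end TripleOperatorIntegrals

section Besov

/-- The class of continuous functions `g` on `ℝ^d` with `|g| ≤ 1` whose distributional Fourier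
transform is supported in the closed unit ball. With the normalisation
`(F φ)(t) = ∫ φ(x) exp(-i (x, t)) dx` of the Fourier transform, the ball `‖t‖ ≤ 1` corresponds to
`2 π ‖ξ‖ ≤ 1` for the transform `𝓕`, whose kernel is `exp(-2 π i (x, ξ))`. -/
def IsUnitBandLimited {d : ℕ} (g : EuclideanSpace ℝ (Fin d) → ℂ) : Prop :=
  Continuous g ∧ (∀ x, ‖g x‖ ≤ 1) ∧
    ∀ φ : SchwartzMap (EuclideanSpace ℝ (Fin d)) ℂ,
      (∀ ξ ∈ tsupport φ, 1 < 2 * Real.pi * ‖ξ‖) →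
        ∫ x, g x * (FourierTransform.fourier φ : SchwartzMap (EuclideanSpace ℝ (Fin d)) ℂ) x = 0

/-- The Besov class `B^1_{∞,1}(ℝ^d)`: the functions
`c + ∑_n α_n σ_n⁻¹ (g_n(σ_n x) - g_n(0))` with `c ∈ ℂ`, `∑ |α_n| < ∞`, `σ_n > 0`, and `g_n`
continuous, bounded by `1`, with Fourier transform supported in the unit ball. -/
def MemBesov {d : ℕ} (f : EuclideanSpace ℝ (Fin d) → ℂ) : Prop :=
  ∃ (c : ℂ) (α : ℕ → ℂ) (σ : ℕ → ℝ) (g : ℕ → EuclideanSpace ℝ (Fin d) → ℂ),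
    (∀ n, IsUnitBandLimited (g n)) ∧ (∀ n, 0 < σ n) ∧ (Summable fun n => ‖α n‖) ∧
      ∀ x, HasSum (fun n => α n * ((σ n)⁻¹ : ℝ) * (g n (σ n • x) - g n 0)) (f x - c)

/-- The divided difference `(f(x₁, y) - f(x₂, y)) / (x₁ - x₂)`, which is `∂f/∂x (x₁, y)` for
`x₁ = x₂`. -/
noncomputable def dividedDiffFirst (f : EuclideanSpace ℝ (Fin 2) → ℂ) (x₁ x₂ y : ℝ) : ℂ :=
  if x₁ = x₂ then deriv (fun x : ℝ => f !₂[x, y]) x₁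
  else (f !₂[x₁, y] - f !₂[x₂, y]) / ((x₁ - x₂ : ℝ) : ℂ)

/-- The divided difference `(f(x, y₁) - f(x, y₂)) / (y₁ - y₂)`, which is `∂f/∂y (x, y₁)` for
`y₁ = y₂`. -/
noncomputable def dividedDiffSecond (f : EuclideanSpace ℝ (Fin 2) → ℂ) (x y₁ y₂ : ℝ) : ℂ :=
  if y₁ = y₂ then deriv (fun y : ℝ => f !₂[x, y]) y₁
  else (f !₂[x, y₁] - f !₂[x, y₂]) / ((y₁ - y₂ : ℝ) : ℂ)

end Besov

end OpInt

/-! The increment splits as `[f(A₁,B₁) - f(A₂,B₁)] + [f(A₂,B₁) - f(A₂,B₂)]`, so only one operator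
changes at a time. The second bracket is treated like the first, with the two variables exchanged
and adjoints taken where necessary. The proof has four ingredients.

Sampling. A function with spectrum in the unit ball is recovered on every line from its values at
equally spaced points by means of a Schwartz kernel `κ`: `g(x) = ∑_j κ(x - j) g(j)`. The divided
difference is an average of derivatives along a segment, so it is sampled in both arguments:
`D(x₁,x₂,y) = ∑_{j,k} κ(x₁ - j) κ(x₂ - k) D(j,k,y)`. For fixed `y` the matrix `D(j,k,y)` is bounded
on `ℓ²`: off the diagonal it is a commutator of the Hilbert matrix with a bounded diagonal matrix,
and on the diagonal it consists of derivatives, bounded by Bernstein's inequality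
(`IsSampled.scalarBound_divDiff`). The scales of the Besov expansion are assembled by giving each
column a factor of modulus `|α_m|^{1/2}` and placing the matrices in a block diagonal. This is a
Haagerup-like representation with the matrix in the variable `y` (`IsBesovSeries.tendsto_factors`).

Schatten estimates. Such a representation leads to `W = ∑_j A_j T D_j^*`, in which the columns
`(A_j)` and `(A_j^*)` are both bounded, but only the column `(D_j)` is. A Schur test shows that `W`
inherits `S_p` from `T` when `p ≤ 2`, and that `trace (W Q) = trace (X T)` for `X = ∑_j D_j^* Q
A_j`; the condition `p ≤ 2` enters as `p' ≥ 2` (`ColumnBound.memSchatten`,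
`exists_column_transform`). The operator `X` is the Haagerup integral that defines `W` by duality.
It does not depend on the representation, because its matrix entries in an orthonormal basis are
integrals of `Ψ` itself (`IsHaagerupRep.triForm_eq`, `FormBound.formVal_eq`).

Functions of a pair. The expansion `f(x,y) = f(0,y) + x ∑ …`, sampled in `x` only, writes `f` as a
sum of products `φ_i(x) ψ_i(y)` with square summable columns on the spectra. Such functions are
Schur multipliers of `S_1`, so `f(A,B)` exists and equals `∑_i φ_i(A) ψ_i(B)` weakly
(`IsBesovSeries.isColumnRep`, `IsColumnRep.exists_isDOI`).

The identity. At one scale everything converges absolutely on the bounded spectra. There `(x₁ - x₂)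
D(x₁,x₂) = x₁ D(x₁,0) - x₂ D(x₂,0)` holds for functions, and it passes to operators because the
matrix element of a triple integral depends on the integrand alone (`TripleElement.unique`). The
left side produces `A₁ - A₂` between the spectral measures and the right side the difference of the
two functions of a pair. Summation over the scales completes the proof. -/

set_option linter.unusedSectionVars false

namespace OpInt

universe u

/-! ### Weak limits and bounded matrices of operators on `ℓ²(H)` -/

section HilbertGeneralities

variable {H : Type*} [NormedAddCommGroup H] [InnerProductSpace ℂ H] [CompleteSpace H]
variable {ι κ : Type*}

/-- A bounded net of operators whose matrix coefficients converge has a limit in the weak operator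
topology. -/
theorem exists_weak_limit {l : Filter ι} [l.NeBot] (S : ι → H →L[ℂ] H) (C : ℝ)
    (hb : ∀ i x y, ‖⟪y, S i x⟫_ℂ‖ ≤ C * ‖x‖ * ‖y‖)
    (hl : ∀ x y, ∃ z, Tendsto (fun i => ⟪y, S i x⟫_ℂ) l (𝓝 z)) :
    ∃ X : H →L[ℂ] H, ∀ x y, Tendsto (fun i => ⟪y, S i x⟫_ℂ) l (𝓝 ⟪y, X x⟫_ℂ) := by
  choose z hz using hl
  have hz' : ∀ x y, Tendsto (fun i => ⟪S i x, y⟫_ℂ) l (𝓝 (starRingEnd ℂ (z x y))) := by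
    intro x y
    have := (Complex.continuous_conj.tendsto _).comp (hz x y)
    refine this.congr fun i => ?_
    simp
  let B : H →ₗ⋆[ℂ] H →ₗ[ℂ] ℂ :=
    LinearMap.mk₂'ₛₗ (starRingEnd ℂ) (RingHom.id ℂ) (fun x y => starRingEnd ℂ (z x y))
      (fun x x' y => tendsto_nhds_unique (hz' (x + x') y) (by
        simpa [inner_add_left] using (hz' x y).add (hz' x' y)))
      (fun c x y => tendsto_nhds_unique (hz' (c • x) y) (by
        simpa [inner_smul_left, mul_comm] using (hz' x y).const_mul (starRingEnd ℂ c)))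
      (fun x y y' => tendsto_nhds_unique (hz' x (y + y')) (by
        simpa [inner_add_right] using (hz' x y).add (hz' x y')))
      (fun c x y => tendsto_nhds_unique (hz' x (c • y)) (by
        simpa [inner_smul_right] using (hz' x y).const_mul c))
  let B' : H →L⋆[ℂ] H →L[ℂ] ℂ := B.mkContinuous₂ C (fun x y => by
    have h1 : ‖z x y‖ ≤ C * ‖x‖ * ‖y‖ :=
      le_of_tendsto (hz x y).norm (Eventually.of_forall fun i => hb i x y)
    simpa [B] using h1)
  refine ⟨InnerProductSpace.continuousLinearMapOfBilin B', fun x y => ?_⟩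
  have h := InnerProductSpace.continuousLinearMapOfBilin_apply B' x y
  have h2 : ⟪y, InnerProductSpace.continuousLinearMapOfBilin B' x⟫_ℂ = z x y := by
    rw [← inner_conj_symm, h]
    simp [B', B]
  rw [h2]
  exact hz x y

theorem eq_of_forall_inner {S T : H →L[ℂ] H} (h : ∀ x y, ⟪y, S x⟫_ℂ = ⟪y, T x⟫_ℂ) : S = T :=
  ContinuousLinearMap.ext fun x => ext_inner_left ℂ fun y => h x y

theorem sum_norm_mul_norm_le (s : Finset ι) (a b : ι → ℝ) (A B : ℝ)
    (hA : ∑ i ∈ s, a i ^ 2 ≤ A ^ 2) (hB : ∑ i ∈ s, b i ^ 2 ≤ B ^ 2) (hA0 : 0 ≤ A) (hB0 : 0 ≤ B) :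
    ∑ i ∈ s, a i * b i ≤ A * B := by
  have h := Finset.sum_mul_sq_le_sq_mul_sq s a b
  refine le_of_sq_le_sq ?_ (mul_nonneg hA0 hB0)
  rw [mul_pow]
  exact h.trans (mul_le_mul hA hB (Finset.sum_nonneg fun _ _ => sq_nonneg _) (sq_nonneg _))

/-- The Cauchy--Schwarz inequality for square summable families of vectors. -/
theorem summable_inner_of_sq {E : Type*} [NormedAddCommGroup E] [InnerProductSpace ℂ E]
    {p r : ι → E} (hp : Summable fun i => ‖p i‖ ^ 2)
    (hr : Summable fun i => ‖r i‖ ^ 2) : Summable fun i => ⟪p i, r i⟫_ℂ := by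
  refine Summable.of_norm_bounded (hp.add hr) fun i => ?_
  refine (norm_inner_le_norm _ _).trans ?_
  nlinarith [sq_nonneg (‖p i‖ - ‖r i‖), sq_nonneg (‖p i‖), sq_nonneg ‖r i‖]

theorem norm_sum_inner_le (s : Finset ι) (p r : ι → H) :
    ‖∑ i ∈ s, ⟪p i, r i⟫_ℂ‖ ≤ √(∑ i ∈ s, ‖p i‖ ^ 2) * √(∑ i ∈ s, ‖r i‖ ^ 2) := by
  refine (norm_sum_le _ _).trans ((Finset.sum_le_sum fun i _ => norm_inner_le_norm _ _).trans ?_)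
  exact sum_norm_mul_norm_le s _ _ _ _ (Real.sq_sqrt (Finset.sum_nonneg fun _ _ => sq_nonneg _)).ge
    (Real.sq_sqrt (Finset.sum_nonneg fun _ _ => sq_nonneg _)).ge (Real.sqrt_nonneg _)
    (Real.sqrt_nonneg _)

/-- The matrix of operators `B` defines a form of norm at most `C` on `ℓ²(H)`. -/
def FormBound (C : ℝ) (B : ι → κ → H →L[ℂ] H) : Prop :=
  ∀ (J : Finset ι) (K : Finset κ) (p : ι → H) (r : κ → H),
    ‖∑ j ∈ J, ∑ k ∈ K, ⟪p j, B j k (r k)⟫_ℂ‖ ≤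
      C * √(∑ j ∈ J, ‖p j‖ ^ 2) * √(∑ k ∈ K, ‖r k‖ ^ 2)

/-- The `j`-th entry of the image of `r` under the matrix of operators `B`. -/
noncomputable def rowSum (B : ι → κ → H →L[ℂ] H) (r : κ → H) (j : ι) : H := ∑' k, B j k (r k)

namespace FormBound

variable {C : ℝ} {B : ι → κ → H →L[ℂ] H}

/-- Test the form on the image of `r` itself, `p_j = ∑_k B_{jk} r_k`: the left side becomes the sum
of squares `S`, and a factor `√S` cancels. -/
theorem sum_sq_le (hB : FormBound C B) (J : Finset ι) (K : Finset κ)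
    (r : κ → H) : ∑ j ∈ J, ‖∑ k ∈ K, B j k (r k)‖ ^ 2 ≤ C ^ 2 * ∑ k ∈ K, ‖r k‖ ^ 2 := by
  set S := ∑ j ∈ J, ‖∑ k ∈ K, B j k (r k)‖ ^ 2 with hS
  have hS0 : 0 ≤ S := Finset.sum_nonneg fun _ _ => sq_nonneg _
  have hR0 : 0 ≤ ∑ k ∈ K, ‖r k‖ ^ 2 := Finset.sum_nonneg fun _ _ => sq_nonneg _
  have h := hB J K (fun j => ∑ k ∈ K, B j k (r k)) r
  have h1 : ∑ j ∈ J, ∑ k ∈ K, ⟪∑ k ∈ K, B j k (r k), B j k (r k)⟫_ℂ = (S : ℂ) := by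
    rw [hS]
    push_cast
    refine Finset.sum_congr rfl fun j _ => ?_
    rw [← inner_sum, inner_self_eq_norm_sq_to_K]
    rfl
  rw [h1, Complex.norm_real, Real.norm_of_nonneg hS0] at h
  rcases hS0.eq_or_lt with h0 | h0
  · rw [← h0]; positivity
  · have h2 : S = √S * √S := (Real.mul_self_sqrt hS0).symm
    have h3 : 0 < √S := Real.sqrt_pos.2 h0
    have h4 : √S ≤ C * √(∑ k ∈ K, ‖r k‖ ^ 2) := by
      have : √S * √S ≤ √S * (C * √(∑ k ∈ K, ‖r k‖ ^ 2)) := by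
        rw [← h2]; refine h.trans (le_of_eq ?_); ring
      exact le_of_mul_le_mul_left this h3
    calc S = √S ^ 2 := (Real.sq_sqrt hS0).symm
      _ ≤ (C * √(∑ k ∈ K, ‖r k‖ ^ 2)) ^ 2 := by gcongr
      _ = _ := by rw [mul_pow, Real.sq_sqrt hR0]

theorem adjoint (hB : FormBound C B) :
    FormBound C (fun k j => ContinuousLinearMap.adjoint (B j k)) := by
  intro K J r p
  have h := hB J K p r
  rw [← RCLike.norm_conj, map_sum] at h
  simp only [map_sum, inner_conj_symm] at h
  simp only [ContinuousLinearMap.adjoint_inner_right]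
  rw [Finset.sum_comm]
  refine h.trans (le_of_eq (by ring))

/-- A row need not converge absolutely. The Cauchy criterion follows from `sum_sq_le` applied to one
row and to a tail of `r`. -/
theorem summable_row (hB : FormBound C B) {r : κ → H} (hr : Summable fun k => ‖r k‖ ^ 2) (j : ι) :
    Summable fun k => B j k (r k) := by
  rw [summable_iff_vanishing_norm]
  intro ε hε
  obtain ⟨s, hs⟩ := summable_iff_vanishing_norm.1 hr (ε ^ 2 / (C ^ 2 + 1)) (by positivity)
  refine ⟨s, fun t ht => ?_⟩
  have h1 := hB.sum_sq_le {j} t r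
  have h2 := hs t ht
  rw [Finset.sum_singleton] at h1
  rw [Real.norm_of_nonneg (Finset.sum_nonneg fun _ _ => sq_nonneg _)] at h2
  refine lt_of_pow_lt_pow_left₀ 2 hε.le (h1.trans_lt ?_)
  rw [lt_div_iff₀ (by positivity)] at h2
  have : 0 ≤ ∑ k ∈ t, ‖r k‖ ^ 2 := Finset.sum_nonneg fun _ _ => sq_nonneg _
  linarith

theorem hasSum_rowSum (hB : FormBound C B) {r : κ → H} (hr : Summable fun k => ‖r k‖ ^ 2) (j : ι) :
    HasSum (fun k => B j k (r k)) (rowSum B r j) := (hB.summable_row hr j).hasSum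

/-- The error is the image of the tail of `r`, so the bound is uniform in `J`. This uniformity
allows `J` and `K` to grow independently in `tendsto_form`. -/
theorem sum_sq_rowSum_sub_le (hB : FormBound C B) {r : κ → H} (hr : Summable fun k => ‖r k‖ ^ 2)
    (J : Finset ι) (K : Finset κ) :
    ∑ j ∈ J, ‖rowSum B r j - ∑ k ∈ K, B j k (r k)‖ ^ 2 ≤
      C ^ 2 * (∑' k, ‖r k‖ ^ 2 - ∑ k ∈ K, ‖r k‖ ^ 2) := by
  classical
  have h1 : Tendsto (fun K' : Finset κ =>
      ∑ j ∈ J, ‖∑ k ∈ K', B j k (r k) - ∑ k ∈ K, B j k (r k)‖ ^ 2) atTop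
      (𝓝 (∑ j ∈ J, ‖rowSum B r j - ∑ k ∈ K, B j k (r k)‖ ^ 2)) :=
    tendsto_finsetSum _ fun j _ => (((hB.hasSum_rowSum hr j).sub_const _).norm).pow 2
  have h2 : Tendsto (fun K' : Finset κ => C ^ 2 * (∑ k ∈ K', ‖r k‖ ^ 2 - ∑ k ∈ K, ‖r k‖ ^ 2)) atTop
      (𝓝 (C ^ 2 * (∑' k, ‖r k‖ ^ 2 - ∑ k ∈ K, ‖r k‖ ^ 2))) :=
    (Tendsto.sub_const hr.hasSum _).const_mul _
  refine le_of_tendsto_of_tendsto h1 h2 ?_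
  filter_upwards [eventually_ge_atTop K] with K' hK
  have hK' : K ⊆ K' := hK
  have h3 : ∀ j, ∑ k ∈ K', B j k (r k) - ∑ k ∈ K, B j k (r k) = ∑ k ∈ K' \ K, B j k (r k) := by
    intro j
    rw [← Finset.sum_sdiff hK']; abel
  have h4 : ∑ k ∈ K', ‖r k‖ ^ 2 - ∑ k ∈ K, ‖r k‖ ^ 2 = ∑ k ∈ K' \ K, ‖r k‖ ^ 2 := by
    rw [← Finset.sum_sdiff hK']; abel
  simp only [h3, h4]
  exact hB.sum_sq_le J _ r

theorem sum_sq_rowSum_le (hB : FormBound C B) {r : κ → H} (hr : Summable fun k => ‖r k‖ ^ 2)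
    (J : Finset ι) : ∑ j ∈ J, ‖rowSum B r j‖ ^ 2 ≤ C ^ 2 * ∑' k, ‖r k‖ ^ 2 := by
  simpa using hB.sum_sq_rowSum_sub_le hr J ∅

theorem summable_sq_rowSum (hB : FormBound C B) {r : κ → H} (hr : Summable fun k => ‖r k‖ ^ 2) :
    Summable fun j => ‖rowSum B r j‖ ^ 2 :=
  summable_of_sum_le (fun _ => sq_nonneg _) (hB.sum_sq_rowSum_le hr)

theorem tsum_sq_rowSum_le (hB : FormBound C B) {r : κ → H} (hr : Summable fun k => ‖r k‖ ^ 2) :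
    ∑' j, ‖rowSum B r j‖ ^ 2 ≤ C ^ 2 * ∑' k, ‖r k‖ ^ 2 :=
  (hB.summable_sq_rowSum hr).tsum_le_of_sum_le (hB.sum_sq_rowSum_le hr)

theorem summable_inner_rowSum (hB : FormBound C B) {p : ι → H} {r : κ → H}
    (hp : Summable fun j => ‖p j‖ ^ 2) (hr : Summable fun k => ‖r k‖ ^ 2) :
    Summable fun j => ⟪p j, rowSum B r j⟫_ℂ :=
  summable_inner_of_sq hp (hB.summable_sq_rowSum hr)

/-- The double series converges only conditionally. The rectangular partial sums differ from the
partial sums over complete rows by the norm of `p` times a tail of `r`, which gives a genuine double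
limit. -/
theorem tendsto_form (hB : FormBound C B) {p : ι → H} {r : κ → H}
    (hp : Summable fun j => ‖p j‖ ^ 2) (hr : Summable fun k => ‖r k‖ ^ 2) :
    Tendsto (fun N : Finset ι × Finset κ => ∑ j ∈ N.1, ∑ k ∈ N.2, ⟪p j, B j k (r k)⟫_ℂ)
      atTop (𝓝 (∑' j, ⟪p j, rowSum B r j⟫_ℂ)) := by
  rw [← prod_atTop_atTop_eq]
  have h1 : Tendsto (fun N : Finset ι × Finset κ => ∑ j ∈ N.1, ⟪p j, rowSum B r j⟫_ℂ)
      (atTop ×ˢ atTop) (𝓝 (∑' j, ⟪p j, rowSum B r j⟫_ℂ)) := by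
    have h : Tendsto (fun J : Finset ι => ∑ j ∈ J, ⟪p j, rowSum B r j⟫_ℂ) atTop
      (𝓝 (∑' j, ⟪p j, rowSum B r j⟫_ℂ)) := (hB.summable_inner_rowSum hp hr).hasSum
    exact h.comp tendsto_fst
  have h2 : Tendsto (fun N : Finset ι × Finset κ =>
      √(∑' j, ‖p j‖ ^ 2) * √(C ^ 2 * (∑' k, ‖r k‖ ^ 2 - ∑ k ∈ N.2, ‖r k‖ ^ 2)))
      (atTop ×ˢ atTop) (𝓝 0) := by
    have h3 : Tendsto (fun K : Finset κ => ∑' k, ‖r k‖ ^ 2 - ∑ k ∈ K, ‖r k‖ ^ 2) atTop (𝓝 0) := by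
      have h : Tendsto (fun K : Finset κ => ∑ k ∈ K, ‖r k‖ ^ 2) atTop (𝓝 (∑' k, ‖r k‖ ^ 2)) :=
        hr.hasSum
      rw [← sub_self (∑' k, ‖r k‖ ^ 2)]
      exact tendsto_const_nhds.sub h
    have h4 := ((h3.const_mul (C ^ 2)).sqrt).const_mul (√(∑' j, ‖p j‖ ^ 2))
    simp only [mul_zero, Real.sqrt_zero] at h4
    exact h4.comp tendsto_snd
  have h5 : Tendsto (fun N : Finset ι × Finset κ => ∑ j ∈ N.1, ⟪p j, rowSum B r j⟫_ℂ -
      ∑ j ∈ N.1, ∑ k ∈ N.2, ⟪p j, B j k (r k)⟫_ℂ) (atTop ×ˢ atTop) (𝓝 0) := by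
    refine squeeze_zero_norm (fun N => ?_) h2
    rw [← Finset.sum_sub_distrib]
    simp only [← inner_sum, ← inner_sub_right]
    refine (norm_sum_inner_le _ _ _).trans ?_
    gcongr
    · exact hp.sum_le_tsum _ fun _ _ => sq_nonneg _
    · exact hB.sum_sq_rowSum_sub_le hr _ _
  have := h1.sub h5
  simpa using this

/-- Fubini without absolute convergence: both iterated sums are the same double limit of
`tendsto_form`, read for `B` and for its adjoint. -/
theorem tsum_inner_rowSum_adjoint (hB : FormBound C B) {p : ι → H} {r : κ → H}
    (hp : Summable fun j => ‖p j‖ ^ 2) (hr : Summable fun k => ‖r k‖ ^ 2) :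
    ∑' k, ⟪rowSum (fun k j => ContinuousLinearMap.adjoint (B j k)) p k, r k⟫_ℂ
      = ∑' j, ⟪p j, rowSum B r j⟫_ℂ := by
  classical
  have h1 := hB.tendsto_form hp hr
  have h2 := (Complex.continuous_conj.tendsto _).comp (hB.adjoint.tendsto_form hr hp)
  have hs : Tendsto (Prod.swap : Finset ι × Finset κ → Finset κ × Finset ι) atTop atTop := by
    rw [← prod_atTop_atTop_eq, ← prod_atTop_atTop_eq]
    exact tendsto_prod_swap
  have h3 := tendsto_nhds_unique h1 ((h2.comp hs).congr fun N => by
    simp only [Function.comp, Prod.fst_swap, Prod.snd_swap, map_sum, inner_conj_symm,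
      ContinuousLinearMap.adjoint_inner_left]
    exact Finset.sum_comm)
  rw [h3, Complex.conj_tsum]
  simp only [inner_conj_symm]

end FormBound

end HilbertGeneralities

/-! ### Scalar matrices bounded on `ℓ²` -/

section ScalarMatrices

variable {H : Type*} [NormedAddCommGroup H] [InnerProductSpace ℂ H] [CompleteSpace H]
variable {ι κ : Type*}

/-- The scalar matrix `b` defines a bilinear form of norm at most `C` on `ℓ²`. -/
def ScalarBound (C : ℝ) (b : ι → κ → ℂ) : Prop :=
  ∀ (J : Finset ι) (K : Finset κ) (p : ι → ℂ) (r : κ → ℂ),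
    ‖∑ j ∈ J, ∑ k ∈ K, p j * b j k * r k‖ ≤
      C * √(∑ j ∈ J, ‖p j‖ ^ 2) * √(∑ k ∈ K, ‖r k‖ ^ 2)

theorem ScalarBound.mono {C C' : ℝ} {b : ι → κ → ℂ} (hb : ScalarBound C b) (h : C ≤ C') :
    ScalarBound C' b := fun J K p r => (hb J K p r).trans (by gcongr)

theorem ScalarBound.norm_le {C : ℝ} {b : ι → κ → ℂ} (hb : ScalarBound C b) (j : ι) (k : κ) :
    ‖b j k‖ ≤ C := by
  simpa using hb {j} {k} (fun _ => 1) (fun _ => 1)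

theorem ScalarBound.swap {C : ℝ} {b : ι → κ → ℂ} (hb : ScalarBound C b) :
    ScalarBound C (fun k j => b j k) := by
  intro K J r p
  have h := hb J K p r
  rw [Finset.sum_comm] at h
  refine (le_of_eq ?_).trans (h.trans (le_of_eq (by ring)))
  congr 1
  exact Finset.sum_congr rfl fun k _ => Finset.sum_congr rfl fun j _ => by ring

theorem sum_sq_inner_le {β : Type*} {e : β → H} (he : Orthonormal ℂ e) (J : Finset ι)
    (F : Finset β) (p : ι → H) :
    ∑ i ∈ F, √(∑ j ∈ J, ‖⟪p j, e i⟫_ℂ‖ ^ 2) ^ 2 ≤ √(∑ j ∈ J, ‖p j‖ ^ 2) ^ 2 := by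
  simp only [Real.sq_sqrt (Finset.sum_nonneg fun _ _ => sq_nonneg _)]
  rw [Finset.sum_comm]
  refine Finset.sum_le_sum fun j _ => ?_
  refine le_trans (Finset.sum_le_sum fun i _ => ?_) (he.sum_inner_products_le (p j) (s := F))
  rw [norm_inner_symm]

/-- Expand the vectors in an orthonormal basis of `H`, apply the scalar bound to each coordinate,
and use Cauchy–Schwarz over the coordinates. The constant does not deteriorate. -/
theorem ScalarBound.formBound {C : ℝ} (hC : 0 ≤ C) {b : ι → κ → ℂ} (hb : ScalarBound C b) :
    FormBound (H := H) C (fun j k => b j k • (1 : H →L[ℂ] H)) := by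
  intro J K p r
  obtain ⟨w, e, -⟩ := exists_hilbertBasis ℂ H
  have h1 : HasSum (fun i => ∑ j ∈ J, ∑ k ∈ K, ⟪p j, e i⟫_ℂ * b j k * ⟪e i, r k⟫_ℂ)
      (∑ j ∈ J, ∑ k ∈ K, ⟪p j, (b j k • (1 : H →L[ℂ] H)) (r k)⟫_ℂ) := by
    refine hasSum_sum fun j _ => hasSum_sum fun k _ => ?_
    have := (e.hasSum_inner_mul_inner (p j) (r k)).mul_left (b j k)
    simp only [smul_apply, one_apply_eq_self, inner_smul_right]
    have h2 : (fun i => ⟪p j, e i⟫_ℂ * b j k * ⟪e i, r k⟫_ℂ) =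
        fun i => b j k * (⟪p j, e i⟫_ℂ * ⟪e i, r k⟫_ℂ) := by ext i; ring
    rw [h2]
    exact this
  have h2 : Tendsto _ atTop _ := h1.norm
  refine le_of_tendsto h2 (Eventually.of_forall fun F => ?_)
  refine (norm_sum_le _ _).trans ?_
  refine (Finset.sum_le_sum fun i _ => hb J K _ _).trans ?_
  simp only [mul_assoc]
  rw [← Finset.mul_sum]
  refine mul_le_mul_of_nonneg_left ?_ hC
  refine sum_norm_mul_norm_le F _ _ _ _ (sum_sq_inner_le e.orthonormal J F p) ?_
    (Real.sqrt_nonneg _) (Real.sqrt_nonneg _)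
  have := sum_sq_inner_le e.orthonormal K F r
  simpa only [norm_inner_symm] using this

theorem MatrixNormLE.scalarBound {C : ℝ} {b : ℕ → ℕ → ℂ} (hb : MatrixNormLE C b) :
    ScalarBound C b := by
  obtain ⟨L, hL, hLb⟩ := hb
  intro J K p r
  set P : lp (fun _ : ℕ => ℂ) 2 := ∑ j ∈ J, lp.single 2 j (starRingEnd ℂ (p j)) with hP
  set R : lp (fun _ : ℕ => ℂ) 2 := ∑ k ∈ K, lp.single 2 k (r k) with hR
  have h0 : ∀ (s : Finset ℕ) (f : ℕ → ℂ),
      ‖∑ i ∈ s, (lp.single 2 i (f i) : lp (fun _ : ℕ => ℂ) 2)‖ = √(∑ i ∈ s, ‖f i‖ ^ 2) := by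
    intro s f
    have := lp.norm_sum_single (E := fun _ : ℕ => ℂ) (p := 2) (by norm_num) f s
    simp only [ENNReal.toReal_ofNat, Real.rpow_ofNat] at this
    rw [← this, Real.sqrt_sq (norm_nonneg _)]
  have h1 : ⟪P, L R⟫_ℂ = ∑ j ∈ J, ∑ k ∈ K, p j * b j k * r k := by
    have h2 : L R = ∑ k ∈ K, r k • L (lp.single 2 k (1 : ℂ)) := by
      rw [hR, map_sum]
      refine Finset.sum_congr rfl fun k _ => ?_
      rw [← map_smul, ← lp.single_smul, smul_eq_mul, mul_one]
    rw [hP, sum_inner]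
    refine Finset.sum_congr rfl fun j _ => ?_
    rw [lp.inner_single_left, h2, lp.coeFn_sum, Finset.sum_apply, inner_sum]
    refine Finset.sum_congr rfl fun k _ => ?_
    rw [lp.coeFn_smul, Pi.smul_apply, hLb, inner_smul_right]
    simp
    ring
  rw [← h1]
  refine (norm_inner_le_norm _ _).trans ?_
  have h3 : ‖P‖ = √(∑ j ∈ J, ‖p j‖ ^ 2) := by
    rw [hP, h0]; simp
  have h4 : ‖R‖ = √(∑ k ∈ K, ‖r k‖ ^ 2) := h0 _ _
  calc ‖P‖ * ‖L R‖ ≤ ‖P‖ * (C * ‖R‖) := by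
        gcongr
        exact (L.le_opNorm _).trans (by gcongr)
    _ = _ := by rw [h3, h4]; ring

/-- The operator on `ℓ²` is given by the row sums; their convergence and their square sum are the
case `H = ℂ` of the bounds for matrices of operators. -/
theorem ScalarBound.matrixNormLE {C : ℝ} (hC : 0 ≤ C) {b : ℕ → ℕ → ℂ} (hb : ScalarBound C b) :
    MatrixNormLE C b := by
  have hB := hb.formBound (H := ℂ) hC
  set B : ℕ → ℕ → ℂ →L[ℂ] ℂ := fun j k => b j k • (1 : ℂ →L[ℂ] ℂ) with hBdef
  have hsum : ∀ r : lp (fun _ : ℕ => ℂ) 2, Summable fun k => ‖r k‖ ^ 2 := fun r => by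
    have := (memℓp_gen_iff (p := 2) (by norm_num)).1 r.2
    simpa using this
  have hnorm : ∀ r : lp (fun _ : ℕ => ℂ) 2, ‖r‖ ^ 2 = ∑' k, ‖r k‖ ^ 2 := fun r => by
    have := lp.norm_rpow_eq_tsum (p := 2) (by norm_num) r
    simpa using this
  have hmem : ∀ r : lp (fun _ : ℕ => ℂ) 2, Memℓp (rowSum B r) 2 := fun r => by
    refine memℓp_gen ?_
    simpa using hB.summable_sq_rowSum (hsum r)
  let L₀ : lp (fun _ : ℕ => ℂ) 2 →ₗ[ℂ] lp (fun _ : ℕ => ℂ) 2 :=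
    { toFun := fun r => ⟨rowSum B r, hmem r⟩
      map_add' := fun r r' => by
        ext j
        have := ((hB.hasSum_rowSum (hsum r) j).add (hB.hasSum_rowSum (hsum r') j))
        refine HasSum.unique (hB.hasSum_rowSum (hsum (r + r')) j) ?_
        convert this using 1
        · ext k; simp
        · rfl
      map_smul' := fun c r => by
        ext j
        have := (hB.hasSum_rowSum (hsum r) j).const_smul c
        refine HasSum.unique (hB.hasSum_rowSum (hsum (c • r)) j) ?_
        convert this using 1
        · ext k; simp [hBdef, mul_left_comm]
        · rfl }
  have hL₀ : ∀ r j, L₀ r j = rowSum B r j := fun _ _ => rfl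
  refine ⟨L₀.mkContinuous C fun r => ?_, LinearMap.mkContinuous_norm_le _ hC _, fun j k => ?_⟩
  · refine le_of_sq_le_sq ?_ (by positivity)
    rw [hnorm, mul_pow, hnorm]
    exact hB.tsum_sq_rowSum_le (hsum r)
  · rw [LinearMap.mkContinuous_apply, hL₀, rowSum, tsum_eq_single k]
    · simp [hBdef]
    · intro k' hk'
      rw [lp.single_apply_ne _ _ _ hk', map_zero]

/-- A block diagonal matrix with uniformly bounded blocks. -/
theorem ScalarBound.block {μ : Type*} [DecidableEq μ] {C : ℝ} (hC : 0 ≤ C) {b : μ → ι → κ → ℂ}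
    (hb : ∀ m, ScalarBound C (b m)) :
    ScalarBound C (fun (j : μ × ι) (k : μ × κ) => if j.1 = k.1 then b j.1 j.2 k.2 else 0) := by
  classical
  intro J K p r
  -- Extending `p` and `r` by zero replaces the index sets by products over the same set `M` of
  -- blocks, so the sum splits block by block.
  set M : Finset μ := J.image Prod.fst ∪ K.image Prod.fst
  set J' : Finset ι := J.image Prod.snd
  set K' : Finset κ := K.image Prod.snd
  let p' : μ × ι → ℂ := fun j => if j ∈ J then p j else 0
  let r' : μ × κ → ℂ := fun k => if k ∈ K then r k else 0
  have hJ : J ⊆ M ×ˢ J' := fun j hj => Finset.mem_product.2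
    ⟨Finset.mem_union_left _ (Finset.mem_image_of_mem _ hj), Finset.mem_image_of_mem _ hj⟩
  have hK : K ⊆ M ×ˢ K' := fun k hk => Finset.mem_product.2
    ⟨Finset.mem_union_right _ (Finset.mem_image_of_mem _ hk), Finset.mem_image_of_mem _ hk⟩
  have hp : ∑ j ∈ J, ‖p j‖ ^ 2 = ∑ m ∈ M, √(∑ i ∈ J', ‖p' (m, i)‖ ^ 2) ^ 2 := by
    simp only [Real.sq_sqrt (Finset.sum_nonneg fun _ _ => sq_nonneg _)]
    rw [← Finset.sum_product' (f := fun m i => ‖p' (m, i)‖ ^ 2), ← Finset.sum_subset hJ]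
    · exact Finset.sum_congr rfl fun j hj => by simp [p', hj]
    · intro j _ hj; simp [p', hj]
  have hr : ∑ k ∈ K, ‖r k‖ ^ 2 = ∑ m ∈ M, √(∑ i ∈ K', ‖r' (m, i)‖ ^ 2) ^ 2 := by
    simp only [Real.sq_sqrt (Finset.sum_nonneg fun _ _ => sq_nonneg _)]
    rw [← Finset.sum_product' (f := fun m i => ‖r' (m, i)‖ ^ 2), ← Finset.sum_subset hK]
    · exact Finset.sum_congr rfl fun j hj => by simp [r', hj]
    · intro j _ hj; simp [r', hj]
  have hs : ∑ j ∈ J, ∑ k ∈ K, p j * (if j.1 = k.1 then b j.1 j.2 k.2 else 0) * r k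
      = ∑ m ∈ M, ∑ i ∈ J', ∑ l ∈ K', p' (m, i) * b m i l * r' (m, l) := by
    have h1 : ∑ j ∈ J, ∑ k ∈ K, p j * (if j.1 = k.1 then b j.1 j.2 k.2 else 0) * r k
        = ∑ j ∈ M ×ˢ J', ∑ k ∈ M ×ˢ K',
          p' j * (if j.1 = k.1 then b j.1 j.2 k.2 else 0) * r' k := by
      rw [← Finset.sum_subset hJ]
      · refine Finset.sum_congr rfl fun j hj => ?_
        rw [← Finset.sum_subset hK]
        · exact Finset.sum_congr rfl fun k hk => by simp [p', r', hj, hk]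
        · intro k _ hk; simp [r', hk]
      · intro j _ hj; simp [p', hj]
    rw [h1, Finset.sum_product]
    refine Finset.sum_congr rfl fun m hm => Finset.sum_congr rfl fun i _ => ?_
    rw [Finset.sum_product, Finset.sum_eq_single_of_mem m hm]
    · simp
    · intro m' _ hm'
      simp [hm'.symm]
  rw [hs]
  refine (norm_sum_le _ _).trans ?_
  refine (Finset.sum_le_sum fun m _ => hb m J' K' _ _).trans ?_
  simp only [mul_assoc]
  rw [← Finset.mul_sum]
  refine mul_le_mul_of_nonneg_left ?_ hC
  refine sum_norm_mul_norm_le M _ _ _ _ ?_ ?_ (Real.sqrt_nonneg _) (Real.sqrt_nonneg _)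
  · rw [← hp, Real.sq_sqrt (Finset.sum_nonneg fun _ _ => sq_nonneg _)]
  · rw [← hr, Real.sq_sqrt (Finset.sum_nonneg fun _ _ => sq_nonneg _)]

end ScalarMatrices

/-! ### Polarisation: complex matrix coefficients through four positive measures -/

section Polarization

variable {H : Type*} [NormedAddCommGroup H] [InnerProductSpace ℂ H] [CompleteSpace H]

/-- The vectors in the polarization identity. -/
noncomputable def polVec (x y : H) : Fin 4 → H :=
  ![x + y, x - y, x + Complex.I • y, x - Complex.I • y]

/-- The coefficients in the polarization identity. -/
noncomputable def polCoef : Fin 4 → ℂ := ![1 / 4, -1 / 4, Complex.I / 4, -Complex.I / 4]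

theorem inner_eq_sum_polCoef (T : H →L[ℂ] H) (x y : H) :
    ⟪y, T x⟫_ℂ = ∑ i, polCoef i * ⟪polVec x y i, T (polVec x y i)⟫_ℂ := by
  simp only [polCoef, polVec, Fin.sum_univ_four, Matrix.cons_val_zero, Matrix.cons_val_one,
    Matrix.cons_val, map_add, map_sub, map_smul, inner_add_left, inner_add_right, inner_sub_left,
    inner_sub_right, inner_smul_left, inner_smul_right, Complex.conj_I]
  ring_nf
  simp only [Complex.I_sq]
  ring

theorem norm_polCoef_le (i : Fin 4) : ‖polCoef i‖ ≤ 1 := by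
  fin_cases i <;> simp [polCoef] <;> norm_num

end Polarization

/-! ### Functional calculus of a spectral measure -/

namespace SpectralMeasure

variable {X : Type*} [MeasurableSpace X] {H : Type*}
  [NormedAddCommGroup H] [InnerProductSpace ℂ H] [CompleteSpace H] (E : SpectralMeasure X H)

theorem measure_univ (x : H) : E.measure x Set.univ = ENNReal.ofReal (‖x‖ ^ 2) := by
  rw [E.measure_apply x MeasurableSet.univ, E.proj_univ, one_apply_eq_self,
    inner_self_eq_norm_sq_to_K]
  norm_cast

instance (x : H) : IsFiniteMeasure (E.measure x) :=
  ⟨by rw [E.measure_univ]; exact ENNReal.ofReal_lt_top⟩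

theorem measureReal_univ (x : H) : (E.measure x).real Set.univ = ‖x‖ ^ 2 := by
  rw [measureReal_def, E.measure_univ, ENNReal.toReal_ofReal (sq_nonneg _)]

theorem norm_sq_proj (x : H) {s : Set X} (hs : MeasurableSet s) :
    ‖E.proj s x‖ ^ 2 = (E.measure x).real s := by
  rw [measureReal_def, E.measure_apply x hs,
    ENNReal.toReal_ofReal (E.re_inner_proj_nonneg x s hs),
    norm_sq_starProjection (E.isStarProjection s hs)]

theorem proj_apply_proj_apply (x : H) {s : Set X} (hs : MeasurableSet s) :
    E.proj s (E.proj s x) = E.proj s x :=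
  DFunLike.congr_fun (E.isStarProjection s hs).isIdempotentElem x

theorem inner_proj_left (x y : H) {s : Set X} (hs : MeasurableSet s) :
    ⟪E.proj s x, y⟫_ℂ = ⟪x, E.proj s y⟫_ℂ := by
  have h := ContinuousLinearMap.adjoint_inner_left (E.proj s) y x
  rwa [(E.isStarProjection s hs).isSelfAdjoint.adjoint_eq] at h

theorem inner_proj (x : H) {s : Set X} (hs : MeasurableSet s) :
    ⟪x, E.proj s x⟫_ℂ = ((E.measure x).real s : ℂ) := by
  rw [← E.norm_sq_proj x hs, ← E.proj_apply_proj_apply x hs, ← E.inner_proj_left _ _ hs,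
    inner_self_eq_norm_sq_to_K, E.proj_apply_proj_apply x hs]
  norm_cast

theorem proj_union {s t : Set X} (hs : MeasurableSet s) (ht : MeasurableSet t)
    (hst : Disjoint s t) : E.proj (s ∪ t) = E.proj s + E.proj t := by
  refine eq_of_inner _ _ fun x => ?_
  rw [E.inner_proj x (hs.union ht), add_apply, inner_add_right, E.inner_proj x hs,
    E.inner_proj x ht, measureReal_union hst ht]
  push_cast
  rfl

/-- For `y = E(t) x` the scalar measure of `y` already has full mass on `t`, so nothing remains on
the disjoint set `s`. -/
theorem proj_mul_of_disjoint {s t : Set X} (hs : MeasurableSet s) (ht : MeasurableSet t)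
    (hst : Disjoint s t) : E.proj s * E.proj t = 0 := by
  ext x
  set y := E.proj t x with hy
  have h1 : (E.measure y).real s + (E.measure y).real t ≤ (E.measure y).real Set.univ := by
    rw [← measureReal_union hst ht]
    exact measureReal_mono (Set.subset_univ _)
  rw [← E.norm_sq_proj y hs, ← E.norm_sq_proj y ht, E.measureReal_univ, hy,
    E.proj_apply_proj_apply x ht, ← hy] at h1
  have h2 : ‖E.proj s y‖ ^ 2 ≤ 0 := by linarith
  have h3 : ‖E.proj s y‖ = 0 := by
    have := sq_nonneg ‖E.proj s y‖
    exact pow_eq_zero_iff two_ne_zero |>.1 (le_antisymm h2 this)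
  simpa using h3

theorem proj_mul {s t : Set X} (hs : MeasurableSet s) (ht : MeasurableSet t) :
    E.proj s * E.proj t = E.proj (s ∩ t) := by
  have h1 : E.proj s = E.proj (s ∩ t) + E.proj (s \ t) := by
    rw [← E.proj_union (hs.inter ht) (hs.diff ht) Set.disjoint_sdiff_inter.symm,
      Set.inter_union_sdiff]
  have h2 : E.proj t = E.proj (s ∩ t) + E.proj (t \ s) := by
    rw [Set.inter_comm s t, ← E.proj_union (ht.inter hs) (ht.diff hs)
      Set.disjoint_sdiff_inter.symm, Set.inter_union_sdiff]
  have h3 : E.proj (s \ t) * E.proj t = 0 :=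
    E.proj_mul_of_disjoint (hs.diff ht) ht Set.disjoint_sdiff_left
  have h4 : E.proj (s ∩ t) * E.proj (t \ s) = 0 :=
    E.proj_mul_of_disjoint (hs.inter ht) (ht.diff hs)
      (Set.disjoint_sdiff_right.mono_left Set.inter_subset_left)
  have h5 : E.proj (s ∩ t) * E.proj (s ∩ t) = E.proj (s ∩ t) :=
    (E.isStarProjection _ (hs.inter ht)).isIdempotentElem
  rw [h1, add_mul, h3, h2, mul_add, h4, h5, add_zero, add_zero]

theorem commute_proj {s t : Set X} (hs : MeasurableSet s) (ht : MeasurableSet t) :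
    Commute (E.proj s) (E.proj t) := by
  rw [commute_iff_eq, E.proj_mul hs ht, E.proj_mul ht hs, Set.inter_comm]

theorem measure_proj_apply (x : H) {s : Set X} (hs : MeasurableSet s) :
    E.measure (E.proj s x) = (E.measure x).restrict s := by
  ext t ht
  rw [Measure.restrict_apply ht, ← ofReal_measureReal, ← ofReal_measureReal,
    ← E.norm_sq_proj _ ht, ← E.norm_sq_proj _ (ht.inter hs), ← E.proj_mul ht hs]
  rfl

variable {E}

theorem HasIntegral.unique {φ : X → ℂ} {S T : H →L[ℂ] H} (hS : E.HasIntegral φ S)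
    (hT : E.HasIntegral φ T) : S = T :=
  eq_of_inner _ _ fun x => by rw [(hS x).2, (hT x).2]

theorem HasIntegral.add {φ ψ : X → ℂ} {S T : H →L[ℂ] H} (hS : E.HasIntegral φ S)
    (hT : E.HasIntegral ψ T) : E.HasIntegral (fun t => φ t + ψ t) (S + T) := fun x =>
  ⟨(hS x).1.add (hT x).1, by
    rw [add_apply, inner_add_right, (hS x).2, (hT x).2, integral_add (hS x).1 (hT x).1]⟩

theorem HasIntegral.const_mul {φ : X → ℂ} {S : H →L[ℂ] H} (hS : E.HasIntegral φ S) (c : ℂ) :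
    E.HasIntegral (fun t => c * φ t) (c • S) := fun x =>
  ⟨(hS x).1.const_mul c, by
    rw [smul_apply, inner_smul_right, (hS x).2, integral_const_mul]⟩

theorem HasIntegral.sum {ι : Type*} (s : Finset ι) {φ : ι → X → ℂ} {S : ι → H →L[ℂ] H}
    (hS : ∀ i ∈ s, E.HasIntegral (φ i) (S i)) :
    E.HasIntegral (fun t => ∑ i ∈ s, φ i t) (∑ i ∈ s, S i) := fun x =>
  ⟨integrable_finsetSum _ fun i hi => (hS i hi x).1, by
    rw [sum_apply, inner_sum, integral_finsetSum _ fun i hi => (hS i hi x).1]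
    exact Finset.sum_congr rfl fun i hi => (hS i hi x).2⟩

theorem HasIntegral.adjoint {φ : X → ℂ} {S : H →L[ℂ] H} (hS : E.HasIntegral φ S) :
    E.HasIntegral (fun t => starRingEnd ℂ (φ t)) (ContinuousLinearMap.adjoint S) := fun x =>
  ⟨Complex.conjCLE.toContinuousLinearMap.integrable_comp (hS x).1, by
    rw [ContinuousLinearMap.adjoint_inner_right, ← inner_conj_symm, (hS x).2, integral_conj]⟩

theorem HasIntegral.congr {φ ψ : X → ℂ} {S : H →L[ℂ] H} (hS : E.HasIntegral φ S)
    (h : E.AE fun t => φ t = ψ t) : E.HasIntegral ψ S := fun x =>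
  ⟨(hS x).1.congr (h x), by rw [(hS x).2, integral_congr_ae (h x)]⟩

theorem hasIntegral_indicator {s : Set X} (hs : MeasurableSet s) :
    E.HasIntegral (s.indicator 1) (E.proj s) := fun x =>
  ⟨(integrable_const (1 : ℂ)).indicator hs, by
    rw [E.inner_proj x hs, integral_indicator hs]; simp⟩

theorem hasIntegral_one : E.HasIntegral (fun _ => 1) 1 := fun x =>
  ⟨integrable_const _, by
    rw [one_apply_eq_self, inner_self_eq_norm_sq_to_K, integral_const, E.measureReal_univ]
    simp⟩

/-- By commutation `T P = P T P`, so the quadratic form of `T P` at `x` is that of `T` at `P x`, and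
the scalar measure of `P x` is a restriction of that of `x`. -/
theorem HasIntegral.mul_indicator {φ : X → ℂ} {T : H →L[ℂ] H} (hT : E.HasIntegral φ T)
    {s : Set X} (hs : MeasurableSet s) (hc : Commute T (E.proj s)) :
    E.HasIntegral (fun t => φ t * s.indicator 1 t) (T * E.proj s) := by
  have h1 : T * E.proj s = E.proj s * T * E.proj s := by
    rw [← hc.eq, mul_assoc, E.proj_mul hs hs, Set.inter_self]
  have h2 : (fun t => φ t * s.indicator 1 t) = s.indicator φ := by
    ext t; by_cases h : t ∈ s <;> simp [h]
  intro x
  have h3 := hT (E.proj s x)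
  rw [E.measure_proj_apply x hs] at h3
  rw [h1, h2]
  refine ⟨(integrable_indicator_iff hs).2 h3.1, ?_⟩
  rw [integral_indicator hs, ← h3.2, E.inner_proj_left _ _ hs]
  rfl

/-- Multiplication by a simple function. -/
theorem HasIntegral.exists_mul_simpleFunc {φ : X → ℂ} {T : H →L[ℂ] H} (hT : E.HasIntegral φ T)
    (hc : ∀ s, MeasurableSet s → Commute T (E.proj s)) (g : SimpleFunc X ℂ) :
    ∃ U : H →L[ℂ] H, E.HasIntegral g U ∧ (∀ s, MeasurableSet s → Commute U (E.proj s)) ∧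
      E.HasIntegral (fun t => φ t * g t) (T * U) := by
  induction g using SimpleFunc.induction with
  | const c hs =>
    rename_i s
    refine ⟨c • E.proj s, ?_, fun t ht => (E.commute_proj hs ht).smul_left c, ?_⟩
    · convert (hasIntegral_indicator (E := E) hs).const_mul c using 1
      ext t; by_cases h : t ∈ s <;> simp [h]
    · rw [mul_smul_comm]
      convert (hT.mul_indicator hs (hc s hs)).const_mul c using 1
      ext t; by_cases h : t ∈ s <;> simp [h, mul_comm]
  | add _ ihf ihg =>
    obtain ⟨U, hU, hUc, hTU⟩ := ihf
    obtain ⟨V, hV, hVc, hTV⟩ := ihg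
    refine ⟨U + V, hU.add hV, fun s hs => (hUc s hs).add_left (hVc s hs), ?_⟩
    rw [mul_add]
    convert hTU.add hTV using 1
    ext t
    simp [mul_add]

/-- Multiplicativity applied to `U^* U`. It bounds `U` by the supremum of `g`, whatever the number
of values of `g`; this uniform bound is needed for the passage to the limit. -/
theorem HasIntegral.norm_sq_apply_simpleFunc {g : SimpleFunc X ℂ} {U : H →L[ℂ] H}
    (hU : E.HasIntegral g U) (hc : ∀ s, MeasurableSet s → Commute U (E.proj s)) (x : H) :
    ((‖U x‖ ^ 2 : ℝ) : ℂ) = ∫ t, starRingEnd ℂ (g t) * g t ∂(E.measure x) := by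
  obtain ⟨V, hV, -, h⟩ := hU.adjoint.exists_mul_simpleFunc (fun s hs => by
    have := (hc s hs).star_star
    rwa [(E.isStarProjection s hs).isSelfAdjoint.star_eq, ContinuousLinearMap.star_eq_adjoint]
      at this) g
  rw [hV.unique hU] at h
  rw [← (h x).2, mul_apply_eq_comp, ContinuousLinearMap.adjoint_inner_right,
    inner_self_eq_norm_sq_to_K]
  norm_cast

theorem HasIntegral.norm_apply_simpleFunc_le {g : SimpleFunc X ℂ} {U : H →L[ℂ] H}
    (hU : E.HasIntegral g U) (hc : ∀ s, MeasurableSet s → Commute U (E.proj s)) {C : ℝ}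
    (hC : 0 ≤ C) (hg : ∀ t, ‖g t‖ ≤ C) (x : H) : ‖U x‖ ≤ C * ‖x‖ := by
  refine le_of_sq_le_sq ?_ (by positivity)
  have h := hU.norm_sq_apply_simpleFunc hc x
  have h1 : ‖((‖U x‖ ^ 2 : ℝ) : ℂ)‖ ≤ C ^ 2 * (E.measure x).real Set.univ := by
    rw [h]
    refine norm_integral_le_of_norm_le_const (Eventually.of_forall fun t => ?_)
    rw [norm_mul, RCLike.norm_conj, sq]
    exact mul_le_mul (hg t) (hg t) (norm_nonneg _) hC
  rw [Complex.norm_real, Real.norm_of_nonneg (sq_nonneg _), E.measureReal_univ] at h1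
  rw [mul_pow]
  exact h1

theorem tendsto_inner_of_hasIntegral {ι : Type*} {l : Filter ι} [l.IsCountablyGenerated]
    {φ : ι → X → ℂ} {ψ : X → ℂ} {T : ι → H →L[ℂ] H}
    (hT : ∀ i, E.HasIntegral (φ i) (T i)) {C : ℝ}
    (hC : ∀ i, E.AE fun t => ‖φ i t‖ ≤ C)
    (hl : E.AE fun t => Tendsto (fun i => φ i t) l (𝓝 (ψ t))) (x y : H) :
    Tendsto (fun i => ⟪y, T i x⟫_ℂ) l
      (𝓝 (∑ j, polCoef j * ∫ t, ψ t ∂(E.measure (polVec x y j)))) := by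
  have h : ∀ i, ⟪y, T i x⟫_ℂ = ∑ j, polCoef j * ∫ t, φ i t ∂(E.measure (polVec x y j)) := fun i => by
    rw [inner_eq_sum_polCoef]
    simp only [(hT _ _).2]
  simp only [h]
  refine tendsto_finsetSum _ fun j _ => Tendsto.const_mul _ ?_
  exact tendsto_integral_filter_of_dominated_convergence (fun _ => C)
    (Eventually.of_forall fun i => (hT i _).1.aestronglyMeasurable)
    (Eventually.of_forall fun i => hC i _) (integrable_const _) (hl _)

variable (E) in
/-- Measurable functions essentially bounded by `C`. -/
def EssBdd (C : ℝ) (φ : X → ℂ) : Prop := Measurable φ ∧ E.AE fun t => ‖φ t‖ ≤ C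

/-- The integrals of approximating simple functions are uniformly bounded, and their quadratic forms
converge by dominated convergence. Their weak limit is the integral, and commutation with the
projections survives the limit. -/
theorem exists_hasIntegral_of_bounded {φ : X → ℂ} (hφ : Measurable φ) {C : ℝ} (hC0 : 0 ≤ C)
    (hC : ∀ t, ‖φ t‖ ≤ C) :
    ∃ T, E.HasIntegral φ T ∧ ∀ s, MeasurableSet s → Commute T (E.proj s) := by
  have h0 : (0 : ℂ) ∈ Metric.closedBall (0 : ℂ) C := by simpa using hC0
  let g : ℕ → SimpleFunc X ℂ := SimpleFunc.approxOn φ hφ (Metric.closedBall 0 C) 0 h0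
  have hg : ∀ n t, ‖g n t‖ ≤ C := fun n t => by
    simpa using SimpleFunc.approxOn_mem hφ h0 n t
  have hlim : ∀ t, Tendsto (fun n => g n t) atTop (𝓝 (φ t)) := fun t =>
    SimpleFunc.tendsto_approxOn hφ h0 (subset_closure (by simpa using hC t))
  choose U hU hUc _ using fun n => (hasIntegral_one (E := E)).exists_mul_simpleFunc
    (fun s _ => Commute.one_left _) (g n)
  have ht : ∀ x y, _ := tendsto_inner_of_hasIntegral hU (C := C)
    (fun n x => Eventually.of_forall (hg n)) (l := atTop)
    (fun x => Eventually.of_forall hlim)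
  obtain ⟨T, hT⟩ := exists_weak_limit (l := atTop) U C (fun n x y => by
    refine (norm_inner_le_norm _ _).trans ?_
    have := (hU n).norm_apply_simpleFunc_le (hUc n) hC0 (hg n) x
    calc ‖y‖ * ‖U n x‖ ≤ ‖y‖ * (C * ‖x‖) := by gcongr
      _ = _ := by ring) fun x y => ⟨_, ht x y⟩
  refine ⟨T, fun x => ⟨Integrable.of_bound hφ.aestronglyMeasurable C (Eventually.of_forall hC),
    ?_⟩, fun s hs => ?_⟩
  · refine tendsto_nhds_unique (hT x x) ?_
    simp only [(hU _ x).2]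
    exact tendsto_integral_of_dominated_convergence (fun _ => C)
      (fun n => (hU n x).1.aestronglyMeasurable) (integrable_const _)
      (fun n => Eventually.of_forall (hg n)) (Eventually.of_forall hlim)
  · refine eq_of_forall_inner fun x y => ?_
    have h1 := hT (E.proj s x) y
    have h2 := hT x (E.proj s y)
    refine (tendsto_nhds_unique h1 (h2.congr fun n => ?_)).trans ?_
    · rw [E.inner_proj_left _ _ hs]
      exact congrArg _ (DFunLike.congr_fun (hUc n s hs).eq x).symm
    · exact E.inner_proj_left _ _ hs

theorem EssBdd.exists_hasIntegral {φ : X → ℂ} {C : ℝ} (h : E.EssBdd C φ) :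
    ∃ T, E.HasIntegral φ T ∧ ∀ s, MeasurableSet s → Commute T (E.proj s) := by
  classical
  obtain ⟨hφ, hC⟩ := h
  obtain ⟨T, hT, hc⟩ := exists_hasIntegral_of_bounded (E := E)
    (φ := fun t => if ‖φ t‖ ≤ C then φ t else 0)
    (Measurable.ite (measurableSet_le hφ.norm measurable_const) hφ measurable_const)
    (le_max_right C 0) (fun t => by split_ifs with h <;> simp [h])
  refine ⟨T, hT.congr fun x => ?_, hc⟩
  filter_upwards [hC x] with t ht
  simp [ht]

theorem EssBdd.hasIntegral {φ : X → ℂ} {C : ℝ} (h : E.EssBdd C φ) :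
    E.HasIntegral φ (E.integral φ) :=
  Classical.epsilon_spec (h.exists_hasIntegral.imp fun _ h => h.1)

theorem HasIntegral.integral_eq {φ : X → ℂ} {T : H →L[ℂ] H} (h : E.HasIntegral φ T) :
    E.integral φ = T :=
  (Classical.epsilon_spec (⟨T, h⟩ : ∃ S, E.HasIntegral φ S) : E.HasIntegral φ _).unique h

theorem EssBdd.commute {φ : X → ℂ} {C : ℝ} (h : E.EssBdd C φ) {s : Set X}
    (hs : MeasurableSet s) : Commute (E.integral φ) (E.proj s) := by
  obtain ⟨T, hT, hc⟩ := h.exists_hasIntegral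
  rw [hT.integral_eq]
  exact hc s hs

theorem EssBdd.conj {φ : X → ℂ} {C : ℝ} (h : E.EssBdd C φ) :
    E.EssBdd C (fun t => starRingEnd ℂ (φ t)) :=
  ⟨Complex.continuous_conj.measurable.comp h.1, fun x => by
    filter_upwards [h.2 x] with t ht
    rwa [RCLike.norm_conj]⟩

theorem EssBdd.adjoint {φ : X → ℂ} {C : ℝ} (h : E.EssBdd C φ) :
    ContinuousLinearMap.adjoint (E.integral φ) = E.integral (fun t => starRingEnd ℂ (φ t)) :=
  h.hasIntegral.adjoint.integral_eq.symm

theorem EssBdd.inner_eq {φ : X → ℂ} {C : ℝ} (h : E.EssBdd C φ) (x y : H) :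
    ⟪y, E.integral φ x⟫_ℂ = ∑ j, polCoef j * ∫ t, φ t ∂(E.measure (polVec x y j)) := by
  rw [inner_eq_sum_polCoef]
  simp only [(h.hasIntegral _).2]

theorem tendsto_inner_integral {ι : Type*} {l : Filter ι} [l.IsCountablyGenerated]
    {φ : ι → X → ℂ} {ψ : X → ℂ} {C C' : ℝ} (hφ : ∀ i, E.EssBdd C (φ i)) (hψ : E.EssBdd C' ψ)
    (hl : E.AE fun t => Tendsto (fun i => φ i t) l (𝓝 (ψ t))) (x y : H) :
    Tendsto (fun i => ⟪y, E.integral (φ i) x⟫_ℂ) l (𝓝 ⟪y, E.integral ψ x⟫_ℂ) := by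
  rw [hψ.inner_eq]
  exact tendsto_inner_of_hasIntegral (fun i => (hφ i).hasIntegral) (fun i => (hφ i).2) hl x y

theorem EssBdd.mul {φ ψ : X → ℂ} {C C' : ℝ} (hφ : E.EssBdd C φ) (hψ : E.EssBdd C' ψ) :
    E.EssBdd (C * C') (fun t => φ t * ψ t) :=
  ⟨hφ.1.mul hψ.1, fun x => by
    filter_upwards [hφ.2 x, hψ.2 x] with t h1 h2
    rw [norm_mul]
    exact mul_le_mul h1 h2 (norm_nonneg _) ((norm_nonneg _).trans h1)⟩

/-- The case of simple `ψ` is known; the general case is a limit in the second factor. -/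
theorem EssBdd.hasIntegral_mul {φ ψ : X → ℂ} {C C' : ℝ} (hφ : E.EssBdd C φ)
    (hψ : E.EssBdd C' ψ) :
    E.HasIntegral (fun t => φ t * ψ t) (E.integral φ * E.integral ψ) := by
  have h0 : (0 : ℂ) ∈ Metric.closedBall (0 : ℂ) (max C' 0) := by simp
  let g : ℕ → SimpleFunc X ℂ := SimpleFunc.approxOn ψ hψ.1 (Metric.closedBall 0 (max C' 0)) 0 h0
  have hg : ∀ n t, ‖g n t‖ ≤ max C' 0 := fun n t => by
    simpa using SimpleFunc.approxOn_mem hψ.1 h0 n t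
  have hgb : ∀ n, E.EssBdd (max C' 0) (g n) := fun n =>
    ⟨(g n).measurable, fun x => Eventually.of_forall (hg n)⟩
  have hlim : E.AE fun t => Tendsto (fun n => g n t) atTop (𝓝 (ψ t)) := fun x => by
    filter_upwards [hψ.2 x] with t ht
    exact SimpleFunc.tendsto_approxOn hψ.1 h0 (subset_closure (by simpa using Or.inl ht))
  have h1 : ∀ n, E.HasIntegral (fun t => φ t * g n t) (E.integral φ * E.integral (g n)) := by
    intro n
    obtain ⟨U, hU, -, h⟩ := hφ.hasIntegral.exists_mul_simpleFunc (fun s hs => hφ.commute hs) (g n)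
    rwa [hU.integral_eq]
  intro x
  refine ⟨((hφ.mul hψ).hasIntegral x).1, ?_⟩
  -- Moving `∫ φ dE` to the left argument as its adjoint makes weak convergence of the second factor
  -- sufficient.
  have h2 := tendsto_inner_integral hgb hψ hlim x (ContinuousLinearMap.adjoint (E.integral φ) x)
  simp only [ContinuousLinearMap.adjoint_inner_left] at h2
  refine tendsto_nhds_unique h2 ?_
  have h3 : ∀ n, ⟪x, E.integral φ (E.integral (g n) x)⟫_ℂ
      = ∫ t, φ t * g n t ∂(E.measure x) := fun n => (h1 n x).2
  simp only [h3]
  refine tendsto_integral_of_dominated_convergence (fun _ => C * max C' 0)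
    (fun n => (h1 n x).1.aestronglyMeasurable) (integrable_const _) (fun n => (hφ.mul (hgb n)).2 x) ?_
  filter_upwards [hlim x] with t ht
  exact ht.const_mul _

theorem EssBdd.integral_mul {φ ψ : X → ℂ} {C C' : ℝ} (hφ : E.EssBdd C φ)
    (hψ : E.EssBdd C' ψ) :
    E.integral (fun t => φ t * ψ t) = E.integral φ * E.integral ψ :=
  (hφ.hasIntegral_mul hψ).integral_eq

theorem EssBdd.norm_sq_apply {φ : X → ℂ} {C : ℝ} (hφ : E.EssBdd C φ) (x : H) :
    ‖E.integral φ x‖ ^ 2 = ∫ t, ‖φ t‖ ^ 2 ∂(E.measure x) := by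
  have h := (hφ.conj.hasIntegral_mul hφ x).2
  rw [← hφ.adjoint, mul_apply_eq_comp, ContinuousLinearMap.adjoint_inner_right,
    inner_self_eq_norm_sq_to_K] at h
  have h1 : ∀ t, starRingEnd ℂ (φ t) * φ t = ((‖φ t‖ ^ 2 : ℝ) : ℂ) := fun t => by
    rw [RCLike.conj_mul]; norm_cast
  simp only [h1, integral_complex_ofReal] at h
  have h2 : ((‖E.integral φ x‖ ^ 2 : ℝ) : ℂ) = ((∫ t, ‖φ t‖ ^ 2 ∂(E.measure x) : ℝ) : ℂ) := by
    rw [← h]; norm_cast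
  exact_mod_cast h2

/-- Normality of the functional calculus. It provides the bounds for both columns `(A_j)` and
`(A_j^*)` of integrals, which the Schatten estimates use. -/
theorem EssBdd.norm_adjoint_apply {φ : X → ℂ} {C : ℝ} (hφ : E.EssBdd C φ) (x : H) :
    ‖ContinuousLinearMap.adjoint (E.integral φ) x‖ = ‖E.integral φ x‖ := by
  rw [← sq_eq_sq₀ (norm_nonneg _) (norm_nonneg _), hφ.adjoint, hφ.conj.norm_sq_apply,
    hφ.norm_sq_apply]
  simp only [RCLike.norm_conj]

theorem EssBdd.norm_apply_le {φ : X → ℂ} {C : ℝ} (hC : 0 ≤ C) (hφ : E.EssBdd C φ) (x : H) :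
    ‖E.integral φ x‖ ≤ C * ‖x‖ := by
  refine le_of_sq_le_sq ?_ (by positivity)
  rw [hφ.norm_sq_apply, mul_pow, ← E.measureReal_univ]
  refine (Real.le_norm_self _).trans (norm_integral_le_of_norm_le_const ?_)
  filter_upwards [hφ.2 x] with t ht
  rw [norm_pow, norm_norm]
  gcongr

/-- Square summable families of functions give square summable families of vectors. -/
theorem sum_sq_integral_le {ι : Type*} {φ : ι → X → ℂ} {C : ℝ}
    (hφ : ∀ i, ∃ C, E.EssBdd C (φ i)) (F : Finset ι)
    (hC : E.AE fun t => ∑ i ∈ F, ‖φ i t‖ ^ 2 ≤ C) (x : H) :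
    ∑ i ∈ F, ‖E.integral (φ i) x‖ ^ 2 ≤ C * ‖x‖ ^ 2 := by
  choose D hD using hφ
  have hi : ∀ i, Integrable (fun t => ‖φ i t‖ ^ 2) (E.measure x) := fun i => by
    refine Integrable.of_bound ((hD i).1.norm.pow_const 2).aestronglyMeasurable (D i ^ 2) ?_
    filter_upwards [(hD i).2 x] with t ht
    rw [norm_pow, norm_norm]
    gcongr
  simp only [(hD _).norm_sq_apply]
  rw [← integral_finsetSum _ fun i _ => hi i, ← E.measureReal_univ]
  refine (integral_mono_ae (integrable_finsetSum _ fun i _ => hi i) (integrable_const C)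
    (hC x)).trans ?_
  rw [integral_const, smul_eq_mul, mul_comm]

end SpectralMeasure

/-! ### Singular numbers and Bessel families -/

section SingularNumbers

variable {H : Type*} [NormedAddCommGroup H] [InnerProductSpace ℂ H] [CompleteSpace H]

theorem singularNumber_nonneg (T : H →L[ℂ] H) (n : ℕ) : 0 ≤ singularNumber T n :=
  Real.sInf_nonneg (by rintro r ⟨F, -, rfl⟩; exact norm_nonneg _)

theorem singularNumber_le (T F : H →L[ℂ] H) {n : ℕ}
    (hF : LinearMap.rank (F : H →ₗ[ℂ] H) ≤ (n : Cardinal)) : singularNumber T n ≤ ‖T - F‖ :=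
  csInf_le ⟨0, by rintro r ⟨F, -, rfl⟩; exact norm_nonneg _⟩ ⟨F, hF, rfl⟩

theorem singularNumber_set_nonempty (T : H →L[ℂ] H) (n : ℕ) :
    {r : ℝ | ∃ F : H →L[ℂ] H, LinearMap.rank (F : H →ₗ[ℂ] H) ≤ (n : Cardinal) ∧
      r = ‖T - F‖}.Nonempty :=
  ⟨_, 0, by simp, rfl⟩

theorem le_singularNumber (T : H →L[ℂ] H) {n : ℕ} {t : ℝ}
    (h : ∀ F : H →L[ℂ] H, LinearMap.rank (F : H →ₗ[ℂ] H) ≤ (n : Cardinal) → t ≤ ‖T - F‖) :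
    t ≤ singularNumber T n :=
  le_csInf (singularNumber_set_nonempty T n) (by rintro r ⟨F, hF, rfl⟩; exact h F hF)

theorem singularNumber_antitone (T : H →L[ℂ] H) : Antitone (singularNumber T) := by
  intro m n hmn
  refine le_singularNumber T fun F hF => singularNumber_le T F (hF.trans ?_)
  exact_mod_cast hmn

theorem singularNumber_neg (T : H →L[ℂ] H) (n : ℕ) : singularNumber (-T) n = singularNumber T n := by
  have key : ∀ S : H →L[ℂ] H, singularNumber (-S) n ≤ singularNumber S n := fun S => by
    refine le_singularNumber S fun F hF => ?_
    have h1 : LinearMap.rank ((-F : H →L[ℂ] H) : H →ₗ[ℂ] H) ≤ (n : Cardinal) := by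
      have : ((-F : H →L[ℂ] H) : H →ₗ[ℂ] H) = (-1 : ℂ) • (F : H →ₗ[ℂ] H) := by
        ext; simp
      rw [this, LinearMap.rank, LinearMap.range_smul _ _ (by norm_num)]
      exact hF
    refine (singularNumber_le (-S) (-F) h1).trans (le_of_eq ?_)
    rw [← norm_neg]; congr 1; abel
  refine le_antisymm (key T) ?_
  simpa using key (-T)

theorem MemSchatten.neg {p : ℝ} {T : H →L[ℂ] H} (h : MemSchatten p T) : MemSchatten p (-T) := by
  unfold MemSchatten at h ⊢
  simpa only [singularNumber_neg] using h

theorem rank_le_card {ι : Type*} (s : Finset ι) (F : H →ₗ[ℂ] H) (c : ι → H → ℂ) (v : ι → H)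
    (hF : ∀ x, F x = ∑ i ∈ s, c i x • v i) : LinearMap.rank F ≤ (s.card : Cardinal) := by
  classical
  have h1 : LinearMap.range F ≤ Submodule.span ℂ ((s.image v : Finset H) : Set H) := by
    rintro _ ⟨x, rfl⟩
    rw [hF]
    refine Submodule.sum_mem _ fun i hi => Submodule.smul_mem _ _ (Submodule.subset_span ?_)
    exact_mod_cast Finset.mem_image_of_mem v hi
  refine (Submodule.rank_mono h1).trans ((rank_span_finset_le _).trans ?_)
  exact_mod_cast Finset.card_image_le

/-- A family whose coefficients satisfy the Bessel inequality. -/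
def Bessel {ι : Type*} (e : ι → H) : Prop :=
  ∀ (x : H) (F : Finset ι), ∑ i ∈ F, ‖⟪e i, x⟫_ℂ‖ ^ 2 ≤ ‖x‖ ^ 2

theorem _root_.Orthonormal.bessel {ι : Type*} {e : ι → H} (he : Orthonormal ℂ e) : Bessel e :=
  fun x _ => he.sum_inner_products_le x

namespace Bessel

variable {ι : Type*} {e : ι → H}

theorem norm_le (he : Bessel e) (i : ι) : ‖e i‖ ≤ 1 := by
  have h := he (e i) {i}
  rw [Finset.sum_singleton, inner_self_eq_norm_sq_to_K] at h
  have h2 : ‖((‖e i‖ : ℂ)) ^ 2‖ = ‖e i‖ ^ 2 := by simp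
  have h3 : (‖e i‖ ^ 2) ^ 2 ≤ ‖e i‖ ^ 2 := by rw [← h2]; exact h2 ▸ h
  by_contra! hlt
  have h4 : 1 < ‖e i‖ ^ 2 := by nlinarith
  nlinarith

theorem summable (he : Bessel e) (x : H) : Summable fun i => ‖⟪e i, x⟫_ℂ‖ ^ 2 :=
  summable_of_sum_le (fun _ => sq_nonneg _) (he x)

end Bessel

/-- Orthogonal vectors of norm at most one satisfy the Bessel inequality. -/
theorem bessel_of_orthogonal {ι : Type*} {f : ι → H} (h0 : ∀ i j, i ≠ j → ⟪f i, f j⟫_ℂ = 0)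
    (h1 : ∀ i, ‖f i‖ ≤ 1) : Bessel f := by
  classical
  intro x F
  set S := ∑ i ∈ F, ‖⟪f i, x⟫_ℂ‖ ^ 2 with hS
  have hS0 : 0 ≤ S := Finset.sum_nonneg fun _ _ => sq_nonneg _
  set z := ∑ i ∈ F, ⟪f i, x⟫_ℂ • f i with hz
  have hz1 : ‖z‖ ^ 2 ≤ S := by
    have h2 : ((‖z‖ ^ 2 : ℝ) : ℂ) = ∑ i ∈ F, ((‖⟪f i, x⟫_ℂ‖ ^ 2 * ‖f i‖ ^ 2 : ℝ) : ℂ) := by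
      have : ((‖z‖ ^ 2 : ℝ) : ℂ) = ⟪z, z⟫_ℂ := by rw [inner_self_eq_norm_sq_to_K]; norm_cast
      rw [this]
      conv_lhs => rw [hz]
      rw [sum_inner]
      refine Finset.sum_congr rfl fun i hi => ?_
      rw [inner_sum, Finset.sum_eq_single_of_mem i hi]
      · rw [inner_smul_left, inner_smul_right, inner_self_eq_norm_sq_to_K, ← mul_assoc,
          RCLike.conj_mul]
        push_cast
        rfl
      · intro j _ hj
        rw [inner_smul_left, inner_smul_right, h0 i j (Ne.symm hj)]
        simp
    have h3 : ‖z‖ ^ 2 = ∑ i ∈ F, ‖⟪f i, x⟫_ℂ‖ ^ 2 * ‖f i‖ ^ 2 := by exact_mod_cast h2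
    rw [h3]
    refine Finset.sum_le_sum fun i _ => mul_le_of_le_one_right (sq_nonneg _) ?_
    exact pow_le_one₀ (norm_nonneg _) (h1 i)
  have hz2 : S ≤ ‖z‖ * ‖x‖ := by
    have h2 : ⟪z, x⟫_ℂ = (S : ℂ) := by
      rw [hz, sum_inner, hS]
      push_cast
      refine Finset.sum_congr rfl fun i _ => ?_
      rw [inner_smul_left, RCLike.conj_mul]
      rfl
    have h3 := norm_inner_le_norm (𝕜 := ℂ) z x
    rwa [h2, Complex.norm_real, Real.norm_of_nonneg hS0] at h3
  have h4 : S ^ 2 ≤ S * ‖x‖ ^ 2 := by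
    calc S ^ 2 ≤ (‖z‖ * ‖x‖) ^ 2 := by gcongr
      _ = ‖z‖ ^ 2 * ‖x‖ ^ 2 := by ring
      _ ≤ S * ‖x‖ ^ 2 := by gcongr
  rcases hS0.eq_or_lt with h | h
  · rw [← h]; positivity
  · rw [sq] at h4
    exact le_of_mul_le_mul_left h4 h

/-- Lower bound for the singular numbers. -/
theorem le_singularNumber_of_orthogonal {ι : Type*} {e : ι → H} (he : Orthonormal ℂ e)
    (T : H →L[ℂ] H) (hT : ∀ i j, i ≠ j → ⟪T (e i), T (e j)⟫_ℂ = 0) (S : Finset ι) {n : ℕ}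
    (hn : n < S.card) {t : ℝ} (ht : 0 ≤ t) (hS : ∀ i ∈ S, t ≤ ‖T (e i)‖) :
    t ≤ singularNumber T n := by
  classical
  refine le_singularNumber T fun F hF => ?_
  let V : (S → ℂ) →ₗ[ℂ] H := Fintype.linearCombination ℂ (fun i : S => e i)
  have hV : ∀ c, V c = ∑ i, c i • e i := fun c => Fintype.linearCombination_apply ..
  -- An operator of rank at most `n` cannot be injective on the span of more than `n` independent
  -- vectors. On a vector killed by `F`, the operator `T - F` equals `T`, which is bounded below by
  -- `t`.
  have hker : ∃ c, c ≠ 0 ∧ F (V c) = 0 := by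
    by_contra! hne
    have hinj : Function.Injective ((F : H →ₗ[ℂ] H) ∘ₗ V) := by
      rw [← LinearMap.ker_eq_bot, LinearMap.ker_eq_bot']
      intro c hc
      by_contra h
      exact hne c h hc
    have h1 := LinearMap.rank_comp_le_left V (F : H →ₗ[ℂ] H)
    have h2 : LinearMap.rank ((F : H →ₗ[ℂ] H) ∘ₗ V) = (S.card : Cardinal) := by
      have h3 := (LinearEquiv.ofInjective _ hinj).lift_rank_eq
      simp only [rank_fun', Fintype.card_coe, Cardinal.lift_natCast] at h3
      rw [LinearMap.rank]
      simpa using h3.symm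
    rw [h2] at h1
    have := h1.trans hF
    norm_cast at this
    omega
  obtain ⟨c, hc, hFc⟩ := hker
  have hnorm : ‖V c‖ ^ 2 = ∑ i, ‖c i‖ ^ 2 := by
    have h := (he.comp (Subtype.val : S → ι) Subtype.val_injective).inner_sum c c Finset.univ
    have h1 : ⟪V c, V c⟫_ℂ = ∑ i, starRingEnd ℂ (c i) * c i := by rw [hV]; exact h
    simp only [RCLike.conj_mul, inner_self_eq_norm_sq_to_K] at h1
    exact_mod_cast h1
  have hTnorm : ‖T (V c)‖ ^ 2 = ∑ i, ‖c i‖ ^ 2 * ‖T (e i)‖ ^ 2 := by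
    have h1 : ⟪T (V c), T (V c)⟫_ℂ = ∑ i, ((‖c i‖ ^ 2 * ‖T (e i)‖ ^ 2 : ℝ) : ℂ) := by
      rw [hV]
      simp only [map_sum, map_smul, sum_inner]
      refine Finset.sum_congr rfl fun i _ => ?_
      rw [inner_sum, Finset.sum_eq_single_of_mem i (Finset.mem_univ _)]
      · rw [inner_smul_left, inner_smul_right, inner_self_eq_norm_sq_to_K, ← mul_assoc,
          RCLike.conj_mul]
        push_cast
        rfl
      · intro j _ hj
        rw [inner_smul_left, inner_smul_right,
          hT i j (fun h => hj (Subtype.ext h.symm))]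
        simp
    rw [inner_self_eq_norm_sq_to_K] at h1
    refine Complex.ofReal_injective ?_
    push_cast at h1 ⊢
    exact h1
  have hpos : 0 < ‖V c‖ := by
    rw [norm_pos_iff]
    intro h0
    rw [h0, norm_zero] at hnorm
    apply hc
    ext i
    have h1 : ∑ i, ‖c i‖ ^ 2 = 0 := by rw [← hnorm]; norm_num
    have h2 := (Finset.sum_eq_zero_iff_of_nonneg (fun i _ => sq_nonneg ‖c i‖)).1 h1 i
      (Finset.mem_univ _)
    simpa using h2
  have h1 : t * ‖V c‖ ≤ ‖T (V c)‖ := by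
    refine le_of_sq_le_sq ?_ (norm_nonneg _)
    rw [mul_pow, hnorm, hTnorm, Finset.mul_sum]
    refine Finset.sum_le_sum fun i _ => ?_
    have := hS i i.2
    rw [mul_comm]
    gcongr
  have h2 : ‖T (V c)‖ ≤ ‖T - F‖ * ‖V c‖ := by
    have h3 : T (V c) = (T - F) (V c) := by rw [sub_apply, hFc, sub_zero]
    rw [h3]
    exact (T - F).le_opNorm _
  exact le_of_mul_le_mul_right (h1.trans h2) hpos

/-- If the numbers `s i` are dominated by a sequence after counting, their sums are too. -/
theorem sum_rpow_le_of_count {ι : Type*} {s : ι → ℝ} {σ : ℕ → ℝ} {p : ℝ} (hp : 0 ≤ p)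
    (hs : ∀ i, 0 ≤ s i)
    (h : ∀ (S : Finset ι) (n : ℕ) (t : ℝ), n < S.card → 0 ≤ t → (∀ i ∈ S, t ≤ s i) → t ≤ σ n)
    (S : Finset ι) : ∑ i ∈ S, s i ^ p ≤ ∑ n ∈ Finset.range S.card, σ n ^ p := by
  classical
  induction hn : S.card generalizing S with
  | zero => simp [Finset.card_eq_zero.1 hn]
  | succ n ih =>
    have hne : S.Nonempty := Finset.card_pos.1 (by omega)
    -- The smallest of `n + 1` numbers is at most `σ n`; the others are handled by induction.
    obtain ⟨i, hi, hmin⟩ := Finset.exists_min_image S s hne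
    rw [← Finset.sum_erase_add _ _ hi, Finset.sum_range_succ]
    refine add_le_add (ih (S.erase i) (by rw [Finset.card_erase_of_mem hi, hn]; rfl)) ?_
    exact Real.rpow_le_rpow (hs i) (h S n (s i) (by omega) (hs i) hmin) hp

end SingularNumbers

/-! ### A variational criterion for the Schatten classes -/

section Criterion

variable {H : Type*} [NormedAddCommGroup H] [InnerProductSpace ℂ H] [CompleteSpace H]

/-- The finite rank operator `x ↦ ∑ i < N, ⟪h i, x⟫ • v i`. -/
noncomputable def sumRankOne (N : ℕ) (h v : ℕ → H) : H →L[ℂ] H :=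
  ∑ i ∈ Finset.range N, (innerSL ℂ (h i)).smulRight (v i)

theorem sumRankOne_apply (N : ℕ) (h v : ℕ → H) (x : H) :
    sumRankOne N h v x = ∑ i ∈ Finset.range N, ⟪h i, x⟫_ℂ • v i := by
  simp [sumRankOne]

theorem rank_sumRankOne_le (N : ℕ) (h v : ℕ → H) :
    LinearMap.rank (sumRankOne N h v : H →ₗ[ℂ] H) ≤ (N : Cardinal) := by
  have := rank_le_card (Finset.range N) (sumRankOne N h v : H →ₗ[ℂ] H)
    (fun i x => ⟪h i, x⟫_ℂ) v (fun x => sumRankOne_apply N h v x)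
  simpa using this

theorem inner_sub_sumRankOne {N : ℕ} {h : ℕ → H}
    (hh : ∀ i < N, ∀ j < N, ⟪h i, h j⟫_ℂ = if i = j then 1 else 0) {i : ℕ} (hi : i < N) (x : H) :
    ⟪h i, x - sumRankOne N h h x⟫_ℂ = 0 := by
  rw [inner_sub_right, sumRankOne_apply, inner_sum,
    Finset.sum_eq_single_of_mem i (Finset.mem_range.2 hi)]
  · rw [inner_smul_right, hh i hi i hi]; simp
  · intro j hj hji
    rw [inner_smul_right, hh i hi j (Finset.mem_range.1 hj), if_neg (Ne.symm hji), mul_zero]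

theorem orthonormal_update {N : ℕ} {h : ℕ → H}
    (hh : ∀ i < N, ∀ j < N, ⟪h i, h j⟫_ℂ = if i = j then 1 else 0) {u : H} (hu : ‖u‖ = 1)
    (huo : ∀ i < N, ⟪h i, u⟫_ℂ = 0) :
    ∀ i < N + 1, ∀ j < N + 1, ⟪Function.update h N u i, Function.update h N u j⟫_ℂ
      = if i = j then 1 else 0 := by
  intro i hi j hj
  have huu : ⟪u, u⟫_ℂ = 1 := by rw [inner_self_eq_norm_sq_to_K, hu]; simp
  rcases (Nat.lt_succ_iff_lt_or_eq.1 hi) with hi | rfl <;>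
    rcases (Nat.lt_succ_iff_lt_or_eq.1 hj) with hj | rfl
  · rw [Function.update_of_ne hi.ne, Function.update_of_ne hj.ne, hh i hi j hj]
  · rw [Function.update_of_ne hi.ne, Function.update_self, huo i hi, if_neg hi.ne]
  · rw [Function.update_of_ne hj.ne, Function.update_self, ← inner_conj_symm, huo j hj,
      if_neg hj.ne', map_zero]
  · rw [Function.update_self, huu, if_pos rfl]

/-- Greedy construction. With `Pg`, `Ph` the projections onto the vectors already chosen, `(1 - Pg)
W (1 - Ph)` differs from `W` by an operator of rank at most `2N`, one `N` for each projection, so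
its norm is at least `s_{2N}`. A vector at which it attains more than half of that norm provides the
next pair. The factor `1/2` avoids any question of attainment. -/
theorem exists_orthonormal_ge_singularNumber (W : H →L[ℂ] H) (N : ℕ)
    (hW : ∀ m < N, 0 < singularNumber W (2 * m)) :
    ∃ g h : ℕ → H, (∀ i < N, ∀ j < N, ⟪g i, g j⟫_ℂ = if i = j then 1 else 0) ∧
      (∀ i < N, ∀ j < N, ⟪h i, h j⟫_ℂ = if i = j then 1 else 0) ∧
      ∀ m < N, singularNumber W (2 * m) / 2 ≤ ‖⟪g m, W (h m)⟫_ℂ‖ := by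
  induction N with
  | zero => exact ⟨fun _ => 0, fun _ => 0, by simp, by simp, by simp⟩
  | succ N ih =>
    obtain ⟨g, h, hg, hh, hgh⟩ := ih fun m hm => hW m (by omega)
    set σ := singularNumber W (2 * N) with hσ
    have hσ0 : 0 < σ := hW N (by omega)
    let Pg := sumRankOne N g g
    let Ph := sumRankOne N h h
    let F₁ : H →L[ℂ] H := sumRankOne N (fun i => ContinuousLinearMap.adjoint W (g i)) g
    let F₂ : H →L[ℂ] H := sumRankOne N h (fun i => W (h i) - Pg (W (h i)))
    have hF₁ : ∀ x, F₁ x = Pg (W x) := fun x => by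
      simp only [F₁, Pg, sumRankOne_apply, ContinuousLinearMap.adjoint_inner_left]
    have hF₂ : ∀ x, F₂ x = W (Ph x) - Pg (W (Ph x)) := fun x => by
      simp only [F₂, Ph]
      rw [sumRankOne_apply, sumRankOne_apply]
      simp only [map_sum, map_smul, smul_sub, Finset.sum_sub_distrib]
    have hrank : LinearMap.rank ((F₁ + F₂ : H →L[ℂ] H) : H →ₗ[ℂ] H) ≤ ((2 * N : ℕ) : Cardinal) := by
      have h1 := (LinearMap.rank_add_le (F₁ : H →ₗ[ℂ] H) (F₂ : H →ₗ[ℂ] H)).trans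
        (add_le_add (rank_sumRankOne_le N _ _) (rank_sumRankOne_le N _ _))
      rw [two_mul]
      push_cast at h1 ⊢
      exact h1
    have hlt : σ / 2 < ‖W - (F₁ + F₂)‖ :=
      (half_lt_self hσ0).trans_le (singularNumber_le W _ hrank)
    obtain ⟨x, hx⟩ : ∃ x, σ / 2 * ‖x‖ < ‖(W - (F₁ + F₂)) x‖ := by
      by_contra! hcon
      exact absurd (ContinuousLinearMap.opNorm_le_bound _ (by positivity) hcon) (not_le.2 hlt)
    set u := x - Ph x with hu
    set v := W u - Pg (W u) with hv
    have hvx : (W - (F₁ + F₂)) x = v := by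
      rw [sub_apply, add_apply, hF₁, hF₂, hv, hu]
      simp only [map_sub]
      abel
    rw [hvx] at hx
    have hux : ‖u‖ ≤ ‖x‖ := by
      have h1 : ⟪Ph x, u⟫_ℂ = 0 := by
        simp only [Ph]
        rw [sumRankOne_apply, sum_inner]
        refine Finset.sum_eq_zero fun i hi => ?_
        rw [inner_smul_left, hu, inner_sub_sumRankOne hh (Finset.mem_range.1 hi), mul_zero]
      have h2 := norm_add_sq_eq_norm_sq_add_norm_sq_of_inner_eq_zero (𝕜 := ℂ) (Ph x) u h1
      rw [hu, add_sub_cancel, ← hu] at h2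
      nlinarith [norm_nonneg x, norm_nonneg u, norm_nonneg (Ph x)]
    have hv0 : 0 < ‖v‖ := lt_of_le_of_lt (by positivity) hx
    have hu0 : 0 < ‖u‖ := by
      rw [norm_pos_iff]
      rintro h0
      rw [hv, h0] at hv0
      simp at hv0
    have hvW : ⟪v, W u⟫_ℂ = ((‖v‖ ^ 2 : ℝ) : ℂ) := by
      have h1 : ⟪v, Pg (W u)⟫_ℂ = 0 := by
        simp only [Pg]
        rw [sumRankOne_apply, inner_sum]
        refine Finset.sum_eq_zero fun i hi => ?_
        rw [inner_smul_right, ← inner_conj_symm v, hv,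
          inner_sub_sumRankOne hg (Finset.mem_range.1 hi), map_zero, mul_zero]
      have h2 : W u = v + Pg (W u) := by rw [hv]; abel
      rw [h2, inner_add_right, h1, add_zero, inner_self_eq_norm_sq_to_K]
      norm_cast
    refine ⟨Function.update g N ((‖v‖⁻¹ : ℂ) • v), Function.update h N ((‖u‖⁻¹ : ℂ) • u),
      orthonormal_update hg ?_ fun i hi => ?_, orthonormal_update hh ?_ fun i hi => ?_,
      fun m hm => ?_⟩
    · rw [norm_smul]; simp [hv0.ne']
    · rw [inner_smul_right, hv, inner_sub_sumRankOne hg hi, mul_zero]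
    · rw [norm_smul]; simp [hu0.ne']
    · rw [inner_smul_right, hu, inner_sub_sumRankOne hh hi, mul_zero]
    · rcases (Nat.lt_succ_iff_lt_or_eq.1 hm) with hm | rfl
      · rw [Function.update_of_ne hm.ne, Function.update_of_ne hm.ne]
        exact hgh m hm
      · rw [Function.update_self, Function.update_self, map_smul, inner_smul_left,
          inner_smul_right, hvW]
        simp only [norm_mul, RCLike.norm_conj, norm_inv, Complex.norm_real, norm_norm, norm_pow]
        have : ‖v‖⁻¹ * (‖u‖⁻¹ * ‖v‖ ^ 2) = ‖v‖ / ‖u‖ := by field_simp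
        rw [this, le_div_iff₀ hu0]
        calc σ / 2 * ‖u‖ ≤ σ / 2 * ‖x‖ := by gcongr
          _ ≤ ‖v‖ := hx.le

/-- A criterion for membership in the Schatten classes. -/
theorem memSchatten_of_sum_le {p : ℝ} (hp : 0 < p) (W : H →L[ℂ] H) (C : ℝ)
    (hW : ∀ (N : ℕ) (g h : Fin N → H), Bessel g → Bessel h →
      ∑ m, ‖⟪g m, W (h m)⟫_ℂ‖ ^ p ≤ C) : MemSchatten p W := by
  have hC : ∀ N, (∀ m < N, 0 < singularNumber W (2 * m)) →
      ∑ m ∈ Finset.range N, singularNumber W (2 * m) ^ p ≤ 2 ^ p * C := by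
    intro N hN
    obtain ⟨g, h, hg, hh, hgh⟩ := exists_orthonormal_ge_singularNumber W N hN
    have key : ∀ g : ℕ → H, (∀ i < N, ∀ j < N, ⟪g i, g j⟫_ℂ = if i = j then 1 else 0) →
        Bessel (fun i : Fin N => g i) := fun g hg => by
      refine Orthonormal.bessel ?_
      rw [orthonormal_iff_ite]
      intro i j
      rw [hg i i.2 j j.2]
      simp [Fin.ext_iff]
    have h1 := hW N _ _ (key g hg) (key h hh)
    rw [← Fin.sum_univ_eq_sum_range (fun m => singularNumber W (2 * m) ^ p)]
    refine le_trans ?_ (mul_le_mul_of_nonneg_left h1 (by positivity))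
    rw [Finset.mul_sum]
    refine Finset.sum_le_sum fun m _ => ?_
    rw [← Real.mul_rpow (by norm_num) (norm_nonneg _)]
    refine Real.rpow_le_rpow (singularNumber_nonneg _ _) ?_ hp.le
    linarith [hgh m m.2]
  have hC0 : 0 ≤ 2 ^ p * C := by simpa using hC 0 (by simp)
  have hall : ∀ N, ∑ m ∈ Finset.range N, singularNumber W (2 * m) ^ p ≤ 2 ^ p * C := by
    intro N
    induction N with
    | zero => simpa using hC0
    | succ N ih =>
      by_cases hpos : ∀ m < N + 1, 0 < singularNumber W (2 * m)
      · exact hC _ hpos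
      · push Not at hpos
        obtain ⟨m, hm, hle⟩ := hpos
        -- Once one singular number vanishes so do all later ones, and the remaining terms add
        -- nothing.
        have h0 : singularNumber W (2 * N) = 0 :=
          le_antisymm ((singularNumber_antitone W (by omega)).trans hle)
            (singularNumber_nonneg _ _)
        rw [Finset.sum_range_succ, h0, Real.zero_rpow hp.ne', add_zero]
        exact ih
  have heven : Summable fun m => singularNumber W (2 * m) ^ p :=
    summable_of_sum_range_le (fun _ => Real.rpow_nonneg (singularNumber_nonneg _ _) _) hall
  -- The construction controls only the even indices; monotonicity transfers summability to the odd
  -- ones.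
  have hodd : Summable fun m => singularNumber W (2 * m + 1) ^ p :=
    heven.of_nonneg_of_le (fun _ => Real.rpow_nonneg (singularNumber_nonneg _ _) _) fun m =>
      Real.rpow_le_rpow (singularNumber_nonneg _ _) (singularNumber_antitone W (by omega)) hp.le
  exact Summable.even_add_odd heven hodd

end Criterion

theorem _root_.HasSum.of_eq {ι M : Type*} [AddCommMonoid M] [TopologicalSpace M] {f g : ι → M}
    {a : M} (h : HasSum f a) (e : ∀ i, g i = f i) : HasSum g a := by
  rwa [funext e]

/-! ### Compactness and the singular value decomposition -/

section SingularValueDecomposition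

variable {H : Type u} [NormedAddCommGroup H] [InnerProductSpace ℂ H] [CompleteSpace H]

theorem summable_rpow_of_le {ι : Type*} {s : ι → ℝ} {p q : ℝ} (hp : 0 < p) (hpq : p ≤ q)
    (hs : ∀ i, 0 ≤ s i) (h : Summable fun i => s i ^ p) : Summable fun i => s i ^ q := by
  refine Summable.of_norm_bounded_eventually h ?_
  have h1 : ∀ᶠ i in cofinite, s i ^ p < 1 :=
    h.tendsto_cofinite_zero.eventually (gt_mem_nhds one_pos)
  filter_upwards [h1] with i hi
  have h2 : s i < 1 := by
    by_contra! hle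
    exact absurd (Real.one_le_rpow hle hp.le) (not_le.2 hi)
  rw [Real.norm_of_nonneg (Real.rpow_nonneg (hs i) _)]
  rcases (hs i).eq_or_lt with h0 | h0
  · rw [← h0, Real.zero_rpow hp.ne', Real.zero_rpow (hp.trans_le hpq).ne']
  · exact Real.rpow_le_rpow_of_exponent_ge h0 h2.le hpq

theorem MemSchatten.mono {p q : ℝ} (hp : 0 < p) (hpq : p ≤ q) {T : H →L[ℂ] H}
    (h : MemSchatten p T) : MemSchatten q T :=
  summable_rpow_of_le hp hpq (singularNumber_nonneg T) h

/-- A singular value decomposition `T = ∑ s i ⟪e i, ·⟫ f i` with `∑ (s i)^p < ∞`. -/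
structure IsSVD {ι : Type*} (p : ℝ) (e f : ι → H) (s : ι → ℝ) (T : H →L[ℂ] H) : Prop where
  left : Bessel e
  right : Bessel f
  nonneg : ∀ i, 0 ≤ s i
  summable : Summable fun i => s i ^ p
  hasSum : ∀ x y, HasSum (fun i => (s i : ℂ) * ⟪e i, x⟫_ℂ * ⟪y, f i⟫_ℂ) ⟪y, T x⟫_ℂ

theorem IsSVD.adjoint {ι : Type*} {p : ℝ} {e f : ι → H} {s : ι → ℝ} {T : H →L[ℂ] H}
    (h : IsSVD p e f s T) : IsSVD p f e s (ContinuousLinearMap.adjoint T) := by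
  refine ⟨h.right, h.left, h.nonneg, h.summable, fun x y => ?_⟩
  rw [ContinuousLinearMap.adjoint_inner_right, ← inner_conj_symm]
  have h1 : HasSum (fun i => starRingEnd ℂ ((s i : ℂ) * ⟪e i, y⟫_ℂ * ⟪x, f i⟫_ℂ))
      (starRingEnd ℂ ⟪x, T y⟫_ℂ) := (h.hasSum y x).map (starRingEnd ℂ) Complex.continuous_conj
  refine h1.of_eq fun i => ?_
  simp only [map_mul, Complex.conj_ofReal, inner_conj_symm]
  ring

/-- Summability forces `s_n → 0`, so `T` is a norm limit of operators of finite rank. -/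
theorem isCompactOperator_of_memSchatten {p : ℝ} (hp : 0 < p) {T : H →L[ℂ] H}
    (hT : MemSchatten p T) : IsCompactOperator T := by
  have h0 : Tendsto (singularNumber T) atTop (𝓝 0) := by
    have h1 := hT.tendsto_atTop_zero.rpow_const (p := p⁻¹) (Or.inr (by positivity))
    rw [Real.zero_rpow (by positivity)] at h1
    refine h1.congr fun n => ?_
    rw [← Real.rpow_mul (singularNumber_nonneg T n), mul_inv_cancel₀ hp.ne', Real.rpow_one]
  have h2 : ∀ n : ℕ, ∃ F : H →L[ℂ] H, IsCompactOperator F ∧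
      ‖T - F‖ ≤ singularNumber T n + 1 / ((n : ℝ) + 1) := by
    intro n
    obtain ⟨r, ⟨F, hF, rfl⟩, hlt⟩ := exists_lt_of_csInf_lt (singularNumber_set_nonempty T n)
      (show singularNumber T n < singularNumber T n + 1 / ((n : ℝ) + 1) from
        lt_add_of_pos_right _ (by positivity))
    refine ⟨F, ?_, hlt.le⟩
    have hfd : FiniteDimensional ℂ (LinearMap.range (F : H →ₗ[ℂ] H)) :=
      Module.rank_lt_aleph0_iff.1 (hF.trans_lt Cardinal.natCast_lt_aleph0)
    have hid := (isCompactOperator_id_iff_finiteDimensional (𝕜 := ℂ)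
      (E := LinearMap.range (F : H →ₗ[ℂ] H))).2 hfd
    have h3 := (hid.comp_clm (F.codRestrict (LinearMap.range (F : H →ₗ[ℂ] H))
      fun x => ⟨x, rfl⟩)).clm_comp (LinearMap.range (F : H →ₗ[ℂ] H)).subtypeL
    exact h3
  choose F hF hle using h2
  refine isCompactOperator_of_tendsto (l := atTop) (F := F) ?_
    (Eventually.of_forall hF)
  rw [tendsto_iff_norm_sub_tendsto_zero]
  refine squeeze_zero (fun _ => norm_nonneg _) (fun n => ?_)
    (by simpa only [add_zero] using h0.add (tendsto_one_div_add_atTop_nhds_zero_nat (𝕜 := ℝ)))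
  rw [norm_sub_rev]
  exact hle n

/-- A compact operator `T` has an orthonormal basis of eigenvectors of `T† T`. -/
theorem exists_hilbertBasis_eigenvectors {G : H →L[ℂ] H} (hG : IsCompactOperator G)
    (hs : (G : H →ₗ[ℂ] H).IsSymmetric) :
    ∃ (ι : Type u) (e : HilbertBasis ι ℂ H) (μ : ι → ℂ), ∀ i, G (e i) = μ i • e i := by
  let V : ℂ → Submodule ℂ H := fun μ => Module.End.eigenspace (G : Module.End ℂ H) μ
  have hVmem : ∀ μ x, x ∈ V μ ↔ G x = μ • x := fun μ x => Module.End.mem_eigenspace_iff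
  have hVc : ∀ μ, CompleteSpace (V μ) := fun μ => by
    have : IsClosed (V μ : Set H) := by
      have h1 : (V μ : Set H) = {x | G x = μ • x} := by ext x; exact hVmem μ x
      rw [h1]
      exact isClosed_eq G.continuous (continuous_const_smul μ)
    exact this.completeSpace_coe
  choose w b hb using fun μ => exists_hilbertBasis ℂ (V μ)
  have hon := hs.orthogonalFamily_eigenspaces.orthonormal_sigma_orthonormal
    (fun μ => (b μ).orthonormal)
  replace hon : Orthonormal ℂ fun a : Σ μ, w μ => ((b a.1 a.2 : V a.1) : H) := hon
  have hbot : (Submodule.span ℂ (Set.range fun a : Σ μ, w μ => ((b a.1 a.2 : V a.1) : H)))ᗮ = ⊥ := by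
    rw [eq_bot_iff]
    intro x hx
    have hx' := fun a : Σ μ, w μ => (Submodule.mem_orthogonal _ _).1 hx _
      (Submodule.subset_span ⟨a, rfl⟩)
    have hxV : x ∈ (⨆ μ, V μ)ᗮ := by
      rw [Submodule.iSup_eq_span, ]
      rw [Submodule.mem_orthogonal]
      intro u hu
      induction hu using Submodule.span_induction with
      | mem y hy =>
        obtain ⟨μ, hy⟩ := Set.mem_iUnion.1 hy
        have h1 := ((b μ).hasSum_repr ⟨y, hy⟩).mapL (V μ).subtypeL
        have h2 := h1.mapL (innerSL ℂ x)
        have h3 : ∀ i, (innerSL ℂ x) ((V μ).subtypeL ((b μ).repr ⟨y, hy⟩ i • b μ i)) = 0 := by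
          intro i
          have h4 := hx' ⟨μ, i⟩
          rw [← inner_conj_symm] at h4
          simp only [map_eq_zero] at h4
          simp only [map_smul, Submodule.subtypeL_apply, innerSL_apply_apply, smul_eq_mul]
          rw [h4, mul_zero]
        simp only [h3] at h2
        have h5 := h2.unique hasSum_zero
        have h6 : ⟪x, y⟫_ℂ = 0 := h5
        rw [← inner_conj_symm, h6, map_zero]
      | zero => simp
      | add y z _ _ hy hz => rw [inner_add_left, hy, hz, add_zero]
      | smul c y _ hy => rw [inner_smul_left, hy, mul_zero]
    rw [ContinuousLinearMap.orthogonalComplement_iSup_eigenspaces_eq_bot hG hs] at hxV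
    exact hxV
  refine ⟨_, HilbertBasis.mkOfOrthogonalEqBot hon hbot, fun i => i.1, fun i => ?_⟩
  rw [HilbertBasis.coe_mkOfOrthogonalEqBot]
  exact (hVmem _ _).1 (b i.1 i.2).2

/-- Diagonalise `T^* T`: in an eigenbasis `e` the vectors `T e_i` are mutually orthogonal, and the
right vectors are their normalisations. Where `T e_i = 0` the convention `0⁻¹ = 0` yields the zero
vector, so the right family is only a Bessel family; this is all that is used later. The counting
lemma compares the norms `‖T e_i‖` with the singular numbers. -/
theorem MemSchatten.exists_isSVD {p : ℝ} (hp : 0 < p) {T : H →L[ℂ] H} (hT : MemSchatten p T) :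
    ∃ (ι : Type u) (e f : ι → H) (s : ι → ℝ), IsSVD p e f s T := by
  have hc := isCompactOperator_of_memSchatten hp hT
  have hG : IsCompactOperator (ContinuousLinearMap.adjoint T ∘L T) :=
    hc.clm_comp (ContinuousLinearMap.adjoint T)
  obtain ⟨ι, e, μ, he⟩ := exists_hilbertBasis_eigenvectors hG (fun x y => by
    simp [ContinuousLinearMap.adjoint_inner_left, ContinuousLinearMap.adjoint_inner_right])
  have hort : ∀ i j, i ≠ j → ⟪T (e i), T (e j)⟫_ℂ = 0 := by
    intro i j hij
    rw [← ContinuousLinearMap.adjoint_inner_right]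
    have h1 : ContinuousLinearMap.adjoint T (T (e j)) = μ j • e j := he j
    rw [h1, inner_smul_right, e.orthonormal.2 hij, mul_zero]
  have hTe : ∀ i, ((‖T (e i)‖ : ℝ) : ℂ) • ((‖T (e i)‖⁻¹ : ℝ) : ℂ) • T (e i) = T (e i) := by
    intro i
    rw [smul_smul, ← Complex.ofReal_mul]
    by_cases h : T (e i) = 0
    · rw [h, smul_zero]
    · rw [mul_inv_cancel₀ (norm_ne_zero_iff.2 h), Complex.ofReal_one, one_smul]
  refine ⟨ι, e, fun i => ((‖T (e i)‖⁻¹ : ℝ) : ℂ) • T (e i), fun i => ‖T (e i)‖,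
    e.orthonormal.bessel, bessel_of_orthogonal (fun i j hij => ?_) (fun i => ?_),
    fun i => norm_nonneg _, ?_, fun x y => ?_⟩
  · rw [inner_smul_left, inner_smul_right, hort i j hij]; simp
  · rw [norm_smul, Complex.norm_real, norm_inv, norm_norm]
    by_cases h : T (e i) = 0
    · simp [h]
    · rw [inv_mul_cancel₀ (norm_ne_zero_iff.2 h)]
  · refine summable_of_sum_le (c := ∑' n, singularNumber T n ^ p)
      (fun i => Real.rpow_nonneg (norm_nonneg _) _) fun S => ?_
    refine (sum_rpow_le_of_count hp.le (fun i => norm_nonneg (T (e i)))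
      (fun S n t hn ht h => le_singularNumber_of_orthogonal e.orthonormal T hort S hn ht h) S).trans ?_
    exact hT.sum_le_tsum _ fun n _ => Real.rpow_nonneg (singularNumber_nonneg T n) _
  · have h1 := e.hasSum_inner_mul_inner (ContinuousLinearMap.adjoint T y) x
    rw [ContinuousLinearMap.adjoint_inner_left] at h1
    refine h1.of_eq fun i => ?_
    rw [ContinuousLinearMap.adjoint_inner_left]
    conv_rhs => rw [← hTe i]
    simp only [inner_smul_right]
    ring

end SingularValueDecomposition

/-! ### Nuclear series and the trace -/

section Trace

variable {H : Type u} [NormedAddCommGroup H] [InnerProductSpace ℂ H] [CompleteSpace H]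

theorem Bessel.sum_mul_le {ι : Type*} {e f : ι → H} (he : Bessel e) (hf : Bessel f) (x y : H)
    (F : Finset ι) : ∑ i ∈ F, ‖⟪e i, x⟫_ℂ‖ * ‖⟪f i, y⟫_ℂ‖ ≤ ‖x‖ * ‖y‖ :=
  sum_norm_mul_norm_le F _ _ _ _ (he x F) (hf y F) (norm_nonneg _) (norm_nonneg _)

/-- Inserting the basis gives a double series dominated by `‖u_i‖ ‖v_i‖` after summation over the
basis. Fubini then identifies the basis sum with the nuclear sum, in particular independently of the
basis. -/
theorem hasSum_inner_of_nuclear {ι κ : Type*} {u v : ι → H}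
    (hs : Summable fun i => ‖u i‖ * ‖v i‖) {W : H →L[ℂ] H}
    (hW : ∀ x y, HasSum (fun i => ⟪v i, x⟫_ℂ * ⟪y, u i⟫_ℂ) ⟪y, W x⟫_ℂ) (b : HilbertBasis κ ℂ H) :
    HasSum (fun i => ⟪v i, u i⟫_ℂ) (∑' k, ⟪b k, W (b k)⟫_ℂ) := by
  have hbb : Bessel b := b.orthonormal.bessel
  have hsum : Summable fun q : ι × κ => ⟪v q.1, b q.2⟫_ℂ * ⟪b q.2, u q.1⟫_ℂ := by
    refine Summable.of_norm ?_
    rw [summable_prod_of_nonneg fun _ => norm_nonneg _]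
    have h1 : ∀ i (F : Finset κ), ∑ k ∈ F, ‖⟪v i, b k⟫_ℂ * ⟪b k, u i⟫_ℂ‖ ≤ ‖u i‖ * ‖v i‖ := by
      intro i F
      refine le_trans (le_of_eq (Finset.sum_congr rfl fun k _ => ?_))
        (hbb.sum_mul_le hbb (u i) (v i) F)
      rw [norm_mul, mul_comm, norm_inner_symm (v i)]
    have h2 : ∀ i, Summable fun k => ‖⟪v i, b k⟫_ℂ * ⟪b k, u i⟫_ℂ‖ := fun i =>
      summable_of_sum_le (fun _ => norm_nonneg _) (h1 i)
    exact ⟨h2, hs.of_nonneg_of_le (fun i => tsum_nonneg fun _ => norm_nonneg _)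
      fun i => (h2 i).tsum_le_of_sum_le (h1 i)⟩
  have h3 : ∀ i, HasSum (fun k => ⟪v i, b k⟫_ℂ * ⟪b k, u i⟫_ℂ) ⟪v i, u i⟫_ℂ := fun i =>
    b.hasSum_inner_mul_inner (v i) (u i)
  have h4 := hsum.hasSum.prod_fiberwise h3
  have h5 : ∑' k, ⟪b k, W (b k)⟫_ℂ = ∑' q : ι × κ, ⟪v q.1, b q.2⟫_ℂ * ⟪b q.2, u q.1⟫_ℂ := by
    rw [hsum.tsum_prod, ← Summable.tsum_comm (f := fun i k => ⟪v i, b k⟫_ℂ * ⟪b k, u i⟫_ℂ) hsum]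
    exact tsum_congr fun k => (hW (b k) (b k)).tsum_eq.symm
  rw [h5]
  exact h4

/-- An operator with a nuclear representation is of trace class, and its trace is computed from the
representation. -/
theorem nuclear_trace {ι : Type*} {u v : ι → H} (hs : Summable fun i => ‖u i‖ * ‖v i‖)
    {W : H →L[ℂ] H} (hW : ∀ x y, HasSum (fun i => ⟪v i, x⟫_ℂ * ⟪y, u i⟫_ℂ) ⟪y, W x⟫_ℂ) :
    MemSchatten 1 W ∧ HasSum (fun i => ⟪v i, u i⟫_ℂ) (trace W) := by
  constructor
  · refine memSchatten_of_sum_le one_pos W (∑' i, ‖u i‖ * ‖v i‖) fun N g h hg hh => ?_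
    simp only [Real.rpow_one]
    have h1 : Tendsto (fun F : Finset ι => ∑ m, ‖∑ i ∈ F, ⟪v i, h m⟫_ℂ * ⟪g m, u i⟫_ℂ‖) atTop
        (𝓝 (∑ m, ‖⟪g m, W (h m)⟫_ℂ‖)) :=
      tendsto_finsetSum _ fun m _ => Tendsto.norm (hW (h m) (g m))
    refine le_of_tendsto h1 (Eventually.of_forall fun F => ?_)
    calc ∑ m, ‖∑ i ∈ F, ⟪v i, h m⟫_ℂ * ⟪g m, u i⟫_ℂ‖
        ≤ ∑ m, ∑ i ∈ F, ‖⟪g m, u i⟫_ℂ‖ * ‖⟪h m, v i⟫_ℂ‖ := by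
          refine Finset.sum_le_sum fun m _ => (norm_sum_le _ _).trans (le_of_eq ?_)
          refine Finset.sum_congr rfl fun i _ => ?_
          rw [norm_mul, mul_comm, norm_inner_symm (v i)]
      _ = ∑ i ∈ F, ∑ m, ‖⟪g m, u i⟫_ℂ‖ * ‖⟪h m, v i⟫_ℂ‖ := Finset.sum_comm
      _ ≤ ∑ i ∈ F, ‖u i‖ * ‖v i‖ := Finset.sum_le_sum fun i _ => hg.sum_mul_le hh _ _ _
      _ ≤ _ := hs.sum_le_tsum _ fun i _ => by positivity
  · exact hasSum_inner_of_nuclear hs hW _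

theorem trace_adjoint (T : H →L[ℂ] H) :
    trace (ContinuousLinearMap.adjoint T) = starRingEnd ℂ (trace T) := by
  rw [trace, trace, Complex.conj_tsum]
  refine tsum_congr fun i => ?_
  rw [ContinuousLinearMap.adjoint_inner_right, inner_conj_symm]

end Trace

/-! ### A Schur test for exponents `q ≥ 2` -/

section SchurTest

variable {ι κ l : Type*}

/-- Jensen's inequality for each `n`, with the row sums of `U` as total weight, followed by
summation over `n`, which uses the column sums. -/
theorem sum_rpow_weight_le (F : Finset ι) (L : Finset l) (U : ι → l → ℝ) (hU : ∀ n i, 0 ≤ U n i)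
    {C : ℝ} (hC : 0 < C) (h1 : ∀ n ∈ F, ∑ i ∈ L, U n i ≤ C) (h2 : ∀ i ∈ L, ∑ n ∈ F, U n i ≤ C)
    (x : l → ℝ) (hx : ∀ i, 0 ≤ x i) {r : ℝ} (hr : 1 ≤ r) :
    ∑ n ∈ F, (∑ i ∈ L, U n i * x i) ^ r ≤ C ^ r * ∑ i ∈ L, x i ^ r := by
  have hr0 : 0 < r := by linarith
  have key : ∀ n ∈ F, (∑ i ∈ L, U n i * x i) ^ r ≤ C ^ (r - 1) * ∑ i ∈ L, U n i * x i ^ r := by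
    intro n hn
    have h := Real.inner_le_weight_mul_Lp_of_nonneg L hr (U n) x (hU n) hx
    have hw0 : 0 ≤ ∑ i ∈ L, U n i := Finset.sum_nonneg fun i _ => hU n i
    have hf0 : 0 ≤ ∑ i ∈ L, U n i * x i ^ r :=
      Finset.sum_nonneg fun i _ => mul_nonneg (hU n i) (Real.rpow_nonneg (hx i) _)
    have hs0 : 0 ≤ ∑ i ∈ L, U n i * x i := Finset.sum_nonneg fun i _ => mul_nonneg (hU n i) (hx i)
    calc (∑ i ∈ L, U n i * x i) ^ r
        ≤ ((∑ i ∈ L, U n i) ^ (1 - r⁻¹) * (∑ i ∈ L, U n i * x i ^ r) ^ r⁻¹) ^ r :=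
          Real.rpow_le_rpow hs0 h hr0.le
      _ = (∑ i ∈ L, U n i) ^ (r - 1) * ∑ i ∈ L, U n i * x i ^ r := by
          rw [Real.mul_rpow (Real.rpow_nonneg hw0 _) (Real.rpow_nonneg hf0 _),
            ← Real.rpow_mul hw0, ← Real.rpow_mul hf0, inv_mul_cancel₀ hr0.ne', Real.rpow_one]
          congr 2
          field_simp
      _ ≤ _ := by
          refine mul_le_mul_of_nonneg_right ?_ hf0
          exact Real.rpow_le_rpow hw0 (h1 n hn) (by linarith)
  calc ∑ n ∈ F, (∑ i ∈ L, U n i * x i) ^ r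
      ≤ ∑ n ∈ F, C ^ (r - 1) * ∑ i ∈ L, U n i * x i ^ r := Finset.sum_le_sum key
    _ = C ^ (r - 1) * ∑ i ∈ L, (∑ n ∈ F, U n i) * x i ^ r := by
        rw [← Finset.mul_sum, Finset.sum_comm]
        simp only [Finset.sum_mul]
    _ ≤ C ^ (r - 1) * ∑ i ∈ L, C * x i ^ r := by
        refine mul_le_mul_of_nonneg_left ?_ (by positivity)
        exact Finset.sum_le_sum fun i hi =>
          mul_le_mul_of_nonneg_right (h2 i hi) (Real.rpow_nonneg (hx i) _)
    _ = _ := by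
        rw [← Finset.mul_sum, ← mul_assoc, ← Real.rpow_add_one hC.ne', sub_add_cancel]

theorem sq_sqrt_sum {α : Type*} (s : Finset α) (f : α → ℝ) :
    √(∑ i ∈ s, f i ^ 2) ^ 2 = ∑ i ∈ s, f i ^ 2 :=
  Real.sq_sqrt (Finset.sum_nonneg fun _ _ => sq_nonneg _)

/-- Cauchy–Schwarz over `(i,j)` puts the weight `w` on `u` and leaves the row bound for `v`; no
column bound for `v` is needed. Then Young's inequality separates `s_n` from `√Y_n`, and `∑_n
Y_n^{q/2}` is estimated by Jensen with exponent `q/2 ≥ 1`. The parameter `t` lets a caller make the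
second term as small as desired. -/
theorem schur_test {p q : ℝ} (hpq : p.HolderConjugate q) (hq : 2 ≤ q) (F : Finset ι) (L : Finset l)
    (J : Finset κ) {s : ι → ℝ} {w : l → ℝ} (hs : ∀ n, 0 ≤ s n) (hw : ∀ i, 0 ≤ w i)
    {u v : ι → l → κ → ℝ} {C : ℝ} (hC : 0 < C)
    (hv : ∀ n ∈ F, ∑ i ∈ L, ∑ j ∈ J, v n i j ^ 2 ≤ C)
    (hu1 : ∀ n ∈ F, ∑ i ∈ L, ∑ j ∈ J, u n i j ^ 2 ≤ C)
    (hu2 : ∀ i ∈ L, ∑ n ∈ F, ∑ j ∈ J, u n i j ^ 2 ≤ C) {t : ℝ} (ht : 0 < t) :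
    ∑ n ∈ F, ∑ i ∈ L, ∑ j ∈ J, s n * w i * (u n i j * v n i j) ≤
      √C * (t ^ p * ∑ n ∈ F, s n ^ p + (t⁻¹) ^ q * (C ^ (q / 2) * ∑ i ∈ L, w i ^ q)) := by
  set U : ι → l → ℝ := fun n i => ∑ j ∈ J, u n i j ^ 2 with hU
  set Y : ι → ℝ := fun n => ∑ i ∈ L, U n i * w i ^ 2 with hY
  have hU0 : ∀ n i, 0 ≤ U n i := fun n i => Finset.sum_nonneg fun _ _ => sq_nonneg _
  have hY0 : ∀ n, 0 ≤ Y n := fun n =>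
    Finset.sum_nonneg fun i _ => mul_nonneg (hU0 n i) (sq_nonneg _)
  have h1 : ∀ n ∈ F, ∑ i ∈ L, ∑ j ∈ J, s n * w i * (u n i j * v n i j) ≤
      √C * (t ^ p * s n ^ p + (t⁻¹) ^ q * Y n ^ (q / 2)) := by
    intro n hn
    have h2 : ∑ i ∈ L, ∑ j ∈ J, w i * u n i j * v n i j ≤ √(Y n) * √C := by
      rw [← Finset.sum_product']
      refine sum_norm_mul_norm_le (L ×ˢ J) (fun x => w x.1 * u n x.1 x.2) (fun x => v n x.1 x.2)
        _ _ ?_ ?_ (Real.sqrt_nonneg _) (Real.sqrt_nonneg _)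
      · rw [Real.sq_sqrt (hY0 n), Finset.sum_product, hY]
        refine le_of_eq (Finset.sum_congr rfl fun i _ => ?_)
        simp only [hU, mul_pow, Finset.sum_mul]
        exact Finset.sum_congr rfl fun j _ => mul_comm _ _
      · rw [Real.sq_sqrt hC.le, Finset.sum_product]
        exact hv n hn
    have h3 : s n * √(Y n) ≤ t ^ p * s n ^ p + (t⁻¹) ^ q * Y n ^ (q / 2) := by
      have hy := Real.young_inequality_of_nonneg (mul_nonneg ht.le (hs n))
        (mul_nonneg (inv_pos.2 ht).le (Real.sqrt_nonneg (Y n))) hpq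
      have e1 : t * s n * (t⁻¹ * √(Y n)) = s n * √(Y n) := by field_simp
      rw [e1, Real.mul_rpow ht.le (hs n),
        Real.mul_rpow (inv_pos.2 ht).le (Real.sqrt_nonneg _)] at hy
      have e2 : √(Y n) ^ q = Y n ^ (q / 2) := by
        rw [Real.sqrt_eq_rpow, ← Real.rpow_mul (hY0 n)]
        congr 1; ring
      rw [e2] at hy
      refine hy.trans (add_le_add ?_ ?_)
      · exact div_le_self (mul_nonneg (Real.rpow_nonneg ht.le _) (Real.rpow_nonneg (hs n) _))
          hpq.lt.le
      · exact div_le_self (mul_nonneg (Real.rpow_nonneg (inv_pos.2 ht).le _)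
          (Real.rpow_nonneg (hY0 n) _)) hpq.symm.lt.le
    calc ∑ i ∈ L, ∑ j ∈ J, s n * w i * (u n i j * v n i j)
        = s n * ∑ i ∈ L, ∑ j ∈ J, w i * u n i j * v n i j := by
          simp only [Finset.mul_sum]
          exact Finset.sum_congr rfl fun i _ => Finset.sum_congr rfl fun j _ => by ring
      _ ≤ s n * (√(Y n) * √C) := mul_le_mul_of_nonneg_left h2 (hs n)
      _ = √C * (s n * √(Y n)) := by ring
      _ ≤ _ := mul_le_mul_of_nonneg_left h3 (Real.sqrt_nonneg _)
  refine (Finset.sum_le_sum h1).trans ?_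
  rw [← Finset.mul_sum, Finset.sum_add_distrib, ← Finset.mul_sum, ← Finset.mul_sum]
  refine mul_le_mul_of_nonneg_left (add_le_add le_rfl ?_) (Real.sqrt_nonneg _)
  refine mul_le_mul_of_nonneg_left ?_ (by positivity)
  refine (sum_rpow_weight_le F L U hU0 hC hu1 hu2 (fun i => w i ^ 2) (fun i => sq_nonneg _)
    (r := q / 2) (by linarith)).trans (le_of_eq ?_)
  congr 1
  refine Finset.sum_congr rfl fun i _ => ?_
  rw [← Real.rpow_natCast, ← Real.rpow_mul (hw i)]
  congr 1; push_cast; ring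

theorem sum_le_sum_image [DecidableEq ι] [DecidableEq κ] (G : Finset (ι × κ)) (f : ι → κ → ℝ)
    (hf : ∀ n j, 0 ≤ f n j) :
    ∑ x ∈ G, f x.1 x.2 ≤ ∑ n ∈ G.image Prod.fst, ∑ j ∈ G.image Prod.snd, f n j := by
  rw [← Finset.sum_product']
  refine Finset.sum_le_sum_of_subset_of_nonneg (fun x hx => ?_) fun _ _ _ => hf _ _
  exact Finset.mem_product.2 ⟨Finset.mem_image_of_mem _ hx, Finset.mem_image_of_mem _ hx⟩

end SchurTest

/-! ### Columns of vectors under an operator of class `S_q` -/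

section Columns

variable {H : Type u} [NormedAddCommGroup H] [InnerProductSpace ℂ H] [CompleteSpace H]
variable {ι κ l : Type*}

theorem IsSVD.exists_le {p : ℝ} (hp : 0 < p) {e f : ι → H} {s : ι → ℝ} {T : H →L[ℂ] H}
    (h : IsSVD p e f s T) : ∃ M, ∀ i, s i ≤ M := by
  refine ⟨(∑' i, s i ^ p) ^ p⁻¹, fun i => ?_⟩
  have h1 := h.summable.le_tsum i fun j _ => Real.rpow_nonneg (h.nonneg j) _
  have h2 := Real.rpow_le_rpow (Real.rpow_nonneg (h.nonneg i) _) h1 (inv_pos.2 hp).le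
  rwa [← Real.rpow_mul (h.nonneg i), mul_inv_cancel₀ hp.ne', Real.rpow_one] at h2

theorem IsSVD.summable_sq {p : ℝ} (hp : 0 < p) {e f : ι → H} {s : ι → ℝ} {T : H →L[ℂ] H}
    (h : IsSVD p e f s T) (x : H) : Summable fun i => s i ^ 2 * ‖⟪e i, x⟫_ℂ‖ ^ 2 := by
  obtain ⟨M, hM⟩ := h.exists_le hp
  refine ((h.left.summable x).mul_left (M ^ 2)).of_nonneg_of_le (fun i => by positivity) fun i => ?_
  have := h.nonneg i
  gcongr
  exact hM i

theorem IsSVD.norm_sq_le {p : ℝ} (hp : 0 < p) {e f : ι → H} {s : ι → ℝ} {T : H →L[ℂ] H}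
    (h : IsSVD p e f s T) (x : H) : ‖T x‖ ^ 2 ≤ ∑' i, s i ^ 2 * ‖⟪e i, x⟫_ℂ‖ ^ 2 := by
  set S := ∑' i, s i ^ 2 * ‖⟪e i, x⟫_ℂ‖ ^ 2 with hS
  have hS0 : 0 ≤ S := tsum_nonneg fun i => by positivity
  have h1 : ‖⟪T x, T x⟫_ℂ‖ ≤ √S * ‖T x‖ := by
    have ht : Tendsto _ atTop _ := (h.hasSum x (T x)).norm
    refine le_of_tendsto ht (Eventually.of_forall fun F => ?_)
    refine (norm_sum_le _ _).trans ?_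
    have h2 : ∀ i, ‖(s i : ℂ) * ⟪e i, x⟫_ℂ * ⟪T x, f i⟫_ℂ‖
        = (s i * ‖⟪e i, x⟫_ℂ‖) * ‖⟪f i, T x⟫_ℂ‖ := fun i => by
      rw [norm_mul, norm_mul, Complex.norm_real, Real.norm_of_nonneg (h.nonneg i),
        norm_inner_symm (T x)]
    simp only [h2]
    refine sum_norm_mul_norm_le F _ _ _ _ ?_ (h.right _ F) (Real.sqrt_nonneg _) (norm_nonneg _)
    rw [Real.sq_sqrt hS0]
    simp only [mul_pow]
    exact (h.summable_sq hp x).sum_le_tsum _ fun i _ => by positivity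
  rw [inner_self_eq_norm_sq_to_K] at h1
  have h3 : ‖((‖T x‖ : ℂ)) ^ 2‖ = ‖T x‖ ^ 2 := by simp
  have h4 : ‖T x‖ ^ 2 ≤ √S * ‖T x‖ := h3 ▸ h1
  rcases (norm_nonneg (T x)).eq_or_lt with h0 | h0
  · rw [← h0]; simpa using hS0
  · have : ‖T x‖ ≤ √S := by nlinarith
    calc ‖T x‖ ^ 2 ≤ √S ^ 2 := by gcongr
      _ = S := Real.sq_sqrt hS0

/-- In the decomposition of `Q` the square norm of a column is a weighted sum of the `s_i^2`, with
weights `∑_j |⟪e_i, a_{nj}⟫|^2`. Rows and columns of these weights are at most `C`, so the weighted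
Jensen inequality with exponent `q/2` applies. -/
theorem IsSVD.sum_column_le {q : ℝ} (hq : 2 ≤ q) {e f : l → H} {s : l → ℝ} {Q : H →L[ℂ] H}
    (h : IsSVD q e f s Q) {a : ι → κ → H} {C : ℝ} (hC : 0 < C) (F : Finset ι) (J : Finset κ)
    (ha1 : ∀ y, ∑ n ∈ F, ∑ j ∈ J, ‖⟪y, a n j⟫_ℂ‖ ^ 2 ≤ C * ‖y‖ ^ 2)
    (ha2 : ∀ n ∈ F, ∑ j ∈ J, ‖a n j‖ ^ 2 ≤ C) :
    ∑ n ∈ F, √(∑ j ∈ J, ‖Q (a n j)‖ ^ 2) ^ q ≤ C ^ (q / 2) * ∑' i, s i ^ q := by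
  have hq0 : 0 < q := by linarith
  set U : ι → l → ℝ := fun n i => ∑ j ∈ J, ‖⟪e i, a n j⟫_ℂ‖ ^ 2 with hU
  have hU0 : ∀ n i, 0 ≤ U n i := fun n i => Finset.sum_nonneg fun _ _ => sq_nonneg _
  have hsum : ∀ n, HasSum (fun i => U n i * s i ^ 2)
      (∑ j ∈ J, ∑' i, s i ^ 2 * ‖⟪e i, a n j⟫_ℂ‖ ^ 2) := fun n => by
    have := hasSum_sum (s := J) fun j _ => (h.summable_sq hq0 (a n j)).hasSum
    refine this.of_eq fun i => ?_
    simp only [hU, Finset.sum_mul]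
    exact Finset.sum_congr rfl fun j _ => mul_comm _ _
  have h1 : ∀ n, ∑ j ∈ J, ‖Q (a n j)‖ ^ 2 ≤ ∑' i, U n i * s i ^ 2 := fun n => by
    rw [(hsum n).tsum_eq]
    exact Finset.sum_le_sum fun j _ => h.norm_sq_le hq0 _
  have h2 : ∀ n, √(∑ j ∈ J, ‖Q (a n j)‖ ^ 2) ^ q ≤ (∑' i, U n i * s i ^ 2) ^ (q / 2) := fun n => by
    have h0 : 0 ≤ ∑ j ∈ J, ‖Q (a n j)‖ ^ 2 := Finset.sum_nonneg fun _ _ => sq_nonneg _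
    rw [Real.sqrt_eq_rpow, ← Real.rpow_mul h0, one_div_mul_eq_div]
    exact Real.rpow_le_rpow h0 (h1 n) (by positivity)
  refine (Finset.sum_le_sum fun n _ => h2 n).trans ?_
  have ht : Tendsto (fun L : Finset l => ∑ n ∈ F, (∑ i ∈ L, U n i * s i ^ 2) ^ (q / 2)) atTop
      (𝓝 (∑ n ∈ F, (∑' i, U n i * s i ^ 2) ^ (q / 2))) :=
    tendsto_finsetSum _ fun n _ =>
      Tendsto.rpow_const (hsum n).summable.hasSum (Or.inr (by positivity))
  refine le_of_tendsto ht (Eventually.of_forall fun L => ?_)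
  refine (sum_rpow_weight_le F L U hU0 hC (fun n hn => ?_) (fun i _ => ?_) (fun i => s i ^ 2)
    (fun i => sq_nonneg _) (r := q / 2) (by linarith)).trans ?_
  · simp only [hU]
    rw [Finset.sum_comm]
    exact (Finset.sum_le_sum fun j _ => h.left _ L).trans (ha2 n hn)
  · refine (ha1 (e i)).trans ?_
    have := pow_le_one₀ (n := 2) (norm_nonneg _) (h.left.norm_le i)
    exact mul_le_of_le_one_right hC.le this
  · refine mul_le_mul_of_nonneg_left ?_ (by positivity)
    refine le_trans (le_of_eq (Finset.sum_congr rfl fun i _ => ?_))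
      (h.summable.sum_le_tsum L fun i _ => Real.rpow_nonneg (h.nonneg i) _)
    rw [← Real.rpow_natCast, ← Real.rpow_mul (h.nonneg i)]
    congr 1; push_cast; ring

/-- If `Q` belongs to `S_q` for some `q ≥ 2`, so does every operator dominated by the column
`(Q A_j)_j`. -/
theorem memSchatten_of_column {q : ℝ} (hq : 2 ≤ q) {Q X : H →L[ℂ] H} (hQ : MemSchatten q Q)
    {A : κ → H →L[ℂ] H} {C : ℝ} (hC : 0 < C)
    (hA : ∀ (x : H) (J : Finset κ), ∑ j ∈ J, ‖A j x‖ ^ 2 ≤ C * ‖x‖ ^ 2)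
    (hA' : ∀ (x : H) (J : Finset κ),
      ∑ j ∈ J, ‖ContinuousLinearMap.adjoint (A j) x‖ ^ 2 ≤ C * ‖x‖ ^ 2)
    {D : ℝ} (hD : 0 ≤ D) (hX : ∀ x, ‖X x‖ ^ 2 ≤ D * ∑' j, ‖Q (A j x)‖ ^ 2) : MemSchatten q X := by
  have hq0 : 0 < q := by linarith
  obtain ⟨l, e, f, s, hsvd⟩ := hQ.exists_isSVD hq0
  have hsum : ∀ x, Summable fun j => ‖Q (A j x)‖ ^ 2 := fun x => by
    refine summable_of_sum_le (c := ‖Q‖ ^ 2 * (C * ‖x‖ ^ 2)) (fun _ => sq_nonneg _) fun J => ?_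
    refine le_trans (Finset.sum_le_sum fun j _ => ?_)
      ((Finset.mul_sum J _ (‖Q‖ ^ 2)).symm.le.trans
        (mul_le_mul_of_nonneg_left (hA x J) (sq_nonneg _)))
    rw [← mul_pow]
    gcongr
    exact Q.le_opNorm _
  refine memSchatten_of_sum_le hq0 X (√D ^ q * (C ^ (q / 2) * ∑' i, s i ^ q))
    fun N g h hg hh => ?_
  have h1 : ∀ m, ‖⟪g m, X (h m)⟫_ℂ‖ ^ q ≤ √D ^ q * √(∑' j, ‖Q (A j (h m))‖ ^ 2) ^ q := fun m => by
    rw [← Real.mul_rpow (Real.sqrt_nonneg _) (Real.sqrt_nonneg _), ← Real.sqrt_mul hD]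
    refine Real.rpow_le_rpow (norm_nonneg _) ?_ hq0.le
    refine (norm_inner_le_norm _ _).trans ?_
    refine (mul_le_of_le_one_left (norm_nonneg _) (hg.norm_le m)).trans ?_
    exact Real.le_sqrt_of_sq_le (hX _)
  refine (Finset.sum_le_sum fun m _ => h1 m).trans ?_
  rw [← Finset.mul_sum]
  refine mul_le_mul_of_nonneg_left ?_ (Real.rpow_nonneg (Real.sqrt_nonneg _) _)
  have ht : Tendsto (fun J : Finset κ => ∑ m, √(∑ j ∈ J, ‖Q (A j (h m))‖ ^ 2) ^ q) atTop
      (𝓝 (∑ m, √(∑' j, ‖Q (A j (h m))‖ ^ 2) ^ q)) :=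
    tendsto_finsetSum _ fun m _ => by
      have h2 : Tendsto (fun J : Finset κ => ∑ j ∈ J, ‖Q (A j (h m))‖ ^ 2) atTop
        (𝓝 (∑' j, ‖Q (A j (h m))‖ ^ 2)) := (hsum (h m)).hasSum
      exact h2.sqrt.rpow_const (Or.inr hq0.le)
  refine le_of_tendsto ht (Eventually.of_forall fun J => ?_)
  refine hsvd.sum_column_le hq hC Finset.univ J (fun y => ?_) fun m _ => ?_
  · rw [Finset.sum_comm]
    refine (Finset.sum_le_sum fun j _ => ?_).trans (hA' y J)
    refine le_trans (le_of_eq (Finset.sum_congr rfl fun m _ => ?_))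
      (hh (ContinuousLinearMap.adjoint (A j) y) Finset.univ)
    rw [← ContinuousLinearMap.adjoint_inner_left, norm_inner_symm]
  · refine (hA (h m) J).trans ?_
    have := pow_le_one₀ (n := 2) (norm_nonneg _) (hh.norm_le m)
    exact mul_le_of_le_one_right hC.le this

end Columns

/-! ### Hölder's inequality and cyclicity of the trace -/

section Holder

variable {H : Type u} [NormedAddCommGroup H] [InnerProductSpace ℂ H] [CompleteSpace H]
variable {ι κ l : Type*}

theorem holderConjugate_of_ne_one {p : ℝ} (hp₁ : 1 ≤ p) (hp : p ≠ 1) :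
    p.HolderConjugate (p / (p - 1)) :=
  Real.HolderConjugate.conjExponent (lt_of_le_of_ne hp₁ (Ne.symm hp))

theorem two_le_conjExponent {p : ℝ} (hp₁ : 1 ≤ p) (hp₂ : p ≤ 2) (hp : p ≠ 1) :
    2 ≤ p / (p - 1) := by
  have : 1 < p := lt_of_le_of_ne hp₁ (Ne.symm hp)
  rw [le_div_iff₀ (by linarith)]
  linarith

theorem MemSchatten.adjoint_two_le {q : ℝ} (hq : 2 ≤ q) {Q : H →L[ℂ] H} (hQ : MemSchatten q Q) :
    MemSchatten q (ContinuousLinearMap.adjoint Q) := by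
  have hq0 : 0 < q := by linarith
  obtain ⟨l, e, f, s, h⟩ := hQ.exists_isSVD hq0
  refine memSchatten_of_sum_le hq0 _ (1 ^ (q / 2) * ∑' i, s i ^ q) fun N g h' hg hh => ?_
  refine le_trans (Finset.sum_le_sum fun m _ => ?_) (h.adjoint.sum_column_le hq one_pos Finset.univ
    {()} (a := fun m (_ : Unit) => h' m) (fun y => ?_) fun m _ => ?_)
  · rw [Finset.sum_singleton, Real.sqrt_sq (norm_nonneg _)]
    refine Real.rpow_le_rpow (norm_nonneg _) ?_ hq0.le
    exact (norm_inner_le_norm _ _).trans (mul_le_of_le_one_left (norm_nonneg _) (hg.norm_le m))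
  · simp only [Finset.sum_singleton, norm_inner_symm y, one_mul]
    exact hh y _
  · simpa using hh.norm_le m

/-- For `p = 1` the operator `X` is only bounded and the summability of `s` suffices. For `p > 1`
the norms `‖X f_i‖` lie in `ℓ^{p'}` by the column estimate, and Young's inequality finishes. -/
theorem IsSVD.summable_mul_norm {p : ℝ} (hp₁ : 1 ≤ p) (hp₂ : p ≤ 2) {e f : ι → H} {s : ι → ℝ}
    {T X : H →L[ℂ] H} (hT : IsSVD p e f s T) (hX : p ≠ 1 → MemSchatten (p / (p - 1)) X) :
    Summable fun i => s i * ‖X (f i)‖ := by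
  by_cases hp : p = 1
  · have h1 := hT.summable
    simp only [hp, Real.rpow_one] at h1
    refine (h1.mul_right ‖X‖).of_nonneg_of_le
      (fun i => mul_nonneg (hT.nonneg i) (norm_nonneg _)) fun i => ?_
    refine mul_le_mul_of_nonneg_left ?_ (hT.nonneg i)
    exact (X.le_opNorm _).trans (mul_le_of_le_one_right (norm_nonneg _) (hT.right.norm_le i))
  · have hpq := holderConjugate_of_ne_one hp₁ hp
    have hq := two_le_conjExponent hp₁ hp₂ hp
    set q := p / (p - 1) with hqdef
    have hq0 : 0 < q := by linarith
    obtain ⟨l, e', f', s', hsvd⟩ := (hX hp).exists_isSVD hq0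
    have h1 : Summable fun i => ‖X (f i)‖ ^ q := by
      refine summable_of_sum_le (c := 1 ^ (q / 2) * ∑' i, s' i ^ q)
        (fun i => Real.rpow_nonneg (norm_nonneg _) _) fun F => ?_
      refine le_trans (Finset.sum_le_sum fun m _ => ?_) (hsvd.sum_column_le hq one_pos F
        {()} (a := fun m (_ : Unit) => f m) (fun y => ?_) fun m _ => ?_)
      · rw [Finset.sum_singleton, Real.sqrt_sq (norm_nonneg _)]
      · simp only [Finset.sum_singleton, norm_inner_symm y, one_mul]
        exact hT.right y _
      · simpa using hT.right.norm_le m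
    refine (hT.summable.add h1).of_nonneg_of_le
      (fun i => mul_nonneg (hT.nonneg i) (norm_nonneg _)) fun i => ?_
    refine (Real.young_inequality_of_nonneg (hT.nonneg i) (norm_nonneg (X (f i))) hpq).trans ?_
    exact add_le_add (div_le_self (Real.rpow_nonneg (hT.nonneg i) _) hpq.lt.le)
      (div_le_self (Real.rpow_nonneg (norm_nonneg _) _) hpq.symm.lt.le)

theorem IsSVD.summable_mul_norm_adjoint {p : ℝ} (hp₁ : 1 ≤ p) (hp₂ : p ≤ 2) {e f : ι → H}
    {s : ι → ℝ} {T X : H →L[ℂ] H} (hT : IsSVD p e f s T)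
    (hX : p ≠ 1 → MemSchatten (p / (p - 1)) X) :
    Summable fun i => s i * ‖ContinuousLinearMap.adjoint X (e i)‖ :=
  hT.adjoint.summable_mul_norm hp₁ hp₂ fun hp =>
    (hX hp).adjoint_two_le (two_le_conjExponent hp₁ hp₂ hp)

/-- The Hölder inequality for the Schatten classes: `X T` is of trace class if `T ∈ S_p` and
`X ∈ S_{p'}`. -/
theorem IsSVD.trace_mul_left {p : ℝ} (hp₁ : 1 ≤ p) (hp₂ : p ≤ 2) {e f : ι → H} {s : ι → ℝ}
    {T X : H →L[ℂ] H} (hT : IsSVD p e f s T) (hX : p ≠ 1 → MemSchatten (p / (p - 1)) X) :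
    MemSchatten 1 (X * T) ∧ HasSum (fun i => (s i : ℂ) * ⟪e i, X (f i)⟫_ℂ) (trace (X * T)) := by
  have h1 := nuclear_trace (u := fun i => (s i : ℂ) • X (f i)) (v := e) (W := X * T) (by
    refine (hT.summable_mul_norm hp₁ hp₂ hX).of_nonneg_of_le (fun i => by positivity) fun i => ?_
    rw [norm_smul, Complex.norm_real, Real.norm_of_nonneg (hT.nonneg i)]
    exact mul_le_of_le_one_right (mul_nonneg (hT.nonneg i) (norm_nonneg _)) (hT.left.norm_le i))
    (fun x y => by
      have := hT.hasSum x (ContinuousLinearMap.adjoint X y)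
      rw [ContinuousLinearMap.adjoint_inner_left] at this
      refine this.of_eq fun i => ?_
      rw [inner_smul_right, ContinuousLinearMap.adjoint_inner_left]
      ring)
  refine ⟨h1.1, h1.2.of_eq fun i => ?_⟩
  rw [inner_smul_right]

theorem IsSVD.trace_mul_right {p : ℝ} (hp₁ : 1 ≤ p) (hp₂ : p ≤ 2) {e f : ι → H} {s : ι → ℝ}
    {T X : H →L[ℂ] H} (hT : IsSVD p e f s T) (hX : p ≠ 1 → MemSchatten (p / (p - 1)) X) :
    MemSchatten 1 (T * X) ∧ HasSum (fun i => (s i : ℂ) * ⟪e i, X (f i)⟫_ℂ) (trace (T * X)) := by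
  have h1 := nuclear_trace (u := f) (v := fun i => (s i : ℂ) • ContinuousLinearMap.adjoint X (e i))
    (W := T * X) (by
    refine (hT.summable_mul_norm_adjoint hp₁ hp₂ hX).of_nonneg_of_le (fun i => by positivity)
      fun i => ?_
    rw [norm_smul, Complex.norm_real, Real.norm_of_nonneg (hT.nonneg i)]
    exact mul_le_of_le_one_left (mul_nonneg (hT.nonneg i) (norm_nonneg _)) (hT.right.norm_le i))
    (fun x y => by
      refine (hT.hasSum (X x) y).of_eq fun i => ?_
      rw [inner_smul_left, ContinuousLinearMap.adjoint_inner_left, Complex.conj_ofReal])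
  refine ⟨h1.1, h1.2.of_eq fun i => ?_⟩
  rw [inner_smul_left, ContinuousLinearMap.adjoint_inner_left, Complex.conj_ofReal]

/-- Both traces are the sum of the same series `∑ s_i ⟪e_i, X f_i⟫`. -/
theorem trace_mul_comm {p : ℝ} (hp₁ : 1 ≤ p) (hp₂ : p ≤ 2) {T X : H →L[ℂ] H}
    (hT : MemSchatten p T) (hX : p ≠ 1 → MemSchatten (p / (p - 1)) X) :
    MemSchatten 1 (X * T) ∧ MemSchatten 1 (T * X) ∧ trace (X * T) = trace (T * X) := by
  obtain ⟨ι, e, f, s, h⟩ := hT.exists_isSVD (by linarith)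
  exact ⟨(h.trace_mul_left hp₁ hp₂ hX).1, (h.trace_mul_right hp₁ hp₂ hX).1,
    (h.trace_mul_left hp₁ hp₂ hX).2.unique (h.trace_mul_right hp₁ hp₂ hX).2⟩

end Holder

/-! ### Interchange of summation -/

section DoubleSums

variable {α β ι κ : Type*}

theorem summable_of_sum_sum_le [DecidableEq α] [DecidableEq β] {f : α × β → ℂ} {M : ℝ}
    (h : ∀ (F : Finset α) (L : Finset β), ∑ a ∈ F, ∑ b ∈ L, ‖f (a, b)‖ ≤ M) : Summable f :=
  Summable.of_norm <| summable_of_sum_le (fun _ => norm_nonneg _) fun G =>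
    (sum_le_sum_image G (fun a b => ‖f (a, b)‖) fun _ _ => norm_nonneg _).trans (h _ _)

/-- Interchange of the order of summation. -/
theorem HasSum.swap_of_summable {f : α × β → ℂ} (hf : Summable f) {r : α → ℂ} {c : β → ℂ} {S : ℂ}
    (hr : ∀ a, HasSum (fun b => f (a, b)) (r a)) (hc : ∀ b, HasSum (fun a => f (a, b)) (c b))
    (h : HasSum r S) : HasSum c S := by
  have h1 := hf.hasSum.prod_fiberwise hr
  rw [← h1.unique h]
  have h2 : HasSum (f ∘ Prod.swap) (∑' x, f x) := (Equiv.prodComm β α).hasSum_iff.2 hf.hasSum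
  exact h2.prod_fiberwise hc

end DoubleSums

/-! ### The transformation `T ↦ ∑_j A_j T D_j^*` on `S_p`, `p ≤ 2` -/

section Core

variable {H : Type u} [NormedAddCommGroup H] [InnerProductSpace ℂ H] [CompleteSpace H]
variable {ι κ l : Type*}

theorem norm_mul_sum_le (J : Finset κ) (a b : κ → H) {C : ℝ} (hC : 0 ≤ C)
    (ha : ∑ j ∈ J, ‖a j‖ ^ 2 ≤ C) (hb : ∑ j ∈ J, ‖b j‖ ^ 2 ≤ C) :
    ∑ j ∈ J, ‖a j‖ * ‖b j‖ ≤ C := by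
  have := sum_norm_mul_norm_le J (fun j => ‖a j‖) (fun j => ‖b j‖) (√C) (√C)
    (by rwa [Real.sq_sqrt hC]) (by rwa [Real.sq_sqrt hC]) (Real.sqrt_nonneg _) (Real.sqrt_nonneg _)
  rwa [Real.mul_self_sqrt hC] at this

/-- The bounds for two families of vectors `a`, `b` that make `∑ s_n a_{nj} ⊗ b_{nj}^*` an operator
of class `S_p` for `s ∈ ℓ^p`, `p ≤ 2`. -/
structure ColumnBound (C : ℝ) (a b : ι → κ → H) : Prop where
  pos : 0 < C
  left (y : H) (F : Finset ι) (J : Finset κ) : ∑ n ∈ F, ∑ j ∈ J, ‖⟪y, a n j⟫_ℂ‖ ^ 2 ≤ C * ‖y‖ ^ 2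
  left_row (n : ι) (J : Finset κ) : ∑ j ∈ J, ‖a n j‖ ^ 2 ≤ C
  right_row (n : ι) (J : Finset κ) : ∑ j ∈ J, ‖b n j‖ ^ 2 ≤ C

theorem IsSVD.columnBound {p : ℝ} {e f : ι → H} {s : ι → ℝ} {T : H →L[ℂ] H}
    (h : IsSVD p e f s T) : ColumnBound 1 (fun m (_ : Unit) => f m) (fun m (_ : Unit) => e m) :=
  ⟨one_pos, fun y F J => by
    rw [Finset.sum_comm]
    have h1 : ∀ j ∈ J, ∑ n ∈ F, ‖⟪y, f n⟫_ℂ‖ ^ 2 ≤ ‖y‖ ^ 2 := fun j _ => by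
      simp only [norm_inner_symm y]; exact h.right y F
    refine (Finset.sum_le_card_nsmul J _ _ h1).trans ?_
    have : (J.card : ℝ) ≤ 1 := by exact_mod_cast (Finset.card_le_univ J).trans (by simp)
    rw [nsmul_eq_mul]
    gcongr, fun n J => by
    refine (Finset.sum_le_card_nsmul J _ 1 fun j _ =>
      pow_le_one₀ (norm_nonneg _) (h.right.norm_le n)).trans ?_
    rw [nsmul_eq_mul, mul_one]
    exact_mod_cast (Finset.card_le_univ J).trans (by simp), fun n J => by
    refine (Finset.sum_le_card_nsmul J _ 1 fun j _ =>
      pow_le_one₀ (norm_nonneg _) (h.left.norm_le n)).trans ?_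
    rw [nsmul_eq_mul, mul_one]
    exact_mod_cast (Finset.card_le_univ J).trans (by simp)⟩

namespace ColumnBound

variable {C : ℝ} {a b : ι → κ → H}

theorem sum_le (h : ColumnBound C a b) {s : ι → ℝ} (hs : Summable fun n => s n ^ 2)
    (hs0 : ∀ n, 0 ≤ s n) (x y : H) (F : Finset ι) (J : Finset κ) :
    ∑ n ∈ F, ∑ j ∈ J, ‖(s n : ℂ) * ⟪b n j, x⟫_ℂ * ⟪y, a n j⟫_ℂ‖ ≤
      (√(∑' n, s n ^ 2) * C) * ‖x‖ * ‖y‖ := by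
  have hS : 0 ≤ ∑' n, s n ^ 2 := tsum_nonneg fun _ => sq_nonneg _
  rw [← Finset.sum_product']
  have e : ∀ z : ι × κ, ‖(s z.1 : ℂ) * ⟪b z.1 z.2, x⟫_ℂ * ⟪y, a z.1 z.2⟫_ℂ‖ =
      (s z.1 * ‖⟪b z.1 z.2, x⟫_ℂ‖) * ‖⟪y, a z.1 z.2⟫_ℂ‖ := fun z => by
    rw [norm_mul, norm_mul, Complex.norm_real, Real.norm_of_nonneg (hs0 _)]
  simp only [e]
  have := sum_norm_mul_norm_le (F ×ˢ J) (fun z => s z.1 * ‖⟪b z.1 z.2, x⟫_ℂ‖)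
    (fun z => ‖⟪y, a z.1 z.2⟫_ℂ‖) (√(∑' n, s n ^ 2) * √C * ‖x‖) (√C * ‖y‖) (by
      rw [mul_pow, mul_pow, Real.sq_sqrt hS, Real.sq_sqrt h.pos.le, Finset.sum_product]
      calc ∑ n ∈ F, ∑ j ∈ J, (s n * ‖⟪b n j, x⟫_ℂ‖) ^ 2
          ≤ ∑ n ∈ F, s n ^ 2 * (C * ‖x‖ ^ 2) := by
            refine Finset.sum_le_sum fun n _ => ?_
            simp only [mul_pow]
            rw [← Finset.mul_sum]
            refine mul_le_mul_of_nonneg_left ?_ (sq_nonneg _)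
            refine le_trans (Finset.sum_le_sum fun j _ => ?_)
              ((Finset.sum_mul J _ (‖x‖ ^ 2)).symm.le.trans
                (mul_le_mul_of_nonneg_right (h.right_row n J) (sq_nonneg _)))
            rw [← mul_pow]
            gcongr
            exact norm_inner_le_norm _ _
        _ = (∑ n ∈ F, s n ^ 2) * (C * ‖x‖ ^ 2) := by rw [Finset.sum_mul]
        _ ≤ (∑' n, s n ^ 2) * (C * ‖x‖ ^ 2) := by
            refine mul_le_mul_of_nonneg_right (hs.sum_le_tsum _ fun _ _ => sq_nonneg _) ?_
            have := h.pos
            positivity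
        _ = _ := by ring) (by
      rw [mul_pow, Real.sq_sqrt h.pos.le, Finset.sum_product]
      exact h.left y F J) (by positivity) (by positivity)
  refine this.trans (le_of_eq ?_)
  calc _ = √(∑' n, s n ^ 2) * (√C * √C) * ‖x‖ * ‖y‖ := by ring
    _ = _ := by rw [Real.mul_self_sqrt h.pos.le]

/-- Square summability of `s` is enough for weak convergence: by Cauchy–Schwarz the weights are
placed on the family `b`, which has only row bounds, while `a` has the stronger Bessel-type bound.
-/
theorem exists_operator (h : ColumnBound C a b) {s : ι → ℝ} (hs : Summable fun n => s n ^ 2)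
    (hs0 : ∀ n, 0 ≤ s n) : ∃ W : H →L[ℂ] H, ∀ x y,
      HasSum (fun z : ι × κ => (s z.1 : ℂ) * ⟪b z.1 z.2, x⟫_ℂ * ⟪y, a z.1 z.2⟫_ℂ) ⟪y, W x⟫_ℂ := by
  classical
  have hsum : ∀ x y, Summable
      (fun z : ι × κ => (s z.1 : ℂ) * ⟪b z.1 z.2, x⟫_ℂ * ⟪y, a z.1 z.2⟫_ℂ) := fun x y =>
    summable_of_sum_sum_le fun F L => h.sum_le hs hs0 x y F L
  have hinner : ∀ (G : Finset (ι × κ)) (x y : H),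
      ⟪y, (∑ z ∈ G, ((innerSL ℂ (b z.1 z.2)).smulRight ((s z.1 : ℂ) • a z.1 z.2))) x⟫_ℂ =
        ∑ z ∈ G, (s z.1 : ℂ) * ⟪b z.1 z.2, x⟫_ℂ * ⟪y, a z.1 z.2⟫_ℂ := fun G x y => by
    rw [sum_apply, inner_sum]
    refine Finset.sum_congr rfl fun z _ => ?_
    rw [ContinuousLinearMap.smulRight_apply, inner_smul_right, inner_smul_right, innerSL_apply_apply]
    ring
  obtain ⟨W, hW⟩ := exists_weak_limit (l := (atTop : Filter (Finset (ι × κ))))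
    (fun G => ∑ z ∈ G, ((innerSL ℂ (b z.1 z.2)).smulRight ((s z.1 : ℂ) • a z.1 z.2)))
    (√(∑' n, s n ^ 2) * C) (fun G x y => by
      rw [hinner]
      refine (norm_sum_le _ _).trans ?_
      exact (sum_le_sum_image G
        (fun n j => ‖(s n : ℂ) * ⟪b n j, x⟫_ℂ * ⟪y, a n j⟫_ℂ‖) fun _ _ => norm_nonneg _).trans
        (h.sum_le hs hs0 x y _ _))
    (fun x y => ⟨_, by simp only [hinner]; exact (hsum x y).hasSum⟩)
  refine ⟨W, fun x y => ?_⟩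
  have := hW x y
  simp only [hinner] at this
  exact this

theorem summable_mul_norm (h : ColumnBound C a b) {s : ι → ℝ} (hs : Summable s)
    (hs0 : ∀ n, 0 ≤ s n) : Summable fun z : ι × κ => s z.1 * (‖a z.1 z.2‖ * ‖b z.1 z.2‖) := by
  classical
  refine summable_of_sum_le (c := (∑' n, s n) * C)
    (fun z => mul_nonneg (hs0 _) (by positivity)) fun G => ?_
  refine (sum_le_sum_image G (fun n j => s n * (‖a n j‖ * ‖b n j‖))
    fun n j => mul_nonneg (hs0 _) (by positivity)).trans ?_
  calc _ ≤ ∑ n ∈ G.image Prod.fst, s n * C := by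
        refine Finset.sum_le_sum fun n _ => ?_
        rw [← Finset.mul_sum]
        exact mul_le_mul_of_nonneg_left (norm_mul_sum_le _ _ _ h.pos.le (h.left_row n _)
          (h.right_row n _)) (hs0 n)
    _ ≤ _ := by
        rw [← Finset.sum_mul]
        exact mul_le_mul_of_nonneg_right (hs.sum_le_tsum _ fun n _ => hs0 n) h.pos.le

theorem schur (h : ColumnBound C a b) {p q : ℝ} (hpq : p.HolderConjugate q) (hq : 2 ≤ q)
    {s : ι → ℝ} {w : l → ℝ} (hs : ∀ n, 0 ≤ s n) (hw : ∀ i, 0 ≤ w i) {e f : l → H}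
    (he : Bessel e) (hf : Bessel f) {t : ℝ} (ht : 0 < t)
    (F : Finset ι) (L : Finset l) (J : Finset κ) :
    ∑ n ∈ F, ∑ i ∈ L, ∑ j ∈ J, s n * w i * (‖⟪e i, a n j⟫_ℂ‖ * ‖⟪f i, b n j⟫_ℂ‖) ≤
      √C * (t ^ p * ∑ n ∈ F, s n ^ p + (t⁻¹) ^ q * (C ^ (q / 2) * ∑ i ∈ L, w i ^ q)) := by
  refine schur_test hpq hq F L J hs hw (u := fun n i j => ‖⟪e i, a n j⟫_ℂ‖)
    (v := fun n i j => ‖⟪f i, b n j⟫_ℂ‖) h.pos (fun n _ => ?_) (fun n _ => ?_) (fun i _ => ?_) ht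
  · rw [Finset.sum_comm]
    exact (Finset.sum_le_sum fun j _ => hf _ L).trans (h.right_row n J)
  · rw [Finset.sum_comm]
    exact (Finset.sum_le_sum fun j _ => he _ L).trans (h.left_row n J)
  · refine (h.left (e i) F J).trans ?_
    exact mul_le_of_le_one_right h.pos.le (pow_le_one₀ (norm_nonneg _) (he.norm_le i))

/-- For `p = 1` the series is nuclear. For `p > 1` let `w_m` be the matrix coefficients of a partial
sum along two Bessel families and test with the weights `w_m^{p-1}`, whose `q`-th powers are
`w_m^p`. The Schur test bounds `∑ w_m^p` by a constant plus half of itself, and the finite sum is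
absorbed. -/
theorem memSchatten (h : ColumnBound C a b) {p : ℝ} (hp₁ : 1 ≤ p) (hp₂ : p ≤ 2) {s : ι → ℝ}
    (hs : Summable fun n => s n ^ p) (hs0 : ∀ n, 0 ≤ s n) {W : H →L[ℂ] H} (hW : ∀ x y,
      HasSum (fun z : ι × κ => (s z.1 : ℂ) * ⟪b z.1 z.2, x⟫_ℂ * ⟪y, a z.1 z.2⟫_ℂ) ⟪y, W x⟫_ℂ) :
    MemSchatten p W := by
  classical
  by_cases hp : p = 1
  · subst hp
    simp only [Real.rpow_one] at hs
    refine (nuclear_trace (u := fun z : ι × κ => (s z.1 : ℂ) • a z.1 z.2) (v := fun z => b z.1 z.2)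
      ((h.summable_mul_norm hs hs0).congr fun z => ?_) fun x y =>
        (hW x y).of_eq fun z => by rw [inner_smul_right]; ring).1
    rw [norm_smul, Complex.norm_real, Real.norm_of_nonneg (hs0 _), mul_assoc]
  have hpq := holderConjugate_of_ne_one hp₁ hp
  have hq := two_le_conjExponent hp₁ hp₂ hp
  set q := p / (p - 1) with hqdef
  have hq0 : 0 < q := by linarith
  have hC := h.pos
  -- Chosen so that the coefficient of `∑ w_m^p` in the Schur test is exactly `1/2`.
  set t : ℝ := (2 * √C * C ^ (q / 2)) ^ q⁻¹ with ht
  have hbase : 0 < 2 * √C * C ^ (q / 2) := by positivity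
  have ht0 : 0 < t := Real.rpow_pos_of_pos hbase _
  have htq : √C * ((t⁻¹) ^ q * C ^ (q / 2)) = 1 / 2 := by
    rw [Real.inv_rpow ht0.le, ht, ← Real.rpow_mul hbase.le, inv_mul_cancel₀ hq0.ne', Real.rpow_one]
    have : √C ≠ 0 := (Real.sqrt_pos.2 hC).ne'
    have : C ^ (q / 2) ≠ 0 := (Real.rpow_pos_of_pos hC _).ne'
    field_simp
  refine memSchatten_of_sum_le (by linarith) W (2 * (√C * (t ^ p * ∑' n, s n ^ p)))
    fun N g k hg hk => ?_
  have hlim : Tendsto (fun G : Finset (ι × κ) => ∑ m : Fin N,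
      ‖∑ z ∈ G, (s z.1 : ℂ) * ⟪b z.1 z.2, k m⟫_ℂ * ⟪g m, a z.1 z.2⟫_ℂ‖ ^ p) atTop
      (𝓝 (∑ m, ‖⟪g m, W (k m)⟫_ℂ‖ ^ p)) :=
    tendsto_finsetSum _ fun m _ => by
      have h1 : Tendsto (fun G : Finset (ι × κ) => ‖∑ z ∈ G, (s z.1 : ℂ) * ⟪b z.1 z.2, k m⟫_ℂ *
        ⟪g m, a z.1 z.2⟫_ℂ‖) atTop (𝓝 ‖⟪g m, W (k m)⟫_ℂ‖) := (hW (k m) (g m)).norm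
      exact h1.rpow_const (Or.inr (by linarith))
  refine le_of_tendsto hlim (Eventually.of_forall fun G => ?_)
  set w : Fin N → ℝ := fun m => ‖∑ z ∈ G, (s z.1 : ℂ) * ⟪b z.1 z.2, k m⟫_ℂ *
    ⟪g m, a z.1 z.2⟫_ℂ‖ with hw
  have hw0 : ∀ m, 0 ≤ w m := fun m => norm_nonneg _
  have hx0 : ∀ m, 0 ≤ w m ^ (p - 1) := fun m => Real.rpow_nonneg (hw0 m) _
  have h1 : ∑ m, w m ^ p ≤ ∑ n ∈ G.image Prod.fst, ∑ m, ∑ j ∈ G.image Prod.snd,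
      s n * w m ^ (p - 1) * (‖⟪g m, a n j⟫_ℂ‖ * ‖⟪k m, b n j⟫_ℂ‖) := by
    rw [Finset.sum_comm]
    refine Finset.sum_le_sum fun m _ => ?_
    have e1 : w m ^ p = w m ^ (p - 1) * w m := by
      rcases (hw0 m).eq_or_lt with h0 | h0
      · rw [← h0, Real.zero_rpow (by linarith), mul_zero]
      · rw [← Real.rpow_add_one h0.ne', sub_add_cancel]
    rw [e1]
    have e2 : w m ≤ ∑ n ∈ G.image Prod.fst, ∑ j ∈ G.image Prod.snd,
        s n * (‖⟪g m, a n j⟫_ℂ‖ * ‖⟪k m, b n j⟫_ℂ‖) := by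
      refine (norm_sum_le _ _).trans ?_
      refine le_trans (le_of_eq (Finset.sum_congr rfl fun z _ => ?_)) (sum_le_sum_image G
        (fun n j => s n * (‖⟪g m, a n j⟫_ℂ‖ * ‖⟪k m, b n j⟫_ℂ‖)) fun n j =>
          mul_nonneg (hs0 n) (by positivity))
      rw [norm_mul, norm_mul, Complex.norm_real, Real.norm_of_nonneg (hs0 _), mul_assoc,
        norm_inner_symm (b _ _), mul_comm ‖⟪k m, b z.1 z.2⟫_ℂ‖]
    refine (mul_le_mul_of_nonneg_left e2 (hx0 m)).trans (le_of_eq ?_)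
    simp only [Finset.mul_sum]
    exact Finset.sum_congr rfl fun n _ => Finset.sum_congr rfl fun j _ => by ring
  have h2 := h1.trans (h.schur hpq hq hs0 hx0 hg hk ht0 (G.image Prod.fst) Finset.univ
    (G.image Prod.snd))
  have h3 : ∀ m, (w m ^ (p - 1)) ^ q = w m ^ p := fun m => by
    rw [← Real.rpow_mul (hw0 m), hqdef, mul_div_cancel₀]
    have : 1 < p := lt_of_le_of_ne hp₁ (Ne.symm hp)
    linarith
  simp only [h3] at h2
  have h4 : ∑ n ∈ G.image Prod.fst, s n ^ p ≤ ∑' n, s n ^ p :=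
    hs.sum_le_tsum _ fun n _ => Real.rpow_nonneg (hs0 n) _
  have h5 : √C * (t ^ p * ∑ n ∈ G.image Prod.fst, s n ^ p) ≤ √C * (t ^ p * ∑' n, s n ^ p) := by
    gcongr
  have h6 : √C * ((t⁻¹) ^ q * (C ^ (q / 2) * ∑ m, w m ^ p)) = 1 / 2 * ∑ m, w m ^ p := by
    rw [← htq]; ring
  rw [mul_add, h6] at h2
  change ∑ m, w m ^ p ≤ _
  linarith

/-- The nuclear case is direct. Otherwise the trace is first moved from the Schmidt expansion of `W`
to that of `Q`, and then, with `Q` fixed, to the defining series of `W`. Each interchange is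
absolutely convergent by the Schur test with `t = 1`. -/
theorem hasSum_trace (h : ColumnBound C a b) {p : ℝ} (hp₁ : 1 ≤ p) (hp₂ : p ≤ 2) {s : ι → ℝ}
    (hs : Summable fun n => s n ^ p) (hs0 : ∀ n, 0 ≤ s n) {W : H →L[ℂ] H} (hW : ∀ x y,
      HasSum (fun z : ι × κ => (s z.1 : ℂ) * ⟪b z.1 z.2, x⟫_ℂ * ⟪y, a z.1 z.2⟫_ℂ) ⟪y, W x⟫_ℂ)
    {Q : H →L[ℂ] H} (hQ : p ≠ 1 → MemSchatten (p / (p - 1)) Q) :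
    HasSum (fun z : ι × κ => (s z.1 : ℂ) * ⟪b z.1 z.2, Q (a z.1 z.2)⟫_ℂ) (trace (W * Q)) := by
  classical
  by_cases hp : p = 1
  · subst hp
    simp only [Real.rpow_one] at hs
    refine (nuclear_trace (u := fun z : ι × κ => (s z.1 : ℂ) • a z.1 z.2)
      (v := fun z => ContinuousLinearMap.adjoint Q (b z.1 z.2)) (W := W * Q)
      (((h.summable_mul_norm hs hs0).mul_right ‖Q‖).of_nonneg_of_le (fun z => by positivity)
        fun z => ?_) fun x y => (hW (Q x) y).of_eq fun z => ?_).2.of_eq fun z => ?_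
    · rw [norm_smul, Complex.norm_real, Real.norm_of_nonneg (hs0 _), mul_assoc, mul_assoc, mul_assoc]
      refine mul_le_mul_of_nonneg_left (mul_le_mul_of_nonneg_left ?_ (norm_nonneg _)) (hs0 _)
      rw [mul_comm]
      exact (ContinuousLinearMap.le_opNorm _ _).trans_eq (by rw [LinearIsometryEquiv.norm_map])
    · rw [inner_smul_right, ContinuousLinearMap.adjoint_inner_left]; ring
    · rw [inner_smul_right, ContinuousLinearMap.adjoint_inner_left]
  have hpq := holderConjugate_of_ne_one hp₁ hp
  have hq := two_le_conjExponent hp₁ hp₂ hp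
  have hWp := h.memSchatten hp₁ hp₂ hs hs0 hW
  have hQ' := hQ hp
  set q := p / (p - 1) with hqdef
  obtain ⟨μ, e, f, w, hsW⟩ := hWp.exists_isSVD (by linarith)
  obtain ⟨l, ε, φ, v, hsQ⟩ := hQ'.exists_isSVD (by linarith)
  have hcol := hsW.columnBound
  -- the trace of `W Q` through the Schmidt expansion of `Q`
  have h1 : HasSum (fun i => (v i : ℂ) * ⟪ε i, W (φ i)⟫_ℂ) (trace (W * Q)) := by
    refine HasSum.swap_of_summable
      (f := fun z : μ × l => (w z.1 : ℂ) * v z.2 * (⟪ε z.2, f z.1⟫_ℂ * ⟪e z.1, φ z.2⟫_ℂ))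
      (summable_of_sum_sum_le (M := √1 * (1 ^ p * ∑' m, w m ^ p + (1⁻¹) ^ q *
        (1 ^ (q / 2) * ∑' i, v i ^ q))) fun F L => ?_) (fun m => ?_) (fun i => ?_)
      (hsW.trace_mul_right hp₁ hp₂ hQ).2
    · have := hcol.schur hpq hq hsW.nonneg hsQ.nonneg hsQ.left hsQ.right one_pos F L {()}
      simp only [Finset.sum_singleton] at this
      refine le_trans (le_of_eq ?_) (this.trans ?_)
      · refine Finset.sum_congr rfl fun m _ => Finset.sum_congr rfl fun i _ => ?_
        simp only [norm_mul, Complex.norm_real, Real.norm_of_nonneg (hsW.nonneg _),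
          Real.norm_of_nonneg (hsQ.nonneg _), norm_inner_symm (e m)]
      · gcongr
        · exact hsW.summable.sum_le_tsum _ fun n _ => Real.rpow_nonneg (hsW.nonneg n) _
        · exact hsQ.summable.sum_le_tsum _ fun n _ => Real.rpow_nonneg (hsQ.nonneg n) _
    · refine ((hsQ.hasSum (f m) (e m)).mul_left (w m : ℂ)).of_eq fun i => by ring
    · refine ((hsW.hasSum (φ i) (ε i)).mul_left (v i : ℂ)).of_eq fun i => by ring
  refine HasSum.swap_of_summable
      (f := fun z : l × (ι × κ) => (s z.2.1 : ℂ) * v z.1 *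
        (⟪ε z.1, a z.2.1 z.2.2⟫_ℂ * ⟪b z.2.1 z.2.2, φ z.1⟫_ℂ))
      (summable_of_sum_sum_le (M := √C * (1 ^ p * ∑' n, s n ^ p + (1⁻¹) ^ q *
        (C ^ (q / 2) * ∑' i, v i ^ q))) fun L G => ?_) (fun i => ?_) (fun z => ?_) h1
  · have := h.schur hpq hq hs0 hsQ.nonneg hsQ.left hsQ.right one_pos (G.image Prod.fst) L
      (G.image Prod.snd)
    refine le_trans ?_ (this.trans ?_)
    · rw [Finset.sum_comm]
      refine (le_of_eq (Finset.sum_congr rfl fun z _ => ?_)).trans ((sum_le_sum_image G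
        (fun n j => ∑ i ∈ L, s n * v i * (‖⟪ε i, a n j⟫_ℂ‖ * ‖⟪φ i, b n j⟫_ℂ‖)) fun n j =>
          Finset.sum_nonneg fun i _ => mul_nonneg (mul_nonneg (hs0 n) (hsQ.nonneg i))
            (by positivity)).trans (le_of_eq (Finset.sum_congr rfl fun n _ => Finset.sum_comm)))
      refine Finset.sum_congr rfl fun i _ => ?_
      simp only [norm_mul, Complex.norm_real, Real.norm_of_nonneg (hs0 _),
          Real.norm_of_nonneg (hsQ.nonneg _), norm_inner_symm (b _ _)]
    · have := h.pos
      gcongr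
      · exact hs.sum_le_tsum _ fun n _ => Real.rpow_nonneg (hs0 n) _
      · exact hsQ.summable.sum_le_tsum _ fun n _ => Real.rpow_nonneg (hsQ.nonneg n) _
  · refine ((hW (φ i) (ε i)).mul_left (v i : ℂ)).of_eq fun z => by ring
  · refine ((hsQ.hasSum (a z.1 z.2) (b z.1 z.2)).mul_left (s z.1 : ℂ)).of_eq fun i => by ring

end ColumnBound

/-- The adjoint decomposition, regarded as a series with a single column, satisfies the column
bounds. -/
theorem MemSchatten.adjoint {p : ℝ} (hp₁ : 1 ≤ p) (hp₂ : p ≤ 2) {T : H →L[ℂ] H}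
    (hT : MemSchatten p T) : MemSchatten p (ContinuousLinearMap.adjoint T) := by
  obtain ⟨ι, e, f, s, h⟩ := hT.exists_isSVD (by linarith)
  refine h.adjoint.columnBound.memSchatten hp₁ hp₂ h.summable h.nonneg fun x y => ?_
  exact (Equiv.prodPUnit ι).hasSum_iff (f := fun i => (s i : ℂ) * ⟪f i, x⟫_ℂ * ⟪y, e i⟫_ℂ) |>.2
    (h.adjoint.hasSum x y)

/-- The operator `W = ∑_j A_j T D_j^*` belongs to `S_p` together with `T`, `1 ≤ p ≤ 2`, and
`trace (W Q) = trace (X T)` for `X = ∑_j D_j^* Q A_j`. -/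
theorem exists_column_transform {p : ℝ} (hp₁ : 1 ≤ p) (hp₂ : p ≤ 2) {T : H →L[ℂ] H}
    (hT : MemSchatten p T) {A D : κ → H →L[ℂ] H} {C : ℝ} (hC : 0 < C)
    (hA : ∀ (x : H) (J : Finset κ), ∑ j ∈ J, ‖A j x‖ ^ 2 ≤ C * ‖x‖ ^ 2)
    (hA' : ∀ (x : H) (J : Finset κ),
      ∑ j ∈ J, ‖ContinuousLinearMap.adjoint (A j) x‖ ^ 2 ≤ C * ‖x‖ ^ 2)
    (hD : ∀ (x : H) (J : Finset κ), ∑ j ∈ J, ‖D j x‖ ^ 2 ≤ C * ‖x‖ ^ 2) :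
    ∃ W : H →L[ℂ] H, MemSchatten p W ∧
      (∀ x y, HasSum (fun j => ⟪ContinuousLinearMap.adjoint (A j) y,
        T (ContinuousLinearMap.adjoint (D j) x)⟫_ℂ) ⟪y, W x⟫_ℂ) ∧
      ∀ Q X : H →L[ℂ] H, (p ≠ 1 → MemSchatten (p / (p - 1)) Q) →
        (∀ x y, HasSum (fun j => ⟪D j y, Q (A j x)⟫_ℂ) ⟪y, X x⟫_ℂ) →
        (p ≠ 1 → MemSchatten (p / (p - 1)) X) ∧
          MemSchatten 1 (X * T) ∧ trace (W * Q) = trace (X * T) := by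
  classical
  have hp0 : 0 < p := by linarith
  obtain ⟨ι, e, f, s, h⟩ := hT.exists_isSVD hp0
  have one_le : ∀ {ι : Type u} {e : ι → H}, Bessel e → ∀ n, C * ‖e n‖ ^ 2 ≤ C := fun he n =>
    mul_le_of_le_one_right hC.le (pow_le_one₀ (norm_nonneg _) (he.norm_le n))
  -- With `T = ∑ s_n ⟪e_n, ·⟫ f_n`, the operator `∑_j A_j T D_j^*` is the series with vectors `A_j
  -- f_n` and `D_j e_n`. The Bessel-type bound for the first family comes from `(A_j^*)`, and the
  -- row bounds come from `(A_j)` and `(D_j)`.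
  have hcol : ColumnBound C (fun n j => A j (f n)) (fun n j => D j (e n)) :=
    ⟨hC, fun y F J => by
      rw [Finset.sum_comm]
      refine (Finset.sum_le_sum fun j _ => ?_).trans (hA' y J)
      refine le_trans (le_of_eq (Finset.sum_congr rfl fun n _ => ?_)) (h.right _ F)
      rw [ContinuousLinearMap.adjoint_inner_right, norm_inner_symm],
    fun n J => (hA _ J).trans (one_le h.right n), fun n J => (hD _ J).trans (one_le h.left n)⟩
  -- Here `p ≤ 2` makes the singular values square summable, as `exists_operator` requires.
  have hs2 : Summable fun n => s n ^ 2 := by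
    have := summable_rpow_of_le hp0 hp₂ h.nonneg h.summable
    exact_mod_cast this
  obtain ⟨W, hW⟩ := hcol.exists_operator hs2 h.nonneg
  have hswap : ∀ {F : ι × κ → ℂ} {S : ℂ} {c : κ → ℂ}, HasSum F S →
      (∀ j, HasSum (fun n => F (n, j)) (c j)) → HasSum c S := fun {F S c} hF hc => by
    have h2 : HasSum (F ∘ Prod.swap) S := (Equiv.prodComm κ ι).hasSum_iff.2 hF
    exact h2.prod_fiberwise hc
  refine ⟨W, hcol.memSchatten hp₁ hp₂ h.summable h.nonneg hW, fun x y => ?_, fun Q X hQ hX => ?_⟩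
  · refine hswap (hW x y) fun j => ?_
    refine (h.hasSum (ContinuousLinearMap.adjoint (D j) x)
      (ContinuousLinearMap.adjoint (A j) y)).of_eq fun n => ?_
    rw [ContinuousLinearMap.adjoint_inner_left, ContinuousLinearMap.adjoint_inner_right]
  · have hsum : ∀ x, Summable fun j => ‖Q (A j x)‖ ^ 2 := fun x => by
      refine summable_of_sum_le (c := ‖Q‖ ^ 2 * (C * ‖x‖ ^ 2)) (fun _ => sq_nonneg _) fun J => ?_
      refine le_trans (Finset.sum_le_sum fun j _ => ?_)
        ((Finset.mul_sum J _ (‖Q‖ ^ 2)).symm.le.trans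
          (mul_le_mul_of_nonneg_left (hA x J) (sq_nonneg _)))
      rw [← mul_pow]
      gcongr
      exact Q.le_opNorm _
    have hXle : ∀ x, ‖X x‖ ^ 2 ≤ C * ∑' j, ‖Q (A j x)‖ ^ 2 := fun x => by
      set S := ∑' j, ‖Q (A j x)‖ ^ 2 with hS
      have hS0 : 0 ≤ S := tsum_nonneg fun _ => sq_nonneg _
      have h1 : ‖⟪X x, X x⟫_ℂ‖ ≤ √C * ‖X x‖ * √S := by
        have ht : Tendsto _ atTop _ := (hX x (X x)).norm
        refine le_of_tendsto ht (Eventually.of_forall fun F => ?_)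
        refine (norm_sum_le _ _).trans ((Finset.sum_le_sum fun j _ =>
          norm_inner_le_norm _ _).trans ?_)
        refine sum_norm_mul_norm_le F _ _ _ _ ?_ ?_ (by positivity) (Real.sqrt_nonneg _)
        · rw [mul_pow, Real.sq_sqrt hC.le]; exact hD _ F
        · rw [Real.sq_sqrt hS0]
          exact (hsum x).sum_le_tsum _ fun _ _ => sq_nonneg _
      rw [inner_self_eq_norm_sq_to_K] at h1
      have h3 : ‖((‖X x‖ : ℂ)) ^ 2‖ = ‖X x‖ ^ 2 := by simp
      have h4 : ‖X x‖ ^ 2 ≤ √C * ‖X x‖ * √S := h3 ▸ h1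
      rcases (norm_nonneg (X x)).eq_or_lt with h0 | h0
      · rw [← h0]; simpa using mul_nonneg hC.le hS0
      · have h5 : ‖X x‖ ≤ √C * √S := by
          have : ‖X x‖ * ‖X x‖ ≤ ‖X x‖ * (√C * √S) := by nlinarith
          exact le_of_mul_le_mul_left this h0
        calc ‖X x‖ ^ 2 ≤ (√C * √S) ^ 2 := by gcongr
          _ = C * S := by rw [mul_pow, Real.sq_sqrt hC.le, Real.sq_sqrt hS0]
    -- Cauchy–Schwarz with the bounded column `(D_j)` dominates `X` by the column `(Q A_j)`, hence
    -- `X` is in the class of `Q`.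
    have hXq : p ≠ 1 → MemSchatten (p / (p - 1)) X := fun hp =>
      memSchatten_of_column (two_le_conjExponent hp₁ hp₂ hp) (hQ hp) hC hA hA' hC.le hXle
    have h1 := h.trace_mul_left hp₁ hp₂ hXq
    refine ⟨hXq, h1.1, (hcol.hasSum_trace hp₁ hp₂ h.summable h.nonneg hW hQ).prod_fiberwise
      (fun n => ?_) |>.unique h1.2⟩
    exact (hX (f n) (e n)).mul_left _

end Core

/-! ### Integration of matrix functions -/

section MatrixIntegrals

variable {X : Type*} [MeasurableSpace X] {H : Type u} [NormedAddCommGroup H]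
  [InnerProductSpace ℂ H] [CompleteSpace H] {E : SpectralMeasure X H}

theorem isClosed_scalarBound {ι κ : Type*} (C : ℝ) :
    IsClosed {b : ι → κ → ℂ | ScalarBound C b} := by
  simp only [ScalarBound, Set.ofPred_forall]
  refine isClosed_iInter fun J => isClosed_iInter fun K => isClosed_iInter fun p =>
    isClosed_iInter fun r => isClosed_le ?_ continuous_const
  fun_prop

theorem scalarBound_zero {ι κ : Type*} {C : ℝ} (hC : 0 ≤ C) :
    ScalarBound C (0 : ι → κ → ℂ) := fun J K p r => by
  simp only [Pi.zero_apply, mul_zero, zero_mul, Finset.sum_const_zero, norm_zero]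
  positivity

namespace SpectralMeasure

theorem sum_norm_sq_proj_le {V : Type*} (s : Finset V) {S : V → Set X}
    (hS : ∀ v, MeasurableSet (S v)) (hd : Pairwise (Function.onFun Disjoint S)) (x : H) :
    ∑ v ∈ s, ‖E.proj (S v) x‖ ^ 2 ≤ ‖x‖ ^ 2 := by
  simp only [E.norm_sq_proj x (hS _), ← E.measureReal_univ x]
  rw [← measureReal_biUnion_finset (fun v _ w _ h => hd h) fun v _ => hS v]
  exact measureReal_mono (Set.subset_univ _)

theorem sum_sq_sqrt_proj_le {V ι : Type*} (s : Finset V) {S : V → Set X}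
    (hS : ∀ v, MeasurableSet (S v)) (hd : Pairwise (Function.onFun Disjoint S)) (J : Finset ι)
    (p : ι → H) :
    ∑ v ∈ s, √(∑ j ∈ J, ‖E.proj (S v) (p j)‖ ^ 2) ^ 2 ≤ √(∑ j ∈ J, ‖p j‖ ^ 2) ^ 2 := by
  simp only [sq_sqrt_sum]
  rw [Finset.sum_comm]
  exact Finset.sum_le_sum fun j _ => sum_norm_sq_proj_le s hS hd (p j)

theorem hasIntegral_simpleFunc_entry {ι κ : Type*} [MeasurableSpace (ι → κ → ℂ)]
    (g : SimpleFunc X (ι → κ → ℂ)) (j : ι) (k : κ) :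
    E.HasIntegral (fun t => g t j k) (∑ v ∈ g.range, v j k • E.proj (g ⁻¹' {v})) := by
  have h := HasIntegral.sum (E := E) g.range (φ := fun v t => v j k * (g ⁻¹' {v}).indicator 1 t)
    fun v _ => (hasIntegral_indicator (E := E) (g.measurableSet_preimage {v})).const_mul (v j k)
  refine h.congr fun x => Eventually.of_forall fun t => ?_
  rw [Finset.sum_eq_single (g t)]
  · simp
  · intro v _ hv
    rw [Set.indicator_of_notMem, mul_zero]
    simpa using hv.symm
  · intro h
    exact absurd (SimpleFunc.mem_range_self g t) h

/-- The level sets of `g` split `H` into orthogonal pieces, on each of which the matrix of operators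
is a constant scalar matrix. Cauchy–Schwarz over the pieces reassembles the bound. -/
theorem norm_form_simpleFunc_le {ι κ : Type*} [MeasurableSpace (ι → κ → ℂ)] {C : ℝ} (hC : 0 ≤ C)
    (g : SimpleFunc X (ι → κ → ℂ)) (hg : ∀ t, ScalarBound C (g t)) :
    FormBound C (fun j k => E.integral fun t => g t j k) := by
  intro J K p r
  simp only [(hasIntegral_simpleFunc_entry g _ _).integral_eq]
  have hm : ∀ v, MeasurableSet (g ⁻¹' {v}) := fun v => g.measurableSet_preimage {v}
  have hd : Pairwise (Function.onFun Disjoint fun v => g ⁻¹' {v}) := fun v w h =>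
    Disjoint.preimage g (by simpa using h)
  set P : (ι → κ → ℂ) → H →L[ℂ] H := fun v => E.proj (g ⁻¹' {v}) with hP
  have h1 : ∑ j ∈ J, ∑ k ∈ K, ⟪p j, (∑ v ∈ g.range, v j k • P v) (r k)⟫_ℂ =
      ∑ v ∈ g.range, ∑ j ∈ J, ∑ k ∈ K, ⟪P v (p j), (v j k • (1 : H →L[ℂ] H)) (P v (r k))⟫_ℂ := by
    have : ∀ j k, ⟪p j, (∑ v ∈ g.range, v j k • P v) (r k)⟫_ℂ =
        ∑ v ∈ g.range, ⟪P v (p j), (v j k • (1 : H →L[ℂ] H)) (P v (r k))⟫_ℂ := fun j k => by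
      rw [sum_apply, inner_sum]
      refine Finset.sum_congr rfl fun v _ => ?_
      rw [smul_apply, smul_apply, one_apply_eq_self, inner_smul_right, inner_smul_right,
        hP, E.inner_proj_left _ _ (hm v), E.proj_apply_proj_apply _ (hm v)]
    simp only [this]
    rw [Finset.sum_comm (s := g.range)]
    refine Finset.sum_congr rfl fun j _ => ?_
    rw [Finset.sum_comm (s := g.range)]
  rw [h1]
  have h2 : ∀ v ∈ g.range, ‖∑ j ∈ J, ∑ k ∈ K,
      ⟪P v (p j), (v j k • (1 : H →L[ℂ] H)) (P v (r k))⟫_ℂ‖ ≤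
      C * (√(∑ j ∈ J, ‖P v (p j)‖ ^ 2) * √(∑ k ∈ K, ‖P v (r k)‖ ^ 2)) := fun v hv => by
    obtain ⟨t, rfl⟩ := SimpleFunc.mem_range.1 hv
    rw [← mul_assoc]
    exact (hg t).formBound hC J K _ _
  refine (norm_sum_le _ _).trans ((Finset.sum_le_sum h2).trans ?_)
  rw [← Finset.mul_sum, mul_assoc]
  refine mul_le_mul_of_nonneg_left ?_ hC
  exact sum_norm_mul_norm_le _ (fun v => √(∑ j ∈ J, ‖P v (p j)‖ ^ 2))
    (fun v => √(∑ k ∈ K, ‖P v (r k)‖ ^ 2)) _ _ (sum_sq_sqrt_proj_le _ hm hd J p)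
    (sum_sq_sqrt_proj_le _ hm hd K r) (Real.sqrt_nonneg _) (Real.sqrt_nonneg _)

/-- Integration of an essentially bounded matrix function with respect to a spectral measure
yields a bounded matrix of operators. -/
theorem formBound_integral {ι κ : Type*} {β : ι → κ → X → ℂ} (hβ : ∀ j k, Measurable (β j k))
    {C : ℝ} (hC : 0 ≤ C) (h : E.AE fun t => ScalarBound C fun j k => β j k t) :
    FormBound C (fun j k => E.integral (β j k)) := by
  classical
  intro J K p r
  -- Only finitely many entries occur in the form, so the values may be taken in the
  -- finite-dimensional space `J → K → ℂ`, where measurable functions are limits of simple ones.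
  let F : X → J → K → ℂ := fun t j k => β j k t
  have hF : Measurable F := measurable_pi_lambda _ fun j => measurable_pi_lambda _ fun k => hβ j k
  set S : Set (J → K → ℂ) := {b | ScalarBound C b} with hS
  have hSm : MeasurableSet S := (isClosed_scalarBound C).measurableSet
  have h0 : (0 : J → K → ℂ) ∈ S := scalarBound_zero hC
  -- Truncation to the closed set of matrices of norm at most `C` alters `F` only on a null set and
  -- lets every simple approximant satisfy the bound everywhere.
  let G : X → J → K → ℂ := fun t => if F t ∈ S then F t else 0
  have hG : Measurable G := Measurable.ite (hF hSm) hF measurable_const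
  have hGS : ∀ t, G t ∈ S := fun t => by
    by_cases ht : F t ∈ S
    · simpa only [G, if_pos ht] using ht
    · simpa only [G, if_neg ht] using h0
  let g : ℕ → SimpleFunc X (J → K → ℂ) := SimpleFunc.approxOn G hG S 0 h0
  have hg : ∀ n t, ScalarBound C (g n t) := fun n t => SimpleFunc.approxOn_mem hG h0 n t
  have hlim : ∀ t, Tendsto (fun n => g n t) atTop (𝓝 (G t)) := fun t =>
    SimpleFunc.tendsto_approxOn hG h0 (subset_closure (hGS t))
  have hFS : E.AE fun t => G t = F t := fun x => by
    filter_upwards [h x] with t ht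
    have : F t ∈ S := fun J' K' p r => by
      have := ht (J'.map (Function.Embedding.subtype _)) (K'.map (Function.Embedding.subtype _))
        (fun j => if hj : j ∈ J then p ⟨j, hj⟩ else 0) (fun k => if hk : k ∈ K then r ⟨k, hk⟩ else 0)
      simpa using this
    simp only [G, if_pos this]
  have hb : ∀ j k, E.EssBdd C (β j k) := fun j k => ⟨hβ j k, fun x => by
    filter_upwards [h x] with t ht using ht.norm_le j k⟩
  have hconv : ∀ (j : J) (k : K), Tendsto (fun n => ⟪p j, E.integral (fun t => g n t j k) (r k)⟫_ℂ)
      atTop (𝓝 ⟪p j, E.integral (β j k) (r k)⟫_ℂ) := fun j k =>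
    tendsto_inner_integral (C := C) (fun n => ⟨by
      have := (g n).measurable
      exact (measurable_pi_apply k).comp ((measurable_pi_apply j).comp this),
      fun x => Eventually.of_forall fun t => (hg n t).norm_le j k⟩) (hb j k) (fun x => by
        filter_upwards [hFS x] with t ht
        have h1 := tendsto_pi_nhds.1 (tendsto_pi_nhds.1 (hlim t) j) k
        rw [ht] at h1
        exact h1) _ _
  have hle : ∀ n, ‖∑ j : J, ∑ k : K, ⟪p j, E.integral (fun t => g n t j k) (r k)⟫_ℂ‖ ≤
      C * √(∑ j : J, ‖p j‖ ^ 2) * √(∑ k : K, ‖r k‖ ^ 2) := fun n =>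
    norm_form_simpleFunc_le hC (g n) (hg n) Finset.univ Finset.univ (fun j : J => p j)
      (fun k : K => r k)
  have hfin := le_of_tendsto (tendsto_finsetSum Finset.univ fun j _ =>
    tendsto_finsetSum Finset.univ fun k _ => hconv j k).norm (Eventually.of_forall hle)
  rw [Finset.sum_coe_sort J (fun j => ‖p j‖ ^ 2), Finset.sum_coe_sort K (fun k => ‖r k‖ ^ 2)] at hfin
  refine le_trans (le_of_eq ?_) hfin
  rw [← Finset.sum_coe_sort J]
  congr 1
  refine Finset.sum_congr rfl fun j _ => ?_
  rw [← Finset.sum_coe_sort K]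

end SpectralMeasure

end MatrixIntegrals

/-! ### Integrals against products of three complex measures -/

section TripleForm

variable {X₁ X₂ X₃ : Type*} [MeasurableSpace X₁] [MeasurableSpace X₂] [MeasurableSpace X₃]
  {H : Type u} [NormedAddCommGroup H] [InnerProductSpace ℂ H] [CompleteSpace H]
  {E₁ : SpectralMeasure X₁ H} {E₂ : SpectralMeasure X₂ H} {E₃ : SpectralMeasure X₃ H}

/-- A property holds almost everywhere with respect to the three spectral measures. -/
def AE₃ (E₁ : SpectralMeasure X₁ H) (E₂ : SpectralMeasure X₂ H) (E₃ : SpectralMeasure X₃ H)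
    (P : X₁ → X₂ → X₃ → Prop) : Prop :=
  ∀ u v w : H, ∀ᵐ q ∂((E₁.measure u).prod ((E₂.measure v).prod (E₃.measure w))),
    P q.1 q.2.1 q.2.2

theorem AE₃.of_left {P : X₁ → Prop} (h : E₁.AE P) : AE₃ E₁ E₂ E₃ fun x _ _ => P x := fun u _ _ =>
  Measure.quasiMeasurePreserving_fst.ae (h u)

theorem AE₃.of_middle {P : X₂ → Prop} (h : E₂.AE P) : AE₃ E₁ E₂ E₃ fun _ y _ => P y :=
  fun _ v _ => (Measure.quasiMeasurePreserving_fst.comp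
    Measure.quasiMeasurePreserving_snd).ae (h v)

theorem AE₃.of_right {P : X₃ → Prop} (h : E₃.AE P) : AE₃ E₁ E₂ E₃ fun _ _ z => P z :=
  fun _ _ w => (Measure.quasiMeasurePreserving_snd.comp
    Measure.quasiMeasurePreserving_snd).ae (h w)

/-- The integral of `Ψ` with respect to the product of the complex measures
`⟪y_i, E_i(·) x_i⟫`. -/
noncomputable def triForm (E₁ : SpectralMeasure X₁ H) (E₂ : SpectralMeasure X₂ H)
    (E₃ : SpectralMeasure X₃ H) (x₁ y₁ x₂ y₂ x₃ y₃ : H) (Ψ : X₁ → X₂ → X₃ → ℂ) : ℂ :=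
  ∑ i, ∑ j, ∑ k, polCoef i * polCoef j * polCoef k *
    ∫ q, Ψ q.1 q.2.1 q.2.2 ∂((E₁.measure (polVec x₁ y₁ i)).prod
      ((E₂.measure (polVec x₂ y₂ j)).prod (E₃.measure (polVec x₃ y₃ k))))

theorem integrable_mul₃ {a : X₁ → ℂ} {b : X₂ → ℂ} {c : X₃ → ℂ} {A B C : ℝ}
    (ha : E₁.EssBdd A a) (hb : E₂.EssBdd B b) (hc : E₃.EssBdd C c) (u v w : H) :
    Integrable (fun q : X₁ × X₂ × X₃ => a q.1 * b q.2.1 * c q.2.2)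
      ((E₁.measure u).prod ((E₂.measure v).prod (E₃.measure w))) := by
  have := (ha.hasIntegral u).1.mul_prod ((hb.hasIntegral v).1.mul_prod (hc.hasIntegral w).1)
  simpa only [mul_assoc] using this

theorem triForm_sum {ι : Type*} (s : Finset ι) {a : ι → X₁ → ℂ} {b : ι → X₂ → ℂ}
    {c : ι → X₃ → ℂ} (ha : ∀ i, ∃ A, E₁.EssBdd A (a i)) (hb : ∀ i, ∃ B, E₂.EssBdd B (b i))
    (hc : ∀ i, ∃ C, E₃.EssBdd C (c i)) (x₁ y₁ x₂ y₂ x₃ y₃ : H) :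
    triForm E₁ E₂ E₃ x₁ y₁ x₂ y₂ x₃ y₃ (fun x y z => ∑ i ∈ s, a i x * b i y * c i z) =
      ∑ i ∈ s, ⟪y₁, E₁.integral (a i) x₁⟫_ℂ * ⟪y₂, E₂.integral (b i) x₂⟫_ℂ *
        ⟪y₃, E₃.integral (c i) x₃⟫_ℂ := by
  choose A hA using ha
  choose B hB using hb
  choose C hC using hc
  simp only [triForm]
  have h1 : ∀ u v w : H, ∫ q : X₁ × X₂ × X₃, ∑ i ∈ s, a i q.1 * b i q.2.1 * c i q.2.2
      ∂((E₁.measure u).prod ((E₂.measure v).prod (E₃.measure w))) =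
      ∑ i ∈ s, (∫ x, a i x ∂(E₁.measure u)) * (∫ x, b i x ∂(E₂.measure v)) *
        (∫ x, c i x ∂(E₃.measure w)) := fun u v w => by
    rw [integral_finsetSum _ fun i _ => integrable_mul₃ (hA i) (hB i) (hC i) u v w]
    refine Finset.sum_congr rfl fun i _ => ?_
    rw [mul_assoc, ← integral_prod_mul, ← integral_prod_mul]
    simp only [mul_assoc]
  simp only [h1, (hA _).inner_eq, (hB _).inner_eq, (hC _).inner_eq]
  have h2 : ∀ f g h : Fin 4 → ℂ, (∑ i, f i) * (∑ j, g j) * ∑ k, h k =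
      ∑ i, ∑ j, ∑ k, f i * g j * h k := fun f g h => by
    rw [Finset.sum_mul_sum, Finset.sum_mul]
    exact Finset.sum_congr rfl fun i _ => Finset.sum_mul_sum ..
  simp only [h2]
  rw [Finset.sum_comm (s := s)]
  refine Finset.sum_congr rfl fun i _ => ?_
  rw [Finset.sum_comm (s := s)]
  refine Finset.sum_congr rfl fun j _ => ?_
  rw [Finset.sum_comm (s := s)]
  refine Finset.sum_congr rfl fun k _ => ?_
  rw [Finset.mul_sum]
  exact Finset.sum_congr rfl fun n _ => by ring

theorem tendsto_triForm {ι : Type*} {l : Filter ι} [l.IsCountablyGenerated]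
    {Φ : ι → X₁ → X₂ → X₃ → ℂ} {Ψ : X₁ → X₂ → X₃ → ℂ}
    (hm : ∀ i, Measurable fun q : X₁ × X₂ × X₃ => Φ i q.1 q.2.1 q.2.2) {C : ℝ}
    (hC : ∀ i, AE₃ E₁ E₂ E₃ fun x y z => ‖Φ i x y z‖ ≤ C)
    (hl : AE₃ E₁ E₂ E₃ fun x y z => Tendsto (fun i => Φ i x y z) l (𝓝 (Ψ x y z)))
    (x₁ y₁ x₂ y₂ x₃ y₃ : H) :
    Tendsto (fun i => triForm E₁ E₂ E₃ x₁ y₁ x₂ y₂ x₃ y₃ (Φ i)) l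
      (𝓝 (triForm E₁ E₂ E₃ x₁ y₁ x₂ y₂ x₃ y₃ Ψ)) := by
  refine tendsto_finsetSum _ fun i _ => tendsto_finsetSum _ fun j _ =>
    tendsto_finsetSum _ fun k _ => Tendsto.const_mul _ ?_
  exact tendsto_integral_filter_of_dominated_convergence (fun _ => C)
    (Eventually.of_forall fun n => (hm n).aestronglyMeasurable)
    (Eventually.of_forall fun n => hC n _ _ _) (integrable_const _) (hl _ _ _)

end TripleForm

/-! ### Expansion of forms on `ℓ²(H)` in an orthonormal basis -/

section FormExpansion

variable {H : Type u} [NormedAddCommGroup H] [InnerProductSpace ℂ H] [CompleteSpace H]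
variable {ι κ ι' κ' w : Type*}

/-- The form on `ℓ²(H)` defined by a matrix of operators. -/
noncomputable def formVal (B : ι → κ → H →L[ℂ] H) (p : ι → H) (r : κ → H) : ℂ :=
  ∑' j, ⟪p j, rowSum B r j⟫_ℂ

theorem sum_sq_basis_sub_le (e : HilbertBasis w ℂ H) (x : H) (F : Finset w) :
    ‖x - ∑ i ∈ F, ⟪e i, x⟫_ℂ • e i‖ ≤ ‖x‖ := by
  have h1 : ⟪∑ i ∈ F, ⟪e i, x⟫_ℂ • e i, x - ∑ i ∈ F, ⟪e i, x⟫_ℂ • e i⟫_ℂ = 0 := by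
    rw [sum_inner]
    refine Finset.sum_eq_zero fun i hi => ?_
    rw [inner_smul_left, inner_sub_right, e.orthonormal.inner_right_sum _ hi, sub_self, mul_zero]
  have h2 := norm_add_sq_eq_norm_sq_add_norm_sq_of_inner_eq_zero _ _ h1
  rw [add_sub_cancel] at h2
  nlinarith [norm_nonneg x, norm_nonneg (x - ∑ i ∈ F, ⟪e i, x⟫_ℂ • e i),
    mul_self_nonneg ‖∑ i ∈ F, ⟪e i, x⟫_ℂ • e i‖]

theorem tendsto_tsum_sq_basis (e : HilbertBasis w ℂ H) {r : κ → H}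
    (hr : Summable fun k => ‖r k‖ ^ 2) :
    Tendsto (fun F : Finset w => ∑' k, ‖r k - ∑ i ∈ F, ⟪e i, r k⟫_ℂ • e i‖ ^ 2) atTop (𝓝 0) := by
  have h0 : (0 : ℝ) = ∑' _ : κ, (0 : ℝ) := by simp
  rw [h0]
  refine tendsto_tsum_of_dominated_convergence hr (fun k => ?_)
    (Eventually.of_forall fun F k => ?_)
  · have h1 : Tendsto (fun F : Finset w => ∑ i ∈ F, ⟪e i, r k⟫_ℂ • e i) atTop (𝓝 (r k)) := by
      have := e.hasSum_repr (r k)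
      simp only [e.repr_apply_apply] at this
      exact this
    have h2 := ((tendsto_const_nhds (x := r k)).sub h1).norm.pow 2
    simpa using h2
  · rw [Real.norm_of_nonneg (sq_nonneg _)]
    gcongr
    exact sum_sq_basis_sub_le e _ F

namespace FormBound

variable {C : ℝ} {B : ι → κ → H →L[ℂ] H}

theorem norm_formVal_le (hB : FormBound C B) {p : ι → H} {r : κ → H}
    (hp : Summable fun j => ‖p j‖ ^ 2) (hr : Summable fun k => ‖r k‖ ^ 2) :
    ‖formVal B p r‖ ≤ √(∑' j, ‖p j‖ ^ 2) * √(C ^ 2 * ∑' k, ‖r k‖ ^ 2) := by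
  have ht : Tendsto _ atTop _ := (hB.summable_inner_rowSum hp hr).hasSum.norm
  refine le_of_tendsto ht (Eventually.of_forall fun J => (norm_sum_inner_le _ _ _).trans ?_)
  gcongr
  · exact hp.sum_le_tsum _ fun _ _ => sq_nonneg _
  · exact hB.sum_sq_rowSum_le hr J

theorem formVal_sub (hB : FormBound C B) {p : ι → H} {r r' : κ → H}
    (hp : Summable fun j => ‖p j‖ ^ 2) (hr : Summable fun k => ‖r k‖ ^ 2)
    (hr' : Summable fun k => ‖r' k‖ ^ 2) :
    formVal B p (fun k => r k - r' k) = formVal B p r - formVal B p r' := by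
  rw [formVal, formVal, formVal, ← (hB.summable_inner_rowSum hp hr).tsum_sub
    (hB.summable_inner_rowSum hp hr')]
  refine tsum_congr fun j => ?_
  rw [← inner_sub_right, rowSum, rowSum, rowSum, ← (hB.summable_row hr j).tsum_sub
    (hB.summable_row hr' j)]
  simp only [map_sub]

theorem formVal_sum (hB : FormBound C B) (F : Finset w) {p : ι → H} {r : w → κ → H}
    (hp : Summable fun j => ‖p j‖ ^ 2) (hr : ∀ i, Summable fun k => ‖r i k‖ ^ 2) :
    formVal B p (fun k => ∑ i ∈ F, r i k) = ∑ i ∈ F, formVal B p (r i) := by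
  simp only [formVal]
  rw [← Summable.tsum_finsetSum fun i _ => hB.summable_inner_rowSum hp (hr i)]
  refine tsum_congr fun j => ?_
  rw [← inner_sum]
  simp only [rowSum]
  rw [← Summable.tsum_finsetSum fun i _ => hB.summable_row (hr i) j]
  simp only [map_sum]

theorem formVal_adjoint (hB : FormBound C B) {p : ι → H} {r : κ → H}
    (hp : Summable fun j => ‖p j‖ ^ 2) (hr : Summable fun k => ‖r k‖ ^ 2) :
    formVal (fun k j => ContinuousLinearMap.adjoint (B j k)) r p =
      starRingEnd ℂ (formVal B p r) := by
  rw [formVal, formVal, ← hB.tsum_inner_rowSum_adjoint hp hr, Complex.conj_tsum]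
  simp only [inner_conj_symm]

theorem summable_sq_component (e : HilbertBasis w ℂ H) {r : κ → H}
    (hr : Summable fun k => ‖r k‖ ^ 2) (i : w) :
    Summable fun k => ‖⟪e i, r k⟫_ℂ • e i‖ ^ 2 := by
  refine hr.of_nonneg_of_le (fun _ => sq_nonneg _) fun k => ?_
  rw [norm_smul, e.orthonormal.norm_eq_one, mul_one]
  gcongr
  refine (norm_inner_le_norm _ _).trans ?_
  rw [e.orthonormal.norm_eq_one, one_mul]

/-- Finite basis projections applied entrywise to `r` converge to `r` in `ℓ²(H)` by dominated
convergence, and the form is bounded. -/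
theorem hasSum_right (hB : FormBound C B) (e : HilbertBasis w ℂ H) {p : ι → H} {r : κ → H}
    (hp : Summable fun j => ‖p j‖ ^ 2) (hr : Summable fun k => ‖r k‖ ^ 2) :
    HasSum (fun i => formVal B p (fun k => ⟪e i, r k⟫_ℂ • e i)) (formVal B p r) := by
  have hc := fun i => summable_sq_component e hr i
  have hF : ∀ F : Finset w, Summable fun k => ‖r k - ∑ i ∈ F, ⟪e i, r k⟫_ℂ • e i‖ ^ 2 := fun F =>
    hr.of_nonneg_of_le (fun _ => sq_nonneg _) fun k => by
      gcongr; exact sum_sq_basis_sub_le e _ F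
  have h1 : Tendsto (fun F : Finset w => formVal B p r -
      ∑ i ∈ F, formVal B p (fun k => ⟪e i, r k⟫_ℂ • e i)) atTop (𝓝 0) := by
    have h2 := (((tendsto_tsum_sq_basis e hr).const_mul (C ^ 2)).sqrt).const_mul
      (√(∑' j, ‖p j‖ ^ 2))
    simp only [mul_zero, Real.sqrt_zero] at h2
    refine squeeze_zero_norm (fun F => ?_) h2
    have h3 := hB.norm_formVal_le hp (hF F)
    have hS : Summable fun k => ‖∑ i ∈ F, ⟪e i, r k⟫_ℂ • e i‖ ^ 2 := by
      refine ((hr.add (hF F)).mul_left 2).of_nonneg_of_le (fun _ => sq_nonneg _) fun k => ?_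
      have h4 : ‖∑ i ∈ F, ⟪e i, r k⟫_ℂ • e i‖ ≤
          ‖r k‖ + ‖r k - ∑ i ∈ F, ⟪e i, r k⟫_ℂ • e i‖ := by
        refine le_trans (le_of_eq ?_) (norm_sub_le (r k) (r k - ∑ i ∈ F, ⟪e i, r k⟫_ℂ • e i))
        rw [sub_sub_cancel]
      nlinarith [norm_nonneg (∑ i ∈ F, ⟪e i, r k⟫_ℂ • e i), norm_nonneg (r k),
        sq_nonneg (‖r k‖ - ‖r k - ∑ i ∈ F, ⟪e i, r k⟫_ℂ • e i‖)]
    rwa [hB.formVal_sub hp hr hS, hB.formVal_sum F hp hc] at h3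
  have h5 := (tendsto_const_nhds (x := formVal B p r)).sub h1
  have h6 : Tendsto (fun F : Finset w => ∑ i ∈ F, formVal B p (fun k => ⟪e i, r k⟫_ℂ • e i)) atTop
      (𝓝 (formVal B p r)) := by simpa using h5
  exact h6

theorem hasSum_left (hB : FormBound C B) (e : HilbertBasis w ℂ H) {p : ι → H} {r : κ → H}
    (hp : Summable fun j => ‖p j‖ ^ 2) (hr : Summable fun k => ‖r k‖ ^ 2) :
    HasSum (fun i => formVal B (fun j => ⟪e i, p j⟫_ℂ • e i) r) (formVal B p r) := by
  have h := hB.adjoint.hasSum_right e hr hp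
  rw [hB.formVal_adjoint hp hr] at h
  have h1 := Complex.hasSum_conj'.2 h
  rw [Complex.conj_conj] at h1
  refine h1.of_eq fun i => ?_
  rw [hB.formVal_adjoint (summable_sq_component e hp i) hr, Complex.conj_conj]

/-- A form is determined by its values on vectors with values in lines spanned by basis vectors. -/
theorem formVal_eq (hB : FormBound C B) {C' : ℝ} {B' : ι' → κ' → H →L[ℂ] H}
    (hB' : FormBound C' B') (e : HilbertBasis w ℂ H) {p : ι → H} {r : κ → H} {p' : ι' → H}
    {r' : κ' → H} (hp : Summable fun j => ‖p j‖ ^ 2) (hr : Summable fun k => ‖r k‖ ^ 2)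
    (hp' : Summable fun j => ‖p' j‖ ^ 2) (hr' : Summable fun k => ‖r' k‖ ^ 2)
    (h : ∀ a b, formVal B (fun j => ⟪e a, p j⟫_ℂ • e a) (fun k => ⟪e b, r k⟫_ℂ • e b) =
      formVal B' (fun j => ⟪e a, p' j⟫_ℂ • e a) (fun k => ⟪e b, r' k⟫_ℂ • e b)) :
    formVal B p r = formVal B' p' r' := by
  refine (hB.hasSum_left e hp hr).unique ((hB'.hasSum_left e hp' hr').of_eq fun a => ?_)
  have h1 := hB.hasSum_right e (summable_sq_component e hp a) hr
  have h2 := hB'.hasSum_right e (summable_sq_component e hp' a) hr'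
  exact h1.unique (h2.of_eq fun b => h a b)

end FormBound

end FormExpansion

/-! ### Triple operator integrals for the Haagerup tensor product -/

section HaagerupIntegral

variable {X X₁ X₂ X₃ : Type*} [MeasurableSpace X] [MeasurableSpace X₁] [MeasurableSpace X₂]
  [MeasurableSpace X₃] {H : Type u} [NormedAddCommGroup H] [InnerProductSpace ℂ H] [CompleteSpace H]
  {E : SpectralMeasure X H}
  {E₁ : SpectralMeasure X₁ H} {E₂ : SpectralMeasure X₂ H} {E₃ : SpectralMeasure X₃ H}

theorem MemLinftyL2.exists_bound {α : ℕ → X → ℂ} (h : MemLinftyL2 E α) :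
    ∃ C : ℝ, 0 ≤ C ∧ (∀ j, E.EssBdd (√C) (α j)) ∧
      E.AE fun t => ∀ F : Finset ℕ, ∑ j ∈ F, ‖α j t‖ ^ 2 ≤ C := by
  obtain ⟨hm, C, hC⟩ := h
  have h1 : E.AE fun t => ∀ F : Finset ℕ, ∑ j ∈ F, ‖α j t‖ ^ 2 ≤ max C 0 := fun x => by
    filter_upwards [hC x] with t ht F
    exact (ht.1.sum_le_tsum F fun _ _ => sq_nonneg _).trans (ht.2.trans (le_max_left _ _))
  refine ⟨max C 0, le_max_right _ _, fun j => ⟨hm j, fun x => ?_⟩, h1⟩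
  filter_upwards [h1 x] with t ht
  have := ht {j}
  rw [Finset.sum_singleton] at this
  exact Real.le_sqrt_of_sq_le this

theorem MemLinftyMatrix.exists_bound {β : ℕ → ℕ → X → ℂ} (h : MemLinftyMatrix E β) :
    ∃ C : ℝ, 0 ≤ C ∧ E.AE fun t => ScalarBound C fun j k => β j k t := by
  obtain ⟨hm, C, hC⟩ := h
  refine ⟨max C 0, le_max_right _ _, fun x => ?_⟩
  filter_upwards [hC x] with t ht
  exact ht.scalarBound.mono (le_max_left _ _)

theorem SpectralMeasure.sum_sq_adjoint_integral_le {ι : Type*} {φ : ι → X → ℂ} {C : ℝ}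
    (hφ : ∀ i, ∃ C, E.EssBdd C (φ i)) (F : Finset ι)
    (hC : E.AE fun t => ∑ i ∈ F, ‖φ i t‖ ^ 2 ≤ C) (x : H) :
    ∑ i ∈ F, ‖ContinuousLinearMap.adjoint (E.integral (φ i)) x‖ ^ 2 ≤ C * ‖x‖ ^ 2 := by
  refine le_trans (le_of_eq (Finset.sum_congr rfl fun i _ => ?_))
    (SpectralMeasure.sum_sq_integral_le hφ F hC x)
  obtain ⟨D, hD⟩ := hφ i
  rw [hD.norm_adjoint_apply]

theorem summable_sq_clm {ι : Type*} {p : ι → H} {C : ℝ} (hp : ∀ F : Finset ι, ∑ i ∈ F, ‖p i‖ ^ 2 ≤ C)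
    (T : H →L[ℂ] H) :
    (Summable fun i => ‖T (p i)‖ ^ 2) ∧ ∀ F : Finset ι, ∑ i ∈ F, ‖T (p i)‖ ^ 2 ≤ ‖T‖ ^ 2 * C := by
  have : ∀ F : Finset ι, ∑ i ∈ F, ‖T (p i)‖ ^ 2 ≤ ‖T‖ ^ 2 * C := fun F => by
    refine le_trans (Finset.sum_le_sum fun j _ => ?_) ((Finset.mul_sum F _ (‖T‖ ^ 2)).symm.le.trans
      (mul_le_mul_of_nonneg_left (hp F) (sq_nonneg _)))
    rw [← mul_pow]
    gcongr
    exact T.le_opNorm _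
  exact ⟨summable_of_sum_le (fun _ => sq_nonneg _) this, this⟩

theorem tendsto_range_prod_range :
    Tendsto (fun N : ℕ × ℕ => (Finset.range N.1, Finset.range N.2)) atTop atTop := by
  rw [← prod_atTop_atTop_eq, ← prod_atTop_atTop_eq]
  exact tendsto_finset_range.prodMap tendsto_finset_range

namespace IsHaagerupRep

variable {Ψ : X₁ → X₂ → X₃ → ℂ} {α : ℕ → X₁ → ℂ} {β : ℕ → ℕ → X₂ → ℂ} {γ : ℕ → X₃ → ℂ}

/-- The scalar partial sums are dominated by a constant, since the three factors are bounded almost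
everywhere, so they may be integrated term by term. The limit involves only `Ψ`; this is the source
of the independence of the representation. -/
theorem triForm_eq (h : IsHaagerupRep E₁ E₂ E₃ Ψ α β γ) (x₁ y₁ x₂ y₂ x₃ y₃ : H) :
    Tendsto (fun N : ℕ × ℕ => ∑ j ∈ Finset.range N.1, ∑ k ∈ Finset.range N.2,
      ⟪y₁, E₁.integral (α j) x₁⟫_ℂ * ⟪y₂, E₂.integral (β j k) x₂⟫_ℂ *
        ⟪y₃, E₃.integral (γ k) x₃⟫_ℂ) atTop
      (𝓝 (triForm E₁ E₂ E₃ x₁ y₁ x₂ y₂ x₃ y₃ Ψ)) := by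
  obtain ⟨hα, hβ, hγ, hsum⟩ := h
  obtain ⟨A, hA0, hAb, hA⟩ := hα.exists_bound
  obtain ⟨B, hB0, hB⟩ := hβ.exists_bound
  obtain ⟨C, hC0, hCb, hC⟩ := hγ.exists_bound
  have hBb : ∀ j k, E₂.EssBdd B (β j k) := fun j k => ⟨hβ.1 j k, fun x => by
    filter_upwards [hB x] with t ht using ht.norm_le j k⟩
  have h1 := tendsto_triForm (E₁ := E₁) (E₂ := E₂) (E₃ := E₃) (l := atTop)
    (Φ := fun (N : ℕ × ℕ) x y z => ∑ j ∈ Finset.range N.1, ∑ k ∈ Finset.range N.2,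
      α j x * β j k y * γ k z) (Ψ := Ψ) (fun N => by
      refine Finset.measurable_fun_sum _ fun j _ => Finset.measurable_fun_sum _ fun k _ => ?_
      exact (((hAb j).1.comp measurable_fst).mul ((hBb j k).1.comp
        (measurable_fst.comp measurable_snd))).mul ((hCb k).1.comp
        (measurable_snd.comp measurable_snd))) (C := B * √A * √C) (fun N u v w => by
      filter_upwards [AE₃.of_left (E₂ := E₂) (E₃ := E₃) hA u v w,
        AE₃.of_middle (E₁ := E₁) (E₃ := E₃) hB u v w,
        AE₃.of_right (E₁ := E₁) (E₂ := E₂) hC u v w] with q h1 h2 h3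
      refine (h2 _ _ _ _).trans ?_
      gcongr
      · exact h1 _
      · exact h3 _) hsum x₁ y₁ x₂ y₂ x₃ y₃
  refine h1.congr fun N => ?_
  have h2 := triForm_sum (E₁ := E₁) (E₂ := E₂) (E₃ := E₃) (Finset.range N.1 ×ˢ Finset.range N.2)
    (a := fun i => α i.1) (b := fun i => β i.1 i.2) (c := fun i => γ i.2) (fun i => ⟨_, hAb _⟩)
    (fun i => ⟨_, hBb _ _⟩) (fun i => ⟨_, hCb _⟩) x₁ y₁ x₂ y₂ x₃ y₃
  simp only [Finset.sum_product] at h2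
  exact h2

theorem exists_form (h : IsHaagerupRep E₁ E₂ E₃ Ψ α β γ) (T R : H →L[ℂ] H) :
    ∃ D C : ℝ, 0 ≤ D ∧ 0 ≤ C ∧ FormBound C (fun j k => E₂.integral (β j k)) ∧
      (∀ y (F : Finset ℕ), ∑ j ∈ F, ‖ContinuousLinearMap.adjoint T
        (ContinuousLinearMap.adjoint (E₁.integral (α j)) y)‖ ^ 2 ≤ D * ‖y‖ ^ 2) ∧
      ∀ x (F : Finset ℕ), ∑ k ∈ F, ‖R (E₃.integral (γ k) x)‖ ^ 2 ≤ D * ‖x‖ ^ 2 := by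
  obtain ⟨hα, hβ, hγ, -⟩ := h
  obtain ⟨A, hA0, hAb, hA⟩ := hα.exists_bound
  obtain ⟨B, hB0, hB⟩ := hβ.exists_bound
  obtain ⟨C, hC0, hCb, hC⟩ := hγ.exists_bound
  refine ⟨‖ContinuousLinearMap.adjoint T‖ ^ 2 * A + ‖R‖ ^ 2 * C, B, by positivity, hB0,
    SpectralMeasure.formBound_integral hβ.1 hB0 hB, fun y F => ?_, fun x F => ?_⟩
  · refine ((summable_sq_clm (fun F => SpectralMeasure.sum_sq_adjoint_integral_le
      (fun i => ⟨_, hAb i⟩) F (fun x => (hA x).mono fun t ht => ht F) y) _).2 F).trans ?_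
    rw [← mul_assoc]
    gcongr
    have : 0 ≤ ‖R‖ ^ 2 * C := by positivity
    linarith
  · refine ((summable_sq_clm (fun F => SpectralMeasure.sum_sq_integral_le
      (fun i => ⟨_, hCb i⟩) F (fun x => (hC x).mono fun t ht => ht F) x) _).2 F).trans ?_
    rw [← mul_assoc]
    gcongr
    have : 0 ≤ ‖ContinuousLinearMap.adjoint T‖ ^ 2 * A := by positivity
    linarith

theorem inner_sum_eq (α : ℕ → X₁ → ℂ) (β : ℕ → ℕ → X₂ → ℂ) (γ : ℕ → X₃ → ℂ)
    (T R : H →L[ℂ] H) (x y : H) (N : ℕ × ℕ) :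
    ⟪y, (∑ j ∈ Finset.range N.1, ∑ k ∈ Finset.range N.2,
        E₁.integral (α j) * T * E₂.integral (β j k) * R * E₃.integral (γ k)) x⟫_ℂ =
      ∑ j ∈ Finset.range N.1, ∑ k ∈ Finset.range N.2, ⟪ContinuousLinearMap.adjoint T
        (ContinuousLinearMap.adjoint (E₁.integral (α j)) y),
          E₂.integral (β j k) (R (E₃.integral (γ k) x))⟫_ℂ := by
  rw [sum_apply, inner_sum]
  refine Finset.sum_congr rfl fun j _ => ?_
  rw [sum_apply, inner_sum]
  refine Finset.sum_congr rfl fun k _ => ?_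
  rw [ContinuousLinearMap.adjoint_inner_left, ContinuousLinearMap.adjoint_inner_left]
  rfl

/-- The triple operator integral of an element of the Haagerup tensor product exists. -/
theorem exists_isHaagerupTOI (h : IsHaagerupRep E₁ E₂ E₃ Ψ α β γ) (T R : H →L[ℂ] H) :
    ∃ W, IsHaagerupTOI E₁ E₂ E₃ Ψ T R W ∧ ∀ x y, ⟪y, W x⟫_ℂ =
      formVal (fun j k => E₂.integral (β j k)) (fun j => ContinuousLinearMap.adjoint T
        (ContinuousLinearMap.adjoint (E₁.integral (α j)) y))
        (fun k => R (E₃.integral (γ k) x)) := by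
  have tends : ∀ {α β γ}, IsHaagerupRep E₁ E₂ E₃ Ψ α β γ → ∀ x y,
      Tendsto (fun N : ℕ × ℕ => ⟪y, (∑ j ∈ Finset.range N.1, ∑ k ∈ Finset.range N.2,
        E₁.integral (α j) * T * E₂.integral (β j k) * R * E₃.integral (γ k)) x⟫_ℂ) atTop
        (𝓝 (formVal (fun j k => E₂.integral (β j k)) (fun j => ContinuousLinearMap.adjoint T
        (ContinuousLinearMap.adjoint (E₁.integral (α j)) y))
        (fun k => R (E₃.integral (γ k) x)))) := fun {α β γ} h x y => by
    obtain ⟨D, C, hD0, hC0, hB, hp, hr⟩ := h.exists_form T R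
    simp only [inner_sum_eq]
    exact (hB.tendsto_form (summable_of_sum_le (fun _ => sq_nonneg _) (hp y))
      (summable_of_sum_le (fun _ => sq_nonneg _) (hr x))).comp tendsto_range_prod_range
  -- On vectors in the lines of `e` and `f` the form factorises into scalar matrix coefficients of
  -- the three spectral measures, whose sum is the integral of `Ψ`.
  have rank : ∀ {α β γ}, IsHaagerupRep E₁ E₂ E₃ Ψ α β γ → ∀ x y e f : H,
      (formVal (fun j k => E₂.integral (β j k)) (fun j => ⟪e, ContinuousLinearMap.adjoint T
        (ContinuousLinearMap.adjoint (E₁.integral (α j)) y)⟫_ℂ • e)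
        (fun k => ⟪f, R (E₃.integral (γ k) x)⟫_ℂ • f)) =
      triForm E₁ E₂ E₃ (T e) y f e x (ContinuousLinearMap.adjoint R f) Ψ :=
    fun {α β γ} h x y e f => by
    obtain ⟨D, C, hD0, hC0, hB, hp, hr⟩ := h.exists_form T R
    have hs : ∀ (q : ℕ → H) (z : H), (Summable fun j => ‖q j‖ ^ 2) →
        Summable fun j => ‖⟪z, q j⟫_ℂ • z‖ ^ 2 := fun q z hq => by
      refine (hq.mul_right (‖z‖ ^ 2 * ‖z‖ ^ 2)).of_nonneg_of_le (fun _ => sq_nonneg _) fun j => ?_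
      rw [norm_smul, mul_pow]
      have : ‖⟪z, q j⟫_ℂ‖ ^ 2 ≤ ‖z‖ ^ 2 * ‖q j‖ ^ 2 := by
        rw [← mul_pow]; gcongr; exact norm_inner_le_norm _ _
      nlinarith [sq_nonneg ‖z‖]
    refine tendsto_nhds_unique ((hB.tendsto_form
      (hs _ e (summable_of_sum_le (fun _ => sq_nonneg _) (hp y)))
      (hs _ f (summable_of_sum_le (fun _ => sq_nonneg _) (hr x)))).comp tendsto_range_prod_range)
      ((h.triForm_eq (T e) y f e x (ContinuousLinearMap.adjoint R f)).congr fun N => ?_)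
    refine Finset.sum_congr rfl fun j _ => Finset.sum_congr rfl fun k _ => ?_
    rw [inner_smul_left, inner_conj_symm, map_smul, inner_smul_right,
      ContinuousLinearMap.adjoint_inner_left, ContinuousLinearMap.adjoint_inner_left,
      ContinuousLinearMap.adjoint_inner_left]
    ring
  obtain ⟨D, C, hD0, hC0, hB, hp, hr⟩ := h.exists_form T R
  obtain ⟨W, hW⟩ := exists_weak_limit (l := (atTop : Filter (ℕ × ℕ)))
    (fun N => ∑ j ∈ Finset.range N.1, ∑ k ∈ Finset.range N.2,
        E₁.integral (α j) * T * E₂.integral (β j k) * R * E₃.integral (γ k)) (C * √D * √D)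
    (fun N x y => by
      rw [inner_sum_eq]
      refine (hB _ _ _ _).trans ?_
      calc _ ≤ C * √(D * ‖y‖ ^ 2) * √(D * ‖x‖ ^ 2) := by
            gcongr
            · exact hp y _
            · exact hr x _
        _ = _ := by
            rw [Real.sqrt_mul hD0, Real.sqrt_mul hD0, Real.sqrt_sq (norm_nonneg _),
              Real.sqrt_sq (norm_nonneg _)]
            ring)
    (fun x y => ⟨_, tends h x y⟩)
  have hWe := fun x y => tendsto_nhds_unique (hW x y) (tends h x y)
  refine ⟨W, ⟨⟨α, β, γ, h⟩, fun α' β' γ' h' x y => ?_⟩, hWe⟩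
  obtain ⟨D', C', hD0', hC0', hB', hp', hr'⟩ := h'.exists_form T R
  obtain ⟨w, e, -⟩ := exists_hilbertBasis ℂ H
  -- Two representations give the same value on every pair of basis lines, hence the same form.
  rw [hWe, hB.formVal_eq hB' e (summable_of_sum_le (fun _ => sq_nonneg _) (hp y))
      (summable_of_sum_le (fun _ => sq_nonneg _) (hr x))
      (summable_of_sum_le (fun _ => sq_nonneg _) (hp' y))
      (summable_of_sum_le (fun _ => sq_nonneg _) (hr' x))
      fun a b => (rank h x y _ _).trans (rank h' x y _ _).symm]
  exact tends h' x y

theorem _root_.OpInt.IsHaagerupTOI.unique {T R W W' : H →L[ℂ] H}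
    (h : IsHaagerupTOI E₁ E₂ E₃ Ψ T R W) (h' : IsHaagerupTOI E₁ E₂ E₃ Ψ T R W') : W = W' := by
  obtain ⟨α, β, γ, hrep⟩ := h.1
  exact eq_of_forall_inner fun x y =>
    tendsto_nhds_unique (h.2 α β γ hrep x y) (h'.2 α β γ hrep x y)

end IsHaagerupRep

end HaagerupIntegral

/-! ### Testing on operators of rank one -/

section RankOne

variable {H : Type u} [NormedAddCommGroup H] [InnerProductSpace ℂ H] [CompleteSpace H]

/-- The operator `x ↦ ⟪v, x⟫ u`. -/
noncomputable def rankOne (u v : H) : H →L[ℂ] H := (innerSL ℂ v).smulRight u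

theorem rankOne_apply (u v x : H) : rankOne u v x = ⟪v, x⟫_ℂ • u := rfl

theorem nuclear_mul_rankOne (W : H →L[ℂ] H) (u v : H) :
    MemSchatten 1 (W * rankOne u v) ∧ trace (W * rankOne u v) = ⟪v, W u⟫_ℂ := by
  have h := nuclear_trace (u := fun _ : Unit => W u) (v := fun _ => v) (W := W * rankOne u v)
    Summable.of_finite (fun x y => by
      rw [mul_apply_eq_comp, rankOne_apply, map_smul, inner_smul_right]
      exact hasSum_unique _)
  exact ⟨h.1, h.2.unique (hasSum_unique _)⟩

theorem memPredual_rankOne {p : ℝ} (hp₁ : 1 ≤ p) (hp₂ : p ≤ 2) (u v : H) :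
    MemPredual p (rankOne u v) := by
  have h : MemSchatten 1 (rankOne u v) := by
    simpa using (nuclear_mul_rankOne 1 u v).1
  refine ⟨fun _ => isCompactOperator_of_memSchatten one_pos h, fun hp => ?_⟩
  exact h.mono one_pos (by linarith [two_le_conjExponent hp₁ hp₂ hp])

theorem eq_of_trace_rankOne {W W' : H →L[ℂ] H}
    (h : ∀ u v, trace (W * rankOne u v) = trace (W' * rankOne u v)) : W = W' :=
  eq_of_forall_inner fun x y => by
    rw [← (nuclear_mul_rankOne W x y).2, h, (nuclear_mul_rankOne W' x y).2]

end RankOne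

/-! ### Triple operator integrals for the Haagerup-like tensor products -/

section HaagerupLike

variable {X₁ X₂ X₃ : Type*} [MeasurableSpace X₁] [MeasurableSpace X₂]
  [MeasurableSpace X₃] {H : Type u} [NormedAddCommGroup H] [InnerProductSpace ℂ H] [CompleteSpace H]
  {E₁ : SpectralMeasure X₁ H} {E₂ : SpectralMeasure X₂ H} {E₃ : SpectralMeasure X₃ H}
  {Ψ : X₁ → X₂ → X₃ → ℂ} {p : ℝ} {T R : H →L[ℂ] H}

/-- Operators of rank one belong to the predual, the inner Haagerup integral is unique, and traces
against rank one operators are the matrix coefficients. -/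
theorem IsTOIFirst.unique (hp₁ : 1 ≤ p) (hp₂ : p ≤ 2) {W W' : H →L[ℂ] H}
    (h : IsTOIFirst p E₁ E₂ E₃ Ψ T R W) (h' : IsTOIFirst p E₁ E₂ E₃ Ψ T R W') : W = W' :=
  eq_of_trace_rankOne fun u v => by
    obtain ⟨Y, hY, -, hWY⟩ := h.2.2.2 _ (memPredual_rankOne hp₁ hp₂ u v)
    obtain ⟨Y', hY', -, hWY'⟩ := h'.2.2.2 _ (memPredual_rankOne hp₁ hp₂ u v)
    rw [hWY, hWY', hY.unique hY']

theorem IsTOISecond.unique (hp₁ : 1 ≤ p) (hp₂ : p ≤ 2) {W W' : H →L[ℂ] H}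
    (h : IsTOISecond p E₁ E₂ E₃ Ψ T R W) (h' : IsTOISecond p E₁ E₂ E₃ Ψ T R W') : W = W' :=
  eq_of_trace_rankOne fun u v => by
    obtain ⟨Y, hY, -, hWY⟩ := h.2.2.2 _ (memPredual_rankOne hp₁ hp₂ u v)
    obtain ⟨Y', hY', -, hWY'⟩ := h'.2.2.2 _ (memPredual_rankOne hp₁ hp₂ u v)
    rw [hWY, hWY', hY.unique hY']

theorem tendsto_range_swap {F : ℕ → ℕ → ℂ} {z : ℂ}
    (h : Tendsto (fun N : ℕ × ℕ => ∑ j ∈ Finset.range N.1, ∑ k ∈ Finset.range N.2, F j k)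
      atTop (𝓝 z)) :
    Tendsto (fun N : ℕ × ℕ => ∑ k ∈ Finset.range N.1, ∑ j ∈ Finset.range N.2, F j k)
      atTop (𝓝 z) := by
  have hs : Tendsto (Prod.swap : ℕ × ℕ → ℕ × ℕ) atTop atTop := by
    rw [← prod_atTop_atTop_eq]
    exact tendsto_prod_swap
  exact (h.comp hs).congr fun N => Finset.sum_comm

theorem MemLinftyMatrix.transpose {X : Type*} [MeasurableSpace X] {E : SpectralMeasure X H}
    {β : ℕ → ℕ → X → ℂ} (h : MemLinftyMatrix E β) : MemLinftyMatrix E fun j k => β k j := by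
  obtain ⟨C, hC0, hC⟩ := h.exists_bound
  exact ⟨fun j k => h.1 k j, C, fun x => (hC x).mono fun t ht => ht.swap.matrixNormLE hC0⟩

/-- The rows of the product of a bounded matrix of operators and a bounded column. -/
theorem exists_row_operator {ι κ : Type*} {B : ι → κ → H →L[ℂ] H} {C : ℝ} (hB : FormBound C B)
    {S : κ → H →L[ℂ] H} {D : ℝ} (hD : 0 ≤ D)
    (hS : ∀ x (F : Finset κ), ∑ k ∈ F, ‖S k x‖ ^ 2 ≤ D * ‖x‖ ^ 2) :
    ∃ V : ι → H →L[ℂ] H, (∀ j x, V j x = rowSum B (fun k => S k x) j) ∧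
      ∀ x (F : Finset ι), ∑ j ∈ F, ‖V j x‖ ^ 2 ≤ C ^ 2 * D * ‖x‖ ^ 2 := by
  have hs : ∀ x, Summable fun k => ‖S k x‖ ^ 2 := fun x =>
    summable_of_sum_le (fun _ => sq_nonneg _) (hS x)
  have hle : ∀ x (F : Finset ι), ∑ j ∈ F, ‖rowSum B (fun k => S k x) j‖ ^ 2 ≤
      C ^ 2 * D * ‖x‖ ^ 2 := fun x F => by
    refine (hB.sum_sq_rowSum_le (hs x) F).trans ?_
    rw [mul_assoc]
    exact mul_le_mul_of_nonneg_left ((hs x).tsum_le_of_sum_le (hS x)) (sq_nonneg _)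
  refine ⟨fun j => LinearMap.mkContinuous
    { toFun := fun x => rowSum B (fun k => S k x) j
      map_add' := fun x y => by
        simp only [rowSum, map_add]
        exact (hB.summable_row (hs x) j).tsum_add (hB.summable_row (hs y) j)
      map_smul' := fun c x => by
        simp only [rowSum, map_smul, RingHom.id_apply]
        exact (hB.summable_row (hs x) j).tsum_const_smul c } (√(C ^ 2 * D)) fun x => ?_,
    fun j x => rfl, fun x F => hle x F⟩
  have := hle x {j}
  rw [Finset.sum_singleton] at this
  refine (Real.le_sqrt_of_sq_le this).trans (le_of_eq ?_)
  rw [Real.sqrt_mul (by positivity), Real.sqrt_sq (norm_nonneg _)]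

theorem MemLinftyL2.exists_sum_sq_le {X : Type*} [MeasurableSpace X] {E : SpectralMeasure X H}
    {α : ℕ → X → ℂ} (h : MemLinftyL2 E α) : ∃ A, 0 ≤ A ∧
      (∀ (x : H) (F : Finset ℕ), ∑ j ∈ F, ‖E.integral (α j) x‖ ^ 2 ≤ A * ‖x‖ ^ 2) ∧
      ∀ (x : H) (F : Finset ℕ), ∑ j ∈ F,
        ‖ContinuousLinearMap.adjoint (E.integral (α j)) x‖ ^ 2 ≤ A * ‖x‖ ^ 2 := by
  obtain ⟨A, hA0, hAb, hA⟩ := h.exists_bound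
  exact ⟨A, hA0, fun x F => SpectralMeasure.sum_sq_integral_le (fun i => ⟨_, hAb i⟩) F
    (fun x => (hA x).mono fun t ht => ht F) x, fun x F =>
    SpectralMeasure.sum_sq_adjoint_integral_le (fun i => ⟨_, hAb i⟩) F
    (fun x => (hA x).mono fun t ht => ht F) x⟩

/-- Existence of the triple operator integral of an element of the Haagerup-like tensor product of
the first kind. -/
theorem exists_isTOIFirst (hp₁ : 1 ≤ p) (hp₂ : p ≤ 2) (hT : MemSchatten p T) {α : ℕ → X₁ → ℂ}
    {β : ℕ → X₂ → ℂ} {γ : ℕ → ℕ → X₃ → ℂ} (hα : MemLinftyL2 E₁ α) (hβ : MemLinftyL2 E₂ β)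
    (hγ : MemLinftyMatrix E₃ γ) (hΨ : ∀ x y z, Tendsto (fun N : ℕ × ℕ => ∑ j ∈ Finset.range N.1,
      ∑ k ∈ Finset.range N.2, α j x * β k y * γ j k z) atTop (𝓝 (Ψ x y z))) :
    ∃ (W : H →L[ℂ] H) (V : ℕ → H →L[ℂ] H), IsTOIFirst p E₁ E₂ E₃ Ψ T 1 W ∧
      (∀ j x y, HasSum (fun k => ⟪y, E₂.integral (β k) (E₃.integral (γ j k) x)⟫_ℂ) ⟪y, V j x⟫_ℂ) ∧
      ∀ x y, HasSum (fun j => ⟪y, E₁.integral (α j) (T (V j x))⟫_ℂ) ⟪y, W x⟫_ℂ := by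
  -- The cyclic permutation `(x₂, x₃, x₁)` puts the matrix factor in the middle, so the dual
  -- integral is an ordinary Haagerup integral.
  have hrep : IsHaagerupRep E₂ E₃ E₁ (fun x₂ x₃ x₁ => Ψ x₁ x₂ x₃) β (fun j k => γ k j) α :=
    ⟨hβ, hγ.transpose, hα, fun u v w => Eventually.of_forall fun q => by
      refine (tendsto_range_swap (hΨ q.2.2 q.1 q.2.1)).congr fun N => ?_
      exact Finset.sum_congr rfl fun k _ => Finset.sum_congr rfl fun j _ => by ring⟩
  obtain ⟨A, hA0, hA, hA'⟩ := hα.exists_sum_sq_le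
  obtain ⟨B, hB0, hB, hB'⟩ := hβ.exists_sum_sq_le
  obtain ⟨C, hC0, hC⟩ := hγ.transpose.exists_bound
  have hF := SpectralMeasure.formBound_integral hγ.transpose.1 hC0 hC
  -- `D_j = ∑_k (∫ γ_{jk} dE₃)^* (∫ β_k dE₂)^*`, so that `D_j^* = ∑_k (∫ β_k dE₂)(∫ γ_{jk} dE₃)`
  -- weakly. Only the column `(D_j)` is known to be bounded.
  obtain ⟨D, hD, hDle⟩ := exists_row_operator hF.adjoint hB0 hB'
  have hsB : ∀ y, Summable fun k => ‖ContinuousLinearMap.adjoint (E₂.integral (β k)) y‖ ^ 2 :=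
    fun y => summable_of_sum_le (fun _ => sq_nonneg _) (hB' y)
  -- One constant for all columns; the `+ 1` makes it strictly positive.
  set K := A + C ^ 2 * B + 1 with hK
  have hCB : 0 ≤ C ^ 2 * B := by positivity
  have mono : ∀ {a : ℝ} (x : H), a ≤ K → a * ‖x‖ ^ 2 ≤ K * ‖x‖ ^ 2 := fun x h => by gcongr
  obtain ⟨W, hW, hWsum, hWtr⟩ := exists_column_transform hp₁ hp₂ hT (C := K) (by positivity)
    (A := fun j => E₁.integral (α j)) (D := D)
    (fun x J => (hA x J).trans (mono x (by linarith)))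
    (fun x J => (hA' x J).trans (mono x (by linarith)))
    (fun x J => (hDle x J).trans (mono x (by linarith)))
  refine ⟨W, fun j => ContinuousLinearMap.adjoint (D j), ⟨⟨α, β, γ, hα, hβ, hγ, fun u v w =>
    Eventually.of_forall fun q => hΨ _ _ _⟩, hT, hW, fun Q hQ => ?_⟩, fun j x y => ?_,
    fun x y => (hWsum x y).of_eq fun j => by rw [ContinuousLinearMap.adjoint_inner_left]⟩
  · obtain ⟨Y, hY, hYform⟩ := hrep.exists_isHaagerupTOI 1 Q
    refine ⟨Y, hY, (hWtr Q Y hQ.2 fun x y => ?_).2⟩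
    have hr : Summable fun j => ‖Q (E₁.integral (α j) x)‖ ^ 2 := (summable_sq_clm (hA x) Q).1
    rw [hYform x y, formVal]
    simp only [ContinuousLinearMap.adjoint_one, one_apply_eq_self]
    -- Summation over `k` first turns the Haagerup form into `∑_j ⟪D_j y, Q A_j x⟫`, as needed for
    -- the trace duality.
    rw [← hF.tsum_inner_rowSum_adjoint (hsB y) hr]
    simp only [hD]
    exact (hF.adjoint.summable_sq_rowSum (hsB y) |> fun h => summable_inner_of_sq h hr).hasSum
  · rw [ContinuousLinearMap.adjoint_inner_right, hD]
    have h1 := hF.adjoint.hasSum_rowSum (hsB y) j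
    have h2 := h1.mapL (innerSL ℂ x)
    have h3 := Complex.hasSum_conj'.2 h2
    simp only [innerSL_apply_apply, inner_conj_symm] at h3
    exact h3.of_eq fun k => by
      rw [ContinuousLinearMap.adjoint_inner_left, ContinuousLinearMap.adjoint_inner_left]

/-- Existence of the triple operator integral of an element of the Haagerup-like tensor product of
the second kind. -/
theorem exists_isTOISecond (hp₁ : 1 ≤ p) (hp₂ : p ≤ 2) (hR : MemSchatten p R)
    {α : ℕ → ℕ → X₁ → ℂ} {β : ℕ → X₂ → ℂ} {γ : ℕ → X₃ → ℂ} (hα : MemLinftyMatrix E₁ α)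
    (hβ : MemLinftyL2 E₂ β) (hγ : MemLinftyL2 E₃ γ)
    (hΨ : ∀ x y z, Tendsto (fun N : ℕ × ℕ => ∑ j ∈ Finset.range N.1,
      ∑ k ∈ Finset.range N.2, α j k x * β j y * γ k z) atTop (𝓝 (Ψ x y z))) :
    ∃ (W : H →L[ℂ] H) (V : ℕ → H →L[ℂ] H), IsTOISecond p E₁ E₂ E₃ Ψ 1 R W ∧
      (∀ k x y, HasSum (fun j => ⟪y, E₁.integral (α j k) (E₂.integral (β j) x)⟫_ℂ) ⟪y, V k x⟫_ℂ) ∧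
      ∀ x y, HasSum (fun k => ⟪y, V k (R (E₃.integral (γ k) x))⟫_ℂ) ⟪y, W x⟫_ℂ := by
  have hrep : IsHaagerupRep E₃ E₁ E₂ (fun x₃ x₁ x₂ => Ψ x₁ x₂ x₃) γ (fun j k => α k j) β :=
    ⟨hγ, hα.transpose, hβ, fun u v w => Eventually.of_forall fun q => by
      refine (tendsto_range_swap (hΨ q.2.1 q.2.2 q.1)).congr fun N => ?_
      exact Finset.sum_congr rfl fun k _ => Finset.sum_congr rfl fun j _ => by ring⟩
  obtain ⟨A, hA0, hA, hA'⟩ := hγ.exists_sum_sq_le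
  obtain ⟨B, hB0, hB, hB'⟩ := hβ.exists_sum_sq_le
  obtain ⟨C, hC0, hC⟩ := hα.transpose.exists_bound
  have hF := SpectralMeasure.formBound_integral hα.transpose.1 hC0 hC
  obtain ⟨D, hD, hDle⟩ := exists_row_operator hF hB0 hB
  have hsB : ∀ y, Summable fun k => ‖E₂.integral (β k) y‖ ^ 2 :=
    fun y => summable_of_sum_le (fun _ => sq_nonneg _) (hB y)
  set K := A + C ^ 2 * B + 1 with hK
  have hCB : 0 ≤ C ^ 2 * B := by positivity
  have mono : ∀ {a : ℝ} (x : H), a ≤ K → a * ‖x‖ ^ 2 ≤ K * ‖x‖ ^ 2 := fun x h => by gcongr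
  -- The second kind is reduced to the same transformation by passing to adjoints: with `A_k = (∫
  -- γ_k dE₃)^*` and `D_k = ∑_j (∫ α_{jk} dE₁)(∫ β_j dE₂)` it gives `W = ∑_k A_k R^* D_k^*`, whose
  -- adjoint is the required integral.
  obtain ⟨W, hW, hWsum, hWtr⟩ := exists_column_transform hp₁ hp₂ (hR.adjoint hp₁ hp₂) (C := K)
    (by positivity) (A := fun k => ContinuousLinearMap.adjoint (E₃.integral (γ k))) (D := D)
    (fun x J => (hA' x J).trans (mono x (by linarith)))
    (fun x J => by
      simp only [ContinuousLinearMap.adjoint_adjoint]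
      exact (hA x J).trans (mono x (by linarith)))
    (fun x J => (hDle x J).trans (mono x (by linarith)))
  refine ⟨ContinuousLinearMap.adjoint W, D, ⟨⟨α, β, γ, hα, hβ, hγ, fun u v w =>
    Eventually.of_forall fun q => hΨ _ _ _⟩, hR, hW.adjoint hp₁ hp₂, fun Q hQ => ?_⟩,
    fun k x y => ?_, fun x y => ?_⟩
  · obtain ⟨Y, hY, hYform⟩ := hrep.exists_isHaagerupTOI Q 1
    have hQ' : p ≠ 1 → MemSchatten (p / (p - 1)) (ContinuousLinearMap.adjoint Q) := fun hp =>
      (hQ.2 hp).adjoint_two_le (two_le_conjExponent hp₁ hp₂ hp)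
    have h1 := hWtr (ContinuousLinearMap.adjoint Q) (ContinuousLinearMap.adjoint Y) hQ'
      fun x y => by
        have hp : Summable fun k => ‖ContinuousLinearMap.adjoint Q
          (ContinuousLinearMap.adjoint (E₃.integral (γ k)) x)‖ ^ 2 := (summable_sq_clm (hA' x) _).1
        have h2 := hYform y x
        rw [formVal] at h2
        have h3 := (summable_inner_of_sq hp (hF.summable_sq_rowSum (hsB y))).hasSum
        simp only [one_apply_eq_self] at h2
        rw [← h2] at h3
        have h4 := Complex.hasSum_conj'.2 h3
        simp only [inner_conj_symm] at h4
        rw [ContinuousLinearMap.adjoint_inner_right]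
        exact h4.of_eq fun k => by rw [hD]
    have hY' : p ≠ 1 → MemSchatten (p / (p - 1)) Y := fun hp => by
      have := (h1.1 hp).adjoint_two_le (two_le_conjExponent hp₁ hp₂ hp)
      rwa [ContinuousLinearMap.adjoint_adjoint] at this
    have e1 : W * ContinuousLinearMap.adjoint Q =
        ContinuousLinearMap.adjoint (Q * ContinuousLinearMap.adjoint W) := by
      simp only [← ContinuousLinearMap.star_eq_adjoint, star_mul, star_star]
    have e2 : ContinuousLinearMap.adjoint Y * ContinuousLinearMap.adjoint R =
        ContinuousLinearMap.adjoint (R * Y) := by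
      simp only [← ContinuousLinearMap.star_eq_adjoint, star_mul]
    have h2 := h1.2.2
    rw [e1, e2, trace_adjoint, trace_adjoint] at h2
    have h3 := trace_mul_comm hp₁ hp₂ hR hY'
    have h4 := trace_mul_comm hp₁ hp₂ (hW.adjoint hp₁ hp₂) hQ.2
    exact ⟨Y, hY, h3.1, by rw [h3.2.2, ← h4.2.2]; exact star_injective h2⟩
  · rw [hD]
    have h2 := (hF.hasSum_rowSum (hsB x) k).mapL (innerSL ℂ y)
    exact h2
  · have h1 := Complex.hasSum_conj'.2 (hWsum y x)
    rw [inner_conj_symm] at h1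
    rw [ContinuousLinearMap.adjoint_inner_right]
    refine h1.of_eq fun k => ?_
    rw [inner_conj_symm, ContinuousLinearMap.adjoint_adjoint, ContinuousLinearMap.adjoint_inner_left,
      ContinuousLinearMap.adjoint_inner_left]

end HaagerupLike

/-! ### Complex measures given by densities -/

section Densities

variable {Z : Type*} [MeasurableSpace Z]

/-- A summable combination of finite measures has a density with respect to a finite measure. -/
theorem exists_density {ι : Type*} [Countable ι] (ν : ι → Measure Z) [∀ i, IsFiniteMeasure (ν i)]
    (hν : Summable fun i => (ν i).real Set.univ) {c : ι → ℂ} (hc : ∀ i, ‖c i‖ ≤ 1) :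
    ∃ (ν₀ : Measure Z) (h : Z → ℂ), IsFiniteMeasure ν₀ ∧ Integrable h ν₀ ∧
      ∀ (g : Z → ℂ) (C : ℝ), Measurable g → (∀ i, ∀ᵐ z ∂(ν i), ‖g z‖ ≤ C) →
        HasSum (fun i => c i * ∫ z, g z ∂(ν i)) (∫ z, g z * h z ∂ν₀) := by
  set ν₀ := Measure.sum ν with hν₀
  have hfin : IsFiniteMeasure ν₀ := ⟨by
    rw [hν₀, Measure.sum_apply _ MeasurableSet.univ]
    have : ∀ i, ν i Set.univ = ENNReal.ofReal ((ν i).real Set.univ) := fun i => by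
      rw [ofReal_measureReal]
    simp only [this]
    exact hν.tsum_ofReal_lt_top⟩
  have hac : ∀ i, ν i ≪ ν₀ := fun i => (Measure.le_sum ν i).absolutelyContinuous
  -- Radon–Nikodym densities with respect to the sum of all the measures combine the series into one
  -- integrable function.
  set ρ : ι → Z → ℝ := fun i z => ((ν i).rnDeriv ν₀ z).toReal with hρ
  have hρm : ∀ i, Measurable (ρ i) := fun i => (Measure.measurable_rnDeriv _ _).ennreal_toReal
  have hρi : ∀ i, Integrable (ρ i) ν₀ := fun i => Measure.integrable_toReal_rnDeriv
  have hρ1 : ∀ i, ∫ z, ‖ρ i z‖ ∂ν₀ = (ν i).real Set.univ := fun i => by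
    simp only [hρ, Real.norm_of_nonneg ENNReal.toReal_nonneg]
    rw [Measure.integral_toReal_rnDeriv (hac i)]
  have hFi : ∀ i, Integrable (fun z => c i * (ρ i z : ℂ)) ν₀ := fun i => (hρi i).ofReal.const_mul _
  have hFle : ∀ i z, ‖c i * (ρ i z : ℂ)‖ ≤ ‖ρ i z‖ := fun i z => by
    rw [norm_mul, Complex.norm_real]
    exact mul_le_of_le_one_left (norm_nonneg _) (hc i)
  refine ⟨ν₀, fun z => ∑' i, c i * (ρ i z : ℂ), hfin, ⟨?_, ?_⟩, fun g C hg hC => ?_⟩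
  · refine (Measurable.tsum fun i => ?_).aestronglyMeasurable
    exact measurable_const.mul (Complex.measurable_ofReal.comp (hρm i))
  · refine lt_of_le_of_lt (lintegral_mono fun z => enorm_tsum_le_tsum_enorm) ?_
    rw [lintegral_tsum fun i => (hFi i).1.enorm]
    refine lt_of_le_of_lt (ENNReal.tsum_le_tsum fun i => ?_) hν.tsum_ofReal_lt_top
    rw [← hρ1 i, ofReal_integral_norm_eq_lintegral_enorm (hρi i)]
    exact lintegral_mono fun z => enorm_le_iff_norm_le.2 (hFle i z)
  · have hC0 : ∀ᵐ z ∂ν₀, ‖g z‖ ≤ C := Measure.ae_sum_iff.2 hC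
    have hGi : ∀ i, Integrable (fun z => g z * (c i * (ρ i z : ℂ))) ν₀ := fun i =>
      (hFi i).bdd_mul hg.aestronglyMeasurable hC0
    have h1 := hasSum_integral_of_summable_integral_norm hGi (by
      refine (hν.mul_left C).of_nonneg_of_le (fun i => integral_nonneg fun _ => norm_nonneg _)
        fun i => ?_
      rw [← hρ1 i, ← integral_const_mul]
      refine integral_mono_ae (hGi i).norm ((hρi i).norm.const_mul C) ?_
      filter_upwards [hC0] with z hz
      rw [norm_mul]
      exact mul_le_mul hz (hFle i z) (norm_nonneg _) ((norm_nonneg _).trans hz))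
    simp only [tsum_mul_left] at h1
    refine h1.of_eq fun i => ?_
    rw [← integral_rnDeriv_smul (hac i), ← integral_const_mul]
    congr 1
    ext z
    rw [Complex.real_smul]
    ring

/-- A complex measure on a product, given by a density, is determined by its values on
rectangles. -/
theorem integral_density_eq {X Y : Type*} [MeasurableSpace X] [MeasurableSpace Y]
    {ν ν' : Measure (X × Y)} [IsFiniteMeasure ν] [IsFiniteMeasure ν'] {h h' : X × Y → ℂ}
    (hh : Integrable h ν) (hh' : Integrable h' ν')
    (heq : ∀ (Λ : Set X) (Δ : Set Y), MeasurableSet Λ → MeasurableSet Δ →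
      ∫ q in Λ ×ˢ Δ, h q ∂ν = ∫ q in Λ ×ˢ Δ, h' q ∂ν') (Φ : X × Y → ℂ) :
    ∫ q, Φ q * h q ∂ν = ∫ q, Φ q * h' q ∂ν' := by
  set μ := ν + ν' with hμ
  have h1 : ν ≪ μ := Measure.absolutelyContinuous_of_le (Measure.le_add_right le_rfl)
  have h2 : ν' ≪ μ := Measure.absolutelyContinuous_of_le (Measure.le_add_left le_rfl)
  have i1 := (integrable_rnDeriv_smul_iff h1).2 hh
  have i2 := (integrable_rnDeriv_smul_iff h2).2 hh'
  have key : ∀ s, MeasurableSet s → ∫ q in s, h q ∂ν = ∫ q in s, h' q ∂ν' := by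
    refine MeasurableSpace.induction_on_inter generateFrom_prod.symm isPiSystem_prod
      (by simp) ?_ ?_ ?_
    · rintro _ ⟨Λ, hΛ, Δ, hΔ, rfl⟩
      exact heq Λ Δ hΛ hΔ
    · intro t ht hteq
      have a1 := integral_add_compl ht hh
      have a2 := integral_add_compl ht hh'
      have a3 := heq Set.univ Set.univ MeasurableSet.univ MeasurableSet.univ
      simp only [Set.univ_prod_univ, Measure.restrict_univ] at a3
      rw [hteq] at a1
      rw [← a2] at a3
      exact add_left_cancel (a1.trans a3)
    · intro s hd hs heqs
      exact (hasSum_integral_iUnion hs hd hh.integrableOn).unique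
        ((hasSum_integral_iUnion hs hd hh'.integrableOn).of_eq heqs)
  have hae := Integrable.ae_eq_of_forall_setIntegral_eq _ _ i1 i2 fun s hs _ => by
    rw [setIntegral_rnDeriv_smul h1 hs, setIntegral_rnDeriv_smul h2 hs, key s hs]
  rw [← integral_rnDeriv_smul h1, ← integral_rnDeriv_smul h2]
  refine integral_congr_ae ?_
  filter_upwards [hae] with q hq
  rw [← mul_smul_comm, ← mul_smul_comm, hq]

end Densities

/-! ### Double operator integrals and functions of a pair -/

section DoubleIntegral

variable {X Y : Type*} [MeasurableSpace X] [MeasurableSpace Y]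
  {H : Type u} [NormedAddCommGroup H] [InnerProductSpace ℂ H] [CompleteSpace H]
  {E₁ : SpectralMeasure X H} {E₂ : SpectralMeasure Y H} {ι κ : Type*}

/-- Any two admissible densities have the same integrals over rectangles, hence define the same
complex measure. -/
theorem IsHilbertSchmidtDOI.unique {Φ : X → Y → ℂ} {T W W' : H →L[ℂ] H}
    (h : IsHilbertSchmidtDOI E₁ E₂ Φ T W) (h' : IsHilbertSchmidtDOI E₁ E₂ Φ T W') : W = W' :=
  eq_of_forall_inner fun a b => by
    obtain ⟨ν, g, hν, hg, hrect, hW⟩ := h.2.2.2 a b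
    obtain ⟨ν', g', hν', hg', hrect', hW'⟩ := h'.2.2.2 a b
    rw [hW, hW']
    exact integral_density_eq hg hg' (fun Λ Δ hΛ hΔ => by rw [hrect _ _ hΛ hΔ, hrect' _ _ hΛ hΔ])
      fun q => Φ q.1 q.2

theorem IsDOI.unique {Φ : X → Y → ℂ} {T W W' : H →L[ℂ] H} (h : IsDOI E₁ E₂ Φ T W)
    (h' : IsDOI E₁ E₂ Φ T W') : W = W' :=
  eq_of_trace_rankOne fun u v => by
    have hQ : MemSchatten 1 (rankOne u v) := by simpa using (nuclear_mul_rankOne 1 u v).1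
    obtain ⟨Y, hY, -⟩ := h.1.2 _ hQ
    rw [h.2 _ hQ Y hY, h'.2 _ hQ Y hY]

/-- A countable singular value decomposition. -/
theorem MemSchatten.exists_countable_isSVD {p : ℝ} (hp : 0 < p) {T : H →L[ℂ] H}
    (hT : MemSchatten p T) : ∃ (ι : Type u) (_ : Countable ι) (e f : ι → H) (s : ι → ℝ),
      IsSVD p e f s T := by
  obtain ⟨ι, e, f, s, h⟩ := hT.exists_isSVD hp
  have hsupp : (Function.support fun i => s i ^ p) = Function.support s := by
    ext i
    simp [Real.rpow_eq_zero (h.nonneg i) hp.ne']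
  refine ⟨Function.support s, ?_, fun i => e i, fun i => f i, fun i => s i, ?_, ?_, fun i => h.nonneg i,
    h.summable.comp_injective Subtype.val_injective, fun x y => ?_⟩
  · rw [← hsupp]
    exact h.summable.countable_support.to_subtype
  · intro x F
    have := h.left x (F.map (Function.Embedding.subtype _))
    simpa using this
  · intro x F
    have := h.right x (F.map (Function.Embedding.subtype _))
    simpa using this
  · refine (hasSum_subtype_iff_of_support_subset (f := fun i => (s i : ℂ) * ⟪e i, x⟫_ℂ * ⟪y, f i⟫_ℂ)
      fun i hi => ?_).2 (h.hasSum x y)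
    intro h0
    simp [h0] at hi

/-- A representation `Φ(x, y) = ∑_i φ_i(x) ψ_i(y)` with square summable columns. -/
structure IsColumnRep (E₁ : SpectralMeasure X H) (E₂ : SpectralMeasure Y H) (Φ : X → Y → ℂ)
    (φ : ι → X → ℂ) (ψ : ι → Y → ℂ) (C : ℝ) : Prop where
  nonneg : 0 ≤ C
  left_meas (i : ι) : Measurable (φ i)
  right_meas (i : ι) : Measurable (ψ i)
  left : E₁.AE fun x => ∀ F : Finset ι, ∑ i ∈ F, ‖φ i x‖ ^ 2 ≤ C
  right : E₂.AE fun y => ∀ F : Finset ι, ∑ i ∈ F, ‖ψ i y‖ ^ 2 ≤ C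
  hasSum (x : X) (y : Y) : HasSum (fun i => φ i x * ψ i y) (Φ x y)
  meas : Measurable fun q : X × Y => Φ q.1 q.2

namespace IsColumnRep

variable {Φ : X → Y → ℂ} {φ : ι → X → ℂ} {ψ : ι → Y → ℂ} {C : ℝ}

theorem symm (h : IsColumnRep E₁ E₂ Φ φ ψ C) : IsColumnRep E₂ E₁ (fun y x => Φ x y) ψ φ C :=
  ⟨h.nonneg, h.right_meas, h.left_meas, h.right, h.left,
    fun x y => (h.hasSum y x).of_eq fun _ => mul_comm _ _, h.meas.comp measurable_swap⟩

theorem essBdd_left (h : IsColumnRep E₁ E₂ Φ φ ψ C) (i : ι) : E₁.EssBdd (√C) (φ i) :=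
  ⟨h.left_meas i, fun x => by
    filter_upwards [h.left x] with t ht
    have := ht {i}
    rw [Finset.sum_singleton] at this
    exact Real.le_sqrt_of_sq_le this⟩

theorem essBdd_right (h : IsColumnRep E₁ E₂ Φ φ ψ C) (i : ι) : E₂.EssBdd (√C) (ψ i) :=
  h.symm.essBdd_left i

theorem sum_le (h : IsColumnRep E₁ E₂ Φ φ ψ C) (x : H) (F : Finset ι) :
    ∑ i ∈ F, ‖E₁.integral (φ i) x‖ ^ 2 ≤ C * ‖x‖ ^ 2 :=
  SpectralMeasure.sum_sq_integral_le (fun i => ⟨_, h.essBdd_left i⟩) F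
    (fun x => (h.left x).mono fun _ ht => ht F) x

theorem sum_adjoint_le (h : IsColumnRep E₁ E₂ Φ φ ψ C) (x : H) (F : Finset ι) :
    ∑ i ∈ F, ‖ContinuousLinearMap.adjoint (E₁.integral (φ i)) x‖ ^ 2 ≤ C * ‖x‖ ^ 2 :=
  SpectralMeasure.sum_sq_adjoint_integral_le (fun i => ⟨_, h.essBdd_left i⟩) F
    (fun x => (h.left x).mono fun _ ht => ht F) x

theorem norm_partial_le (h : IsColumnRep E₁ E₂ Φ φ ψ C) (u v : H) (F : Finset ι) :
    ∀ᵐ q ∂((E₁.measure u).prod (E₂.measure v)), ‖∑ i ∈ F, φ i q.1 * ψ i q.2‖ ≤ C := by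
  filter_upwards [Measure.quasiMeasurePreserving_fst.ae (h.left u),
    Measure.quasiMeasurePreserving_snd.ae (h.right v)] with q h1 h2
  refine (norm_sum_le _ _).trans ?_
  simp only [norm_mul]
  have := sum_norm_mul_norm_le F (fun i => ‖φ i q.1‖) (fun i => ‖ψ i q.2‖) (√C) (√C)
    (by rw [Real.sq_sqrt h.nonneg]; exact h1 F) (by rw [Real.sq_sqrt h.nonneg]; exact h2 F)
    (Real.sqrt_nonneg _) (Real.sqrt_nonneg _)
  rwa [Real.mul_self_sqrt h.nonneg] at this

/-- Countability of the index set yields a single null set outside which all finite partial sums are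
bounded. -/
theorem norm_le (h : IsColumnRep E₁ E₂ Φ φ ψ C) [Countable ι] (u v : H) :
    ∀ᵐ q ∂((E₁.measure u).prod (E₂.measure v)), ‖Φ q.1 q.2‖ ≤ C := by
  have : ∀ᵐ q ∂((E₁.measure u).prod (E₂.measure v)), ∀ F : Finset ι,
    ‖∑ i ∈ F, φ i q.1 * ψ i q.2‖ ≤ C := ae_all_iff.2 fun F => h.norm_partial_le u v F
  filter_upwards [this] with q hq
  have h1 : Tendsto (fun F : Finset ι => ‖∑ i ∈ F, φ i q.1 * ψ i q.2‖) atTop (𝓝 ‖Φ q.1 q.2‖) :=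
    Tendsto.norm (h.hasSum q.1 q.2)
  exact le_of_tendsto h1 (Eventually.of_forall hq)

theorem hasSum_integral (h : IsColumnRep E₁ E₂ Φ φ ψ C) [Countable ι] (u v : H) :
    HasSum (fun i => (∫ x, φ i x ∂(E₁.measure u)) * ∫ y, ψ i y ∂(E₂.measure v))
      (∫ q, Φ q.1 q.2 ∂((E₁.measure u).prod (E₂.measure v))) := by
  have h1 : ∀ i, Integrable (fun q : X × Y => φ i q.1 * ψ i q.2)
      ((E₁.measure u).prod (E₂.measure v)) := fun i =>
    ((h.essBdd_left i).hasIntegral u).1.mul_prod ((h.essBdd_right i).hasIntegral v).1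
  have h2 : Tendsto (fun F : Finset ι => ∫ q, ∑ i ∈ F, φ i q.1 * ψ i q.2
      ∂((E₁.measure u).prod (E₂.measure v))) atTop
      (𝓝 (∫ q, Φ q.1 q.2 ∂((E₁.measure u).prod (E₂.measure v)))) :=
    tendsto_integral_filter_of_dominated_convergence (fun _ => C)
      (Eventually.of_forall fun F => (integrable_finsetSum F fun i _ => h1 i).1)
      (Eventually.of_forall fun F => h.norm_partial_le u v F) (integrable_const _)
      (Eventually.of_forall fun q => h.hasSum q.1 q.2)
  refine h2.congr fun F => ?_
  rw [integral_finsetSum F fun i _ => h1 i]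
  exact Finset.sum_congr rfl fun i _ => integral_prod_mul _ _

theorem hasSum_inner (h : IsColumnRep E₁ E₂ Φ φ ψ C) [Countable ι] (x y x' y' : H) :
    HasSum (fun i => ⟪y, E₁.integral (φ i) x⟫_ℂ * ⟪y', E₂.integral (ψ i) x'⟫_ℂ)
      (∑ a : Fin 4 × Fin 4, polCoef a.1 * polCoef a.2 *
        ∫ q, Φ q.1 q.2 ∂((E₁.measure (polVec x y a.1)).prod (E₂.measure (polVec x' y' a.2)))) := by
  have h1 : HasSum (fun i => ∑ a : Fin 4 × Fin 4, polCoef a.1 * polCoef a.2 *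
      ((∫ t, φ i t ∂(E₁.measure (polVec x y a.1))) *
        ∫ t, ψ i t ∂(E₂.measure (polVec x' y' a.2)))) _ :=
    hasSum_sum fun (a : Fin 4 × Fin 4) _ =>
      (h.hasSum_integral (polVec x y a.1) (polVec x' y' a.2)).mul_left (polCoef a.1 * polCoef a.2)
  refine h1.of_eq fun i => ?_
  rw [(h.essBdd_left i).inner_eq, (h.essBdd_right i).inner_eq, Finset.sum_mul_sum,
    Fintype.sum_prod_type]
  exact Finset.sum_congr rfl fun a _ => Finset.sum_congr rfl fun b _ => by ring

end IsColumnRep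

theorem sum_norm_sq_indicator_le {S : Set X} (F : Finset Unit) (t : X) :
    ∑ _i ∈ F, ‖S.indicator (1 : X → ℂ) t‖ ^ 2 ≤ 1 := by
  have h1 : ‖S.indicator (1 : X → ℂ) t‖ ≤ 1 := by
    by_cases h : t ∈ S <;> simp [h]
  refine (Finset.sum_le_card_nsmul F _ 1 fun _ _ => pow_le_one₀ (norm_nonneg _) h1).trans ?_
  rw [nsmul_eq_mul, mul_one]
  exact_mod_cast (Finset.card_le_univ F).trans (by simp)

/-- The density of the complex measure `⟪b, E₁(·) T E₂(·) a⟫` for a trace class operator `T`. -/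
theorem IsSVD.exists_density [Countable ι] {e f : ι → H} {s : ι → ℝ} {T : H →L[ℂ] H}
    (hT : IsSVD 1 e f s T) (E₁ : SpectralMeasure X H) (E₂ : SpectralMeasure Y H) (a b : H) :
    ∃ (ν : Measure (X × Y)) (h : X × Y → ℂ), IsFiniteMeasure ν ∧ Integrable h ν ∧
      ∀ (Φ : X → Y → ℂ) (C : ℝ), (Measurable fun q : X × Y => Φ q.1 q.2) →
        (∀ u v : H, ∀ᵐ q ∂((E₁.measure u).prod (E₂.measure v)), ‖Φ q.1 q.2‖ ≤ C) →
        HasSum (fun n => (s n : ℂ) * ∑ i : Fin 4 × Fin 4, polCoef i.1 * polCoef i.2 *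
          ∫ q, Φ q.1 q.2 ∂((E₁.measure (polVec (f n) b i.1)).prod
            (E₂.measure (polVec a (e n) i.2)))) (∫ q, Φ q.1 q.2 * h q ∂ν) := by
  -- Polarising `s_n ⟪b, E₁(·) f_n⟫ ⟪e_n, E₂(·) a⟫` gives sixteen product measures for each `n`.
  -- Their masses are summable because `∑ s_n < ∞`.
  set ν : ι × (Fin 4 × Fin 4) → Measure (X × Y) := fun z => ENNReal.ofReal (s z.1) •
    ((E₁.measure (polVec (f z.1) b z.2.1)).prod (E₂.measure (polVec a (e z.1) z.2.2))) with hν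
  have hfin : ∀ z, IsFiniteMeasure (ν z) := fun z => by
    rw [hν]
    exact Measure.smul_finite _ ENNReal.ofReal_ne_top
  have hpol : ∀ (x y : H) (i : Fin 4), ‖polVec x y i‖ ≤ ‖x‖ + ‖y‖ := fun x y i => by
    fin_cases i
    · exact norm_add_le _ _ |>.trans (by simp)
    · exact norm_sub_le _ _ |>.trans (by simp)
    · exact norm_add_le _ _ |>.trans (by simp [norm_smul])
    · exact norm_sub_le _ _ |>.trans (by simp [norm_smul])
  have hsum : Summable fun z => (ν z).real Set.univ := by
    have h1 : Summable fun z : ι × (Fin 4 × Fin 4) => s z.1 * ((1 + ‖b‖) ^ 2 * (‖a‖ + 1) ^ 2) := by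
      have h2 := hT.summable
      simp only [Real.rpow_one] at h2
      have h3 : Summable fun _ : Fin 4 × Fin 4 => ((1 + ‖b‖) ^ 2 * (‖a‖ + 1) ^ 2) :=
        Summable.of_finite
      exact h2.mul_of_nonneg h3 hT.nonneg fun _ => by positivity
    refine h1.of_nonneg_of_le (fun _ => measureReal_nonneg) fun z => ?_
    rw [hν]
    simp only [measureReal_ennreal_smul_apply, ENNReal.toReal_ofReal (hT.nonneg _)]
    refine mul_le_mul_of_nonneg_left ?_ (hT.nonneg _)
    rw [← Set.univ_prod_univ, measureReal_prod_prod, E₁.measureReal_univ, E₂.measureReal_univ]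
    gcongr
    · exact (hpol _ _ _).trans (by gcongr; exact hT.right.norm_le _)
    · exact (hpol _ _ _).trans (by gcongr; exact hT.left.norm_le _)
  obtain ⟨ν₀, h, hν₀, hh, hsumh⟩ := OpInt.exists_density ν hsum
    (c := fun z => polCoef z.2.1 * polCoef z.2.2) fun z => by
      rw [norm_mul]
      exact mul_le_one₀ (norm_polCoef_le _) (norm_nonneg _) (norm_polCoef_le _)
  refine ⟨ν₀, h, hν₀, hh, fun Φ C hΦ hC => ?_⟩
  have h1 := hsumh (fun q => Φ q.1 q.2) C hΦ fun z =>
    (Measure.smul_absolutelyContinuous (c := ENNReal.ofReal (s z.1))).ae_le (hC _ _)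
  refine (h1.prod_fiberwise fun n => hasSum_fintype _).of_eq fun n => ?_
  rw [Finset.mul_sum]
  refine Finset.sum_congr rfl fun i _ => ?_
  rw [hν]
  simp only [integral_smul_measure, ENNReal.toReal_ofReal (hT.nonneg _), Complex.real_smul]
  ring

namespace IsColumnRep

variable {Φ : X → Y → ℂ} {φ : ι → X → ℂ} {ψ : ι → Y → ℂ} {C : ℝ}

/-- The double operator integral `∑_i E₁(φ_i) T E₂(ψ_i)` of a trace class operator. -/
theorem exists_isHilbertSchmidtDOI [Countable ι] (h : IsColumnRep E₁ E₂ Φ φ ψ C) [Countable κ]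
    {e f : κ → H} {s : κ → ℝ} {T : H →L[ℂ] H} (hT₁ : MemSchatten 1 T) (hT : IsSVD 1 e f s T) :
    ∃ W : H →L[ℂ] H, IsHilbertSchmidtDOI E₁ E₂ Φ T W ∧ MemSchatten 1 W ∧
      HasSum (fun z : κ × ι => (s z.1 : ℂ) * ⟪e z.1, E₂.integral (ψ z.2)
        (E₁.integral (φ z.2) (f z.1))⟫_ℂ) (trace W) := by
  have hK : C ≤ C + 1 := by linarith
  have one_le : ∀ {e : κ → H}, Bessel e → ∀ n, C * ‖e n‖ ^ 2 ≤ C + 1 := fun he n =>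
    (mul_le_of_le_one_right h.nonneg (pow_le_one₀ (norm_nonneg _) (he.norm_le n))).trans hK
  -- The vectors of the series `∑_i E₁(φ_i) T E₂(ψ_i)` in the decomposition of `T`; the `+ 1` makes
  -- the constant strictly positive.
  have hcol : ColumnBound (C + 1) (fun n i => E₁.integral (φ i) (f n))
      (fun n i => ContinuousLinearMap.adjoint (E₂.integral (ψ i)) (e n)) :=
    ⟨by linarith [h.nonneg], fun y F J => by
      rw [Finset.sum_comm]
      refine (Finset.sum_le_sum fun i _ => ?_).trans ((h.sum_adjoint_le y J).trans
        (mul_le_mul_of_nonneg_right hK (sq_nonneg _)))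
      refine le_trans (le_of_eq (Finset.sum_congr rfl fun n _ => ?_)) (hT.right _ F)
      rw [ContinuousLinearMap.adjoint_inner_right, norm_inner_symm],
    fun n J => (h.sum_le _ J).trans (one_le hT.right n),
    fun n J => (h.symm.sum_adjoint_le _ J).trans (one_le hT.left n)⟩
  have hs : Summable s := by simpa only [Real.rpow_one] using hT.summable
  have hs2 : Summable fun n => s n ^ 2 := by
    have := summable_rpow_of_le one_pos one_le_two hT.nonneg hT.summable
    exact_mod_cast this
  obtain ⟨W, hW⟩ := hcol.exists_operator hs2 hT.nonneg
  have hnuc := nuclear_trace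
    (u := fun z : κ × ι => (s z.1 : ℂ) • E₁.integral (φ z.2) (f z.1))
    (v := fun z : κ × ι => ContinuousLinearMap.adjoint (E₂.integral (ψ z.2)) (e z.1)) (W := W)
    ((hcol.summable_mul_norm hs hT.nonneg).congr fun z => by
      rw [norm_smul, Complex.norm_real, Real.norm_of_nonneg (hT.nonneg _), mul_assoc])
    fun x y => (hW x y).of_eq fun z => by rw [inner_smul_right]; ring
  refine ⟨W, ⟨⟨h.meas, C, h.norm_le⟩, hT₁.mono one_pos one_le_two, hnuc.1.mono one_pos one_le_two, fun a b => ?_⟩,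
    hnuc.1, hnuc.2.of_eq fun z => by
      rw [inner_smul_right, ContinuousLinearMap.adjoint_inner_left]⟩
  obtain ⟨ν, g, hν, hg, hsum⟩ := hT.exists_density E₁ E₂ a b
  refine ⟨ν, g, hν, hg, fun Λ Δ hΛ hΔ => ?_, ?_⟩
  -- The indicator of a rectangle is itself a column representation with one term, so the density
  -- formula evaluates the measure on rectangles.
  · have hrep : IsColumnRep E₁ E₂ (fun x y => Λ.indicator 1 x * Δ.indicator 1 y)
        (fun (_ : Unit) => Λ.indicator 1) (fun _ => Δ.indicator 1) 1 :=
      { nonneg := zero_le_one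
        left_meas := fun _ => measurable_one.indicator hΛ
        right_meas := fun _ => measurable_one.indicator hΔ
        left := fun x => Eventually.of_forall fun t F => sum_norm_sq_indicator_le F t
        right := fun x => Eventually.of_forall fun t F => sum_norm_sq_indicator_le F t
        hasSum := fun x y => hasSum_unique _
        meas := ((measurable_one.indicator hΛ).comp measurable_fst).mul
          ((measurable_one.indicator hΔ).comp measurable_snd) }
    have h1 := hsum (fun x y => Λ.indicator 1 x * Δ.indicator 1 y) 1 hrep.meas hrep.norm_le
    have h2 : ∀ q : X × Y, Λ.indicator (1 : X → ℂ) q.1 * Δ.indicator (1 : Y → ℂ) q.2 * g q =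
        (Λ ×ˢ Δ).indicator g q := fun q => by
      by_cases h1 : q.1 ∈ Λ <;> by_cases h2 : q.2 ∈ Δ <;> simp [Set.indicator, h1, h2]
    simp only [h2] at h1
    rw [integral_indicator (hΛ.prod hΔ)] at h1
    refine h1.unique ((hT.hasSum (E₂.proj Δ a) (E₁.proj Λ b)).of_eq fun n => ?_) |>.trans ?_
    · rw [(hrep.hasSum_inner (f n) b a (e n)).unique (hasSum_unique _)]
      rw [SpectralMeasure.hasIntegral_indicator hΛ |>.integral_eq,
        SpectralMeasure.hasIntegral_indicator hΔ |>.integral_eq, E₁.inner_proj_left _ _ hΛ]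
      ring
    · rw [E₁.inner_proj_left _ _ hΛ]
  · refine HasSum.unique ?_ (hsum Φ C h.meas h.norm_le)
    refine (hW a b).prod_fiberwise fun n => ?_
    refine ((h.hasSum_inner (f n) b a (e n)).mul_left (s n : ℂ)).of_eq fun i => ?_
    rw [ContinuousLinearMap.adjoint_inner_left]
    ring

/-- The double operator integral `∬ Φ dE₁ dE₂` of a function with square summable columns. -/
theorem exists_isDOI [Countable ι] (h : IsColumnRep E₁ E₂ Φ φ ψ C) :
    ∃ F : H →L[ℂ] H, IsDOI E₁ E₂ Φ 1 F ∧
      ∀ x y, HasSum (fun i => ⟪y, E₁.integral (φ i) (E₂.integral (ψ i) x)⟫_ℂ) ⟪y, F x⟫_ℂ := by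
  have hp : ∀ y, Summable fun i => ‖ContinuousLinearMap.adjoint (E₁.integral (φ i)) y‖ ^ 2 :=
    fun y => summable_of_sum_le (fun _ => sq_nonneg _) (h.sum_adjoint_le y)
  have hr : ∀ x, Summable fun i => ‖E₂.integral (ψ i) x‖ ^ 2 :=
    fun x => summable_of_sum_le (fun _ => sq_nonneg _) (h.symm.sum_le x)
  have hinner : ∀ (F : Finset ι) (x y : H), ⟪y, (∑ i ∈ F, E₁.integral (φ i) * E₂.integral (ψ i)) x⟫_ℂ
      = ∑ i ∈ F, ⟪ContinuousLinearMap.adjoint (E₁.integral (φ i)) y, E₂.integral (ψ i) x⟫_ℂ :=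
    fun F x y => by
      rw [sum_apply, inner_sum]
      refine Finset.sum_congr rfl fun i _ => ?_
      rw [ContinuousLinearMap.adjoint_inner_left]
      rfl
  obtain ⟨F, hF⟩ := exists_weak_limit (l := (atTop : Filter (Finset ι)))
    (fun F => ∑ i ∈ F, E₁.integral (φ i) * E₂.integral (ψ i)) C (fun F x y => by
      rw [hinner]
      refine (norm_sum_inner_le _ _ _).trans ?_
      calc _ ≤ √(C * ‖y‖ ^ 2) * √(C * ‖x‖ ^ 2) := by
            gcongr
            · exact h.sum_adjoint_le y F
            · exact h.symm.sum_le x F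
        _ = √C * √C * ‖x‖ * ‖y‖ := by
            rw [Real.sqrt_mul h.nonneg, Real.sqrt_mul h.nonneg, Real.sqrt_sq (norm_nonneg _),
              Real.sqrt_sq (norm_nonneg _)]
            ring
        _ = _ := by rw [Real.mul_self_sqrt h.nonneg])
    (fun x y => ⟨_, by simp only [hinner]; exact (summable_inner_of_sq (hp y) (hr x)).hasSum⟩)
  have hF' : ∀ x y, HasSum (fun i => ⟪y, E₁.integral (φ i) (E₂.integral (ψ i) x)⟫_ℂ) ⟪y, F x⟫_ℂ :=
    fun x y => by
      have := hF x y
      simp only [hinner, ContinuousLinearMap.adjoint_inner_left] at this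
      exact this
  refine ⟨F, ⟨⟨⟨h.symm.meas, C, h.symm.norm_le⟩, fun T hT => ?_⟩, fun Q hQ Y hY => ?_⟩, hF'⟩
  · obtain ⟨κ, hκ, e, f, s, hsvd⟩ := hT.exists_countable_isSVD one_pos
    obtain ⟨W, hW, hW1, -⟩ := h.symm.exists_isHilbertSchmidtDOI hT hsvd
    exact ⟨W, hW, hW1⟩
  · obtain ⟨κ, hκ, e, f, s, hsvd⟩ := hQ.exists_countable_isSVD one_pos
    obtain ⟨W, hW, hW1, htr⟩ := h.symm.exists_isHilbertSchmidtDOI hQ hsvd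
    rw [one_mul, hY.unique hW]
    -- Both traces equal `∑_n s_n ∑_i ⟪e_n, E₁(φ_i) E₂(ψ_i) f_n⟫`: one by the weak series for `F`,
    -- the other by the nuclear series of the double operator integral.
    have h1 := hsvd.trace_mul_left le_rfl one_le_two (X := F) (fun h => absurd rfl h)
    refine h1.2.unique (htr.prod_fiberwise fun n => (hF' (f n) (e n)).mul_left _)

end IsColumnRep

end DoubleIntegral

/-! ### Sums of translates of Schwartz functions -/

section Decay

theorem summable_int_weight : Summable fun j : ℤ => 1 / (1 + (j : ℝ) ^ 2) := by
  refine Summable.of_norm_bounded_eventually (Real.summable_one_div_int_pow (p := 2).2 one_lt_two) ?_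
  rw [Filter.eventually_cofinite]
  refine (Set.finite_singleton (0 : ℤ)).subset fun j hj => ?_
  by_contra h0
  have hj0 : (j : ℝ) ≠ 0 := by simpa using h0
  refine hj ?_
  rw [Real.norm_of_nonneg (by positivity)]
  exact one_div_le_one_div_of_le (by positivity) (by linarith)

theorem SchwartzMap.exists_decay (ψ : SchwartzMap ℝ ℂ) :
    ∃ C : ℝ, 0 ≤ C ∧ ∀ t, ‖ψ t‖ ≤ C * (1 / (1 + t ^ 2)) := by
  obtain ⟨C₀, -, h0⟩ := ψ.decay 0 0
  obtain ⟨C₂, -, h2⟩ := ψ.decay 2 0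
  simp only [norm_iteratedFDeriv_zero, pow_zero, one_mul] at h0 h2
  have hle : ∀ t, ‖ψ t‖ * (1 + t ^ 2) ≤ C₀ + C₂ := fun t => by
    have h2' := h2 t
    rw [Real.norm_eq_abs, sq_abs] at h2'
    nlinarith [h0 t]
  refine ⟨C₀ + C₂, le_trans (by positivity) (hle 0), fun t => ?_⟩
  rw [mul_one_div, le_div_iff₀ (by positivity)]
  exact hle t

theorem weight_shift_le {Y y : ℝ} (hy : |y| ≤ Y) (t : ℝ) :
    1 / (1 + (y - t) ^ 2) ≤ (2 + 2 * Y ^ 2) * (1 / (1 + t ^ 2)) := by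
  rw [mul_one_div, div_le_div_iff₀ (by positivity) (by positivity)]
  have h1 : y ^ 2 ≤ Y ^ 2 := sq_le_sq' (neg_le_of_abs_le hy) (le_of_abs_le hy)
  nlinarith [sq_nonneg (y - t - y), sq_nonneg (2 * y - t), sq_nonneg Y,
    mul_nonneg (sq_nonneg Y) (sq_nonneg (y - t))]

/-- Locally uniform summability of the translates of a Schwartz function. -/
theorem SchwartzMap.exists_summable_bound (ψ : SchwartzMap ℝ ℂ) (Y : ℝ) :
    ∃ u : ℤ → ℝ, Summable u ∧ ∀ y, |y| ≤ Y → ∀ j : ℤ, ‖ψ (y - j)‖ ≤ u j := by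
  obtain ⟨C, hC0, hC⟩ := SchwartzMap.exists_decay ψ
  refine ⟨fun j => C * ((2 + 2 * Y ^ 2) * (1 / (1 + (j : ℝ) ^ 2))),
    (summable_int_weight.mul_left _).mul_left _, fun y hy j => (hC _).trans ?_⟩
  exact mul_le_mul_of_nonneg_left (weight_shift_le hy _) hC0

theorem SchwartzMap.summable_translates (ψ : SchwartzMap ℝ ℂ) (x : ℝ) :
    Summable fun j : ℤ => ‖ψ (x - j)‖ := by
  obtain ⟨u, hu, h⟩ := SchwartzMap.exists_summable_bound ψ |x|
  exact hu.of_nonneg_of_le (fun _ => norm_nonneg _) fun j => h x le_rfl j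

/-- The sum is periodic in `x`, so it suffices to bound it on `[0,1]`, where the terms have a common
summable majorant. -/
theorem SchwartzMap.exists_tsum_translates_le (ψ : SchwartzMap ℝ ℂ) :
    ∃ K : ℝ, 0 ≤ K ∧ ∀ x, ∑' j : ℤ, ‖ψ (x - j)‖ ≤ K := by
  obtain ⟨u, hu, h⟩ := SchwartzMap.exists_summable_bound ψ 1
  have hle : ∀ x, ∑' j : ℤ, ‖ψ (x - j)‖ ≤ ∑' j, u j := fun x => by
    have h1 : ∑' j : ℤ, ‖ψ (x - j)‖ = ∑' j : ℤ, ‖ψ (Int.fract x - j)‖ := by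
      rw [← (Equiv.addRight ⌊x⌋).tsum_eq]
      refine tsum_congr fun j => ?_
      congr 2
      rw [Equiv.coe_addRight, Int.fract]
      push_cast
      ring
    rw [h1]
    refine (SchwartzMap.summable_translates ψ _).tsum_le_tsum (fun j => h _ ?_ j) hu
    rw [abs_of_nonneg (Int.fract_nonneg x)]
    exact (Int.fract_lt_one x).le
  exact ⟨_, (tsum_nonneg fun _ => norm_nonneg _).trans (hle 0), hle⟩

end Decay

/-! ### The sampling kernel and Poisson summation -/

section SamplingKernel

/-- A smooth function equal to `1` on `[-1/4, 1/4]` and to `0` outside `(-3/4, 3/4)`. -/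
noncomputable def lowPassBump : ContDiffBump (0 : ℝ) where
  rIn := 1 / 4
  rOut := 3 / 4
  rIn_pos := by norm_num
  rIn_lt_rOut := by norm_num

theorem lowPass_hasCompactSupport : HasCompactSupport fun x => (lowPassBump x : ℂ) :=
  lowPassBump.hasCompactSupport.comp_left Complex.ofReal_zero

noncomputable def lowPass : SchwartzMap ℝ ℂ :=
  lowPass_hasCompactSupport.toSchwartzMap (Complex.ofRealCLM.contDiff.comp lowPassBump.contDiff)

theorem lowPass_apply (x : ℝ) : lowPass x = (lowPassBump x : ℂ) := rfl

/-- The kernel of the sampling formula for functions with spectrum in `[-1/4, 1/4]`. -/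
noncomputable def samplingKernel : SchwartzMap ℝ ℂ := FourierTransformInv.fourierInv lowPass

/-- The character `x ↦ e^{2 π i s x}`. -/
noncomputable def expChar (s x : ℝ) : ℂ := Complex.exp (2 * Real.pi * s * x * Complex.I)

theorem norm_expChar (s x : ℝ) : ‖expChar s x‖ = 1 := by
  rw [expChar]
  have := Complex.norm_exp_ofReal_mul_I (2 * Real.pi * s * x)
  push_cast at this
  exact this

theorem expChar_add (s x y : ℝ) : expChar s (x + y) = expChar s x * expChar s y := by
  rw [expChar, expChar, expChar, ← Complex.exp_add]
  congr 1
  push_cast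
  ring

theorem continuous_expChar (s : ℝ) : Continuous (expChar s) := by
  unfold expChar; fun_prop

/-- Translation on the Fourier side is modulation. Thus Poisson summation for the kernel times a
character involves only the values of the bump at the points `n + s`. -/
theorem fourierInv_shift (s u : ℝ) :
    (FourierTransformInv.fourierInv (lowPass.compSubConstCLM ℂ (-s)) : SchwartzMap ℝ ℂ) u =
      expChar s (-u) * samplingKernel u := by
  rw [samplingKernel, SchwartzMap.fourierInv_coe, SchwartzMap.fourierInv_coe,
    Real.fourierInv_eq', Real.fourierInv_eq',
    ← integral_sub_right_eq_self _ s, ← integral_const_mul]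
  congr 1
  ext v
  simp only [SchwartzMap.compSubConstCLM_apply, smul_eq_mul, sub_neg_eq_add]
  rw [sub_add_cancel, ← mul_assoc]
  congr 1
  rw [expChar, ← Complex.exp_add]
  congr 1
  simp only [RCLike.inner_apply, conj_trivial]
  push_cast
  ring

/-- The sampling formula for characters. -/
theorem hasSum_sampling_expChar {s : ℝ} (hs : |s| ≤ 1 / 4) (x : ℝ) :
    HasSum (fun j : ℤ => samplingKernel (x - j) * expChar s j) (expChar s x) := by
  have h1 := SchwartzMap.tsum_eq_tsum_fourier
    (FourierTransformInv.fourierInv (lowPass.compSubConstCLM ℂ (-s))) x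
  have h2 : ∀ n : ℤ, (FourierTransform.fourier (FourierTransformInv.fourierInv
      (lowPass.compSubConstCLM ℂ (-s)) : SchwartzMap ℝ ℂ) : SchwartzMap ℝ ℂ) n =
      if n = 0 then 1 else 0 := fun n => by
    rw [FourierTransform.fourier_fourierInv_eq, SchwartzMap.compSubConstCLM_apply, lowPass_apply,
      sub_neg_eq_add]
    split_ifs with hn
    · subst hn
      rw [lowPassBump.one_of_mem_closedBall, Complex.ofReal_one]
      simpa [lowPassBump] using hs
    · rw [lowPassBump.zero_of_le_dist, Complex.ofReal_zero]
      rw [dist_zero_right, Real.norm_eq_abs]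
      -- For `n ≠ 0` the point `n + s` lies at distance at least `1 - 1/4 = 3/4` from the origin,
      -- outside the open support of the bump; for `n = 0` it lies where the bump equals `1`. Only
      -- the term `n = 0` survives.
      have h3 : (1 : ℝ) ≤ |(n : ℝ)| := by exact_mod_cast Int.one_le_abs hn
      have h4 : |(n : ℝ)| ≤ |(n : ℝ) + s| + |s| := by
        calc |(n : ℝ)| = |((n : ℝ) + s) - s| := by ring_nf
          _ ≤ _ := abs_sub _ _
      have h5 : lowPassBump.rOut = 3 / 4 := rfl
      linarith
  simp only [h2, fourierInv_shift] at h1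
  have h3 : ∑' n : ℤ, (if n = 0 then (1 : ℂ) else 0) * fourier n (x : UnitAddCircle) = 1 := by
    rw [tsum_eq_single 0 (fun n hn => by simp [hn])]
    simp
  rw [h3] at h1
  have hsum : Summable fun j : ℤ => samplingKernel (x - j) * expChar s j := by
    refine Summable.of_norm ((SchwartzMap.summable_translates samplingKernel x).congr fun j => ?_)
    rw [norm_mul, norm_expChar, mul_one]
  convert hsum.hasSum using 1
  rw [← mul_one (expChar s x), ← h1, ← tsum_mul_left, ← (Equiv.neg ℤ).tsum_eq]
  refine tsum_congr fun j => ?_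
  have e : x + ((-j : ℤ) : ℝ) = x - j := by push_cast; ring
  rw [Equiv.neg_apply, e, ← mul_assoc, ← expChar_add, mul_comm]
  congr 2
  ring

end SamplingKernel

/-! ### Regularisation of the Fourier transform -/

section Mollifier

variable (V : Type*) [NormedAddCommGroup V] [InnerProductSpace ℝ V] [FiniteDimensional ℝ V]
  [MeasurableSpace V] [BorelSpace V]

/-- The offset `12` keeps the enlarged spectrum inside the ball of radius `1/4` of the sampling
formula: `1/4 - 1/12 = 1/6`, and `2π/6 > 1`. -/
noncomputable def mollifierBump (n : ℕ) : ContDiffBump (0 : V) where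
  rIn := 1 / (2 * ((n : ℝ) + 12))
  rOut := 1 / ((n : ℝ) + 12)
  rIn_pos := by positivity
  rIn_lt_rOut := one_div_lt_one_div_of_lt (by positivity) (by linarith [n.cast_nonneg (α := ℝ)])

theorem mollifier_hasCompactSupport (n : ℕ) :
    HasCompactSupport fun v : V => (((mollifierBump V n).normed volume v : ℝ) : ℂ) :=
  (mollifierBump V n).hasCompactSupport_normed.comp_left Complex.ofReal_zero

/-- An approximate identity of smooth functions with supports shrinking to the origin. -/
noncomputable def mollifier (n : ℕ) : SchwartzMap V ℂ :=
  (mollifier_hasCompactSupport V n).toSchwartzMap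
    (Complex.ofRealCLM.contDiff.comp (mollifierBump V n).contDiff_normed)

variable {V}

theorem mollifier_apply (n : ℕ) (v : V) :
    mollifier V n v = (((mollifierBump V n).normed volume v : ℝ) : ℂ) := rfl

theorem norm_mollifier (n : ℕ) (v : V) :
    ‖mollifier V n v‖ = (mollifierBump V n).normed volume v := by
  rw [mollifier_apply, Complex.norm_real, Real.norm_of_nonneg ((mollifierBump V n).nonneg_normed v)]

theorem mollifier_eq_zero {n : ℕ} {v : V} (hv : 1 / ((n : ℝ) + 12) < ‖v‖) :
    mollifier V n v = 0 := by
  have h : v ∉ tsupport ((mollifierBump V n).normed volume) := by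
    rw [ContDiffBump.tsupport_normed_eq]
    simpa [mollifierBump] using hv
  rw [mollifier_apply, image_eq_zero_of_notMem_tsupport h, Complex.ofReal_zero]

theorem integral_mollifier (n : ℕ) : ∫ v, mollifier V n v = 1 := by
  simp only [mollifier_apply]
  rw [integral_complex_ofReal, ContDiffBump.integral_normed, Complex.ofReal_one]

theorem integral_norm_mollifier (n : ℕ) : ∫ v, ‖mollifier V n v‖ = 1 := by
  simp only [norm_mollifier]
  exact ContDiffBump.integral_normed _

theorem norm_exp_ofReal_mul_I_mul (t : ℝ) (z : ℂ) : ‖Complex.exp (t * Complex.I) • z‖ = ‖z‖ := by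
  rw [norm_smul, Complex.norm_exp_ofReal_mul_I, one_mul]

theorem norm_fourier_mollifier_le (n : ℕ) (x : V) :
    ‖(FourierTransform.fourier (mollifier V n) : SchwartzMap V ℂ) x‖ ≤ 1 := by
  rw [SchwartzMap.fourier_coe, Real.fourier_eq', ← integral_norm_mollifier (V := V) n]
  refine (norm_integral_le_integral_norm _).trans (le_of_eq (integral_congr_ae ?_))
  exact Eventually.of_forall fun v => norm_exp_ofReal_mul_I_mul _ _

theorem norm_fourier_mollifier_sub_one_le (n : ℕ) (x : V) :
    ‖(FourierTransform.fourier (mollifier V n) : SchwartzMap V ℂ) x - 1‖ ≤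
      2 * Real.pi * ‖x‖ * (1 / ((n : ℝ) + 12)) := by
  have hint : Integrable (mollifier V n) := (mollifier V n).integrable
  rw [SchwartzMap.fourier_coe, Real.fourier_eq']
  have hi : Integrable fun v : V =>
      Complex.exp (((-2 * Real.pi * ⟪v, x⟫_ℝ : ℝ) : ℂ) * Complex.I) • mollifier V n v := by
    refine (integrable_norm_iff (Continuous.aestronglyMeasurable ?_)).1
      (hint.norm.congr (Eventually.of_forall fun v => ?_))
    · have := (mollifier V n).continuous
      fun_prop
    · exact (norm_exp_ofReal_mul_I_mul _ _).symm
  rw [← integral_mollifier (V := V) n, ← integral_sub hi hint]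
  have h1 : 2 * Real.pi * ‖x‖ * (1 / ((n : ℝ) + 12)) =
      ∫ v, 2 * Real.pi * ‖x‖ * (1 / ((n : ℝ) + 12)) * ‖mollifier V n v‖ := by
    rw [integral_const_mul, integral_norm_mollifier, mul_one]
  rw [h1]
  refine norm_integral_le_of_norm_le (hint.norm.const_mul _) (Eventually.of_forall fun v => ?_)
  by_cases hv : 1 / ((n : ℝ) + 12) < ‖v‖
  · simp [mollifier_eq_zero hv]
  · rw [smul_eq_mul, ← sub_one_mul, norm_mul]
    refine mul_le_mul_of_nonneg_right ?_ (norm_nonneg _)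
    rw [mul_comm _ Complex.I]
    refine Real.norm_exp_I_mul_ofReal_sub_one_le.trans ?_
    rw [norm_mul, Real.norm_of_nonpos (by linarith [Real.pi_pos])]
    have h2 := norm_inner_le_norm (𝕜 := ℝ) v x
    have h3 : ‖v‖ * ‖x‖ ≤ 1 / ((n : ℝ) + 12) * ‖x‖ :=
      mul_le_mul_of_nonneg_right (not_lt.1 hv) (norm_nonneg _)
    nlinarith [Real.pi_pos]

theorem tendsto_fourier_mollifier (x : V) :
    Tendsto (fun n => (FourierTransform.fourier (mollifier V n) : SchwartzMap V ℂ) x) atTop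
      (𝓝 1) := by
  rw [tendsto_iff_norm_sub_tendsto_zero]
  refine squeeze_zero (fun _ => norm_nonneg _) (fun n => norm_fourier_mollifier_sub_one_le n x) ?_
  have : Tendsto (fun n : ℕ => 1 / ((n : ℝ) + 12)) atTop (𝓝 0) := by
    simp only [one_div]
    exact tendsto_inv_atTop_zero.comp (tendsto_atTop_add_const_right _ _ tendsto_natCast_atTop_atTop)
  simpa using this.const_mul (2 * Real.pi * ‖x‖)

end Mollifier

/-- Dominated convergence for series, used to pass from regularised functions, and later from
difference quotients, to the limit in the sampling formula. -/
theorem hasSum_mul_of_tendsto {ι : Type*} {u : ι → ℂ} (hu : Summable fun i => ‖u i‖)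
    {c : ℕ → ι → ℂ} {s : ℕ → ℂ} {c₀ : ι → ℂ} {s₀ : ℂ} {M : ℝ} (hM : ∀ n i, ‖c n i‖ ≤ M)
    (hc : ∀ i, Tendsto (fun n => c n i) atTop (𝓝 (c₀ i))) (hs : Tendsto s atTop (𝓝 s₀))
    (h : ∀ n, HasSum (fun i => u i * c n i) (s n)) : HasSum (fun i => u i * c₀ i) s₀ := by
  have hM0 : ∀ i, ‖c₀ i‖ ≤ M := fun i => le_of_tendsto (hc i).norm (Eventually.of_forall fun n => hM n i)
  have hsum : Summable fun i => u i * c₀ i := by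
    refine Summable.of_norm_bounded (hu.mul_right M) fun i => ?_
    rw [norm_mul]
    exact mul_le_mul_of_nonneg_left (hM0 i) (norm_nonneg _)
  have ht : Tendsto (fun n => ∑' i, u i * c n i) atTop (𝓝 (∑' i, u i * c₀ i)) := by
    refine tendsto_tsum_of_dominated_convergence (hu.mul_right M) (fun i => (hc i).const_mul _)
      (Eventually.of_forall fun n i => ?_)
    rw [norm_mul]
    exact mul_le_mul_of_nonneg_left (hM n i) (norm_nonneg _)
  rw [← tendsto_nhds_unique (ht.congr fun n => (h n).tsum_eq) hs]
  exact hsum.hasSum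

/-! ### The sampling formula for band-limited functions -/

section BandLimited

variable {d : ℕ}

local notation "𝔼" => EuclideanSpace ℝ (Fin d)

/-- The Fourier integral at `η` is the pairing of `g` with the transform of the mollifier translated
to `η`. For `‖η‖ > 1/4` this translate is supported off the spectrum of `g`. -/
theorem IsUnitBandLimited.fourier_mul_mollifier_eq_zero {g : 𝔼 → ℂ} (hg : IsUnitBandLimited g)
    (n : ℕ) {η : 𝔼} (hη : 1 / 4 < ‖η‖) :
    FourierTransform.fourier (fun x => g x *
      (FourierTransform.fourier (mollifier 𝔼 n) : SchwartzMap 𝔼 ℂ) x) η = 0 := by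
  have h := hg.2.2 ((mollifier 𝔼 n).compSubConstCLM ℂ η) ?_
  · rw [Real.fourier_eq', ← h]
    congr 1
    ext x
    rw [smul_eq_mul, SchwartzMap.fourier_coe, SchwartzMap.fourier_coe, Real.fourier_eq',
      Real.fourier_eq', ← integral_sub_right_eq_self (fun v => Complex.exp
        (((-2 * Real.pi * ⟪v, x⟫_ℝ : ℝ) : ℂ) * Complex.I) • mollifier 𝔼 n v) η,
      mul_left_comm, ← integral_const_mul]
    congr 2
    ext v
    simp only [SchwartzMap.compSubConstCLM_apply, smul_eq_mul]
    rw [← mul_assoc, ← Complex.exp_add]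
    congr 2
    rw [inner_sub_left, real_inner_comm x η]
    push_cast
    ring
  · intro ξ hξ
    have hcl : tsupport ((mollifier 𝔼 n).compSubConstCLM ℂ η) ⊆
        Metric.closedBall η (1 / ((n : ℝ) + 12)) := by
      refine closure_minimal (fun v hv => ?_) Metric.isClosed_closedBall
      rw [Metric.mem_closedBall, dist_eq_norm]
      by_contra hlt
      exact hv (by rw [SchwartzMap.compSubConstCLM_apply, mollifier_eq_zero (not_le.1 hlt)])
    have h1 := hcl hξ
    rw [Metric.mem_closedBall, dist_eq_norm] at h1
    -- A point `ξ` of the support has norm greater than `1/4 - 1/12 = 1/6`, so `2π‖ξ‖ > 1` follows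
    -- from `π > 3`.
    have h2 : 1 / ((n : ℝ) + 12) ≤ 1 / 12 :=
      one_div_le_one_div_of_le (by norm_num) (by linarith [n.cast_nonneg (α := ℝ)])
    have h3 : ‖η‖ ≤ ‖ξ‖ + ‖ξ - η‖ := by
      calc ‖η‖ = ‖ξ - (ξ - η)‖ := by rw [sub_sub_cancel]
        _ ≤ _ := norm_sub_le _ _
    nlinarith [Real.pi_gt_three]

/-- The sampling formula for integrable functions with spectrum in the ball of radius `1/4`. -/
theorem hasSum_sampling_of_fourier_eq_zero {h : 𝔼 → ℂ} (hc : Continuous h) (hi : Integrable h)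
    (h0 : ∀ η : 𝔼, 1 / 4 < ‖η‖ → FourierTransform.fourier h η = 0) (z v : 𝔼) (hv : ‖v‖ ≤ 1)
    (x : ℝ) :
    HasSum (fun j : ℤ => samplingKernel (x - j) * h (z + (j : ℝ) • v)) (h (z + x • v)) := by
  have hFc : Continuous (FourierTransform.fourier h) :=
    VectorFourier.fourierIntegral_continuous Real.continuous_fourierChar
      (by exact continuous_inner) hi
  have hFi : Integrable (FourierTransform.fourier h) := by
    refine hFc.integrable_of_hasCompactSupport
      (HasCompactSupport.of_support_subset_isCompact (isCompact_closedBall (0 : 𝔼) (1 / 4)) ?_)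
    intro η hη
    rw [mem_closedBall_zero_iff]
    by_contra hlt
    exact hη (h0 η (not_le.1 hlt))
  have hinv : ∀ t : ℝ, h (z + t • v) = ∫ η : 𝔼, expChar ⟪η, v⟫_ℝ t *
      (Complex.exp (((2 * Real.pi * ⟪η, z⟫_ℝ : ℝ) : ℂ) * Complex.I) *
        FourierTransform.fourier h η) := fun t => by
    conv_lhs => rw [← hc.fourierInv_fourier_eq hi hFi]
    rw [Real.fourierInv_eq']
    congr 1
    ext η
    rw [smul_eq_mul, ← mul_assoc, expChar, ← Complex.exp_add]
    congr 2
    rw [inner_add_right, inner_smul_right]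
    push_cast
    ring
  have hn : ∀ (t : ℝ) (η : 𝔼), ‖expChar ⟪η, v⟫_ℝ t *
      (Complex.exp (((2 * Real.pi * ⟪η, z⟫_ℝ : ℝ) : ℂ) * Complex.I) *
        FourierTransform.fourier h η)‖ = ‖FourierTransform.fourier h η‖ := fun t η => by
    rw [norm_mul, norm_mul, norm_expChar, Complex.norm_exp_ofReal_mul_I, one_mul, one_mul]
  have hI : ∀ t : ℝ, Integrable fun η : 𝔼 => expChar ⟪η, v⟫_ℝ t *
      (Complex.exp (((2 * Real.pi * ⟪η, z⟫_ℝ : ℝ) : ℂ) * Complex.I) *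
        FourierTransform.fourier h η) := fun t => by
    refine (integrable_norm_iff (Continuous.aestronglyMeasurable ?_)).1
      (hFi.norm.congr (Eventually.of_forall fun η => (hn t η).symm))
    unfold expChar
    fun_prop
  -- Sampling is applied to each character `t ↦ e^{2πi⟪η,v⟫t}` under the Fourier inversion integral;
  -- the interchange is justified by `∑_j |κ(x - j)| < ∞` and integrability of the transform.
  have key := hasSum_integral_of_summable_integral_norm
    (F := fun (j : ℤ) (η : 𝔼) => samplingKernel (x - j) * (expChar ⟪η, v⟫_ℝ j *
      (Complex.exp (((2 * Real.pi * ⟪η, z⟫_ℝ : ℝ) : ℂ) * Complex.I) *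
        FourierTransform.fourier h η))) (μ := volume) (fun j => (hI j).const_mul _) ?_
  · have e : (fun η : 𝔼 => ∑' j : ℤ, samplingKernel (x - j) * (expChar ⟪η, v⟫_ℝ j *
        (Complex.exp (((2 * Real.pi * ⟪η, z⟫_ℝ : ℝ) : ℂ) * Complex.I) *
        FourierTransform.fourier h η))) = fun η : 𝔼 => expChar ⟪η, v⟫_ℝ x *
        (Complex.exp (((2 * Real.pi * ⟪η, z⟫_ℝ : ℝ) : ℂ) * Complex.I) *
          FourierTransform.fourier h η) := by
      funext η
      by_cases hη : 1 / 4 < ‖η‖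
      · simp [h0 η hη]
      · have hs : |⟪η, v⟫_ℝ| ≤ 1 / 4 := by
          refine (abs_real_inner_le_norm η v).trans ?_
          calc ‖η‖ * ‖v‖ ≤ 1 / 4 * 1 := mul_le_mul (not_lt.1 hη) hv (norm_nonneg _) (by norm_num)
            _ = 1 / 4 := mul_one _
        have := (hasSum_sampling_expChar hs x).mul_right
          (Complex.exp (((2 * Real.pi * ⟪η, z⟫_ℝ : ℝ) : ℂ) * Complex.I) *
            FourierTransform.fourier h η)
        simp only [mul_assoc] at this ⊢
        exact this.tsum_eq
    rw [e, ← hinv] at key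
    refine HasSum.of_eq key (fun j => ?_)
    rw [integral_const_mul, hinv]
  · simp only [norm_mul (samplingKernel _), hn, integral_const_mul]
    exact (SchwartzMap.summable_translates samplingKernel x).mul_right _

/-- Multiplication by the Fourier transform of the mollifier makes `g` integrable, keeps it bounded
by `1`, and enlarges the spectrum only slightly. The formula for these products passes to the limit.
-/
theorem IsUnitBandLimited.hasSum_sampling {g : 𝔼 → ℂ} (hg : IsUnitBandLimited g) (z v : 𝔼)
    (hv : ‖v‖ ≤ 1) (x : ℝ) :
    HasSum (fun j : ℤ => samplingKernel (x - j) * g (z + (j : ℝ) • v)) (g (z + x • v)) := by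
  have hlim : ∀ y : 𝔼, Tendsto (fun n => g y *
      (FourierTransform.fourier (mollifier 𝔼 n) : SchwartzMap 𝔼 ℂ) y) atTop (𝓝 (g y)) := fun y => by
    simpa using (tendsto_fourier_mollifier y).const_mul (g y)
  refine hasSum_mul_of_tendsto (M := 1) (SchwartzMap.summable_translates samplingKernel x)
    (fun n j => ?_) (fun j => hlim _) (hlim _)
    (fun n => hasSum_sampling_of_fourier_eq_zero
      (h := fun y => g y * (FourierTransform.fourier (mollifier 𝔼 n) : SchwartzMap 𝔼 ℂ) y)
      (hg.1.mul (SchwartzMap.continuous _)) ?_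
      (fun η hη => hg.fourier_mul_mollifier_eq_zero n hη) z v hv x)
  · rw [norm_mul]
    exact mul_le_one₀ (hg.2.1 _) (norm_nonneg _) (norm_fourier_mollifier_le n _)
  · exact (SchwartzMap.integrable _).bdd_mul hg.1.aestronglyMeasurable
      (Eventually.of_forall hg.2.1)

end BandLimited

/-! ### Sampled functions of one variable, Bernstein's inequality, divided differences -/

section Sampled

/-- A bounded function is recovered from its samples at the points of every arithmetic progression
of step at most `1`. -/
structure IsSampled (M : ℝ) (φ : ℝ → ℂ) : Prop where
  norm_le : ∀ x, ‖φ x‖ ≤ M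
  hasSum_affine : ∀ a b x : ℝ, |a| ≤ 1 →
    HasSum (fun j : ℤ => samplingKernel (x - j) * φ (a * j + b)) (φ (a * x + b))

noncomputable def samplingKernelDeriv : SchwartzMap ℝ ℂ := SchwartzMap.derivCLM ℂ ℂ samplingKernel

theorem hasDerivAt_samplingKernel (x : ℝ) :
    HasDerivAt samplingKernel (samplingKernelDeriv x) x := by
  rw [samplingKernelDeriv, SchwartzMap.derivCLM_apply]
  exact samplingKernel.differentiableAt.hasDerivAt

/-- The constant in Bernstein's inequality for sampled functions. -/
noncomputable def bernsteinConst : ℝ :=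
  (SchwartzMap.exists_tsum_translates_le samplingKernelDeriv).choose

theorem bernsteinConst_nonneg : 0 ≤ bernsteinConst :=
  (SchwartzMap.exists_tsum_translates_le samplingKernelDeriv).choose_spec.1

theorem tsum_samplingKernelDeriv_le (x : ℝ) :
    ∑' j : ℤ, ‖samplingKernelDeriv (x - j)‖ ≤ bernsteinConst :=
  (SchwartzMap.exists_tsum_translates_le samplingKernelDeriv).choose_spec.2 x

namespace IsSampled

variable {M : ℝ} {φ : ℝ → ℂ}

theorem nonneg (h : IsSampled M φ) : 0 ≤ M := (norm_nonneg _).trans (h.norm_le 0)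

theorem hasSum (h : IsSampled M φ) (x : ℝ) :
    HasSum (fun j : ℤ => samplingKernel (x - j) * φ j) (φ x) := by
  simpa using h.hasSum_affine 1 0 x (by simp)

/-- The sampling series is differentiated term by term; on bounded intervals the derivatives have a
summable majorant. Bernstein's inequality is read off from this formula. -/
theorem hasDerivAt_tsum (h : IsSampled M φ) (x : ℝ) :
    HasDerivAt φ (∑' j : ℤ, samplingKernelDeriv (x - j) * φ j) x := by
  obtain ⟨u, hu, hle⟩ := SchwartzMap.exists_summable_bound samplingKernelDeriv (|x| + 1)
  have hx : x ∈ Metric.ball (0 : ℝ) (|x| + 1) := by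
    rw [mem_ball_zero_iff, Real.norm_eq_abs]; linarith
  have key := hasDerivAt_tsum_of_isPreconnected
    (g := fun (j : ℤ) t => samplingKernel (t - j) * φ j)
    (g' := fun (j : ℤ) t => samplingKernelDeriv (t - j) * φ j)
    (hu.mul_right M) Metric.isOpen_ball (convex_ball (0 : ℝ) (|x| + 1)).isPreconnected
    (fun j t _ => ((hasDerivAt_samplingKernel (t - j)).comp_sub_const t (j : ℝ)).mul_const _)
    (fun j t ht => ?_) hx (h.hasSum x).summable hx
  · rwa [show (fun z => ∑' j : ℤ, samplingKernel (z - j) * φ j) = φ from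
      funext fun z => (h.hasSum z).tsum_eq] at key
  · rw [mem_ball_zero_iff, Real.norm_eq_abs] at ht
    rw [norm_mul]
    exact mul_le_mul (hle t ht.le j) (h.norm_le _) (norm_nonneg _)
      ((norm_nonneg _).trans (hle t ht.le j))

theorem differentiableAt (h : IsSampled M φ) (x : ℝ) : DifferentiableAt ℝ φ x :=
  (h.hasDerivAt_tsum x).differentiableAt

theorem continuous (h : IsSampled M φ) : Continuous φ :=
  continuous_iff_continuousAt.2 fun x => (h.differentiableAt x).continuousAt

theorem norm_deriv_le (h : IsSampled M φ) (x : ℝ) : ‖deriv φ x‖ ≤ bernsteinConst * M := by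
  rw [(h.hasDerivAt_tsum x).deriv]
  have hs := (SchwartzMap.summable_translates samplingKernelDeriv x).mul_right M
  refine (tsum_of_norm_bounded hs.hasSum fun j => ?_).trans ?_
  · rw [norm_mul]
    exact mul_le_mul_of_nonneg_left (h.norm_le _) (norm_nonneg _)
  · rw [tsum_mul_right]
    exact mul_le_mul_of_nonneg_right (tsum_samplingKernelDeriv_le x) h.nonneg

theorem norm_sub_le (h : IsSampled M φ) (x y : ℝ) :
    ‖φ x - φ y‖ ≤ bernsteinConst * M * |x - y| :=
  convex_univ.norm_image_sub_le_of_norm_deriv_le (fun t _ => h.differentiableAt t)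
    (fun t _ => h.norm_deriv_le t) (Set.mem_univ y) (Set.mem_univ x)

/-- Difference quotients are combinations of translates, for which the affine sampling formula
holds. By Bernstein they are uniformly bounded, so the formula passes to the derivative. -/
protected theorem deriv (h : IsSampled M φ) : IsSampled (bernsteinConst * M) (deriv φ) := by
  refine ⟨h.norm_deriv_le, fun a b x ha => ?_⟩
  have hpos : ∀ n : ℕ, (0 : ℝ) < 1 / ((n : ℝ) + 1) := fun n => Nat.one_div_pos_of_nat
  have hlim : ∀ y, Tendsto (fun n : ℕ => (((1 / ((n : ℝ) + 1))⁻¹ : ℝ) : ℂ) *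
      (φ (y + 1 / ((n : ℝ) + 1)) - φ y)) atTop (𝓝 (deriv φ y)) := fun y => by
    have h1 := (h.differentiableAt y).hasDerivAt.tendsto_slope_zero_right
    have h2 : Tendsto (fun n : ℕ => 1 / ((n : ℝ) + 1)) atTop (𝓝[>] 0) :=
      tendsto_nhdsWithin_iff.2 ⟨tendsto_one_div_add_atTop_nhds_zero_nat,
        Eventually.of_forall hpos⟩
    exact (h1.comp h2).congr fun n => by simp only [Function.comp, Complex.real_smul]
  refine hasSum_mul_of_tendsto (M := bernsteinConst * M)
    (SchwartzMap.summable_translates samplingKernel x) (fun n j => ?_) (fun j => hlim _) (hlim _)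
    fun n => ?_
  · rw [norm_mul, Complex.norm_real, norm_inv, Real.norm_of_nonneg (hpos n).le,
      inv_mul_le_iff₀ (hpos n)]
    refine (h.norm_sub_le _ _).trans (le_of_eq ?_)
    rw [add_sub_cancel_left, abs_of_pos (hpos n), mul_comm]
  · have h1 := ((h.hasSum_affine a (b + 1 / ((n : ℝ) + 1)) x ha).sub
      (h.hasSum_affine a b x ha)).mul_left (((1 / ((n : ℝ) + 1))⁻¹ : ℝ) : ℂ)
    rw [← add_assoc] at h1
    refine h1.of_eq fun j => ?_
    rw [← add_assoc]
    ring

theorem continuous_deriv (h : IsSampled M φ) : Continuous (deriv φ) := h.deriv.continuous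

end IsSampled

/-- The divided difference of a function of one real variable. -/
noncomputable def divDiff (φ : ℝ → ℂ) (x y : ℝ) : ℂ :=
  if x = y then deriv φ x else (φ x - φ y) / ((x - y : ℝ) : ℂ)

theorem divDiff_comm (φ : ℝ → ℂ) (x y : ℝ) : divDiff φ x y = divDiff φ y x := by
  unfold divDiff
  by_cases h : x = y
  · subst h; rfl
  · rw [if_neg h, if_neg (Ne.symm h), ← neg_sub (φ y), ← neg_sub y x, Complex.ofReal_neg,
      neg_div_neg_eq]

theorem sub_mul_divDiff (φ : ℝ → ℂ) (x y : ℝ) :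
    ((x : ℂ) - y) * divDiff φ x y = φ x - φ y := by
  unfold divDiff
  by_cases h : x = y
  · subst h; simp
  · rw [if_neg h, Complex.ofReal_sub]
    exact mul_div_cancel₀ _ (by rw [sub_ne_zero]; exact_mod_cast h)

namespace IsSampled

variable {M : ℝ} {φ : ℝ → ℂ}

theorem divDiff_eq_integral (h : IsSampled M φ) (x y : ℝ) :
    divDiff φ x y = ∫ t in (0 : ℝ)..1, deriv φ (t * x + (1 - t) * y) := by
  unfold divDiff
  split_ifs with hxy
  · subst hxy
    have : ∀ t : ℝ, t * x + (1 - t) * x = x := fun t => by ring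
    simp [this]
  · have hne : ((x - y : ℝ) : ℂ) ≠ 0 := by exact_mod_cast sub_ne_zero.2 hxy
    have hd : ∀ t ∈ Set.uIcc (0 : ℝ) 1, HasDerivAt (fun t : ℝ => φ (t * x + (1 - t) * y))
        (((x - y : ℝ) : ℂ) * deriv φ (t * x + (1 - t) * y)) t := fun t _ => by
      have h1 : HasDerivAt (fun t : ℝ => t * x + (1 - t) * y) (x - y) t := by
        have : HasDerivAt (fun t : ℝ => t * x + (1 - t) * y) (1 * x + -1 * y) t :=
          ((hasDerivAt_id t).mul_const x).add (((hasDerivAt_id t).const_sub 1).mul_const y)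
        exact this.congr_deriv (by ring)
      have := (h.differentiableAt (t * x + (1 - t) * y)).hasDerivAt.scomp t h1
      rwa [Complex.real_smul] at this
    have hc : Continuous fun t : ℝ => deriv φ (t * x + (1 - t) * y) :=
      h.continuous_deriv.comp (by fun_prop)
    have key := intervalIntegral.integral_eq_sub_of_hasDerivAt hd
      ((continuous_const.mul hc).intervalIntegrable _ _)
    rw [intervalIntegral.integral_const_mul] at key
    simp only [one_mul, sub_self, zero_mul, add_zero, sub_zero, zero_add] at key
    rw [← key, mul_div_cancel_left₀ _ hne]

theorem norm_divDiff_le (h : IsSampled M φ) (x y : ℝ) :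
    ‖divDiff φ x y‖ ≤ bernsteinConst * M := by
  rw [h.divDiff_eq_integral]
  simpa using intervalIntegral.norm_integral_le_of_norm_le_const (a := 0) (b := 1)
    fun t _ => h.norm_deriv_le (t * x + (1 - t) * y)

/-- For each `t ∈ (0,1]` the integrand `φ'(t x + (1 - t) y)` is sampled in `x` with step `t`. This
is why sampling is required for all affine changes of slope at most `1`. -/
theorem hasSum_divDiff (h : IsSampled M φ) (x y : ℝ) :
    HasSum (fun j : ℤ => samplingKernel (x - j) * divDiff φ j y) (divDiff φ x y) := by
  have hc : ∀ z : ℝ, Continuous fun t : ℝ => deriv φ (t * z + (1 - t) * y) := fun z =>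
    h.continuous_deriv.comp (by fun_prop)
  simp only [h.divDiff_eq_integral, ← intervalIntegral.integral_const_mul]
  refine intervalIntegral.hasSum_integral_of_dominated_convergence
    (fun (j : ℤ) _ => ‖samplingKernel (x - j)‖ * (bernsteinConst * M)) (fun j => ?_) (fun j => ?_)
    ?_ ?_ ?_
  · exact (continuous_const.mul (hc j)).aestronglyMeasurable
  · refine Eventually.of_forall fun t _ => ?_
    rw [norm_mul]
    exact mul_le_mul_of_nonneg_left (h.norm_deriv_le _) (norm_nonneg _)
  · exact Eventually.of_forall fun t _ =>
      (SchwartzMap.summable_translates samplingKernel x).mul_right _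
  · exact intervalIntegrable_const
  · refine Eventually.of_forall fun t ht => ?_
    rw [Set.uIoc_of_le zero_le_one] at ht
    exact h.deriv.hasSum_affine t ((1 - t) * y) x (by rw [abs_of_pos ht.1]; exact ht.2)

theorem hasSum_divDiff_right (h : IsSampled M φ) (x y : ℝ) :
    HasSum (fun k : ℤ => samplingKernel (y - k) * divDiff φ x k) (divDiff φ x y) := by
  simp only [divDiff_comm φ x]
  exact h.hasSum_divDiff y x

end IsSampled

end Sampled

/-! ### The Hilbert matrix -/

section HilbertMatrix

/-- The Hilbert matrix `1 / (j - k)`, with zeros on the diagonal. -/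
noncomputable def hilbertMatrix (j k : ℤ) : ℂ := if j = k then 0 else 1 / ((j : ℂ) - k)

theorem expChar_intCast_one (n : ℤ) : expChar n 1 = 1 := by
  rw [expChar, Complex.exp_eq_one_iff]
  exact ⟨n, by push_cast; ring⟩

theorem expChar_zero_right (s : ℝ) : expChar s 0 = 1 := by simp [expChar]

theorem hasDerivAt_expChar (s x : ℝ) :
    HasDerivAt (expChar s) (2 * Real.pi * s * Complex.I * expChar s x) x := by
  have h1 : HasDerivAt (fun t : ℝ => (2 * Real.pi * s * t * Complex.I : ℂ))
      (2 * Real.pi * s * Complex.I) x := by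
    have := ((Complex.ofRealCLM.hasDerivAt (x := x)).const_mul
      (2 * Real.pi * s : ℂ)).mul_const Complex.I
    simpa using this
  exact h1.cexp.congr_deriv (mul_comm _ _)

theorem integral_expChar (n : ℤ) :
    ∫ t in (0 : ℝ)..1, expChar n t = if n = 0 then 1 else 0 := by
  split_ifs with hn
  · subst hn; simp [expChar]
  · have hc : (2 * Real.pi * n * Complex.I : ℂ) ≠ 0 := by
      simp [Real.pi_ne_zero, hn]
    have key := intervalIntegral.integral_eq_sub_of_hasDerivAt (a := 0) (b := 1)
      (fun t _ => hasDerivAt_expChar n t)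
      (((continuous_expChar n).const_mul _).intervalIntegrable _ _)
    rw [intervalIntegral.integral_const_mul, expChar_intCast_one, expChar_zero_right, sub_self]
      at key
    simpa [hc] using key

/-- The entries of the Hilbert matrix are the Fourier coefficients of the function `πi(2t - 1)` on
`[0,1]`, which has modulus at most `π`. -/
theorem integral_linear_mul_expChar (n : ℤ) :
    ∫ t in (0 : ℝ)..1, Real.pi * Complex.I * (2 * t - 1) * expChar n t =
      if n = 0 then 0 else 1 / (n : ℂ) := by
  have hpi : (Real.pi : ℂ) ≠ 0 := by exact_mod_cast Real.pi_ne_zero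
  have hlin : ∀ t : ℝ, HasDerivAt (fun t : ℝ => (2 * t - 1 : ℂ)) 2 t := fun t => by
    simpa using (((Complex.ofRealCLM.hasDerivAt (x := t)).const_mul (2 : ℂ)).sub_const 1)
  have hcont := continuous_expChar n
  split_ifs with hn
  · subst hn
    have hd : ∀ t ∈ Set.uIcc (0 : ℝ) 1, HasDerivAt (fun t : ℝ => Real.pi * Complex.I *
        ((2 * t - 1) * (2 * t - 1) / 4 : ℂ)) (Real.pi * Complex.I * (2 * t - 1)) t := fun t _ => by
      refine ((((hlin t).mul (hlin t)).div_const 4).const_mul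
        (Real.pi * Complex.I)).congr_deriv ?_
      ring
    have e : ∀ t : ℝ, expChar ((0 : ℤ) : ℝ) t = 1 := fun t => by simp [expChar]
    simp only [e, mul_one]
    rw [intervalIntegral.integral_eq_sub_of_hasDerivAt hd
      ((by fun_prop : Continuous fun t : ℝ => (Real.pi * Complex.I * (2 * t - 1) : ℂ)).intervalIntegrable _ _)]
    push_cast
    ring
  · have hn' : (n : ℂ) ≠ 0 := by exact_mod_cast hn
    have hd : ∀ t ∈ Set.uIcc (0 : ℝ) 1, HasDerivAt (fun t : ℝ =>
        ((2 * t - 1) * (2 * (n : ℂ))⁻¹ - (2 * Real.pi * Complex.I * (n : ℂ) ^ 2)⁻¹) * expChar n t)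
        (Real.pi * Complex.I * (2 * t - 1) * expChar n t) t := fun t _ => by
      refine ((((hlin t).mul_const _).sub_const _).mul (hasDerivAt_expChar n t)).congr_deriv ?_
      push_cast
      field_simp
      ring
    rw [intervalIntegral.integral_eq_sub_of_hasDerivAt hd
      ((by fun_prop : Continuous fun t : ℝ =>
        (Real.pi * Complex.I * (2 * t - 1) * expChar n t : ℂ)).intervalIntegrable _ _),
      expChar_intCast_one, expChar_zero_right]
    push_cast
    field_simp
    ring

theorem conj_expChar (s t : ℝ) : (starRingEnd ℂ) (expChar s t) = expChar (-s) t := by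
  rw [expChar, expChar, ← Complex.exp_conj]
  congr 1
  simp only [map_mul, Complex.conj_ofReal, Complex.conj_I, map_ofNat, Complex.ofReal_neg]
  ring

theorem expChar_add_left (s s' t : ℝ) : expChar (s + s') t = expChar s t * expChar s' t := by
  rw [expChar, expChar, expChar, ← Complex.exp_add]
  congr 1
  push_cast
  ring

theorem integral_norm_sq_sum_expChar (J : Finset ℤ) (p : ℤ → ℂ) :
    ∫ t in (0 : ℝ)..1, ‖∑ j ∈ J, p j * expChar j t‖ ^ 2 = ∑ j ∈ J, ‖p j‖ ^ 2 := by
  have h1 : ∀ t : ℝ, ((‖∑ j ∈ J, p j * expChar j t‖ ^ 2 : ℝ) : ℂ) =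
      ∑ j ∈ J, ∑ k ∈ J, p j * (starRingEnd ℂ) (p k) * expChar ((j - k : ℤ) : ℝ) t := fun t => by
    push_cast
    rw [← Complex.mul_conj', map_sum, Finset.sum_mul_sum]
    refine Finset.sum_congr rfl fun j _ => Finset.sum_congr rfl fun k _ => ?_
    rw [map_mul, conj_expChar, sub_eq_add_neg, expChar_add_left]
    ring
  have h2 : ((∫ t in (0 : ℝ)..1, ‖∑ j ∈ J, p j * expChar j t‖ ^ 2 : ℝ) : ℂ) =
      ((∑ j ∈ J, ‖p j‖ ^ 2 : ℝ) : ℂ) := by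
    rw [← intervalIntegral.integral_ofReal]
    simp only [h1]
    have hi : ∀ j k : ℤ, Continuous fun t =>
        p j * (starRingEnd ℂ) (p k) * expChar ((j - k : ℤ) : ℝ) t := fun j k =>
      (continuous_expChar _).const_mul _
    rw [intervalIntegral.integral_finsetSum fun j _ =>
      (continuous_finsetSum _ fun k _ => hi j k).intervalIntegrable _ _]
    rw [Complex.ofReal_sum]
    refine Finset.sum_congr rfl fun j hj => ?_
    rw [Complex.ofReal_pow, intervalIntegral.integral_finsetSum fun k _ => (hi j k).intervalIntegrable _ _]
    simp only [intervalIntegral.integral_const_mul, integral_expChar, sub_eq_zero]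
    simp only [mul_ite, mul_one, mul_zero, Finset.sum_ite_eq, hj, if_true]
    exact Complex.mul_conj' _
  exact_mod_cast h2

theorem integral_norm_mul_norm_le {P R : ℝ → ℂ} (hP : Continuous P) (hR : Continuous R) :
    ∫ t in (0 : ℝ)..1, ‖P t‖ * ‖R t‖ ≤
      √(∫ t in (0 : ℝ)..1, ‖P t‖ ^ 2) * √(∫ t in (0 : ℝ)..1, ‖R t‖ ^ 2) := by
  have hL : ∀ {f : ℝ → ℂ}, Continuous f → MemLp f (ENNReal.ofReal 2)
      (volume.restrict (Set.Ioc (0 : ℝ) 1)) := fun {f} hf => by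
    obtain ⟨C, hC⟩ := (isCompact_Icc (a := (0 : ℝ)) (b := 1)).exists_bound_of_continuousOn
      hf.continuousOn
    refine MemLp.of_bound hf.aestronglyMeasurable C ?_
    exact (ae_restrict_iff' measurableSet_Ioc).2
      (Eventually.of_forall fun t ht => hC t (Set.Ioc_subset_Icc_self ht))
  have := integral_mul_norm_le_Lp_mul_Lq Real.HolderConjugate.two_two (hL hP) (hL hR)
  simp only [intervalIntegral.integral_of_le zero_le_one, Real.sqrt_eq_rpow]
  simpa only [Real.rpow_two] using this

/-- The form is the integral of `πi(2t - 1) P(t) R(t)` with trigonometric polynomials `P`, `R`. Its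
bound follows from the supremum `π`, Cauchy–Schwarz and Parseval. -/
theorem scalarBound_hilbertMatrix : ScalarBound Real.pi hilbertMatrix := by
  intro J K p r
  set P : ℝ → ℂ := fun t => ∑ j ∈ J, p j * expChar j t with hP
  set R : ℝ → ℂ := fun t => ∑ k ∈ K, r k * expChar ((-k : ℤ) : ℝ) t with hR
  have hPc : Continuous P := continuous_finsetSum _ fun j _ => (continuous_expChar _).const_mul _
  have hRc : Continuous R := continuous_finsetSum _ fun j _ => (continuous_expChar _).const_mul _
  have hRn : ∀ t, ‖R t‖ = ‖∑ k ∈ K, (starRingEnd ℂ) (r k) * expChar k t‖ := fun t => by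
    rw [← RCLike.norm_conj]
    simp only [hR, map_sum, map_mul, conj_expChar]
    push_cast
    simp only [neg_neg]
  have h1 : ∑ j ∈ J, ∑ k ∈ K, p j * hilbertMatrix j k * r k =
      ∫ t in (0 : ℝ)..1, Real.pi * Complex.I * (2 * t - 1) * (P t * R t) := by
    have h2 : ∀ t : ℝ, Real.pi * Complex.I * (2 * t - 1) * (P t * R t) =
        ∑ j ∈ J, ∑ k ∈ K, p j * r k *
          (Real.pi * Complex.I * (2 * t - 1) * expChar ((j - k : ℤ) : ℝ) t) := fun t => by
      rw [hP, hR, Finset.sum_mul_sum, Finset.mul_sum]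
      refine Finset.sum_congr rfl fun j _ => ?_
      rw [Finset.mul_sum]
      refine Finset.sum_congr rfl fun k _ => ?_
      rw [Int.sub_eq_add_neg, Int.cast_add, expChar_add_left]
      ring
    have hi : ∀ j k : ℤ, Continuous fun t : ℝ => p j * r k *
        (Real.pi * Complex.I * (2 * t - 1) * expChar ((j - k : ℤ) : ℝ) t) := fun j k => by
      have := continuous_expChar ((j - k : ℤ) : ℝ)
      fun_prop
    simp only [h2]
    rw [intervalIntegral.integral_finsetSum fun j _ =>
      (continuous_finsetSum _ fun k _ => hi j k).intervalIntegrable _ _]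
    refine Finset.sum_congr rfl fun j _ => ?_
    rw [intervalIntegral.integral_finsetSum fun k _ => (hi j k).intervalIntegrable _ _]
    refine Finset.sum_congr rfl fun k _ => ?_
    rw [intervalIntegral.integral_const_mul, integral_linear_mul_expChar, hilbertMatrix]
    simp only [sub_eq_zero]
    split_ifs <;> push_cast <;> ring
  rw [h1]
  have h3 : ‖∫ t in (0 : ℝ)..1, Real.pi * Complex.I * (2 * t - 1) * (P t * R t)‖ ≤
      ∫ t in (0 : ℝ)..1, Real.pi * (‖P t‖ * ‖R t‖) := by
    refine intervalIntegral.norm_integral_le_of_norm_le zero_le_one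
      (Eventually.of_forall fun t ht => ?_)
      ((by fun_prop : Continuous fun t => Real.pi * (‖P t‖ * ‖R t‖)).intervalIntegrable _ _)
    rw [norm_mul, norm_mul (P t), norm_mul, norm_mul, Complex.norm_I, mul_one, Complex.norm_real,
      Real.norm_of_nonneg Real.pi_pos.le]
    refine mul_le_mul_of_nonneg_right ?_ (by positivity)
    have : ‖(2 * t - 1 : ℂ)‖ ≤ 1 := by
      rw [show (2 * t - 1 : ℂ) = ((2 * t - 1 : ℝ) : ℂ) by push_cast; rfl, Complex.norm_real,
        Real.norm_eq_abs, abs_le]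
      constructor <;> linarith [ht.1, ht.2]
    exact mul_le_of_le_one_right Real.pi_pos.le this
  refine h3.trans ?_
  rw [intervalIntegral.integral_const_mul, mul_assoc]
  refine mul_le_mul_of_nonneg_left ?_ Real.pi_pos.le
  refine (integral_norm_mul_norm_le hPc hRc).trans (le_of_eq ?_)
  simp only [hRn, hP, integral_norm_sq_sum_expChar, RCLike.norm_conj]

end HilbertMatrix

/-! ### The matrix of divided differences at the integers -/

section ScalarBoundOperations

variable {ι κ : Type*} {C C' M : ℝ} {b b' : ι → κ → ℂ}

theorem ScalarBound.add (hb : ScalarBound C b) (hb' : ScalarBound C' b') :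
    ScalarBound (C + C') fun j k => b j k + b' j k := fun J K p r => by
  simp only [mul_add, add_mul, Finset.sum_add_distrib]
  exact (norm_add_le _ _).trans (add_le_add (hb J K p r) (hb' J K p r))

theorem ScalarBound.neg (hb : ScalarBound C b) : ScalarBound C fun j k => -b j k :=
  fun J K p r => by
    simp only [mul_neg, neg_mul, Finset.sum_neg_distrib, norm_neg]
    exact hb J K p r

theorem ScalarBound.mul_left (hC : 0 ≤ C) (hb : ScalarBound C b) {a : ι → ℂ}
    (ha : ∀ j, ‖a j‖ ≤ M) (hM : 0 ≤ M) : ScalarBound (C * M) fun j k => a j * b j k :=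
  fun J K p r => by
    have h := hb J K (fun j => p j * a j) r
    simp only [mul_assoc] at h ⊢
    refine h.trans (mul_le_mul_of_nonneg_left ?_ hC)
    rw [← mul_assoc]
    refine mul_le_mul_of_nonneg_right ?_ (Real.sqrt_nonneg _)
    rw [Real.sqrt_le_left (by positivity), mul_pow, Real.sq_sqrt
      (Finset.sum_nonneg fun _ _ => sq_nonneg _), Finset.mul_sum]
    refine Finset.sum_le_sum fun j _ => ?_
    rw [norm_mul, mul_pow, mul_comm]
    exact mul_le_mul_of_nonneg_right (pow_le_pow_left₀ (norm_nonneg _) (ha j) 2) (sq_nonneg _)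

theorem scalarBound_diagonal [DecidableEq ι] {a : ι → ℂ} (ha : ∀ j, ‖a j‖ ≤ M) (hM : 0 ≤ M) :
    ScalarBound M fun j k => if j = k then a j else 0 := fun J K p r => by
  have h1 : ∑ j ∈ J, ∑ k ∈ K, p j * (if j = k then a j else 0) * r k =
      ∑ j ∈ J ∩ K, p j * a j * r j := by
    simp only [mul_ite, ite_mul, mul_zero, zero_mul, Finset.sum_ite_eq, Finset.sum_ite_mem]
  rw [h1]
  have h2 : ‖∑ j ∈ J ∩ K, p j * a j * r j‖ ≤ M * ∑ j ∈ J ∩ K, ‖p j‖ * ‖r j‖ := by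
    rw [Finset.mul_sum]
    refine norm_sum_le_of_le _ fun j _ => ?_
    rw [norm_mul, norm_mul, mul_comm ‖p j‖, mul_assoc]
    exact mul_le_mul_of_nonneg_right (ha j) (by positivity)
  refine h2.trans ?_
  rw [mul_assoc]
  refine mul_le_mul_of_nonneg_left (sum_norm_mul_norm_le _ _ _ _ _ ?_ ?_ (Real.sqrt_nonneg _)
    (Real.sqrt_nonneg _)) hM
  all_goals
    rw [Real.sq_sqrt (Finset.sum_nonneg fun _ _ => sq_nonneg _)]
    exact Finset.sum_le_sum_of_subset_of_nonneg (by first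
      | exact Finset.inter_subset_left | exact Finset.inter_subset_right)
      fun _ _ _ => sq_nonneg _

/-- A bounded matrix has bounded columns. -/
theorem ScalarBound.sum_sq_column_le (hC : 0 ≤ C) (hb : ScalarBound C b) (k : κ) (J : Finset ι) :
    ∑ j ∈ J, ‖b j k‖ ^ 2 ≤ C ^ 2 := by
  have h := hb J {k} (fun j => (starRingEnd ℂ) (b j k)) (fun _ => 1)
  simp only [Finset.sum_singleton, mul_one, norm_one, one_pow, Real.sqrt_one, RCLike.norm_conj,
    Complex.conj_mul'] at h
  have e : ‖∑ j ∈ J, (‖b j k‖ : ℂ) ^ 2‖ = ∑ j ∈ J, ‖b j k‖ ^ 2 := by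
    rw [show ∑ j ∈ J, (‖b j k‖ : ℂ) ^ 2 = ((∑ j ∈ J, ‖b j k‖ ^ 2 : ℝ) : ℂ) by push_cast; rfl,
      Complex.norm_real, Real.norm_of_nonneg (Finset.sum_nonneg fun _ _ => sq_nonneg _)]
  rw [e] at h
  set S := ∑ j ∈ J, ‖b j k‖ ^ 2 with hS
  have hS0 : 0 ≤ S := Finset.sum_nonneg fun _ _ => sq_nonneg _
  have h1 := Real.sq_sqrt hS0
  by_cases h0 : √S = 0
  · rw [h0] at h1
    rw [← h1]
    exact pow_le_pow_left₀ le_rfl hC 2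
  · have hpos : 0 < √S := lt_of_le_of_ne (Real.sqrt_nonneg _) (Ne.symm h0)
    have h2 : √S ≤ C := le_of_mul_le_mul_right (by nlinarith) hpos
    rw [← h1]
    exact pow_le_pow_left₀ hpos.le h2 2

end ScalarBoundOperations

/-- The norm of the matrix of divided differences at the integers. -/
noncomputable def divDiffConst : ℝ := 2 * Real.pi + bernsteinConst

theorem divDiffConst_nonneg : 0 ≤ divDiffConst :=
  add_nonneg (by positivity) bernsteinConst_nonneg

/-- Off the diagonal `(φ(j) - φ(k))/(j - k)` is the commutator of multiplication by `φ` with the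
Hilbert matrix, of norm at most `2π`; the diagonal `φ'(j)` is bounded by Bernstein's inequality. -/
theorem IsSampled.scalarBound_divDiff {φ : ℝ → ℂ} (h : IsSampled 1 φ) :
    ScalarBound divDiffConst fun j k : ℤ => divDiff φ j k := by
  have hπ := Real.pi_pos.le
  have h1 := scalarBound_hilbertMatrix.mul_left hπ (a := fun j : ℤ => φ j)
    (fun j => h.norm_le j) zero_le_one
  have h2 := (scalarBound_hilbertMatrix.swap.mul_left hπ (a := fun j : ℤ => φ j)
    (fun j => h.norm_le j) zero_le_one).swap.neg
  have h3 := scalarBound_diagonal (a := fun j : ℤ => deriv φ j)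
    (fun j => h.norm_deriv_le j) (mul_nonneg bernsteinConst_nonneg zero_le_one)
  have h4 := (h1.add h2).add h3
  rw [mul_one, mul_one, ← two_mul] at h4
  have e : (fun j k : ℤ => divDiff φ j k) = fun j k : ℤ => φ j * hilbertMatrix j k +
      -(φ k * hilbertMatrix j k) + if j = k then deriv φ j else 0 := by
    funext j k
    unfold divDiff hilbertMatrix
    by_cases hjk : j = k
    · simp [hjk]
    · have : (j : ℝ) ≠ k := by exact_mod_cast hjk
      rw [if_neg this, if_neg hjk, if_neg hjk]
      push_cast
      ring
  rw [e, divDiffConst]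
  exact h4.mono (le_of_eq (by ring))

/-! ### Matrix elements of triple integrals with no operators inserted -/

section TripleElement

variable {X₁ X₂ X₃ : Type*} [MeasurableSpace X₁] [MeasurableSpace X₂] [MeasurableSpace X₃]
  {H : Type u} [NormedAddCommGroup H] [InnerProductSpace ℂ H] [CompleteSpace H]
  {E₁ : SpectralMeasure X₁ H} {E₂ : SpectralMeasure X₂ H} {E₃ : SpectralMeasure X₃ H}
  {w : Set H} {e : HilbertBasis w ℂ H} {x y : H}

theorem AE₃.mono {P Q : X₁ → X₂ → X₃ → Prop} (h : AE₃ E₁ E₂ E₃ P)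
    (hPQ : ∀ a b c, P a b c → Q a b c) : AE₃ E₁ E₂ E₃ Q :=
  fun u v w => (h u v w).mono fun _ hq => hPQ _ _ _ hq

theorem AE₃.and {P Q : X₁ → X₂ → X₃ → Prop} (hP : AE₃ E₁ E₂ E₃ P) (hQ : AE₃ E₁ E₂ E₃ Q) :
    AE₃ E₁ E₂ E₃ fun a b c => P a b c ∧ Q a b c :=
  fun u v w => (hP u v w).and (hQ u v w)

theorem AE₃.all {ι : Type*} [Countable ι] {P : ι → X₁ → X₂ → X₃ → Prop}
    (h : ∀ i, AE₃ E₁ E₂ E₃ (P i)) : AE₃ E₁ E₂ E₃ fun a b c => ∀ i, P i a b c :=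
  fun u v w => ae_all_iff.2 fun i => h i u v w

/-- The matrix element at `x`, `y` of the operator `∭ Ψ dE₁ dE₂ dE₃`, computed by inserting an
orthonormal basis between the spectral measures. -/
structure TripleElement (e : HilbertBasis w ℂ H) (E₁ : SpectralMeasure X₁ H)
    (E₂ : SpectralMeasure X₂ H) (E₃ : SpectralMeasure X₃ H) (x y : H) (Ψ : X₁ → X₂ → X₃ → ℂ)
    (s : ℂ) : Prop where
  meas : Measurable fun q : X₁ × X₂ × X₃ => Ψ q.1 q.2.1 q.2.2
  bdd : ∃ C : ℝ, AE₃ E₁ E₂ E₃ fun a b c => ‖Ψ a b c‖ ≤ C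
  lim : Tendsto (fun P : Finset w × Finset w => ∑ i ∈ P.1, ∑ j ∈ P.2,
    triForm E₁ E₂ E₃ (e i) y (e j) (e i) x (e j) Ψ) atTop (𝓝 s)

theorem triForm_sub {Ψ Ψ' : X₁ → X₂ → X₃ → ℂ} {C C' : ℝ}
    (hm : Measurable fun q : X₁ × X₂ × X₃ => Ψ q.1 q.2.1 q.2.2)
    (hC : AE₃ E₁ E₂ E₃ fun a b c => ‖Ψ a b c‖ ≤ C)
    (hm' : Measurable fun q : X₁ × X₂ × X₃ => Ψ' q.1 q.2.1 q.2.2)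
    (hC' : AE₃ E₁ E₂ E₃ fun a b c => ‖Ψ' a b c‖ ≤ C') (x₁ y₁ x₂ y₂ x₃ y₃ : H) :
    triForm E₁ E₂ E₃ x₁ y₁ x₂ y₂ x₃ y₃ (fun a b c => Ψ a b c - Ψ' a b c) =
      triForm E₁ E₂ E₃ x₁ y₁ x₂ y₂ x₃ y₃ Ψ - triForm E₁ E₂ E₃ x₁ y₁ x₂ y₂ x₃ y₃ Ψ' := by
  simp only [triForm, ← Finset.sum_sub_distrib, ← mul_sub]
  refine Finset.sum_congr rfl fun i _ => Finset.sum_congr rfl fun j _ =>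
    Finset.sum_congr rfl fun k _ => ?_
  rw [integral_sub (Integrable.of_bound hm.aestronglyMeasurable _ (hC _ _ _))
    (Integrable.of_bound hm'.aestronglyMeasurable _ (hC' _ _ _))]

theorem TripleElement.sub {Ψ Ψ' : X₁ → X₂ → X₃ → ℂ} {s s' : ℂ}
    (h : TripleElement e E₁ E₂ E₃ x y Ψ s) (h' : TripleElement e E₁ E₂ E₃ x y Ψ' s') :
    TripleElement e E₁ E₂ E₃ x y (fun a b c => Ψ a b c - Ψ' a b c) (s - s') := by
  obtain ⟨C, hC⟩ := h.bdd
  obtain ⟨C', hC'⟩ := h'.bdd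
  refine ⟨h.meas.sub h'.meas, ⟨C + C', (hC.and hC').mono fun a b c hq =>
    (norm_sub_le _ _).trans (add_le_add hq.1 hq.2)⟩, (h.lim.sub h'.lim).congr fun P => ?_⟩
  simp only [triForm_sub h.meas hC h'.meas hC', Finset.sum_sub_distrib]

/-- The value is a limit of expressions in the integrand alone. An identity between functions thus
becomes an identity between operators, even if the two sides are expanded into products in unrelated
ways. -/
theorem TripleElement.unique {Ψ Ψ' : X₁ → X₂ → X₃ → ℂ} {s s' : ℂ}
    (h : TripleElement e E₁ E₂ E₃ x y Ψ s) (h' : TripleElement e E₁ E₂ E₃ x y Ψ' s')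
    (hΨ : ∀ a b c, Ψ a b c = Ψ' a b c) : s = s' := by
  classical
  rw [← show Ψ = Ψ' from funext fun a => funext fun b => funext fun c => hΨ a b c] at h'
  exact tendsto_nhds_unique h.lim h'.lim

theorem tendsto_basis_partial_sum (e : HilbertBasis w ℂ H) (v : H) :
    Tendsto (fun F : Finset w => ∑ i ∈ F, ⟪e i, v⟫_ℂ • e i) atTop (𝓝 v) := by
  have := e.hasSum_repr v
  simp only [e.repr_apply_apply] at this
  exact this

theorem norm_basis_partial_sum_le (e : HilbertBasis w ℂ H) (v : H) (F : Finset w) :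
    ‖∑ i ∈ F, ⟪e i, v⟫_ℂ • e i‖ ≤ ‖v‖ := by
  set a := ∑ i ∈ F, ⟪e i, v⟫_ℂ • e i with ha
  have h1 : ⟪a, v - a⟫_ℂ = 0 := by
    rw [ha, sum_inner]
    refine Finset.sum_eq_zero fun i hi => ?_
    rw [inner_smul_left, inner_sub_right, e.orthonormal.inner_right_sum _ hi, sub_self, mul_zero]
  have h2 := norm_add_sq_eq_norm_sq_add_norm_sq_of_inner_eq_zero _ _ h1
  rw [add_sub_cancel] at h2
  nlinarith [norm_nonneg v, norm_nonneg a, mul_self_nonneg ‖v - a‖]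

/-- For an absolutely summable product expansion, truncation by finite basis projections on both
sides of `E₂` gives the truncated sum of scalar integrals. Removing the truncation is dominated
convergence over the index of the expansion. -/
theorem exists_tripleElement {ι : Type*} [Countable ι] (e : HilbertBasis w ℂ H)
    {a : ι → X₁ → ℂ} {b : ι → X₂ → ℂ} {c : ι → X₃ → ℂ} {A B C : ι → ℝ}
    (hA0 : ∀ i, 0 ≤ A i) (hB0 : ∀ i, 0 ≤ B i) (hC0 : ∀ i, 0 ≤ C i)
    (ha : ∀ i, E₁.EssBdd (A i) (a i)) (hb : ∀ i, E₂.EssBdd (B i) (b i))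
    (hc : ∀ i, E₃.EssBdd (C i) (c i)) (hs : Summable fun i => A i * B i * C i)
    {Ψ : X₁ → X₂ → X₃ → ℂ}
    (hΨ : ∀ x y z, HasSum (fun i => a i x * b i y * c i z) (Ψ x y z)) (x y : H) :
    ∃ s, HasSum (fun i => ⟪y, E₁.integral (a i) (E₂.integral (b i) (E₃.integral (c i) x))⟫_ℂ) s ∧
      TripleElement e E₁ E₂ E₃ x y Ψ s := by
  have hmt : ∀ F : Finset ι, Measurable fun q : X₁ × X₂ × X₃ =>
      ∑ i ∈ F, a i q.1 * b i q.2.1 * c i q.2.2 := fun F =>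
    Finset.measurable_fun_sum _ fun i _ => (((ha i).1.comp measurable_fst).mul
      ((hb i).1.comp (measurable_fst.comp measurable_snd))).mul
      ((hc i).1.comp (measurable_snd.comp measurable_snd))
  have hm : Measurable fun q : X₁ × X₂ × X₃ => Ψ q.1 q.2.1 q.2.2 :=
    measurable_of_tendsto_metrizable' atTop hmt (tendsto_pi_nhds.2 fun q => hΨ q.1 q.2.1 q.2.2)
  set S : ℝ := ∑' i, A i * B i * C i with hS
  have h0 : ∀ i, 0 ≤ A i * B i * C i := fun i => mul_nonneg (mul_nonneg (hA0 i) (hB0 i)) (hC0 i)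
  have hterm : AE₃ E₁ E₂ E₃ fun x y z => ∀ i, ‖a i x * b i y * c i z‖ ≤ A i * B i * C i :=
    AE₃.all fun i => (((AE₃.of_left (ha i).2).and (AE₃.of_middle (hb i).2)).and
      (AE₃.of_right (hc i).2)).mono fun x y z h => by
        rw [norm_mul, norm_mul]
        exact mul_le_mul (mul_le_mul h.1.1 h.1.2 (norm_nonneg _) (hA0 i)) h.2 (norm_nonneg _)
          (mul_nonneg (hA0 i) (hB0 i))
  have hsum : ∀ F : Finset ι, AE₃ E₁ E₂ E₃ fun x y z =>
      ‖∑ i ∈ F, a i x * b i y * c i z‖ ≤ S := fun F => hterm.mono fun x y z h =>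
    (norm_sum_le_of_le _ fun i _ => h i).trans (hs.sum_le_tsum _ fun i _ => h0 i)
  have hbdd : AE₃ E₁ E₂ E₃ fun x y z => ‖Ψ x y z‖ ≤ S := hterm.mono fun x y z h => by
    rw [← (hΨ x y z).tsum_eq]
    exact tsum_of_norm_bounded hs.hasSum h
  set u : ι → H := fun i => ContinuousLinearMap.adjoint (E₁.integral (a i)) y with hu
  set v : ι → H := fun i => E₃.integral (c i) x with hv
  have hun : ∀ i, ‖u i‖ ≤ A i * ‖y‖ := fun i => by
    rw [hu, (ha i).norm_adjoint_apply]
    exact (ha i).norm_apply_le (hA0 i) y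
  have hvn : ∀ i, ‖v i‖ ≤ C i * ‖x‖ := fun i => (hc i).norm_apply_le (hC0 i) x
  have hbound : ∀ i (u' v' : H), ‖u'‖ ≤ ‖u i‖ → ‖v'‖ ≤ ‖v i‖ →
      ‖⟪u', E₂.integral (b i) v'⟫_ℂ‖ ≤ A i * B i * C i * (‖x‖ * ‖y‖) := fun i u' v' h1 h2 => by
    refine (norm_inner_le_norm _ _).trans ?_
    have h3 : ‖E₂.integral (b i) v'‖ ≤ B i * (C i * ‖x‖) :=
      ((hb i).norm_apply_le (hB0 i) v').trans
        (mul_le_mul_of_nonneg_left (h2.trans (hvn i)) (hB0 i))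
    calc ‖u'‖ * ‖E₂.integral (b i) v'‖ ≤ A i * ‖y‖ * (B i * (C i * ‖x‖)) :=
          mul_le_mul (h1.trans (hun i)) h3 (norm_nonneg _) (mul_nonneg (hA0 i) (norm_nonneg _))
      _ = _ := by ring
  have hsum' : Summable fun i => A i * B i * C i * (‖x‖ * ‖y‖) := hs.mul_right _
  have hconv : Summable fun i => ⟪u i, E₂.integral (b i) (v i)⟫_ℂ :=
    Summable.of_norm_bounded hsum' fun i => hbound i _ _ le_rfl le_rfl
  refine ⟨∑' i, ⟪u i, E₂.integral (b i) (v i)⟫_ℂ, hconv.hasSum.of_eq fun i => by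
    rw [hu, ContinuousLinearMap.adjoint_inner_left], hm, ⟨S, hbdd⟩, ?_⟩
  have hform : ∀ i j : w, HasSum (fun n => ⟪y, E₁.integral (a n) (e i)⟫_ℂ *
      ⟪e i, E₂.integral (b n) (e j)⟫_ℂ * ⟪(e j : H), v n⟫_ℂ)
      (triForm E₁ E₂ E₃ (e i) y (e j) (e i) x (e j) Ψ) := fun i j => by
    refine (tendsto_triForm hmt hsum (fun u' v' w' => Eventually.of_forall fun q => hΨ _ _ _)
      (e i) y (e j) (e i) x (e j)).congr fun F => ?_
    exact triForm_sum F (fun i => ⟨_, ha i⟩) (fun i => ⟨_, hb i⟩) (fun i => ⟨_, hc i⟩) ..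
  -- The double sum over basis vectors compresses `∫ b_n dE₂` between two finite-rank projections.
  have hproj : ∀ P : Finset w × Finset w, ∑ i ∈ P.1, ∑ j ∈ P.2,
      triForm E₁ E₂ E₃ (e i) y (e j) (e i) x (e j) Ψ =
      ∑' n, ⟪∑ i ∈ P.1, ⟪(e i : H), u n⟫_ℂ • (e i : H),
        E₂.integral (b n) (∑ j ∈ P.2, ⟪(e j : H), v n⟫_ℂ • (e j : H))⟫_ℂ := fun P => by
    rw [← (hasSum_sum fun i _ => hasSum_sum fun j _ => hform i j).tsum_eq]
    refine tsum_congr fun n => ?_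
    rw [sum_inner]
    refine Finset.sum_congr rfl fun i _ => ?_
    rw [map_sum, inner_sum]
    refine Finset.sum_congr rfl fun j _ => ?_
    rw [map_smul, inner_smul_left, inner_smul_right, inner_conj_symm, hu,
      ContinuousLinearMap.adjoint_inner_left]
    ring
  simp only [hproj]
  refine tendsto_tsum_of_dominated_convergence hsum' (fun n => ?_)
    (Eventually.of_forall fun P n => hbound n _ _ (norm_basis_partial_sum_le e _ _)
      (norm_basis_partial_sum_le e _ _))
  rw [← prod_atTop_atTop_eq]
  exact ((tendsto_basis_partial_sum e (u n)).comp tendsto_fst).inner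
    (((E₂.integral (b n)).continuous.tendsto _).comp
      ((tendsto_basis_partial_sum e (v n)).comp tendsto_snd))

end TripleElement

/-! ### The Besov expansion and its sampled divided differences -/

section BesovSeries

/-- A bounded continuous function of two variables that is sampled in each variable. -/
structure IsSampledPair (G : ℝ → ℝ → ℂ) : Prop where
  continuous : Continuous fun q : ℝ × ℝ => G q.1 q.2
  left : ∀ y, IsSampled 1 fun x => G x y
  right : ∀ x, IsSampled 1 fun y => G x y

theorem IsSampledPair.flip {G : ℝ → ℝ → ℂ} (h : IsSampledPair G) :
    IsSampledPair fun y x => G x y :=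
  ⟨h.continuous.comp continuous_swap, h.right, h.left⟩

/-- The expansion of a function of two variables into sampled functions of different scales. -/
structure IsBesovSeries (α : ℕ → ℂ) (σ : ℕ → ℝ) (G : ℕ → ℝ → ℝ → ℂ) (f : ℝ → ℝ → ℂ) : Prop where
  sampled : ∀ m, IsSampledPair (G m)
  pos : ∀ m, 0 < σ m
  summable : Summable fun m => ‖α m‖
  hasSum : ∀ x y x' y', HasSum (fun m => α m * ((σ m)⁻¹ : ℝ) *
    (G m (σ m * x) (σ m * y) - G m (σ m * x') (σ m * y'))) (f x y - f x' y')

theorem IsBesovSeries.flip {α : ℕ → ℂ} {σ : ℕ → ℝ} {G : ℕ → ℝ → ℝ → ℂ} {f : ℝ → ℝ → ℂ}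
    (h : IsBesovSeries α σ G f) :
    IsBesovSeries α σ (fun m y x => G m x y) (fun y x => f x y) :=
  ⟨fun m => (h.sampled m).flip, h.pos, h.summable, fun x y x' y' => h.hasSum y x y' x'⟩

/-- An affine change of parameter on a line is again a line, with direction vector `a • v` of norm
at most `1`. -/
theorem IsUnitBandLimited.isSampled {d : ℕ} {g : EuclideanSpace ℝ (Fin d) → ℂ}
    (hg : IsUnitBandLimited g) (z v : EuclideanSpace ℝ (Fin d)) (hv : ‖v‖ ≤ 1) :
    IsSampled 1 fun x : ℝ => g (z + x • v) :=
  ⟨fun x => hg.2.1 _, fun a b x ha => by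
    have h := hg.hasSum_sampling (z + b • v) (a • v) (by
      rw [norm_smul, Real.norm_eq_abs]
      exact mul_le_one₀ ha (norm_nonneg _) hv) x
    have e : ∀ t : ℝ, z + (a * t + b) • v = z + b • v + t • a • v := fun t => by
      rw [add_smul, smul_smul, mul_comm t a, add_assoc, add_comm (b • v)]
    simp only [e]
    exact h⟩

theorem MemBesov.exists_isBesovSeries {f : EuclideanSpace ℝ (Fin 2) → ℂ} (hf : MemBesov f) :
    ∃ α σ G, IsBesovSeries α σ G fun x y => f !₂[x, y] := by
  obtain ⟨c, α, σ, g, hg, hσ, hα, hs⟩ := hf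
  have e1 : ∀ x y : ℝ, !₂[x, y] = !₂[0, y] + x • EuclideanSpace.single (0 : Fin 2) (1 : ℝ) :=
    fun x y => by ext i; fin_cases i <;> simp
  have e2 : ∀ x y : ℝ, !₂[x, y] = !₂[x, 0] + y • EuclideanSpace.single (1 : Fin 2) (1 : ℝ) :=
    fun x y => by ext i; fin_cases i <;> simp
  have e3 : ∀ s x y : ℝ, s • !₂[x, y] = !₂[s * x, s * y] := fun s x y => by
    ext i; fin_cases i <;> simp
  refine ⟨α, σ, fun m x y => g m !₂[x, y], fun m => ⟨(hg m).1.comp (by fun_prop), fun y => ?_,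
    fun x => ?_⟩, hσ, hα, fun x y x' y' => ?_⟩
  · rw [show (fun x => g m !₂[x, y]) = fun x => g m (!₂[0, y] +
      x • EuclideanSpace.single (0 : Fin 2) (1 : ℝ)) from funext fun x => congrArg (g m) (e1 x y)]
    exact (hg m).isSampled _ _ (by simp)
  · rw [show (fun y => g m !₂[x, y]) = fun y => g m (!₂[x, 0] +
      y • EuclideanSpace.single (1 : Fin 2) (1 : ℝ)) from funext fun y => congrArg (g m) (e2 x y)]
    exact (hg m).isSampled _ _ (by simp)
  · have h := (hs !₂[x, y]).sub (hs !₂[x', y'])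
    rw [sub_sub_sub_cancel_right] at h
    refine h.of_eq fun m => ?_
    rw [e3, e3]
    ring

/-- The samples of the divided differences in the first variable of the `m`-th term. -/
noncomputable def divDiffSample (σ : ℝ) (G : ℝ → ℝ → ℂ) (j k : ℤ) (y : ℝ) : ℂ :=
  divDiff (fun x => G x (σ * y)) j k

/-- The dilated and translated sampling kernel. -/
noncomputable def sampleWeight (σ : ℝ) (j : ℤ) (x : ℝ) : ℂ := samplingKernel (σ * x - j)

theorem measurable_sampleWeight (σ : ℝ) (j : ℤ) : Measurable (sampleWeight σ j) :=
  (samplingKernel.continuous.comp (by fun_prop)).measurable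

noncomputable def samplingConst : ℝ :=
  (SchwartzMap.exists_tsum_translates_le samplingKernel).choose

theorem sum_norm_sampleWeight_le (σ x : ℝ) (J : Finset ℤ) :
    ∑ j ∈ J, ‖sampleWeight σ j x‖ ≤ samplingConst :=
  ((SchwartzMap.summable_translates samplingKernel (σ * x)).sum_le_tsum J
    fun _ _ => norm_nonneg _).trans
    ((SchwartzMap.exists_tsum_translates_le samplingKernel).choose_spec.2 _)

theorem sum_sq_sampleWeight_le (σ x : ℝ) (J : Finset ℤ) :
    ∑ j ∈ J, ‖sampleWeight σ j x‖ ^ 2 ≤ samplingConst ^ 2 := by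
  calc ∑ j ∈ J, ‖sampleWeight σ j x‖ ^ 2 ≤ (∑ j ∈ J, ‖sampleWeight σ j x‖) ^ 2 :=
        Finset.sum_sq_le_sq_sum_of_nonneg fun _ _ => norm_nonneg _
    _ ≤ _ := pow_le_pow_left₀ (Finset.sum_nonneg fun _ _ => norm_nonneg _)
        (sum_norm_sampleWeight_le σ x J) 2

theorem summable_norm_sampleWeight (σ x : ℝ) : Summable fun j => ‖sampleWeight σ j x‖ :=
  SchwartzMap.summable_translates samplingKernel (σ * x)

/-- On a bounded spectrum the sample weights have one summable majorant. Absolute convergence at a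
single scale rests on this, hence on the boundedness of the operators. -/
theorem exists_sampleWeight_bound (σ R : ℝ) :
    ∃ u : ℤ → ℝ, Summable u ∧ (∀ j, 0 ≤ u j) ∧ ∀ x, |x| ≤ R → ∀ j, ‖sampleWeight σ j x‖ ≤ u j := by
  obtain ⟨u, hu, h⟩ := SchwartzMap.exists_summable_bound samplingKernel (|σ| * |R|)
  refine ⟨u, hu, fun j => (norm_nonneg _).trans (h 0 (by simp; positivity) j),
    fun x hx j => h _ ?_ j⟩
  rw [abs_mul]
  exact mul_le_mul_of_nonneg_left (hx.trans (le_abs_self R)) (abs_nonneg σ)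

section Pair

variable {G : ℝ → ℝ → ℂ} {σ : ℝ}

theorem IsSampledPair.measurable_divDiffSample (h : IsSampledPair G) (σ : ℝ) (j k : ℤ) :
    Measurable (divDiffSample σ G j k) := by
  have hc := h.continuous
  by_cases hjk : (j : ℝ) = k
  · have h1 : Measurable fun p : ℝ × ℝ => deriv (fun x => G x p.1) p.2 :=
      measurable_deriv_with_param (f := fun y x => G x y) (hc.comp continuous_swap)
    have h2 : divDiffSample σ G j k = fun y => deriv (fun x => G x (σ * y)) j := by
      funext y; simp only [divDiffSample, divDiff, if_pos hjk]
    rw [h2]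
    exact h1.comp (by fun_prop : Measurable fun y : ℝ => (σ * y, (j : ℝ)))
  · have h2 : divDiffSample σ G j k = fun y =>
        (G j (σ * y) - G k (σ * y)) / ((j - k : ℝ) : ℂ) := by
      funext y; simp only [divDiffSample, divDiff, if_neg hjk]
    rw [h2]
    have h3 : ∀ t : ℝ, Continuous fun y => G t (σ * y) := fun t =>
      hc.comp (by fun_prop : Continuous fun y : ℝ => (t, σ * y))
    exact (((h3 _).sub (h3 _)).div_const _).measurable

theorem IsSampledPair.scalarBound (h : IsSampledPair G) (σ y : ℝ) :
    ScalarBound divDiffConst fun j k => divDiffSample σ G j k y :=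
  (h.left (σ * y)).scalarBound_divDiff

theorem IsSampledPair.norm_divDiffSample_le (h : IsSampledPair G) (σ y : ℝ) (j k : ℤ) :
    ‖divDiffSample σ G j k y‖ ≤ divDiffConst := (h.scalarBound σ y).norm_le j k

theorem IsSampledPair.hasSum_divDiff_row (h : IsSampledPair G) (x y : ℝ) (j : ℤ) :
    HasSum (fun k => sampleWeight σ k x * divDiffSample σ G j k y)
      (divDiff (fun x => G x (σ * y)) j (σ * x)) :=
  (h.left (σ * y)).hasSum_divDiff_right j (σ * x)

/-- Sampling in one argument and then in the other; the bounded samples and summable weights make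
the double series absolutely convergent. -/
theorem IsSampledPair.hasSum_divDiff_prod (h : IsSampledPair G) (x₁ x₂ y : ℝ) :
    HasSum (fun q : ℤ × ℤ => sampleWeight σ q.1 x₁ * sampleWeight σ q.2 x₂ *
      divDiffSample σ G q.1 q.2 y) (divDiff (fun x => G x (σ * y)) (σ * x₁) (σ * x₂)) := by
  have hs : Summable fun q : ℤ × ℤ => sampleWeight σ q.1 x₁ * sampleWeight σ q.2 x₂ *
      divDiffSample σ G q.1 q.2 y := by
    refine Summable.of_norm_bounded (((summable_norm_sampleWeight σ x₁).mul_of_nonneg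
      (summable_norm_sampleWeight σ x₂) (fun _ => norm_nonneg _) fun _ => norm_nonneg _).mul_right
      divDiffConst) fun q => ?_
    rw [norm_mul, norm_mul]
    exact mul_le_mul_of_nonneg_left (h.norm_divDiffSample_le σ y _ _) (by positivity)
  have h1 := hs.hasSum.prod_fiberwise (fun j => by
    simpa only [mul_assoc] using (h.hasSum_divDiff_row x₂ y j).mul_left (sampleWeight σ j x₁))
  rw [((h.left (σ * y)).hasSum_divDiff (σ * x₁) (σ * x₂)).unique h1]
  exact hs.hasSum

theorem IsSampledPair.hasSum_divDiff_zero (h : IsSampledPair G) (x y : ℝ) :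
    HasSum (fun j => sampleWeight σ j x * divDiffSample σ G j 0 y)
      (divDiff (fun x => G x (σ * y)) (σ * x) 0) := by
  have := (h.left (σ * y)).hasSum_divDiff (σ * x) 0
  refine this.of_eq fun j => ?_
  simp only [divDiffSample, sampleWeight, Int.cast_zero]

end Pair

namespace IsBesovSeries

variable {α : ℕ → ℂ} {σ : ℕ → ℝ} {G : ℕ → ℝ → ℝ → ℂ} {f : ℝ → ℝ → ℂ}

theorem inv_mul_sub (h : IsBesovSeries α σ G f) (m : ℕ) (x₁ x₂ y : ℝ) :
    (((σ m)⁻¹ : ℝ) : ℂ) * (G m (σ m * x₁) (σ m * y) - G m (σ m * x₂) (σ m * y)) =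
      ((x₁ : ℂ) - x₂) * divDiff (fun x => G m x (σ m * y)) (σ m * x₁) (σ m * x₂) := by
  have h1 := sub_mul_divDiff (fun x => G m x (σ m * y)) (σ m * x₁) (σ m * x₂)
  rw [← h1]
  have h2 : (σ m : ℂ) ≠ 0 := by exact_mod_cast (h.pos m).ne'
  push_cast
  field_simp

theorem hasSum_sub (h : IsBesovSeries α σ G f) (x₁ x₂ y : ℝ) :
    HasSum (fun m => ((x₁ : ℂ) - x₂) * (α m *
      divDiff (fun x => G m x (σ m * y)) (σ m * x₁) (σ m * x₂))) (f x₁ y - f x₂ y) :=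
  (h.hasSum x₁ y x₂ y).of_eq fun m => by
    rw [mul_assoc, h.inv_mul_sub]
    ring

theorem norm_term_le (h : IsBesovSeries α σ G f) (m : ℕ) (x₁ x₂ y : ℝ) :
    ‖α m * divDiff (fun x => G m x (σ m * y)) x₁ x₂‖ ≤ ‖α m‖ * bernsteinConst := by
  rw [norm_mul]
  refine mul_le_mul_of_nonneg_left ?_ (norm_nonneg _)
  simpa using ((h.sampled m).left (σ m * y)).norm_divDiff_le x₁ x₂

theorem summable_divDiff (h : IsBesovSeries α σ G f) (x₁ x₂ y : ℝ) :
    Summable fun m => α m * divDiff (fun x => G m x (σ m * y)) (σ m * x₁) (σ m * x₂) :=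
  Summable.of_norm_bounded (h.summable.mul_right bernsteinConst) fun m => h.norm_term_le m _ _ y

/-- The factor `σ_m⁻¹` cancels the derivative of the dilation, so Bernstein bounds the
differentiated terms by a multiple of `|α_m|` uniformly in the scale. This supplies the diagonal
values of the divided difference. -/
theorem hasDerivAt_left (h : IsBesovSeries α σ G f) (x y : ℝ) :
    HasDerivAt (fun t => f t y) (∑' m, α m * deriv (fun t => G m t (σ m * y)) (σ m * x)) x := by
  have key := hasDerivAt_tsum_of_isPreconnected
    (g := fun m t => α m * ((σ m)⁻¹ : ℝ) * (G m (σ m * t) (σ m * y) - G m (σ m * 0) (σ m * y)))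
    (g' := fun m t => α m * deriv (fun t => G m t (σ m * y)) (σ m * t))
    (h.summable.mul_right bernsteinConst) isOpen_univ isPreconnected_univ
    (fun m t _ => ?_) (fun m t _ => ?_) (Set.mem_univ (0 : ℝ)) (h.hasSum 0 y 0 y).summable
    (Set.mem_univ x)
  · have e : (fun z => ∑' m, α m * ((σ m)⁻¹ : ℝ) *
        (G m (σ m * z) (σ m * y) - G m (σ m * 0) (σ m * y))) = fun t => f t y - f 0 y :=
      funext fun t => (h.hasSum t y 0 y).tsum_eq
    rw [e] at key
    simpa using key.add_const (f 0 y)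
  · have h1 : HasDerivAt (fun t : ℝ => σ m * t) (σ m) t := by
      simpa using (hasDerivAt_id t).const_mul (σ m)
    have h2 := (((h.sampled m).left (σ m * y)).differentiableAt (σ m * t)).hasDerivAt.scomp t h1
    refine ((h2.sub_const (G m (σ m * 0) (σ m * y))).const_mul
      (α m * ((σ m)⁻¹ : ℝ))).congr_deriv ?_
    have h3 : (σ m : ℂ) ≠ 0 := by exact_mod_cast (h.pos m).ne'
    rw [Complex.real_smul]
    push_cast
    field_simp
  · rw [norm_mul]
    refine mul_le_mul_of_nonneg_left ?_ (norm_nonneg _)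
    simpa using ((h.sampled m).left (σ m * y)).norm_deriv_le (σ m * t)

theorem hasSum_divDiff (h : IsBesovSeries α σ G f) (x₁ x₂ y : ℝ) :
    HasSum (fun m => α m * divDiff (fun x => G m x (σ m * y)) (σ m * x₁) (σ m * x₂))
      (divDiff (fun x => f x y) x₁ x₂) := by
  convert (h.summable_divDiff x₁ x₂ y).hasSum using 1
  by_cases hx : x₁ = x₂
  · subst hx
    simp only [divDiff, if_true]
    exact (h.hasDerivAt_left x₁ y).deriv
  · have h1 := (h.hasSum_sub x₁ x₂ y).tsum_eq
    rw [tsum_mul_left] at h1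
    have h2 : ((x₁ - x₂ : ℝ) : ℂ) ≠ 0 := by exact_mod_cast sub_ne_zero.2 hx
    rw [divDiff, if_neg hx, ← h1, Complex.ofReal_sub, mul_div_cancel_left₀]
    rwa [Complex.ofReal_sub] at h2

theorem measurable (h : IsBesovSeries α σ G f) : Measurable fun q : ℝ × ℝ => f q.1 q.2 := by
  have h1 : Measurable fun q : ℝ × ℝ => f q.1 q.2 - f 0 0 := by
    refine measurable_of_tendsto_metrizable (f := fun (n : ℕ) (q : ℝ × ℝ) =>
      ∑ m ∈ Finset.range n, α m * ((σ m)⁻¹ : ℝ) *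
        (G m (σ m * q.1) (σ m * q.2) - G m (σ m * 0) (σ m * 0))) (fun n => ?_)
      (tendsto_pi_nhds.2 fun q => (h.hasSum q.1 q.2 0 0).tendsto_sum_nat)
    refine (continuous_finsetSum _ fun m _ => continuous_const.mul (Continuous.sub ?_
      continuous_const)).measurable
    exact (h.sampled m).continuous.comp
      (by fun_prop : Continuous fun q : ℝ × ℝ => (σ m * q.1, σ m * q.2))
  simpa using h1.add_const (f 0 0)

theorem norm_axis_le (h : IsBesovSeries α σ G f) (x y : ℝ) :
    ‖f x y - f 0 y‖ ≤ |x| * ((∑' m, ‖α m‖) * bernsteinConst) := by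
  rw [← (h.hasSum_sub x 0 y).tsum_eq, tsum_mul_left, norm_mul]
  refine mul_le_mul (by simp) ?_ (norm_nonneg _) (abs_nonneg _)
  rw [← tsum_mul_right]
  exact tsum_of_norm_bounded (h.summable.mul_right bernsteinConst).hasSum
    fun m => h.norm_term_le m _ _ y

end IsBesovSeries

end BesovSeries

/-! ### The difference formula at a single scale -/

section Blocks

variable {H : Type u} [NormedAddCommGroup H] [InnerProductSpace ℂ H] [CompleteSpace H]
  {E₁ E₂ E₃ : SpectralMeasure ℝ H} {R : ℝ} {G : ℝ → ℝ → ℂ} {σ : ℝ}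

theorem essBdd_of_abs_le {E : SpectralMeasure ℝ H} (hR : E.AE fun t => |t| ≤ R) {φ : ℝ → ℂ} {C : ℝ}
    (hm : Measurable φ) (h : ∀ t, |t| ≤ R → ‖φ t‖ ≤ C) : E.EssBdd C φ :=
  ⟨hm, fun x => (hR x).mono h⟩

theorem essBdd_ofReal {E : SpectralMeasure ℝ H} (hR : E.AE fun t => |t| ≤ R) :
    E.EssBdd |R| fun t : ℝ => (t : ℂ) :=
  essBdd_of_abs_le hR Complex.measurable_ofReal fun t ht => by
    rw [Complex.norm_real]; exact ht.trans (le_abs_self R)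

theorem essBdd_one {E : SpectralMeasure ℝ H} : E.EssBdd 1 fun _ : ℝ => (1 : ℂ) :=
  ⟨measurable_const, fun _ => Eventually.of_forall fun _ => by simp⟩

theorem integral_one_apply {E : SpectralMeasure ℝ H} (x : H) :
    E.integral (fun _ : ℝ => (1 : ℂ)) x = x := by
  rw [SpectralMeasure.HasIntegral.integral_eq SpectralMeasure.hasIntegral_one]
  rfl

theorem integral_ofReal_mul_left {E : SpectralMeasure ℝ H} (hR : E.AE fun t => |t| ≤ R)
    {A : H →L[ℂ] H} (hA : E.HasIntegral (fun t : ℝ => (t : ℂ)) A) {φ : ℝ → ℂ} {C : ℝ}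
    (hφ : E.EssBdd C φ) (x : H) :
    E.integral (fun t : ℝ => (t : ℂ) * φ t) x = A (E.integral φ x) := by
  rw [(essBdd_ofReal hR).integral_mul hφ, hA.integral_eq]
  rfl

theorem integral_ofReal_mul_right {E : SpectralMeasure ℝ H} (hR : E.AE fun t => |t| ≤ R)
    {A : H →L[ℂ] H} (hA : E.HasIntegral (fun t : ℝ => (t : ℂ)) A) {φ : ℝ → ℂ} {C : ℝ}
    (hφ : E.EssBdd C φ) (x : H) :
    E.integral (fun t : ℝ => (t : ℂ) * φ t) x = E.integral φ (A x) := by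
  rw [show (fun t : ℝ => (t : ℂ) * φ t) = fun t : ℝ => φ t * t from funext fun t => mul_comm _ _,
    hφ.integral_mul (essBdd_ofReal hR), hA.integral_eq]
  rfl

/-- Both sides are `c σ⁻¹ (φ(σ t₁) - φ(σ t₂))`. On the left `t₁ - t₂` will become the increment of
the operator; on the right the variables are separated, as in the expansion defining the function of
the pair. -/
theorem sub_mul_divDiff_zero {φ : ℝ → ℂ} (hσ : σ ≠ 0) (t₁ t₂ : ℝ) (c : ℂ) :
    (t₁ : ℂ) * (c * divDiff φ (σ * t₁) (σ * t₂)) - t₂ * (c * divDiff φ (σ * t₁) (σ * t₂)) =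
      t₁ * (c * divDiff φ (σ * t₁) 0) - t₂ * (c * divDiff φ (σ * t₂) 0) := by
  have hσ' : (σ : ℂ) ≠ 0 := by exact_mod_cast hσ
  have h1 := sub_mul_divDiff φ (σ * t₁) (σ * t₂)
  have h2 := sub_mul_divDiff φ (σ * t₁) 0
  have h3 := sub_mul_divDiff φ (σ * t₂) 0
  push_cast at h1 h2 h3
  refine mul_left_cancel₀ hσ' ?_
  linear_combination c * h1 - c * h2 + c * h3

theorem IsSampledPair.essBdd_divDiffSample {E : SpectralMeasure ℝ H} (hG : IsSampledPair G) (σ : ℝ)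
    (j k : ℤ) : E.EssBdd divDiffConst (divDiffSample σ G j k) :=
  ⟨hG.measurable_divDiffSample σ j k, fun _ => Eventually.of_forall fun t =>
    hG.norm_divDiffSample_le σ t j k⟩

theorem essBdd_mul_sampleWeight {E : SpectralMeasure ℝ H} (hR : E.AE fun t => |t| ≤ R) {u : ℤ → ℝ}
    (hu : ∀ x, |x| ≤ R → ∀ j, ‖sampleWeight σ j x‖ ≤ u j) (c : ℂ) (j : ℤ) :
    E.EssBdd (‖c‖ * u j) fun t => c * sampleWeight σ j t :=
  essBdd_of_abs_le hR ((measurable_sampleWeight σ j).const_mul c) fun t ht => by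
    rw [norm_mul]
    exact mul_le_mul_of_nonneg_left (hu t ht j) (norm_nonneg c)

theorem IsSampledPair.essBdd_mul_divDiffSample {E : SpectralMeasure ℝ H} (hG : IsSampledPair G)
    (σ : ℝ) (c : ℂ) (j k : ℤ) :
    E.EssBdd (‖c‖ * divDiffConst) fun t => c * divDiffSample σ G j k t :=
  ⟨(hG.measurable_divDiffSample σ j k).const_mul c, fun _ => Eventually.of_forall fun t => by
    rw [norm_mul]
    exact mul_le_mul_of_nonneg_left (hG.norm_divDiffSample_le σ t j k) (norm_nonneg c)⟩

theorem _root_.HasSum.of_eq_of_eq {ι : Type*} {f g : ι → ℂ} {a b : ℂ} (h : HasSum f a)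
    (e : ∀ i, g i = f i) (hab : b = a) : HasSum g b := by
  rw [hab]
  exact h.of_eq e

/-- The difference `φ(A₁, B) - φ(A₂, B)` for a sampled function `φ`. -/
theorem IsSampledPair.hasSum_first (hG : IsSampledPair G) (hσ : σ ≠ 0)
    (hR₁ : E₁.AE fun t => |t| ≤ R) (hR₂ : E₂.AE fun t => |t| ≤ R) {A₁ A₂ : H →L[ℂ] H}
    (hA₁ : E₁.HasIntegral (fun t : ℝ => (t : ℂ)) A₁)
    (hA₂ : E₂.HasIntegral (fun t : ℝ => (t : ℂ)) A₂) (c c' : ℂ) (x y : H) {V : ℤ → H}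
    (hV : ∀ j z, HasSum (fun k => ⟪z, E₂.integral (fun t => c' * sampleWeight σ k t)
      (E₃.integral (divDiffSample σ G j k) x)⟫_ℂ) ⟪z, V j⟫_ℂ) :
    ∃ s, HasSum (fun j => ⟪y, E₁.integral (fun t => c * sampleWeight σ j t)
        ((A₁ - A₂) (V j))⟫_ℂ) s ∧
      HasSum (fun j => ⟪y, E₁.integral (fun t => (t : ℂ) * (c * sampleWeight σ j t))
          (E₃.integral (fun t => c' * divDiffSample σ G j 0 t) x)⟫_ℂ -
        ⟪y, E₂.integral (fun t => (t : ℂ) * (c * sampleWeight σ j t))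
          (E₃.integral (fun t => c' * divDiffSample σ G j 0 t) x)⟫_ℂ) s := by
  obtain ⟨w, e, -⟩ := exists_hilbertBasis ℂ H
  obtain ⟨u, hus, hu0, hu⟩ := exists_sampleWeight_bound σ R
  have hK := divDiffConst_nonneg
  have hp := hus.mul_of_nonneg hus hu0 hu0
  have a₁ := essBdd_mul_sampleWeight hR₁ hu
  have a₂ := essBdd_mul_sampleWeight hR₂ hu
  have d := fun j k => hG.essBdd_divDiffSample (E := E₃) σ j k
  have d' := fun j => hG.essBdd_mul_divDiffSample (E := E₃) σ c' j 0
  have n0 : ∀ (c : ℂ) j, 0 ≤ ‖c‖ * u j := fun c j => mul_nonneg (norm_nonneg _) (hu0 j)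
  have n1 : 0 ≤ ‖c'‖ * divDiffConst := mul_nonneg (norm_nonneg _) hK
  have p₁ : ∀ t₁ t₂ z : ℝ, HasSum (fun q : ℤ × ℤ => ((t₁ : ℂ) * (c * sampleWeight σ q.1 t₁)) *
      (c' * sampleWeight σ q.2 t₂) * divDiffSample σ G q.1 q.2 z)
      (t₁ * (c * c' * divDiff (fun x => G x (σ * z)) (σ * t₁) (σ * t₂))) := fun t₁ t₂ z =>
    ((hG.hasSum_divDiff_prod t₁ t₂ z).mul_left (t₁ * (c * c'))).of_eq_of_eq
      (fun q => by ring) (by ring)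
  have p₂ : ∀ t₁ t₂ z : ℝ, HasSum (fun q : ℤ × ℤ => (c * sampleWeight σ q.1 t₁) *
      ((t₂ : ℂ) * (c' * sampleWeight σ q.2 t₂)) * divDiffSample σ G q.1 q.2 z)
      (t₂ * (c * c' * divDiff (fun x => G x (σ * z)) (σ * t₁) (σ * t₂))) := fun t₁ t₂ z =>
    ((hG.hasSum_divDiff_prod t₁ t₂ z).mul_left (t₂ * (c * c'))).of_eq_of_eq
      (fun q => by ring) (by ring)
  have p₃ : ∀ t₁ _t₂ z : ℝ, HasSum (fun j : ℤ => ((t₁ : ℂ) * (c * sampleWeight σ j t₁)) * 1 *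
      (c' * divDiffSample σ G j 0 z))
      (t₁ * (c * c' * divDiff (fun x => G x (σ * z)) (σ * t₁) 0)) := fun t₁ _ z =>
    ((hG.hasSum_divDiff_zero t₁ z).mul_left (t₁ * (c * c'))).of_eq_of_eq
      (fun q => by ring) (by ring)
  have p₄ : ∀ _t₁ t₂ z : ℝ, HasSum (fun j : ℤ => 1 * ((t₂ : ℂ) * (c * sampleWeight σ j t₂)) *
      (c' * divDiffSample σ G j 0 z))
      (t₂ * (c * c' * divDiff (fun x => G x (σ * z)) (σ * t₂) 0)) := fun _ t₂ z =>
    ((hG.hasSum_divDiff_zero t₂ z).mul_left (t₂ * (c * c'))).of_eq_of_eq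
      (fun q => by ring) (by ring)
  -- The four terms of the identity are expanded separately. Multiplication by `t₁` or `t₂` costs a
  -- factor `|R|`, and the constant function `1` stands for the absent variable in the last two.
  obtain ⟨s₁, hs₁, h₁⟩ := exists_tripleElement e
    (fun q : ℤ × ℤ => mul_nonneg (abs_nonneg R) (n0 c q.1)) (fun q => n0 c' q.2) (fun _ => hK)
    (fun q => (essBdd_ofReal hR₁).mul (a₁ c q.1)) (fun q => a₂ c' q.2) (fun q => d q.1 q.2)
    ((hp.mul_left (|R| * ‖c‖ * ‖c'‖ * divDiffConst)).congr fun q => by ring) p₁ x y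
  obtain ⟨s₂, hs₂, h₂⟩ := exists_tripleElement e
    (fun q : ℤ × ℤ => n0 c q.1) (fun q => mul_nonneg (abs_nonneg R) (n0 c' q.2)) (fun _ => hK)
    (fun q => a₁ c q.1) (fun q => (essBdd_ofReal hR₂).mul (a₂ c' q.2)) (fun q => d q.1 q.2)
    ((hp.mul_left (|R| * ‖c‖ * ‖c'‖ * divDiffConst)).congr fun q => by ring) p₂ x y
  obtain ⟨s₃, hs₃, h₃⟩ := exists_tripleElement e
    (fun j : ℤ => mul_nonneg (abs_nonneg R) (n0 c j)) (fun _ => zero_le_one) (fun _ => n1)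
    (fun j => (essBdd_ofReal hR₁).mul (a₁ c j)) (fun _ => essBdd_one (E := E₂)) d'
    ((hus.mul_left (|R| * ‖c‖ * ‖c'‖ * divDiffConst)).congr fun q => by ring) p₃ x y
  obtain ⟨s₄, hs₄, h₄⟩ := exists_tripleElement e
    (fun _ => zero_le_one) (fun j : ℤ => mul_nonneg (abs_nonneg R) (n0 c j)) (fun _ => n1)
    (fun _ => essBdd_one (E := E₁)) (fun j => (essBdd_ofReal hR₂).mul (a₂ c j)) d'
    ((hus.mul_left (|R| * ‖c‖ * ‖c'‖ * divDiffConst)).congr fun q => by ring) p₄ x y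
  have hs : s₁ - s₂ = s₃ - s₄ := (h₁.sub h₂).unique (h₃.sub h₄) fun t₁ t₂ z =>
    sub_mul_divDiff_zero hσ t₁ t₂ (c * c')
  -- For fixed `j`, summation over `k` reproduces `V j`, with `A₁` taken from the first factor and
  -- `A₂` from the second to form `A₁ - A₂`.
  refine ⟨s₁ - s₂, (hs₁.sub hs₂).prod_fiberwise fun j => ?_, ?_⟩
  · have h := hV j (ContinuousLinearMap.adjoint (E₁.integral (fun t => c * sampleWeight σ j t) *
      (A₁ - A₂)) y)
    simp only [ContinuousLinearMap.adjoint_inner_left] at h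
    refine h.of_eq fun k => ?_
    simp only [integral_ofReal_mul_right hR₁ hA₁ (a₁ c j),
      integral_ofReal_mul_left hR₂ hA₂ (a₂ c' k)]
    rw [← inner_sub_right, ← map_sub]
    rfl
  · rw [hs]
    simpa only [integral_one_apply] using hs₃.sub hs₄

/-- The difference `φ(A, B₁) - φ(A, B₂)` for a sampled function `φ`. -/
theorem IsSampledPair.hasSum_second (hG : IsSampledPair G) (hσ : σ ≠ 0)
    (hR₂ : E₂.AE fun t => |t| ≤ R) (hR₃ : E₃.AE fun t => |t| ≤ R) {B₁ B₂ : H →L[ℂ] H}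
    (hB₁ : E₂.HasIntegral (fun t : ℝ => (t : ℂ)) B₁)
    (hB₂ : E₃.HasIntegral (fun t : ℝ => (t : ℂ)) B₂) (c c' : ℂ) (x y : H) {V : ℤ → H →L[ℂ] H}
    (hV : ∀ k v, HasSum (fun j => ⟪y, E₁.integral (divDiffSample σ G j k)
      (E₂.integral (fun t => c * sampleWeight σ j t) v)⟫_ℂ) ⟪y, V k v⟫_ℂ) :
    ∃ s, HasSum (fun k => ⟪y, V k ((B₁ - B₂)
        (E₃.integral (fun t => c' * sampleWeight σ k t) x))⟫_ℂ) s ∧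
      HasSum (fun j => ⟪y, E₁.integral (fun t => c' * divDiffSample σ G j 0 t)
          (E₂.integral (fun t => (t : ℂ) * (c * sampleWeight σ j t)) x)⟫_ℂ -
        ⟪y, E₁.integral (fun t => c' * divDiffSample σ G j 0 t)
          (E₃.integral (fun t => (t : ℂ) * (c * sampleWeight σ j t)) x)⟫_ℂ) s := by
  obtain ⟨w, e, -⟩ := exists_hilbertBasis ℂ H
  obtain ⟨u, hus, hu0, hu⟩ := exists_sampleWeight_bound σ R
  have hK := divDiffConst_nonneg
  have hp := hus.mul_of_nonneg hus hu0 hu0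
  have a₂ := essBdd_mul_sampleWeight hR₂ hu
  have a₃ := essBdd_mul_sampleWeight hR₃ hu
  have d := fun j k => hG.essBdd_divDiffSample (E := E₁) σ j k
  have d' := fun j => hG.essBdd_mul_divDiffSample (E := E₁) σ c' j 0
  have n0 : ∀ (c : ℂ) j, 0 ≤ ‖c‖ * u j := fun c j => mul_nonneg (norm_nonneg _) (hu0 j)
  have n1 : 0 ≤ ‖c'‖ * divDiffConst := mul_nonneg (norm_nonneg _) hK
  have p₁ : ∀ z t₁ t₂ : ℝ, HasSum (fun q : ℤ × ℤ => divDiffSample σ G q.1 q.2 z *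
      ((t₁ : ℂ) * (c * sampleWeight σ q.1 t₁)) * (c' * sampleWeight σ q.2 t₂))
      (t₁ * (c * c' * divDiff (fun x => G x (σ * z)) (σ * t₁) (σ * t₂))) := fun z t₁ t₂ =>
    ((hG.hasSum_divDiff_prod t₁ t₂ z).mul_left (t₁ * (c * c'))).of_eq_of_eq
      (fun q => by ring) (by ring)
  have p₂ : ∀ z t₁ t₂ : ℝ, HasSum (fun q : ℤ × ℤ => divDiffSample σ G q.1 q.2 z *
      (c * sampleWeight σ q.1 t₁) * ((t₂ : ℂ) * (c' * sampleWeight σ q.2 t₂)))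
      (t₂ * (c * c' * divDiff (fun x => G x (σ * z)) (σ * t₁) (σ * t₂))) := fun z t₁ t₂ =>
    ((hG.hasSum_divDiff_prod t₁ t₂ z).mul_left (t₂ * (c * c'))).of_eq_of_eq
      (fun q => by ring) (by ring)
  have p₃ : ∀ z t₁ _t₂ : ℝ, HasSum (fun j : ℤ => (c' * divDiffSample σ G j 0 z) *
      ((t₁ : ℂ) * (c * sampleWeight σ j t₁)) * 1)
      (t₁ * (c * c' * divDiff (fun x => G x (σ * z)) (σ * t₁) 0)) := fun z t₁ _ =>
    ((hG.hasSum_divDiff_zero t₁ z).mul_left (t₁ * (c * c'))).of_eq_of_eq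
      (fun q => by ring) (by ring)
  have p₄ : ∀ z _t₁ t₂ : ℝ, HasSum (fun j : ℤ => (c' * divDiffSample σ G j 0 z) * 1 *
      ((t₂ : ℂ) * (c * sampleWeight σ j t₂)))
      (t₂ * (c * c' * divDiff (fun x => G x (σ * z)) (σ * t₂) 0)) := fun z _ t₂ =>
    ((hG.hasSum_divDiff_zero t₂ z).mul_left (t₂ * (c * c'))).of_eq_of_eq
      (fun q => by ring) (by ring)
  obtain ⟨s₁, hs₁, h₁⟩ := exists_tripleElement e (fun _ => hK)
    (fun q : ℤ × ℤ => mul_nonneg (abs_nonneg R) (n0 c q.1)) (fun q => n0 c' q.2)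
    (fun q => d q.1 q.2) (fun q => (essBdd_ofReal hR₂).mul (a₂ c q.1)) (fun q => a₃ c' q.2)
    ((hp.mul_left (|R| * ‖c‖ * ‖c'‖ * divDiffConst)).congr fun q => by ring) p₁ x y
  obtain ⟨s₂, hs₂, h₂⟩ := exists_tripleElement e (fun _ => hK)
    (fun q : ℤ × ℤ => n0 c q.1) (fun q => mul_nonneg (abs_nonneg R) (n0 c' q.2))
    (fun q => d q.1 q.2) (fun q => a₂ c q.1) (fun q => (essBdd_ofReal hR₃).mul (a₃ c' q.2))
    ((hp.mul_left (|R| * ‖c‖ * ‖c'‖ * divDiffConst)).congr fun q => by ring) p₂ x y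
  obtain ⟨s₃, hs₃, h₃⟩ := exists_tripleElement e (fun _ => n1)
    (fun j : ℤ => mul_nonneg (abs_nonneg R) (n0 c j)) (fun _ => zero_le_one)
    d' (fun j => (essBdd_ofReal hR₂).mul (a₂ c j)) (fun _ => essBdd_one (E := E₃))
    ((hus.mul_left (|R| * ‖c‖ * ‖c'‖ * divDiffConst)).congr fun q => by ring) p₃ x y
  obtain ⟨s₄, hs₄, h₄⟩ := exists_tripleElement e (fun _ => n1)
    (fun _ => zero_le_one) (fun j : ℤ => mul_nonneg (abs_nonneg R) (n0 c j))
    d' (fun _ => essBdd_one (E := E₂)) (fun j => (essBdd_ofReal hR₃).mul (a₃ c j))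
    ((hus.mul_left (|R| * ‖c‖ * ‖c'‖ * divDiffConst)).congr fun q => by ring) p₄ x y
  have hs : s₁ - s₂ = s₃ - s₄ := (h₁.sub h₂).unique (h₃.sub h₄) fun z t₁ t₂ =>
    sub_mul_divDiff_zero hσ t₁ t₂ (c * c')
  have h12 := hs₁.sub hs₂
  -- Here `V k` contains the sum over the first index, so the indices are exchanged before summing
  -- along fibres.
  rw [← (Equiv.prodComm ℤ ℤ).hasSum_iff] at h12
  refine ⟨s₁ - s₂, h12.prod_fiberwise fun k => ?_, ?_⟩
  · refine (hV k _).of_eq fun j => ?_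
    simp only [Function.comp, Equiv.prodComm_apply, Prod.swap_prod_mk]
    rw [integral_ofReal_mul_right hR₂ hB₁ (a₂ c j), integral_ofReal_mul_left hR₃ hB₂ (a₃ c' k),
      ← inner_sub_right, ← map_sub, ← map_sub]
    rfl
  · rw [hs]
    simpa only [integral_one_apply] using hs₃.sub hs₄

end Blocks

/-! ### Assembling the scales -/

section Factors

/-- The modulus `|a|^{1/2}` in the factorisation `a = |a|^{1/2} · (a / |a|^{1/2})`. -/
noncomputable def halfWeight (a : ℂ) : ℂ := (√‖a‖ : ℝ)

noncomputable def coWeight (a : ℂ) : ℂ := a / halfWeight a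

theorem norm_halfWeight_sq (a : ℂ) : ‖halfWeight a‖ ^ 2 = ‖a‖ := by
  rw [halfWeight, Complex.norm_real, Real.norm_of_nonneg (Real.sqrt_nonneg _),
    Real.sq_sqrt (norm_nonneg _)]

theorem halfWeight_mul_coWeight (a : ℂ) : halfWeight a * coWeight a = a := by
  rw [coWeight]
  by_cases h : halfWeight a = 0
  · have := norm_halfWeight_sq a
    rw [h, norm_zero, zero_pow two_ne_zero] at this
    rw [norm_eq_zero.1 this.symm]
    simp
  · exact mul_div_cancel₀ _ h

theorem norm_coWeight_sq (a : ℂ) : ‖coWeight a‖ ^ 2 = ‖a‖ := by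
  by_cases h : a = 0
  · simp [h, coWeight]
  · have h1 : ‖halfWeight a‖ ^ 2 * ‖coWeight a‖ ^ 2 = ‖a‖ ^ 2 := by
      rw [← mul_pow, ← norm_mul, halfWeight_mul_coWeight]
    rw [norm_halfWeight_sq, sq ‖a‖] at h1
    exact mul_left_cancel₀ (norm_ne_zero_iff.2 h) h1

theorem ScalarBound.comp_equiv {ι κ ι' κ' : Type*} {C : ℝ} {b : ι → κ → ℂ} (hb : ScalarBound C b)
    (e : ι' ≃ ι) (e' : κ' ≃ κ) : ScalarBound C fun j k => b (e j) (e' k) := fun J K p r => by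
  have h := hb (J.map e.toEmbedding) (K.map e'.toEmbedding) (fun j => p (e.symm j))
    (fun k => r (e'.symm k))
  simpa using h

theorem hasSum_block {M : Type*} [AddCommMonoid M] [TopologicalSpace M] {g : ℤ → M} {a : M} (m : ℕ)
    (h : HasSum g a) : HasSum (fun k : ℕ × ℤ => if m = k.1 then g k.2 else 0) a := by
  have hinj : Function.Injective (Prod.mk m : ℤ → ℕ × ℤ) := fun _ _ h => (Prod.mk.inj h).2
  rw [← hinj.hasSum_iff]
  · simpa [Function.comp_def] using h
  · rintro ⟨m', j⟩ hx
    rw [if_neg]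
    rintro rfl
    exact hx ⟨j, rfl⟩

theorem sum_prod_le {c : ℕ → ℝ} (hc : Summable c) (hc0 : ∀ m, 0 ≤ c m) {v : ℕ × ℤ → ℝ} {K : ℝ}
    (hK : 0 ≤ K) (hv0 : ∀ i, 0 ≤ v i) (hv : ∀ m (J : Finset ℤ), ∑ j ∈ J, v (m, j) ≤ K)
    (F : Finset (ℕ × ℤ)) : ∑ i ∈ F, c i.1 * v i ≤ (∑' m, c m) * K := by
  classical
  calc ∑ i ∈ F, c i.1 * v i ≤ ∑ i ∈ F.image Prod.fst ×ˢ F.image Prod.snd, c i.1 * v i :=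
        Finset.sum_le_sum_of_subset_of_nonneg Finset.subset_product
          fun i _ _ => mul_nonneg (hc0 _) (hv0 _)
    _ = ∑ m ∈ F.image Prod.fst, c m * ∑ j ∈ F.image Prod.snd, v (m, j) := by
        rw [Finset.sum_product]
        exact Finset.sum_congr rfl fun m _ => by rw [Finset.mul_sum]
    _ ≤ ∑ m ∈ F.image Prod.fst, c m * K :=
        Finset.sum_le_sum fun m _ => mul_le_mul_of_nonneg_left (hv m _) (hc0 m)
    _ ≤ _ := by
        rw [← Finset.sum_mul]
        exact mul_le_mul_of_nonneg_right (hc.sum_le_tsum _ fun m _ => hc0 m) hK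

/-- An enumeration of the pairs of a scale and a sampling point. -/
def scaleEquiv : ℕ ≃ ℕ × ℤ := (Denumerable.eqv (ℕ × ℤ)).symm

variable {α : ℕ → ℂ} {σ : ℕ → ℝ} {G : ℕ → ℝ → ℝ → ℂ} {f : ℝ → ℝ → ℂ}

/-- Together with `rightFactor` this distributes `α_m` over the two columns as factors each of
modulus `|α_m|^{1/2}`, so both are square summable when `∑ |α_m| < ∞` and no weight remains on the
blocks. -/
noncomputable def leftFactor (α : ℕ → ℂ) (σ : ℕ → ℝ) (i : ℕ × ℤ) (x : ℝ) : ℂ :=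
  halfWeight (α i.1) * sampleWeight (σ i.1) i.2 x

noncomputable def rightFactor (α : ℕ → ℂ) (σ : ℕ → ℝ) (i : ℕ × ℤ) (x : ℝ) : ℂ :=
  coWeight (α i.1) * sampleWeight (σ i.1) i.2 x

noncomputable def blockFactor (σ : ℕ → ℝ) (G : ℕ → ℝ → ℝ → ℂ) (i k : ℕ × ℤ) (y : ℝ) : ℂ :=
  if i.1 = k.1 then divDiffSample (σ i.1) (G i.1) i.2 k.2 y else 0

theorem hasSum_option {ι M : Type*} [AddCommMonoid M] [TopologicalSpace M] [ContinuousAdd M]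
    {g : Option ι → M} {a : M} (h : HasSum (fun i => g (some i)) a) : HasSum g (g none + a) := by
  classical
  have h1 : HasSum (fun o : Option ι => if o = none then g none else 0) (g none) :=
    hasSum_ite_eq none _
  have h2 : HasSum (fun o : Option ι => o.elim 0 fun i => g (some i)) a := by
    rw [← (Option.some_injective ι).hasSum_iff]
    · exact h
    · rintro (_ | i) hx
      · rfl
      · exact absurd ⟨i, rfl⟩ hx
  refine (h1.add h2).of_eq fun o => ?_
  cases o <;> simp

theorem sum_option_le {ι : Type*} {g : Option ι → ℝ} (hg : ∀ o, 0 ≤ g o) {a b : ℝ} (ha : g none ≤ a)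
    (hb : ∀ F : Finset ι, ∑ i ∈ F, g (some i) ≤ b) (F : Finset (Option ι)) :
    ∑ o ∈ F, g o ≤ a + b := by
  classical
  calc ∑ o ∈ F, g o ≤ ∑ o ∈ Finset.insertNone (Finset.eraseNone F), g o :=
        Finset.sum_le_sum_of_subset_of_nonneg (by simp [Finset.insertNone_eraseNone])
          fun o _ _ => hg o
    _ = g none + ∑ i ∈ Finset.eraseNone F, g (some i) := Finset.sum_insertNone ..
    _ ≤ a + b := add_le_add ha (hb _)

/-- The boundedness of the block diagonal matrix gives the double limit, and its value is computed
by iterated sums: within a row, then over sampling points of one scale, then over scales. -/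
theorem tendsto_block_form (e : ℕ ≃ ℕ × ℤ) {K : ℝ} (hK : 0 ≤ K) {b : ℕ → ℤ → ℤ → ℂ} (hb : ∀ m, ScalarBound K (b m))
    {l r : ℕ × ℤ → ℂ} (hl : Summable fun i => ‖l i‖ ^ 2) (hr : Summable fun i => ‖r i‖ ^ 2)
    {d : ℕ × ℤ → ℂ} (hd : ∀ i, HasSum (fun k => b i.1 i.2 k * r (i.1, k)) (d i)) {t : ℕ → ℂ}
    (ht : ∀ m, HasSum (fun j => l (m, j) * d (m, j)) (t m)) {S : ℂ} (hS : HasSum t S) :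
    Tendsto (fun N : ℕ × ℕ => ∑ j ∈ Finset.range N.1, ∑ k ∈ Finset.range N.2,
      l (e j) * r (e k) * (if (e j).1 = (e k).1 then
        b (e j).1 (e j).2 (e k).2 else 0)) atTop (𝓝 S) := by
  have hF := ((ScalarBound.block hK hb).comp_equiv e e).formBound (H := ℂ) hK
  have hp : Summable fun j : ℕ => ‖(starRingEnd ℂ) (l (e j))‖ ^ 2 := by
    simp only [RCLike.norm_conj]
    exact hl.comp_injective e.injective
  have hr' : Summable fun k : ℕ => ‖r (e k)‖ ^ 2 :=
    hr.comp_injective e.injective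
  have hrow : ∀ i : ℕ × ℤ, HasSum (fun k : ℕ × ℤ => (if i.1 = k.1 then b i.1 i.2 k.2 else 0) * r k)
      (d i) := fun i => by
    refine (hasSum_block i.1 (hd i)).of_eq fun k => ?_
    split_ifs with hik
    · rw [hik]
    · rw [zero_mul]
  have hrow' : ∀ j, rowSum (fun j k => (if (e j).1 = (e k).1 then
        b (e j).1 (e j).2 (e k).2 else 0) • (1 : ℂ →L[ℂ] ℂ))
      (fun k => r (e k)) j = d (e j) := fun j =>
    (hF.hasSum_rowSum hr' j).unique (e.hasSum_iff.2 (hrow (e j)))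
  have hsum := (hF.summable_inner_rowSum hp hr').hasSum
  have hval := hsum.of_eq (g := fun j => l (e j) * d (e j)) fun j => by
    rw [hrow', RCLike.inner_apply, RCLike.conj_conj, mul_comm]
  have hfib := ((e.hasSum_iff (f := fun i => l i * d i)).1 hval).prod_fiberwise ht
  rw [hS.unique hfib]
  refine ((hF.tendsto_form hp hr').comp tendsto_range_prod_range).congr fun N => ?_
  refine Finset.sum_congr rfl fun j _ => Finset.sum_congr rfl fun k _ => ?_
  rw [RCLike.inner_apply, RCLike.conj_conj, mul_assoc, mul_comm (r _)]
  exact mul_comm _ _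

namespace IsBesovSeries

theorem sum_sq_weight_le (h : IsBesovSeries α σ G f) {u : ℕ → ℂ} (hu : ∀ m, ‖u m‖ ^ 2 = ‖α m‖)
    {v : ℕ × ℤ → ℂ} {K : ℝ} (hK : 0 ≤ K)
    (hv : ∀ m (J : Finset ℤ), ∑ j ∈ J, ‖v (m, j)‖ ^ 2 ≤ K) (F : Finset (ℕ × ℤ)) :
    ∑ i ∈ F, ‖u i.1 * v i‖ ^ 2 ≤ (∑' m, ‖α m‖) * K := by
  simp only [norm_mul, mul_pow, hu]
  exact sum_prod_le h.summable (fun _ => norm_nonneg _) hK (fun _ => sq_nonneg _) hv F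

theorem sum_sq_leftFactor_le (h : IsBesovSeries α σ G f) (x : ℝ) (F : Finset (ℕ × ℤ)) :
    ∑ i ∈ F, ‖leftFactor α σ i x‖ ^ 2 ≤ (∑' m, ‖α m‖) * samplingConst ^ 2 := by
  unfold leftFactor
  exact h.sum_sq_weight_le (u := fun m => halfWeight (α m)) (fun m => norm_halfWeight_sq (α m))
    (sq_nonneg _) (v := fun i => sampleWeight (σ i.1) i.2 x)
    (fun m J => sum_sq_sampleWeight_le (σ m) x J) F

theorem sum_sq_rightFactor_le (h : IsBesovSeries α σ G f) (x : ℝ) (F : Finset (ℕ × ℤ)) :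
    ∑ i ∈ F, ‖rightFactor α σ i x‖ ^ 2 ≤ (∑' m, ‖α m‖) * samplingConst ^ 2 := by
  unfold rightFactor
  exact h.sum_sq_weight_le (u := fun m => coWeight (α m)) (fun m => norm_coWeight_sq (α m))
    (sq_nonneg _) (v := fun i => sampleWeight (σ i.1) i.2 x)
    (fun m J => sum_sq_sampleWeight_le (σ m) x J) F

theorem sum_sq_column_le (h : IsBesovSeries α σ G f) (y : ℝ) (F : Finset (ℕ × ℤ)) :
    ∑ i ∈ F, ‖coWeight (α i.1) * divDiffSample (σ i.1) (G i.1) i.2 0 y‖ ^ 2 ≤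
      (∑' m, ‖α m‖) * divDiffConst ^ 2 :=
  h.sum_sq_weight_le (u := fun m => coWeight (α m)) (fun m => norm_coWeight_sq (α m))
    (sq_nonneg _) (v := fun i => divDiffSample (σ i.1) (G i.1) i.2 0 y) (fun m J =>
      ((h.sampled m).scalarBound (σ m) y).sum_sq_column_le divDiffConst_nonneg 0 J) F

theorem scalarBound_blockFactor (h : IsBesovSeries α σ G f) (y : ℝ) :
    ScalarBound divDiffConst fun i k => blockFactor σ G i k y := by
  unfold blockFactor
  exact ScalarBound.block (b := fun m j k => divDiffSample (σ m) (G m) j k y)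
    divDiffConst_nonneg fun m => (h.sampled m).scalarBound (σ m) y

theorem measurable_blockFactor (h : IsBesovSeries α σ G f) (i k : ℕ × ℤ) :
    Measurable (blockFactor σ G i k) := by
  unfold blockFactor
  by_cases hik : i.1 = k.1
  · simp only [if_pos hik]
    exact (h.sampled i.1).measurable_divDiffSample _ _ _
  · simp only [if_neg hik]
    exact measurable_const

/-- The Haagerup-like representation of the divided difference in the first variable. -/
theorem tendsto_factors (h : IsBesovSeries α σ G f) (x₁ x₂ y : ℝ) :
    Tendsto (fun N : ℕ × ℕ => ∑ j ∈ Finset.range N.1, ∑ k ∈ Finset.range N.2,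
      leftFactor α σ (scaleEquiv j) x₁ * rightFactor α σ (scaleEquiv k) x₂ *
        blockFactor σ G (scaleEquiv j) (scaleEquiv k) y) atTop
      (𝓝 (divDiff (fun x => f x y) x₁ x₂)) := by
  refine tendsto_block_form scaleEquiv divDiffConst_nonneg
    (b := fun m j k => divDiffSample (σ m) (G m) j k y)
    (fun m => (h.sampled m).scalarBound (σ m) y)
    (l := fun i => leftFactor α σ i x₁) (r := fun k => rightFactor α σ k x₂)
    (summable_of_sum_le (fun _ => sq_nonneg _) (h.sum_sq_leftFactor_le x₁))
    (summable_of_sum_le (fun _ => sq_nonneg _) (h.sum_sq_rightFactor_le x₂))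
    (d := fun i => coWeight (α i.1) * divDiff (fun x => G i.1 x (σ i.1 * y)) i.2 (σ i.1 * x₂))
    (fun i => ?_) (fun m => ?_) (h.hasSum_divDiff x₁ x₂ y)
  · refine (((h.sampled i.1).hasSum_divDiff_row x₂ y i.2).mul_left
      (coWeight (α i.1))).of_eq fun k => ?_
    simp only [rightFactor]
    ring
  · refine ((((h.sampled m).left (σ m * y)).hasSum_divDiff (σ m * x₁) (σ m * x₂)).mul_left
      (α m)).of_eq fun j => ?_
    simp only [leftFactor, sampleWeight]
    linear_combination samplingKernel (σ m * x₁ - j) *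
      divDiff (fun x => G m x (σ m * y)) j (σ m * x₂) * halfWeight_mul_coWeight (α m)

/-- The factors depending on the first variable in the expansion
`f(x, y) = f(0, y) + ∑ (f(x, y) - f(0, y))`. -/
noncomputable def _root_.OpInt.columnLeft (α : ℕ → ℂ) (σ : ℕ → ℝ) (o : Option (ℕ × ℤ)) (x : ℝ) : ℂ :=
  o.elim 1 fun i => x * leftFactor α σ i x

noncomputable def _root_.OpInt.columnRight (α : ℕ → ℂ) (σ : ℕ → ℝ) (G : ℕ → ℝ → ℝ → ℂ)
    (f : ℝ → ℝ → ℂ) (o : Option (ℕ × ℤ)) (y : ℝ) : ℂ :=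
  o.elim (f 0 y) fun i => coWeight (α i.1) * divDiffSample (σ i.1) (G i.1) i.2 0 y

/-- The increment from `0` to `x` is `x` times the divided difference at `(x,0)`, sampled in the
first variable only. The index `none` carries the term `f(0,y)`. -/
theorem hasSum_column (h : IsBesovSeries α σ G f) (x y : ℝ) :
    HasSum (fun o => columnLeft α σ o x * columnRight α σ G f o y) (f x y) := by
  have hs : Summable fun i : ℕ × ℤ => leftFactor α σ i x *
      (coWeight (α i.1) * divDiffSample (σ i.1) (G i.1) i.2 0 y) := by
    refine (summable_inner_of_sq (E := ℂ) (p := fun i : ℕ × ℤ => (starRingEnd ℂ)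
      (leftFactor α σ i x)) (r := fun i : ℕ × ℤ => coWeight (α i.1) *
        divDiffSample (σ i.1) (G i.1) i.2 0 y) ?_ ?_).congr fun i => ?_
    · simp only [RCLike.norm_conj]
      exact summable_of_sum_le (fun _ => sq_nonneg _) (h.sum_sq_leftFactor_le x)
    · exact summable_of_sum_le (fun _ => sq_nonneg _) (h.sum_sq_column_le y)
    · rw [RCLike.inner_apply, RCLike.conj_conj, mul_comm]
  have h1 := hs.hasSum.prod_fiberwise fun m =>
    (((h.sampled m).hasSum_divDiff_zero (σ := σ m) x y).mul_left
      (halfWeight (α m) * coWeight (α m))).of_eq fun j => by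
        simp only [leftFactor]; ring
  simp only [halfWeight_mul_coWeight] at h1
  have h2 := h.hasSum_sub x 0 y
  simp only [mul_zero, Complex.ofReal_zero, sub_zero] at h2
  have h3 := h2.unique (h1.mul_left (x : ℂ))
  have h4 := hasSum_option (g := fun o => columnLeft α σ o x * columnRight α σ G f o y)
    ((hs.hasSum.mul_left (x : ℂ)).of_eq fun i => by
      simp only [columnLeft, columnRight, Option.elim_some]; ring)
  rw [← h3] at h4
  simpa only [columnLeft, columnRight, Option.elim_none, one_mul, add_sub_cancel] using h4

/-- The left column is controlled by the weights on `|x| ≤ R`. In the right column the samples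
`D(j,0,y)` form a column of a bounded matrix, so they are square summable uniformly in `y`. -/
theorem isColumnRep {H : Type u} [NormedAddCommGroup H] [InnerProductSpace ℂ H] [CompleteSpace H]
    {E₁ E₂ : SpectralMeasure ℝ H} {R : ℝ} (h : IsBesovSeries α σ G f)
    (hR₁ : E₁.AE fun t => |t| ≤ R) (hR₂ : E₂.AE fun t => |t| ≤ R) :
    ∃ C, IsColumnRep E₁ E₂ f (columnLeft α σ) (columnRight α σ G f) C := by
  set S := ∑' m, ‖α m‖ with hS
  have hS0 : 0 ≤ S := tsum_nonneg fun _ => norm_nonneg _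
  set C₁ := 1 + R ^ 2 * (S * samplingConst ^ 2) with hC₁
  -- The first summand bounds `|f(0,y)|²` for `|y| ≤ R` by the Lipschitz estimate along the second
  -- axis; the other bounds the column of samples.
  set C₂ := (‖f 0 0‖ + |R| * (S * bernsteinConst)) ^ 2 + S * divDiffConst ^ 2 with hC₂
  have h1 : 0 ≤ C₁ := by positivity
  have h2 : 0 ≤ C₂ := by positivity
  have hmeas := h.measurable
  refine ⟨C₁ + C₂, by positivity, ?_, ?_, ?_, ?_, h.hasSum_column, hmeas⟩
  · rintro (_ | i)
    · exact measurable_const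
    · exact Complex.measurable_ofReal.mul ((measurable_sampleWeight _ _).const_mul _)
  · rintro (_ | i)
    · exact hmeas.comp (by fun_prop : Measurable fun y : ℝ => ((0 : ℝ), y))
    · exact ((h.sampled i.1).measurable_divDiffSample _ _ _).const_mul _
  · refine fun v => (hR₁ v).mono fun x hx F => (sum_option_le (fun _ => sq_nonneg _)
      (a := 1) (by simp [columnLeft]) (fun F => ?_) F).trans (le_add_of_nonneg_right h2)
    simp only [columnLeft, Option.elim_some, norm_mul (x : ℂ), mul_pow, ← Finset.mul_sum]
    refine mul_le_mul ?_ (h.sum_sq_leftFactor_le x F) (Finset.sum_nonneg fun _ _ => sq_nonneg _)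
      (sq_nonneg _)
    rw [Complex.norm_real, Real.norm_eq_abs, sq_abs]
    exact sq_le_sq' (neg_le_of_abs_le hx) (le_of_abs_le hx)
  · refine fun v => (hR₂ v).mono fun y hy F => (sum_option_le (fun _ => sq_nonneg _)
      (a := (‖f 0 0‖ + |R| * (S * bernsteinConst)) ^ 2) ?_ (fun F => ?_) F).trans
        (le_add_of_nonneg_left h1)
    · refine pow_le_pow_left₀ (norm_nonneg _) ?_ 2
      have h3 := h.flip.norm_axis_le y 0
      have h4 : |y| * (S * bernsteinConst) ≤ |R| * (S * bernsteinConst) :=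
        mul_le_mul_of_nonneg_right (hy.trans (le_abs_self R))
          (mul_nonneg hS0 bernsteinConst_nonneg)
      calc ‖f 0 y‖ = ‖f 0 0 + (f 0 y - f 0 0)‖ := by rw [add_sub_cancel]
        _ ≤ _ := (norm_add_le _ _).trans (add_le_add_right (h3.trans h4) _)
    · exact h.sum_sq_column_le y F

end IsBesovSeries

end Factors

/-! ### The difference formula and the theorem -/

section Difference

variable {H : Type u} [NormedAddCommGroup H] [InnerProductSpace ℂ H] [CompleteSpace H]
  {E₁ E₂ E₃ : SpectralMeasure ℝ H} {R p : ℝ}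
  {α : ℕ → ℂ} {σ : ℕ → ℝ} {G : ℕ → ℝ → ℝ → ℂ} {f : ℝ → ℝ → ℂ}

theorem integral_zero (E : SpectralMeasure ℝ H) : E.integral (fun _ : ℝ => (0 : ℂ)) = 0 := by
  have h0 : E.EssBdd 0 fun _ : ℝ => (0 : ℂ) :=
    ⟨measurable_const, fun _ => Eventually.of_forall fun _ => by simp⟩
  ext x
  simpa using h0.norm_apply_le le_rfl x

theorem blockFactor_self (m : ℕ) (j k : ℤ) :
    blockFactor σ G (m, j) (m, k) = divDiffSample (σ m) (G m) j k := by
  funext y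
  simp only [blockFactor, if_true]

theorem blockFactor_of_ne {i k : ℕ × ℤ} (h : i.1 ≠ k.1) :
    blockFactor σ G i k = fun _ => 0 := by
  funext y
  simp only [blockFactor, if_neg h]

theorem hasSum_of_block (e : ℕ ≃ ℕ × ℤ) {g : ℕ × ℤ → ℂ} {a : ℂ} {m : ℕ}
    (h : HasSum (fun k : ℕ => g (e k)) a) (h0 : ∀ k : ℕ × ℤ, m ≠ k.1 → g k = 0) :
    HasSum (fun j : ℤ => g (m, j)) a := by
  have h1 : HasSum g a := e.hasSum_iff.1 h
  have hinj : Function.Injective (Prod.mk m : ℤ → ℕ × ℤ) := fun _ _ h => (Prod.mk.inj h).2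
  refine (hinj.hasSum_iff ?_).2 h1
  rintro ⟨m', j⟩ hx
  refine h0 _ ?_
  rintro rfl
  exact hx ⟨j, rfl⟩

/-- The two sides are compared scale by scale, since the single-scale identity gives equality only
after summation over the sampling points. -/
theorem eq_of_fiberwise (e : ℕ ≃ ℕ × ℤ) {g : ℕ → ℂ} {g' : ℕ × ℤ → ℂ} {a a' : ℂ} (h : HasSum g a)
    (h' : HasSum g' a') (hs : ∀ m, ∃ s, HasSum (fun j : ℤ => g (e.symm (m, j))) s ∧
      HasSum (fun j => g' (m, j)) s) : a = a' := by
  choose s h1 h2 using hs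
  have h3 : HasSum (fun i => g (e.symm i)) a := e.symm.hasSum_iff.2 h
  exact (h3.prod_fiberwise h1).unique (h'.prod_fiberwise h2)

namespace IsBesovSeries

theorem memLinftyL2_leftFactor (h : IsBesovSeries α σ G f) (E : SpectralMeasure ℝ H) :
    MemLinftyL2 E fun j => leftFactor α σ (scaleEquiv j) :=
  ⟨fun j => (measurable_sampleWeight _ _).const_mul _, (∑' m, ‖α m‖) * samplingConst ^ 2,
    fun _ => Eventually.of_forall fun x => by
      have hb := h.sum_sq_leftFactor_le x
      have hs := summable_of_sum_le (fun _ => sq_nonneg _) hb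
      exact ⟨hs.comp_injective scaleEquiv.injective,
        (scaleEquiv.tsum_eq fun i => ‖leftFactor α σ i x‖ ^ 2).trans_le (hs.tsum_le_of_sum_le hb)⟩⟩

theorem memLinftyL2_rightFactor (h : IsBesovSeries α σ G f) (E : SpectralMeasure ℝ H) :
    MemLinftyL2 E fun j => rightFactor α σ (scaleEquiv j) :=
  ⟨fun j => (measurable_sampleWeight _ _).const_mul _, (∑' m, ‖α m‖) * samplingConst ^ 2,
    fun _ => Eventually.of_forall fun x => by
      have hb := h.sum_sq_rightFactor_le x
      have hs := summable_of_sum_le (fun _ => sq_nonneg _) hb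
      exact ⟨hs.comp_injective scaleEquiv.injective,
        (scaleEquiv.tsum_eq fun i => ‖rightFactor α σ i x‖ ^ 2).trans_le
          (hs.tsum_le_of_sum_le hb)⟩⟩

theorem memLinftyMatrix_blockFactor (h : IsBesovSeries α σ G f) (E : SpectralMeasure ℝ H) :
    MemLinftyMatrix E fun j k => blockFactor σ G (scaleEquiv j) (scaleEquiv k) :=
  ⟨fun _ _ => h.measurable_blockFactor _ _, divDiffConst, fun _ => Eventually.of_forall fun y =>
    ((h.scalarBound_blockFactor y).comp_equiv scaleEquiv scaleEquiv).matrixNormLE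
      divDiffConst_nonneg⟩

theorem exists_isDOI (h : IsBesovSeries α σ G f) (hR₁ : E₁.AE fun t => |t| ≤ R)
    (hR₂ : E₂.AE fun t => |t| ≤ R) : ∃ F : H →L[ℂ] H, IsDOI E₁ E₂ f 1 F ∧
      ∀ x y, HasSum (fun o => ⟪y, E₁.integral (columnLeft α σ o)
        (E₂.integral (columnRight α σ G f o) x)⟫_ℂ) ⟪y, F x⟫_ℂ := by
  obtain ⟨C, hC⟩ := h.isColumnRep hR₁ hR₂
  exact hC.exists_isDOI

/-- When the second operator varies, the expansion must separate `y` from `0`. It defines the same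
operator as the expansion in `x`, since the double operator integral is unique. -/
theorem exists_isDOI_flip (h : IsBesovSeries α σ G f) (hR₁ : E₁.AE fun t => |t| ≤ R)
    (hR₂ : E₂.AE fun t => |t| ≤ R) : ∃ F : H →L[ℂ] H, IsDOI E₁ E₂ f 1 F ∧
      ∀ x y, HasSum (fun o => ⟪y, E₁.integral (columnRight α σ (fun m y x => G m x y)
        (fun y x => f x y) o) (E₂.integral (columnLeft α σ o) x)⟫_ℂ) ⟪y, F x⟫_ℂ := by
  obtain ⟨C, hC⟩ := h.flip.isColumnRep hR₂ hR₁
  exact hC.symm.exists_isDOI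

/-- The triple integral is the sum over all scales of the series of `IsSampledPair.hasSum_first`,
because the block structure leaves only samples of one scale in each `V j`. The other side of that
identity is the difference of the column expansions of the two functions of a pair. -/
theorem exists_isTOIFirst (h : IsBesovSeries α σ G f) (hp₁ : 1 ≤ p) (hp₂ : p ≤ 2)
    (hR₁ : E₁.AE fun t => |t| ≤ R) (hR₂ : E₂.AE fun t => |t| ≤ R) (hR₃ : E₃.AE fun t => |t| ≤ R)
    {A₁ A₂ : H →L[ℂ] H} (hA₁ : E₁.HasIntegral (fun t : ℝ => (t : ℂ)) A₁)
    (hA₂ : E₂.HasIntegral (fun t : ℝ => (t : ℂ)) A₂) (hT : MemSchatten p (A₁ - A₂)) :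
    ∃ W, IsTOIFirst p E₁ E₂ E₃ (fun x₁ x₂ y => divDiff (fun x => f x y) x₁ x₂) (A₁ - A₂) 1 W ∧
      ∀ F₁ F₂ : H →L[ℂ] H, IsDOI E₁ E₃ f 1 F₁ → IsDOI E₂ E₃ f 1 F₂ → F₁ - F₂ = W := by
  obtain ⟨W, V, hW, hV, hWV⟩ := OpInt.exists_isTOIFirst hp₁ hp₂ hT
    (h.memLinftyL2_leftFactor E₁) (h.memLinftyL2_rightFactor E₂) (h.memLinftyMatrix_blockFactor E₃)
    h.tendsto_factors
  refine ⟨W, hW, fun F₁ F₂ h₁ h₂ => eq_of_forall_inner fun x y => ?_⟩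
  obtain ⟨F₁', h₁', hs₁⟩ := h.exists_isDOI hR₁ hR₃
  obtain ⟨F₂', h₂', hs₂⟩ := h.exists_isDOI hR₂ hR₃
  rw [h₁.unique h₁', h₂.unique h₂', sub_apply, inner_sub_right]
  have hs := (hs₁ x y).sub (hs₂ x y)
  -- The terms `f(0,·)` of the two expansions coincide, because the constant `1` integrates to the
  -- identity for both spectral measures. They cancel in the difference.
  rw [← (Option.some_injective _).hasSum_iff] at hs
  · refine (eq_of_fiberwise scaleEquiv (hWV x y) hs fun m => ?_).symm
    refine IsSampledPair.hasSum_first (h.sampled m) (h.pos m).ne' hR₁ hR₂ hA₁ hA₂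
      (halfWeight (α m)) (coWeight (α m)) x y (V := fun j => V (scaleEquiv.symm (m, j)) x)
      (fun j z => ?_) |>.imp fun s hs => ⟨?_, hs.2⟩
    · have h3 := hasSum_of_block scaleEquiv (m := m) (g := fun k => ⟪z, E₂.integral
        (rightFactor α σ k) (E₃.integral (blockFactor σ G (m, j) k) x)⟫_ℂ)
        ((hV (scaleEquiv.symm (m, j)) x z).of_eq fun k => by rw [Equiv.apply_symm_apply])
        fun k hk => by
          rw [blockFactor_of_ne (i := (m, j)) hk, integral_zero]
          simp
      refine h3.of_eq fun k => ?_
      rw [blockFactor_self]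
      rfl
    · refine hs.1.of_eq fun j => ?_
      rw [Equiv.apply_symm_apply]
      rfl
  · rintro (_ | i) hi
    · change ⟪y, E₁.integral (fun _ => (1 : ℂ)) _⟫_ℂ - ⟪y, E₂.integral (fun _ => (1 : ℂ)) _⟫_ℂ = 0
      rw [integral_one_apply, integral_one_apply, sub_self]
    · exact absurd ⟨i, rfl⟩ hi

/-- The same comparison by scales for the function with its variables exchanged: the matrix factor
now belongs to the first spectral measure and the functions of the pair are expanded in `y`. -/
theorem exists_isTOISecond (h : IsBesovSeries α σ G f) (hp₁ : 1 ≤ p) (hp₂ : p ≤ 2)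
    (hR₁ : E₁.AE fun t => |t| ≤ R) (hR₂ : E₂.AE fun t => |t| ≤ R) (hR₃ : E₃.AE fun t => |t| ≤ R)
    {B₁ B₂ : H →L[ℂ] H} (hB₁ : E₂.HasIntegral (fun t : ℝ => (t : ℂ)) B₁)
    (hB₂ : E₃.HasIntegral (fun t : ℝ => (t : ℂ)) B₂) (hT : MemSchatten p (B₁ - B₂)) :
    ∃ W, IsTOISecond p E₁ E₂ E₃ (fun x y₁ y₂ => divDiff (fun y => f x y) y₁ y₂) 1 (B₁ - B₂) W ∧
      ∀ F₁ F₂ : H →L[ℂ] H, IsDOI E₁ E₂ f 1 F₁ → IsDOI E₁ E₃ f 1 F₂ → F₁ - F₂ = W := by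
  obtain ⟨W, V, hW, hV, hWV⟩ := OpInt.exists_isTOISecond hp₁ hp₂ hT
    (h.flip.memLinftyMatrix_blockFactor E₁) (h.flip.memLinftyL2_leftFactor E₂)
    (h.flip.memLinftyL2_rightFactor E₃) fun x y₁ y₂ => (h.flip.tendsto_factors y₁ y₂ x).congr
      fun N => Finset.sum_congr rfl fun j _ => Finset.sum_congr rfl fun k _ => by
        rw [mul_comm, mul_assoc]
  refine ⟨W, hW, fun F₁ F₂ h₁ h₂ => eq_of_forall_inner fun x y => ?_⟩
  obtain ⟨F₁', h₁', hs₁⟩ := h.exists_isDOI_flip hR₁ hR₂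
  obtain ⟨F₂', h₂', hs₂⟩ := h.exists_isDOI_flip hR₁ hR₃
  rw [h₁.unique h₁', h₂.unique h₂', sub_apply, inner_sub_right]
  have hs := (hs₁ x y).sub (hs₂ x y)
  rw [← (Option.some_injective _).hasSum_iff] at hs
  · refine (eq_of_fiberwise scaleEquiv (hWV x y) hs fun m => ?_).symm
    refine IsSampledPair.hasSum_second (h.flip.sampled m) (h.pos m).ne' hR₂ hR₃ hB₁ hB₂
      (halfWeight (α m)) (coWeight (α m)) x y (V := fun j => V (scaleEquiv.symm (m, j)))
      (fun k v => ?_) |>.imp fun s hs => ⟨?_, hs.2⟩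
    · have h3 := hasSum_of_block scaleEquiv (m := m) (g := fun j => ⟪y, E₁.integral
        (blockFactor σ (fun m y x => G m x y) j (m, k)) (E₂.integral (leftFactor α σ j) v)⟫_ℂ)
        ((hV (scaleEquiv.symm (m, k)) v y).of_eq fun j => by rw [Equiv.apply_symm_apply])
        fun j hj => by
          rw [blockFactor_of_ne (k := (m, k)) hj.symm, integral_zero]
          simp
      refine h3.of_eq fun j => ?_
      rw [blockFactor_self]
      rfl
    · refine hs.1.of_eq fun j => ?_
      rw [Equiv.apply_symm_apply]
      rfl
  · rintro (_ | i) hi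
    · change ⟪y, _⟫_ℂ - ⟪y, _⟫_ℂ = 0
      rw [show columnLeft α σ none = fun _ => 1 from rfl, integral_one_apply, integral_one_apply,
        sub_self]
    · exact absurd ⟨i, rfl⟩ hi

end IsBesovSeries

theorem IsSpectralMeasureOf.ae_abs_le {E : SpectralMeasure ℝ H} {A : H →L[ℂ] H}
    (h : IsSpectralMeasureOf E A) {R : ℝ} (hR : ‖A‖ ≤ R) : E.AE fun t => |t| ≤ R := fun x => by
  have hmeas : MeasurableSet (spectrum ℝ A) := (spectrum.isClosed A).measurableSet
  have h1 : E.measure x (spectrum ℝ A)ᶜ = 0 := by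
    rw [measure_compl hmeas (measure_ne_top _ _), E.measure_apply x hmeas,
      E.measure_apply x MeasurableSet.univ, h.1, E.proj_univ, tsub_self]
  refine measure_mono_null (fun t (ht : ¬|t| ≤ R) (hts : t ∈ spectrum ℝ A) => ht ?_) h1
  calc |t| = ‖t‖ := (Real.norm_eq_abs t).symm
    _ ≤ ‖A‖ * ‖(1 : H →L[ℂ] H)‖ := spectrum.norm_le_norm_mul_of_mem hts
    _ ≤ ‖A‖ * 1 := mul_le_mul_of_nonneg_left ContinuousLinearMap.norm_id_le (norm_nonneg _)
    _ ≤ R := by rwa [mul_one]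

theorem isSpectralMeasureOf_spectralMeasure (A : H →L[ℂ] H) (hA : IsSelfAdjoint A) :
    IsSpectralMeasureOf (spectralMeasure A hA) A :=
  (exists_isSpectralMeasureOf A hA).choose_spec

theorem IsDOI.doubleOpIntegral_eq {E₁ E₂ : SpectralMeasure ℝ H} {Φ : ℝ → ℝ → ℂ}
    {T F : H →L[ℂ] H} (h : IsDOI E₁ E₂ Φ T F) : doubleOpIntegral E₁ E₂ Φ T = F :=
  (Classical.epsilon_spec (p := IsDOI E₁ E₂ Φ T) ⟨F, h⟩).unique h

theorem IsTOIFirst.tripleOpIntegralFirst_eq (hp₁ : 1 ≤ p) (hp₂ : p ≤ 2) {Ψ : ℝ → ℝ → ℝ → ℂ}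
    {T S W : H →L[ℂ] H} (h : IsTOIFirst p E₁ E₂ E₃ Ψ T S W) :
    tripleOpIntegralFirst p E₁ E₂ E₃ Ψ T S = W :=
  (Classical.epsilon_spec (p := IsTOIFirst p E₁ E₂ E₃ Ψ T S) ⟨W, h⟩).unique hp₁ hp₂ h

theorem IsTOISecond.tripleOpIntegralSecond_eq (hp₁ : 1 ≤ p) (hp₂ : p ≤ 2) {Ψ : ℝ → ℝ → ℝ → ℂ}
    {T S W : H →L[ℂ] H} (h : IsTOISecond p E₁ E₂ E₃ Ψ T S W) :
    tripleOpIntegralSecond p E₁ E₂ E₃ Ψ T S = W :=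
  (Classical.epsilon_spec (p := IsTOISecond p E₁ E₂ E₃ Ψ T S) ⟨W, h⟩).unique hp₁ hp₂ h

end Difference

end OpInt

theorem theorem7p1 {H : Type*} [NormedAddCommGroup H] [InnerProductSpace ℂ H] [CompleteSpace H]
    (f : EuclideanSpace ℝ (Fin 2) → ℂ) (hf : OpInt.MemBesov f)
    (p : ℝ) (hp₁ : 1 ≤ p) (hp₂ : p ≤ 2)
    (A₁ B₁ A₂ B₂ : H →L[ℂ] H)
    (hA₁ : IsSelfAdjoint A₁) (hB₁ : IsSelfAdjoint B₁)
    (hA₂ : IsSelfAdjoint A₂) (hB₂ : IsSelfAdjoint B₂)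
    (hA : OpInt.MemSchatten p (A₂ - A₁)) (hB : OpInt.MemSchatten p (B₂ - B₁)) :
    -- the two double operator integrals and the two triple operator integrals are well defined
    (∃! F : H →L[ℂ] H, OpInt.IsDOI (OpInt.spectralMeasure A₁ hA₁) (OpInt.spectralMeasure B₁ hB₁)
        (fun x y => f !₂[x, y]) 1 F) ∧
    (∃! F : H →L[ℂ] H, OpInt.IsDOI (OpInt.spectralMeasure A₂ hA₂) (OpInt.spectralMeasure B₂ hB₂)
        (fun x y => f !₂[x, y]) 1 F) ∧
    (∃! W : H →L[ℂ] H, OpInt.IsTOIFirst p (OpInt.spectralMeasure A₁ hA₁)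
        (OpInt.spectralMeasure A₂ hA₂) (OpInt.spectralMeasure B₁ hB₁)
        (OpInt.dividedDiffFirst f) (A₁ - A₂) 1 W) ∧
    (∃! W : H →L[ℂ] H, OpInt.IsTOISecond p (OpInt.spectralMeasure A₂ hA₂)
        (OpInt.spectralMeasure B₁ hB₁) (OpInt.spectralMeasure B₂ hB₂)
        (OpInt.dividedDiffSecond f) 1 (B₁ - B₂) W) ∧
    OpInt.doubleOpIntegral (OpInt.spectralMeasure A₁ hA₁) (OpInt.spectralMeasure B₁ hB₁)
        (fun x y => f !₂[x, y]) 1 -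
      OpInt.doubleOpIntegral (OpInt.spectralMeasure A₂ hA₂) (OpInt.spectralMeasure B₂ hB₂)
        (fun x y => f !₂[x, y]) 1 =
    OpInt.tripleOpIntegralFirst p (OpInt.spectralMeasure A₁ hA₁)
        (OpInt.spectralMeasure A₂ hA₂) (OpInt.spectralMeasure B₁ hB₁)
        (OpInt.dividedDiffFirst f) (A₁ - A₂) 1 +
      OpInt.tripleOpIntegralSecond p (OpInt.spectralMeasure A₂ hA₂)
        (OpInt.spectralMeasure B₁ hB₁) (OpInt.spectralMeasure B₂ hB₂)
        (OpInt.dividedDiffSecond f) 1 (B₁ - B₂) := by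
  obtain ⟨α, σ, G, h⟩ := hf.exists_isBesovSeries
  set R := max (max ‖A₁‖ ‖A₂‖) (max ‖B₁‖ ‖B₂‖) with hR
  have a₁ := OpInt.isSpectralMeasureOf_spectralMeasure A₁ hA₁
  have a₂ := OpInt.isSpectralMeasureOf_spectralMeasure A₂ hA₂
  have b₁ := OpInt.isSpectralMeasureOf_spectralMeasure B₁ hB₁
  have b₂ := OpInt.isSpectralMeasureOf_spectralMeasure B₂ hB₂
  have ra₁ := a₁.ae_abs_le (R := R) ((le_max_left _ _).trans (le_max_left _ _))
  have ra₂ := a₂.ae_abs_le (R := R) ((le_max_right _ _).trans (le_max_left _ _))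
  have rb₁ := b₁.ae_abs_le (R := R) ((le_max_left _ _).trans (le_max_right _ _))
  have rb₂ := b₂.ae_abs_le (R := R) ((le_max_right _ _).trans (le_max_right _ _))
  have hT : OpInt.MemSchatten p (A₁ - A₂) := by simpa using hA.neg
  have hS : OpInt.MemSchatten p (B₁ - B₂) := by simpa using hB.neg
  obtain ⟨F₁₁, hF₁₁, -⟩ := h.exists_isDOI ra₁ rb₁
  -- The intermediate operator `f(A₂, B₁)`, through which the increment telescopes.
  obtain ⟨F₂₁, hF₂₁, -⟩ := h.exists_isDOI ra₂ rb₁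
  obtain ⟨F₂₂, hF₂₂, -⟩ := h.exists_isDOI ra₂ rb₂
  obtain ⟨W₁, hW₁, e₁⟩ := h.exists_isTOIFirst hp₁ hp₂ ra₁ ra₂ rb₁ a₁.2 a₂.2 hT
  obtain ⟨W₂, hW₂, e₂⟩ := h.exists_isTOISecond hp₁ hp₂ ra₂ rb₁ rb₂ b₁.2 b₂.2 hS
  refine ⟨⟨F₁₁, hF₁₁, fun F hF => hF.unique hF₁₁⟩, ⟨F₂₂, hF₂₂, fun F hF => hF.unique hF₂₂⟩,
    ⟨W₁, hW₁, fun W hW => hW.unique hp₁ hp₂ hW₁⟩, ⟨W₂, hW₂, fun W hW => hW.unique hp₁ hp₂ hW₂⟩, ?_⟩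
  -- The divided differences in the statement unfold to those of the one-variable slices, so the
  -- operators already constructed are the chosen ones.
  rw [hF₁₁.doubleOpIntegral_eq, hF₂₂.doubleOpIntegral_eq,
    (show OpInt.IsTOIFirst p _ _ _ (OpInt.dividedDiffFirst f) _ 1 W₁ from
      hW₁).tripleOpIntegralFirst_eq hp₁ hp₂,
    (show OpInt.IsTOISecond p _ _ _ (OpInt.dividedDiffSecond f) 1 _ W₂ from
      hW₂).tripleOpIntegralSecond_eq hp₁ hp₂,
    ← e₁ F₁₁ F₂₁ hF₁₁ hF₂₁, ← e₂ F₂₁ F₂₂ hF₂₁ hF₂₂, sub_add_sub_cancel]
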